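/- Let $K$ be a field of characteristic $0$, $a,b\in\mathbb Z$; for a graded space $V$ put $V[k]_i=V_{i+k}$. A differential graded $(a,b)$-algebra is a $\mathbb Z$-graded $K$-vector space $\mathcal A$ with bilinear operations $\cdot$ of degree $a$ and $[\,,]$ of degree $b$ and a linear map $d$ of degree $1$, such that for homogeneous $\alpha,\beta,\gamma$: $\alpha\cdot\beta=(-1)^{(|\alpha|+a)(|\beta|+a)}\beta\cdot\alpha$; $\alpha\cdot(\beta\cdot\gamma)=(\alpha\cdot\beta)\cdot\gamma$; $[\alpha,\beta]=-(-1)^{(|\alpha|+b)(|\beta|+b)}[\beta,\alpha]$; the graded Jacobi identity holds for the degree $|\alpha|+b$; $[\alpha,\beta\cdot\gamma]=[\alpha,\beta]\cdot\gamma+(-1)^{(|\beta|+a)(|\alpha|+b)}\beta\cdot[\alpha,\gamma]$; $d^2=0$; $d(\alpha\cdot\beta)=d\alpha\cdot\beta+(-1)^{|\alpha|+a}\alpha\cdot d\beta$; $d[\alpha,\beta]=[d\alpha,\beta]+(-1)^{|\alpha|+b}[\alpha,d\beta]$. **Construction.** Let $\mathcal H=\underline{\bigotimes}^+(\mathcal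 A[-a+1])$ be the quotient of $\bigoplus_{n\ge1}(\mathcal A[-a+1])^{\otimes n}$ by all signed shuffle products $\sum_{\sigma\in Bat(p,q)}\varepsilon_\alpha(\sigma^{-1})\,\alpha_{\sigma^{-1}(1)}\otimes\dots\otimes\alpha_{\sigma^{-1}(p+q)}$ ($p,q\ge1$). In signs, $\alpha$ denotes the degree $|\alpha|+a-1$ of a letter; a packet $X=\alpha_1\underline\otimes\cdots\underline\otimes\alpha_n$ has degree $x=\alpha_1+\dots+\alpha_n$ in $\mathcal H$, $x'=x-a+b+1$ in $\mathcal H[a-b-1]$, and $x''=x-a+b$ in $\mathcal H[a-b]$; $\varepsilon$ denotes Koszul signs. On letters put $\mu(\alpha,\beta)=(-1)^{\alpha}\alpha\cdot\beta$ and $\ell(\alpha,\beta)=(-1)^{(b-a+1)\alpha}[\alpha,\beta]$. On packets put $$D(X)=\sum_k(-1)^{\sum_{i<k}\alpha_i}\alpha_1\underline\otimes\cdots d\alpha_k\cdots\underline\otimes\alpha_n+\sum_{k<n}(-1)^{\sum_{i<k}\alpha_i}\alpha_1\underline\otimes\cdots\mu(\alpha_k,\alpha_{k+1})\cdots\underline\otimes\alpha_n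 .$$ For $X=\alpha_1\underline\otimes\cdots\underline\otimes\alpha_p$, $Y=\alpha_{p+1}\underline\otimes\cdots\underline\otimes\alpha_{p+q}$ put $$\ell_2(X,Y)=\sum_{\substack{\sigma\in Bat(p,q),\ k\\ \sigma^{-1}(k)\le p<\sigma^{-1}(k+1)}}\varepsilon_\alpha(\sigma^{-1})(-1)^{(b-a+1)\sum_{s<k}\alpha_{\sigma^{-1}(s)}}\,\alpha_{\sigma^{-1}(1)}\underline\otimes\cdots\ell(\alpha_{\sigma^{-1}(k)},\alpha_{\sigma^{-1}(k+1)})\cdots\underline\otimes\alpha_{\sigma^{-1}(p+q)},$$ $\ell_2'(X,Y)=(-1)^{(a-b-1)x'}\ell_2(X,Y)$ and $\ell_2''(X,Y)=(-1)^{x''}\ell_2'(X,Y)$. Let $S=S^+(\mathcal H[a-b])=\bigoplus_{n\ge1}S^n(\mathcal H[a-b])$ (graded symmetric powers), and on monomials in packets put $$\Delta(X_1\cdots X_n)=\sum_{I\sqcup J=\{1..n\},\ I,J\ne\emptyset}\varepsilon\binom{x''_1\dots x''_n}{x''_I\,x''_J}X_I\otimes X_J,$$ $$\delta''(X_1\cdots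 X_n)=\sum_{s,\ I\sqcup J=\{1..n\}\setminus\{s\}}\varepsilon\binom{x''_1\dots x''_n}{x''_I\,x''_s\,x''_J}\sum_{U\underline\otimes V=X_s}(-1)^{(a-b)(x''_I+u'')}\big(X_IU\otimes VX_J+(-1)^{u''v''+a-b+1}X_IV\otimes UX_J\big),$$ where the inner sum is over the cuts of the word $X_s$ into two nonempty words, $$m(X_1\cdots X_n)=\sum_i\varepsilon\binom{x''_1\dots x''_n}{x''_i\,x''_1\dots\widehat{i}\dots x''_n}D(X_i)\,X_1\cdots\widehat{i}\cdots X_n,$$ $$\ell''(X_1\cdots X_n)=\sum_{i<j}\varepsilon\binom{x''_1\dots x''_n}{x''_i\,x''_j\,x''_1\dots\widehat{ij}\dots x''_n}\ell_2''(X_i,X_j)\,X_1\cdots\widehat{ij}\cdots X_n .$$ **Theorem.** (1) There are unique linear maps $\Delta,\delta'',m,\ell''$ on $S$ with these values, and with $Q=\ell''+m$ the quadruple $(S,\Delta,\delta'',Q)$ is a codifferential graded bicoalgebra. That is, $S$ is the direct sum of its homogeneous components; $\Delta$ has degree $0$, $\delta''$ has degree $b-a$, $Q$ has degree $1$; and,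 with $\tau$ the graded flip and the Koszul rule for tensor products of maps: $\tau\Delta=\Delta$; $(\Delta\otimes id)\Delta=(id\otimes\Delta)\Delta$; $\tau\delta''=-(-1)^{a-b}\delta''$; $(id+\tau_{12}\tau_{23}+\tau_{23}\tau_{12})(\delta''\otimes id)\delta''=0$; $(id\otimes\Delta)\delta''=(\delta''\otimes id)\Delta+\tau_{12}(id\otimes\delta'')\Delta$; $Q^2=0$; $(Q\otimes id+id\otimes Q)\Delta=\Delta Q$; $(Q\otimes id+id\otimes Q)\delta''=(-1)^{a-b}\delta''Q$. (2) $(S,\Delta,\delta'')$ is the cofree graded bicoalgebra on $\mathcal A[-a+1][a-b]$, with projection $\pi$ the identity on monomials with a single one-letter packet and $0$ on all other monomials. That is, it is conilpotent, $\pi$ has degree $0$, and every degree $0$ linear map from a conilpotent graded bicoalgebra $B$ (same degrees and same five identities for its coproduct and cobracket) to $\mathcal A[-a+1][a-b]$ is $\pi\circ F$ for a unique degree $0$ bicoalgebra morphism $F:B\to S$. Here conilpotent means: there is an exhaustive increasing filtration $0=F_0\subseteq F_1\subseteq\cdots$ with both cooperations mapping $F_n$ into $\sum_{i+j=n}F_i\otimes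 F_j$. (3) Let $(a,b)=(0,-1)$ and let $\mathcal A$ be a differential graded Gerstenhaber algebra. Its $G_\infty$ envelope is $(S,\Delta,\kappa,m+\ell)$ with the same $S$, $\Delta$ and $m$, where $\kappa$ is given by the formula of $\delta''$ with the signs $(-1)^{x''_I+u''}$ and $(-1)^{u''v''}$ in place of $(-1)^{(a-b)(x''_I+u'')}$ and $(-1)^{u''v''+a-b+1}$, and $\ell$ is the extension (by the formula of $\ell''$) of $(-1)^{x}[X,Y]$, $[X,Y]=\ell_2(X,Y)$ being the extension of the bracket to packets. Then $\delta''=\kappa$ and $\ell''=-\ell$; equivalently $(S,\Delta,\delta'',\ell''+m)$ is exactly the $G_\infty$ envelope of $\mathcal A$ with the opposite bracket $-[\,,]$. (4) Let $(a,b)=(0,0)$ and let $\mathcal A$ be a differential graded Poisson algebra with bracket $\{\,,\}$. Its $P_\infty$ envelope is $(S,\Delta,\delta,m+\ell)$ with the same $S$, $\Delta$ and $m$, where $\delta$ is given by the formula of $\delta''$ with the signs $1$ and $-(-1)^{u''v''}$ in the same two places, and $\ell$ is the extension (by the formula of $\ell''$) of the bracket $[X,Y]=\ell_2(X,Y)$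 on packets, which extends $[\alpha,\beta]=(-1)^{\alpha}\{\alpha,\beta\}$. Then $\delta''=\delta$ and $\ell''=-\ell$; equivalently $(S,\Delta,\delta'',\ell''+m)$ is exactly the $P_\infty$ envelope of $\mathcal A$ with the opposite bracket $-\{\,,\}$. -/

import Mathlib

open scoped TensorProduct DirectSum

universe u v w x

namespace HomotopyAB

/-! ### Graded vector spaces, Koszul signs -/

section Graded

variable {K : Type u} [Field K] {C : Type v} [AddCommGroup C] [Module K C]

/-- The shifted grading `V[k]`, with `V[k]_i = V_{i+k}`. -/
def shift (𝒱 : ℤ → Submodule K C) (k : ℤ) : ℤ → Submodule K C := fun i => 𝒱 (i + k)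

/-- A homogeneous vector together with its degree. -/
structure Letter (𝒱 : ℤ → Submodule K C) where
  deg : ℤ
  val : C
  mem : val ∈ 𝒱 deg

/-- The total degree of a list of homogeneous vectors. -/
def totalDeg {𝒱 : ℤ → Submodule K C} (X : List (Letter 𝒱)) : ℤ := (X.map Letter.deg).sum

/-- The underlying vectors of a list of homogeneous vectors. -/
def vals {𝒱 : ℤ → Submodule K C} (X : List (Letter 𝒱)) : List C := X.map Letter.val

/-- Exponent of the Koszul sign: the sum of `deg i * deg j` over all inversions of `L`. -/
def koszulExp {ι : Type*} [LinearOrder ι] (deg : ι → ℤ) : List ι → ℤ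
  | [] => 0
  | i :: L => ((L.filter (· < i)).map fun j => deg i * deg j).sum + koszulExp deg L

/-- The Koszul sign of the rearrangement of `x_1 ... x_n` into `x_{L_1} ... x_{L_n}`, where `L`
lists every index once and `x_i` has degree `deg i`. -/
def koszulSign {ι : Type*} [LinearOrder ι] (deg : ι → ℤ) (L : List ι) : ℤˣ :=
  (koszulExp deg L).negOnePow

theorem coe_bijective (𝒞 : ℤ → Submodule K C) (h : DirectSum.IsInternal 𝒞) :
    Function.Bijective (DirectSum.coeLinearMap 𝒞) := h

/-- The decomposition of a graded space into its homogeneous components. -/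
noncomputable def components (𝒞 : ℤ → Submodule K C) (h : DirectSum.IsInternal 𝒞) :
    C ≃ₗ[K] ⨁ i, 𝒞 i :=
  (LinearEquiv.ofBijective (DirectSum.coeLinearMap 𝒞) (coe_bijective 𝒞 h)).symm

/-- The linear map `x ↦ (-1)^{k |x|} x`. -/
noncomputable def parity (𝒞 : ℤ → Submodule K C) (h : DirectSum.IsInternal 𝒞) (k : ℤ) :
    C →ₗ[K] C :=
  (DirectSum.toModule K ℤ C fun i => (k * i).negOnePow • (𝒞 i).subtype) ∘ₗ
    (components 𝒞 h).toLinearMap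

/-- The graded flip `x ⊗ y ↦ (-1)^{|x| |y|} y ⊗ x`. -/
noncomputable def koszulFlip (𝒞 : ℤ → Submodule K C) (h : DirectSum.IsInternal 𝒞) :
    C ⊗[K] C →ₗ[K] C ⊗[K] C :=
  TensorProduct.lift
    ((DirectSum.toModule K ℤ (C →ₗ[K] C ⊗[K] C) fun i =>
      (TensorProduct.mk K C C).flip.compl₂ (parity 𝒞 h i) ∘ₗ (𝒞 i).subtype) ∘ₗ
    (components 𝒞 h).toLinearMap)

theorem components_of_mem (𝒞 : ℤ → Submodule K C) (h : DirectSum.IsInternal 𝒞) {i : ℤ} {x : C}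
    (hx : x ∈ 𝒞 i) : components 𝒞 h x = DirectSum.lof K ℤ (fun i => 𝒞 i) i ⟨x, hx⟩ := by
  rw [components, LinearEquiv.symm_apply_eq]
  simp [LinearEquiv.ofBijective_apply, DirectSum.coeLinearMap_lof]

theorem parity_of_mem (𝒞 : ℤ → Submodule K C) (h : DirectSum.IsInternal 𝒞) (k : ℤ) {i : ℤ} {x : C}
    (hx : x ∈ 𝒞 i) : parity 𝒞 h k x = (k * i).negOnePow • x := by
  simp [parity, components_of_mem 𝒞 h hx, DirectSum.toModule_lof]

theorem koszulFlip_tmul_of_mem (𝒞 : ℤ → Submodule K C) (h : DirectSum.IsInternal 𝒞) {i j : ℤ} {x y : C}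
    (hx : x ∈ 𝒞 i) (hy : y ∈ 𝒞 j) :
    koszulFlip 𝒞 h (x ⊗ₜ[K] y) = (i * j).negOnePow • (y ⊗ₜ[K] x) := by
  simp [koszulFlip, components_of_mem 𝒞 h hx, DirectSum.toModule_lof, parity_of_mem 𝒞 h i hy,
    Units.smul_def, TensorProduct.smul_tmul']

/-- `F ⊗ G` inside `C ⊗ C`, for subspaces `F` and `G`. -/
def tensorSub (F G : Submodule K C) : Submodule K (C ⊗[K] C) :=
  Submodule.map₂ (TensorProduct.mk K C C) F G

/-- The component of degree `n` of `C ⊗ C`. -/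
def tensorGrading (𝒞 : ℤ → Submodule K C) (n : ℤ) : Submodule K (C ⊗[K] C) :=
  ⨆ i : ℤ, tensorSub (𝒞 i) (𝒞 (n - i))

/-- `τ₁₂` on `C ⊗ C ⊗ C`. -/
noncomputable def flip12 (𝒞 : ℤ → Submodule K C) (h : DirectSum.IsInternal 𝒞) :
    (C ⊗[K] C) ⊗[K] C →ₗ[K] (C ⊗[K] C) ⊗[K] C :=
  TensorProduct.map (koszulFlip 𝒞 h) LinearMap.id

/-- `τ₂₃` on `C ⊗ C ⊗ C`. -/
noncomputable def flip23 (𝒞 : ℤ → Submodule K C) (h : DirectSum.IsInternal 𝒞) :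
    (C ⊗[K] C) ⊗[K] C →ₗ[K] (C ⊗[K] C) ⊗[K] C :=
  (TensorProduct.assoc K C C C).symm.toLinearMap ∘ₗ TensorProduct.map LinearMap.id (koszulFlip 𝒞 h) ∘ₗ
    (TensorProduct.assoc K C C C).toLinearMap

/-- `f ⊗ id`, for `f : C → C ⊗ C`. -/
noncomputable def onLeft (f : C →ₗ[K] C ⊗[K] C) : C ⊗[K] C →ₗ[K] (C ⊗[K] C) ⊗[K] C :=
  TensorProduct.map f LinearMap.id

/-- `id ⊗ f`, for `f : C → C ⊗ C` of parity `k`: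
`(id ⊗ f)(x ⊗ y) = (-1)^{k |x|} x ⊗ f(y)`. -/
noncomputable def onRight (𝒞 : ℤ → Submodule K C) (h : DirectSum.IsInternal 𝒞) (k : ℤ)
    (f : C →ₗ[K] C ⊗[K] C) : C ⊗[K] C →ₗ[K] (C ⊗[K] C) ⊗[K] C :=
  (TensorProduct.assoc K C C C).symm.toLinearMap ∘ₗ TensorProduct.map (parity 𝒞 h k) f

end Graded

/-! ### Graded bicoalgebras -/

section Bicoalgebra

variable {K : Type u} [Field K] {C : Type v} [AddCommGroup C] [Module K C]

/-- A graded bicoalgebra: a cocommutative coassociative coproduct `Δ` of degree `0` and a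
`p`-coantisymmetric Lie cobracket `δ` of degree `-p`, related by the coLeibniz identity. -/
structure IsGradedBicoalgebra (p : ℤ) (𝒞 : ℤ → Submodule K C) (Δ δ : C →ₗ[K] C ⊗[K] C) :
    Prop where
  internal : DirectSum.IsInternal 𝒞
  coproduct_mem : ∀ i, ∀ x ∈ 𝒞 i, Δ x ∈ tensorGrading 𝒞 i
  cobracket_mem : ∀ i, ∀ x ∈ 𝒞 i, δ x ∈ tensorGrading 𝒞 (i - p)
  cocommutative : koszulFlip 𝒞 internal ∘ₗ Δ = Δ
  coassociative : onLeft Δ ∘ₗ Δ = onRight 𝒞 internal 0 Δ ∘ₗ Δ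
  coantisymmetric : koszulFlip 𝒞 internal ∘ₗ δ = -(p.negOnePow • δ)
  coJacobi :
    (LinearMap.id + flip12 𝒞 internal ∘ₗ flip23 𝒞 internal
      + flip23 𝒞 internal ∘ₗ flip12 𝒞 internal) ∘ₗ onLeft δ ∘ₗ δ = 0
  coLeibniz :
    onRight 𝒞 internal 0 Δ ∘ₗ δ
      = onLeft δ ∘ₗ Δ + flip12 𝒞 internal ∘ₗ onRight 𝒞 internal p δ ∘ₗ Δ

/-- `Q ⊗ id + id ⊗ Q`, for `Q : C → C` of degree `1`. -/
noncomputable def tensorDeriv (𝒞 : ℤ → Submodule K C) (h : DirectSum.IsInternal 𝒞)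
    (Q : C →ₗ[K] C) : C ⊗[K] C →ₗ[K] C ⊗[K] C :=
  TensorProduct.map Q LinearMap.id + TensorProduct.map (parity 𝒞 h 1) Q

/-- A codifferential graded bicoalgebra: `Q` has degree `1`, square zero, and is a (graded)
coderivation of `Δ` and of `δ`. -/
structure IsCodifferentialBicoalgebra (p : ℤ) (𝒞 : ℤ → Submodule K C)
    (Δ δ : C →ₗ[K] C ⊗[K] C) (Q : C →ₗ[K] C) : Prop
    extends IsGradedBicoalgebra p 𝒞 Δ δ where
  codiff_mem : ∀ i, ∀ x ∈ 𝒞 i, Q x ∈ 𝒞 (i + 1)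
  codiff_sq : Q ∘ₗ Q = 0
  coderivation_coproduct : tensorDeriv 𝒞 internal Q ∘ₗ Δ = Δ ∘ₗ Q
  coderivation_cobracket : tensorDeriv 𝒞 internal Q ∘ₗ δ = p.negOnePow • (δ ∘ₗ Q)

/-- Conilpotence: there is an exhaustive increasing filtration `0 = F_0 ⊆ F_1 ⊆ ...` such that
both operations map `F_n` into `∑_{i+j=n} F_i ⊗ F_j`. -/
def IsConilpotent (Δ δ : C →ₗ[K] C ⊗[K] C) : Prop :=
  ∃ F : ℕ → Submodule K C, Monotone F ∧ F 0 = ⊥ ∧ (⨆ n, F n) = ⊤ ∧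
    ∀ n, ∀ x ∈ F n,
      Δ x ∈ (⨆ (i : ℕ) (j : ℕ) (_ : i + j = n), tensorSub (F i) (F j)) ∧
      δ x ∈ (⨆ (i : ℕ) (j : ℕ) (_ : i + j = n), tensorSub (F i) (F j))

/-- `(C, Δ, δ)` is the cofree (conilpotent) graded bicoalgebra on the graded space `V`, with
projection `π : C → V`: it is conilpotent, and every degree `0` linear map from a conilpotent
graded bicoalgebra to `V` lifts uniquely to a morphism of graded bicoalgebras to `C`. -/
def IsCofree {V : Type x} [AddCommGroup V] [Module K V] (p : ℤ) (𝒞 : ℤ → Submodule K C)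
    (Δ δ : C →ₗ[K] C ⊗[K] C) (𝒱 : ℤ → Submodule K V) (π : C →ₗ[K] V) : Prop :=
  IsConilpotent Δ δ ∧ (∀ i, ∀ x ∈ 𝒞 i, π x ∈ 𝒱 i) ∧
    ∀ (B : Type w) [AddCommGroup B] [Module K B] (ℬ : ℤ → Submodule K B)
      (Δ' δ' : B →ₗ[K] B ⊗[K] B),
      IsGradedBicoalgebra p ℬ Δ' δ' → IsConilpotent Δ' δ' →
      ∀ f : B →ₗ[K] V, (∀ i, ∀ x ∈ ℬ i, f x ∈ 𝒱 i) →
        ∃! F : B →ₗ[K] C, (∀ i, ∀ x ∈ ℬ i, F x ∈ 𝒞 i) ∧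
          Δ ∘ₗ F = TensorProduct.map F F ∘ₗ Δ' ∧ δ ∘ₗ F = TensorProduct.map F F ∘ₗ δ' ∧
          π ∘ₗ F = f

end Bicoalgebra

/-! ### The space of tensors modulo shuffles -/

section Bar

variable {K : Type u} [Field K] {V : Type v} [AddCommGroup V] [Module K V]

/-- The tensor `v_1 ⊗ ... ⊗ v_n`. -/
noncomputable def tensorWord (K : Type u) [Field K] [Module K V] (l : List V) : TensorAlgebra K V :=
  (l.map (TensorAlgebra.ι K)).prod

/-- `(p,q)`-shuffles: permutations increasing on the first `p` and on the last `q` indices. -/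
def IsBat (p q : ℕ) (σ : Equiv.Perm (Fin (p + q))) : Prop :=
  ∀ i j : Fin (p + q), i < j → (j.val < p ∨ p ≤ i.val) → σ i < σ j

instance (p q : ℕ) : DecidablePred (IsBat p q) := fun σ => by
  unfold IsBat; infer_instance

variable {𝒱 : ℤ → Submodule K V}

/-- The letters `α_1, ..., α_{p+q}` of two words `X = α_1 ... α_p` and `Y = α_{p+1} ... α_{p+q}`. -/
def joined (X Y : List (Letter 𝒱)) : Fin (X.length + Y.length) → Letter 𝒱 :=
  Fin.append X.get Y.get

/-- The word `α_{σ⁻¹(1)} ... α_{σ⁻¹(p+q)}`. -/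
def rearranged (X Y : List (Letter 𝒱)) (σ : Equiv.Perm (Fin (X.length + Y.length))) :
    List (Letter 𝒱) :=
  List.ofFn fun i => joined X Y (σ.symm i)

/-- The Koszul sign `ε_α(σ⁻¹)` of that rearrangement. -/
def rearrangedSign (X Y : List (Letter 𝒱)) (σ : Equiv.Perm (Fin (X.length + Y.length))) : ℤˣ :=
  koszulSign (fun i => (joined X Y i).deg) (List.ofFn fun i => σ.symm i)

/-- The shuffle product of two words of homogeneous vectors. -/
noncomputable def bat (X Y : List (Letter 𝒱)) : TensorAlgebra K V :=
  ∑ σ with IsBat X.length Y.length σ,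
    rearrangedSign X Y σ • tensorWord K (vals (rearranged X Y σ))

variable (𝒱) in
/-- The span of the constants and of all shuffle products of two nonempty words. -/
def shuffleRel : Submodule K (TensorAlgebra K V) :=
  Submodule.span K
    ({1} ∪ {s | ∃ X Y : List (Letter 𝒱), X ≠ [] ∧ Y ≠ [] ∧ s = bat X Y})

variable (𝒱) in
/-- `⨁_{n ≥ 1} V^{⊗ n} / (shuffles)`. The summand `n = 0` of the tensor algebra is removed by
dividing by the constants. -/
abbrev Bar : Type (max u v) := TensorAlgebra K V ⧸ shuffleRel 𝒱

variable (𝒱) in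
/-- The class of `v_1 ⊗ ... ⊗ v_n`. -/
noncomputable def Bar.mk (l : List V) : Bar 𝒱 := (shuffleRel 𝒱).mkQ (tensorWord K l)

/-- The packet (class) of a word of homogeneous vectors. -/
noncomputable def packet (X : List (Letter 𝒱)) : Bar 𝒱 := Bar.mk 𝒱 (vals X)

variable (𝒱) in
/-- The grading of `Bar`: a packet has the sum of the degrees of its letters as its degree. -/
def Bar.grading (n : ℤ) : Submodule K (Bar 𝒱) :=
  Submodule.span K {s | ∃ X : List (Letter 𝒱), totalDeg X = n ∧ s = packet X}

/-- The extension of operations `d` (one argument) and `μ` (two arguments) of degree `1` to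
packets: the sum of
`(-1)^{α_1+...+α_{k-1}} α_1 ... d(α_k) ... α_n` and
`(-1)^{α_1+...+α_{k-1}} α_1 ... μ(α_k, α_{k+1}) ... α_n`. -/
noncomputable def barDiff (d : Letter 𝒱 → V) (μ : Letter 𝒱 → Letter 𝒱 → V)
    (X : List (Letter 𝒱)) : Bar 𝒱 :=
  (∑ k : Fin X.length, (totalDeg (X.take k.val)).negOnePow •
      Bar.mk 𝒱 (vals (X.take k.val) ++ [d (X.get k)] ++ vals (X.drop (k.val + 1))))
  + ∑ k : Fin X.length, ∑ k' : Fin X.length,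
      if k'.val = k.val + 1 then
        (totalDeg (X.take k.val)).negOnePow •
          Bar.mk 𝒱 (vals (X.take k.val) ++ [μ (X.get k) (X.get k')] ++ vals (X.drop (k.val + 2)))
      else 0

/-- The extension of a bracket `ℓ` of degree `c` to two packets: the sum over all shuffles `σ`, and
all `k` with `σ⁻¹(k) ≤ p < σ⁻¹(k+1)`, of `ε_α(σ⁻¹) (-1)^{c ∑_{s<k} α_{σ⁻¹(s)}}` times
`α_{σ⁻¹(1)} ... ℓ(α_{σ⁻¹(k)}, α_{σ⁻¹(k+1)}) ... α_{σ⁻¹(p+q)}`. -/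
noncomputable def barBracket (c : ℤ) (ℓ : Letter 𝒱 → Letter 𝒱 → V) (X Y : List (Letter 𝒱)) :
    Bar 𝒱 :=
  ∑ σ with IsBat X.length Y.length σ,
    ∑ k : Fin (X.length + Y.length), ∑ k' : Fin (X.length + Y.length),
      if k'.val = k.val + 1 ∧ (σ.symm k).val < X.length ∧ X.length ≤ (σ.symm k').val then
        (rearrangedSign X Y σ * (c * totalDeg ((rearranged X Y σ).take k.val)).negOnePow) •
          Bar.mk 𝒱 (vals ((rearranged X Y σ).take k.val)
            ++ [ℓ (joined X Y (σ.symm k)) (joined X Y (σ.symm k'))]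
            ++ vals ((rearranged X Y σ).drop (k.val + 2)))
      else 0

end Bar

/-! ### The graded symmetric space -/

section Sym

variable {K : Type u} [Field K] {W : Type v} [AddCommGroup W] [Module K W]

/-- The span of the constants and of the two-sided ideal of graded commutators. -/
def symRel (𝒲 : ℤ → Submodule K W) : Submodule K (TensorAlgebra K W) :=
  Submodule.span K
    ({1} ∪ {s | ∃ (x y : Letter 𝒲) (p q : TensorAlgebra K W),
      s = p * (TensorAlgebra.ι K x.val * TensorAlgebra.ι K y.val
        - (x.deg * y.deg).negOnePow • (TensorAlgebra.ι K y.val * TensorAlgebra.ι K x.val)) * q})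

/-- `S⁺(W) = ⨁_{n ≥ 1} Sⁿ(W)`, the positive part of the graded symmetric algebra (as above, the
summand `n = 0` is removed by dividing by the constants). -/
abbrev SymPlus (𝒲 : ℤ → Submodule K W) : Type (max u v) := TensorAlgebra K W ⧸ symRel 𝒲

/-- The monomial `X_1 ... X_n`. -/
noncomputable def SymPlus.mk (𝒲 : ℤ → Submodule K W) (l : List W) : SymPlus 𝒲 :=
  (symRel 𝒲).mkQ (tensorWord K l)

/-- The grading of `S⁺(W)` by total degree. -/
def SymPlus.grading (𝒲 : ℤ → Submodule K W) (n : ℤ) : Submodule K (SymPlus 𝒲) :=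
  Submodule.span K {s | ∃ l : List (Letter 𝒲), totalDeg l = n ∧ s = SymPlus.mk 𝒲 (vals l)}

end Sym

/-! ### Operations on `S⁺(H[t])`, where `H` is the space of tensors of `V` modulo shuffles -/

section Env

variable {K : Type u} [Field K] {V : Type v} [AddCommGroup V] [Module K V]

/-- The space `S⁺(H[t])`. -/
abbrev Env (𝒱 : ℤ → Submodule K V) (t : ℤ) : Type (max u v) :=
  SymPlus (shift (Bar.grading 𝒱) t)

/-- The grading of `S⁺(H[t])`. -/
abbrev Env.grading (𝒱 : ℤ → Submodule K V) (t : ℤ) : ℤ → Submodule K (Env 𝒱 t) :=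
  SymPlus.grading (shift (Bar.grading 𝒱) t)

variable {𝒱 : ℤ → Submodule K V}

/-- The degree of a packet in `H[t]`. -/
def degIn (t : ℤ) (X : List (Letter 𝒱)) : ℤ := totalDeg X - t

/-- The monomial of `S⁺(H[t])` whose factors are the given packets. -/
noncomputable def monomial (t : ℤ) (l : List (List (Letter 𝒱))) : Env 𝒱 t :=
  SymPlus.mk _ (l.map packet)

/-- The elements of a finite set of indices in increasing order. -/
def sorted {n : ℕ} (I : Finset (Fin n)) : List (Fin n) := I.sort (· ≤ ·)

/-- `X_I`, as a list of packets. -/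
def factors {n : ℕ} (X : Fin n → List (Letter 𝒱)) (I : Finset (Fin n)) : List (List (Letter 𝒱)) :=
  (sorted I).map X

variable (𝒱) in
/-- Two cooperations and two linear endomorphisms of `S⁺(H[t])`. -/
@[ext] structure EnvOps (t : ℤ) where
  coproduct : Env 𝒱 t →ₗ[K] Env 𝒱 t ⊗[K] Env 𝒱 t
  cobracket : Env 𝒱 t →ₗ[K] Env 𝒱 t ⊗[K] Env 𝒱 t
  m : Env 𝒱 t →ₗ[K] Env 𝒱 t
  ell : Env 𝒱 t →ₗ[K] Env 𝒱 t

/-- `Δ(X_1 ... X_n) = ∑ ε(x_1 ... x_n ; x_I x_J) X_I ⊗ X_J`, over all partitions of `{1, ..., n}`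
into nonempty `I` and `J`. -/
def IsCoproduct (t : ℤ) (Δ : Env 𝒱 t →ₗ[K] Env 𝒱 t ⊗[K] Env 𝒱 t) : Prop :=
  ∀ (n : ℕ) (X : Fin n → List (Letter 𝒱)),
    Δ (monomial t (List.ofFn X)) =
      ∑ I : Finset (Fin n) with I.Nonempty ∧ Iᶜ.Nonempty,
        koszulSign (fun i => degIn t (X i)) (sorted I ++ sorted Iᶜ) •
          (monomial t (factors X I) ⊗ₜ[K] monomial t (factors X Iᶜ))

/-- The value of `δ(X_1 ... X_n)` is the sum over `s`, over the partitions of the other indices into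
`I` and `J` (possibly empty), and over the ways to cut `X_s = U V` into two nonempty words, of
`ε(x_1 ... x_n ; x_I x_s x_J) (-1)^{e₁(x_I + u)}` times
`X_I.U ⊗ V.X_J + (-1)^{e₂(u, v)} X_I.V ⊗ U.X_J`. -/
def IsCobracket (t : ℤ) (e₁ : ℤ → ℤ) (e₂ : ℤ → ℤ → ℤ)
    (δ : Env 𝒱 t →ₗ[K] Env 𝒱 t ⊗[K] Env 𝒱 t) : Prop :=
  ∀ (n : ℕ) (X : Fin n → List (Letter 𝒱)),
    δ (monomial t (List.ofFn X)) =
      ∑ s : Fin n, ∑ I ∈ ({s}ᶜ : Finset (Fin n)).powerset,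
        koszulSign (fun i => degIn t (X i)) (sorted I ++ [s] ++ sorted ({s}ᶜ \ I)) •
          ∑ j ∈ Finset.Ioo 0 (X s).length,
            (e₁ ((∑ i ∈ I, degIn t (X i)) + degIn t ((X s).take j))).negOnePow •
              (monomial t (factors X I ++ [(X s).take j]) ⊗ₜ[K]
                  monomial t ([(X s).drop j] ++ factors X ({s}ᶜ \ I))
                + (e₂ (degIn t ((X s).take j)) (degIn t ((X s).drop j))).negOnePow •
                  (monomial t (factors X I ++ [(X s).drop j]) ⊗ₜ[K]
                    monomial t ([(X s).take j] ++ factors X ({s}ᶜ \ I))))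

/-- `m(X_1 ... X_n) = ∑_i ε(x_1 ... x_n ; x_i x_1 ...î... x_n) D(X_i).X_1 ...î... X_n`. -/
def IsUnaryExtension (t : ℤ) (D : List (Letter 𝒱) → Bar 𝒱) (m : Env 𝒱 t →ₗ[K] Env 𝒱 t) : Prop :=
  ∀ (n : ℕ) (X : Fin n → List (Letter 𝒱)),
    m (monomial t (List.ofFn X)) =
      ∑ i : Fin n,
        koszulSign (fun i => degIn t (X i)) ([i] ++ sorted {i}ᶜ) •
          SymPlus.mk _ ([D (X i)] ++ (factors X {i}ᶜ).map packet)

/-- `ℓ(X_1 ... X_n) = ∑_{i<j} ε(x_1 ... x_n ; x_i x_j x_1 ...îĵ... x_n) L(X_i,X_j).X_1 ...îĵ... X_n`.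
-/
def IsBinaryExtension (t : ℤ) (L : List (Letter 𝒱) → List (Letter 𝒱) → Bar 𝒱)
    (ℓ : Env 𝒱 t →ₗ[K] Env 𝒱 t) : Prop :=
  ∀ (n : ℕ) (X : Fin n → List (Letter 𝒱)),
    ℓ (monomial t (List.ofFn X)) =
      ∑ i : Fin n, ∑ j : Fin n, if i < j then
        koszulSign (fun i => degIn t (X i)) ([i, j] ++ sorted {i, j}ᶜ) •
          SymPlus.mk _ ([L (X i) (X j)] ++ (factors X {i, j}ᶜ).map packet)
      else 0

/-- The canonical projection `S⁺(H[t]) → V`: the identity on monomials with one factor that has one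
letter, and zero on all other monomials. -/
def IsCanonicalProjection (t : ℤ) (π : Env 𝒱 t →ₗ[K] V) : Prop :=
  ∀ l : List (List (Letter 𝒱)), π (monomial t l) =
    match l with
    | [[α]] => α.val
    | _ => 0

end Env

/-! ### Differential graded `(a,b)`-algebras -/

section Algebras

variable {K : Type u} [Field K] {A : Type v} [AddCommGroup A] [Module K A]

/-- A differential graded `(a,b)`-algebra. -/
structure DGABAlgebra (a b : ℤ) (𝒜 : ℤ → Submodule K A) where
  mul : A →ₗ[K] A →ₗ[K] A
  bracket : A →ₗ[K] A →ₗ[K] A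
  d : A →ₗ[K] A
  mul_mem : ∀ {i j x y}, x ∈ 𝒜 i → y ∈ 𝒜 j → mul x y ∈ 𝒜 (i + j + a)
  bracket_mem : ∀ {i j x y}, x ∈ 𝒜 i → y ∈ 𝒜 j → bracket x y ∈ 𝒜 (i + j + b)
  d_mem : ∀ {i x}, x ∈ 𝒜 i → d x ∈ 𝒜 (i + 1)
  mul_comm : ∀ {i j x y}, x ∈ 𝒜 i → y ∈ 𝒜 j →
    mul x y = ((i + a) * (j + a)).negOnePow • mul y x
  mul_assoc : ∀ x y z, mul x (mul y z) = mul (mul x y) z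
  bracket_antisymm : ∀ {i j x y}, x ∈ 𝒜 i → y ∈ 𝒜 j →
    bracket x y = -(((i + b) * (j + b)).negOnePow • bracket y x)
  jacobi : ∀ {i j k x y z}, x ∈ 𝒜 i → y ∈ 𝒜 j → z ∈ 𝒜 k →
    ((i + b) * (k + b)).negOnePow • bracket (bracket x y) z
      + ((j + b) * (i + b)).negOnePow • bracket (bracket y z) x
      + ((k + b) * (j + b)).negOnePow • bracket (bracket z x) y = 0
  leibniz : ∀ {i j k x y z}, x ∈ 𝒜 i → y ∈ 𝒜 j → z ∈ 𝒜 k →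
    bracket x (mul y z) =
      mul (bracket x y) z + ((j + a) * (i + b)).negOnePow • mul y (bracket x z)
  d_d : ∀ x, d (d x) = 0
  d_mul : ∀ {i x}, x ∈ 𝒜 i → ∀ y, d (mul x y) = mul (d x) y + (i + a).negOnePow • mul x (d y)
  d_bracket : ∀ {i x}, x ∈ 𝒜 i → ∀ y,
    d (bracket x y) = bracket (d x) y + (i + b).negOnePow • bracket x (d y)

namespace DGABAlgebra

variable {a b : ℤ} {𝒜 : ℤ → Submodule K A} (X : DGABAlgebra a b 𝒜)

/-- `μ(α, β) = (-1)^α α·β` on `A[-a+1]`. -/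
def mu (α β : Letter (shift 𝒜 (-a + 1))) : A := α.deg.negOnePow • X.mul α.val β.val

/-- `ℓ(α, β) = (-1)^{(b-a+1) α} [α, β]` on `A[-a+1]`. -/
def ell (α β : Letter (shift 𝒜 (-a + 1))) : A :=
  ((b - a + 1) * α.deg).negOnePow • X.bracket α.val β.val

/-- `D = d₁ + μ₁`. -/
noncomputable def D (P : List (Letter (shift 𝒜 (-a + 1)))) : Bar (shift 𝒜 (-a + 1)) :=
  barDiff (fun α => X.d α.val) X.mu P

/-- `ℓ₂` on `H`. -/
noncomputable def ell₂ (P R : List (Letter (shift 𝒜 (-a + 1)))) : Bar (shift 𝒜 (-a + 1)) :=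
  barBracket (b - a + 1) X.ell P R

/-- `ℓ'₂(P, R) = (-1)^{(a-b-1) p'} ℓ₂(P, R)` on `H[a-b-1]`. -/
noncomputable def ell₂' (P R : List (Letter (shift 𝒜 (-a + 1)))) : Bar (shift 𝒜 (-a + 1)) :=
  ((a - b - 1) * degIn (a - b - 1) P).negOnePow • X.ell₂ P R

/-- `ℓ''₂(P, R) = (-1)^{p''} ℓ'₂(P, R)` on `H[a-b]`. -/
noncomputable def ell₂'' (P R : List (Letter (shift 𝒜 (-a + 1)))) : Bar (shift 𝒜 (-a + 1)) :=
  (degIn (a - b) P).negOnePow • X.ell₂' P R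

/-- The operations `Δ`, `δ''`, `m`, `ℓ''` on `S⁺((⊗⁺ A[-a+1] / shuffles)[a-b])`, given by their
values on monomials in packets. -/
structure IsEnvelope (E : EnvOps (shift 𝒜 (-a + 1)) (a - b)) : Prop where
  coproduct : IsCoproduct (a - b) E.coproduct
  cobracket : IsCobracket (a - b) (fun x => (a - b) * x) (fun u v => u * v + (a - b) + 1)
    E.cobracket
  m : IsUnaryExtension (a - b) X.D E.m
  ell : IsBinaryExtension (a - b) X.ell₂'' E.ell

end DGABAlgebra

/-! ### Gerstenhaber algebras and their `G∞` envelope -/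

/-- A differential graded Gerstenhaber algebra. -/
structure DGGerstenhaberAlgebra (𝒜 : ℤ → Submodule K A) where
  mul : A →ₗ[K] A →ₗ[K] A
  bracket : A →ₗ[K] A →ₗ[K] A
  d : A →ₗ[K] A
  mul_mem : ∀ {i j x y}, x ∈ 𝒜 i → y ∈ 𝒜 j → mul x y ∈ 𝒜 (i + j)
  bracket_mem : ∀ {i j x y}, x ∈ 𝒜 i → y ∈ 𝒜 j → bracket x y ∈ 𝒜 (i + j - 1)
  d_mem : ∀ {i x}, x ∈ 𝒜 i → d x ∈ 𝒜 (i + 1)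
  mul_comm : ∀ {i j x y}, x ∈ 𝒜 i → y ∈ 𝒜 j → mul x y = (i * j).negOnePow • mul y x
  mul_assoc : ∀ x y z, mul x (mul y z) = mul (mul x y) z
  bracket_antisymm : ∀ {i j x y}, x ∈ 𝒜 i → y ∈ 𝒜 j →
    bracket x y = -(((i - 1) * (j - 1)).negOnePow • bracket y x)
  jacobi : ∀ {i j k x y z}, x ∈ 𝒜 i → y ∈ 𝒜 j → z ∈ 𝒜 k →
    ((i - 1) * (k - 1)).negOnePow • bracket (bracket x y) z
      + ((j - 1) * (i - 1)).negOnePow • bracket (bracket y z) x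
      + ((k - 1) * (j - 1)).negOnePow • bracket (bracket z x) y = 0
  leibniz : ∀ {i j k x y z}, x ∈ 𝒜 i → y ∈ 𝒜 j → z ∈ 𝒜 k →
    bracket x (mul y z) = mul (bracket x y) z + (j * (i - 1)).negOnePow • mul y (bracket x z)
  d_d : ∀ x, d (d x) = 0
  d_mul : ∀ {i x}, x ∈ 𝒜 i → ∀ y, d (mul x y) = mul (d x) y + i.negOnePow • mul x (d y)
  d_bracket : ∀ {i x}, x ∈ 𝒜 i → ∀ y,
    d (bracket x y) = bracket (d x) y + (i - 1).negOnePow • bracket x (d y)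

namespace DGGerstenhaberAlgebra

variable {𝒜 : ℤ → Submodule K A} (G : DGGerstenhaberAlgebra 𝒜)

/-- A differential graded Gerstenhaber algebra is a differential graded `(0,-1)`-algebra. -/
def toAB : DGABAlgebra 0 (-1) 𝒜 where
  mul := G.mul
  bracket := G.bracket
  d := G.d
  mul_mem hx hy := by simpa using G.mul_mem hx hy
  bracket_mem hx hy := G.bracket_mem hx hy
  d_mem := G.d_mem
  mul_comm hx hy := by simpa using G.mul_comm hx hy
  mul_assoc := G.mul_assoc
  bracket_antisymm hx hy := G.bracket_antisymm hx hy
  jacobi hx hy hz := G.jacobi hx hy hz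
  leibniz {i j} _ _ _ _ hx hy hz := by
    rw [add_zero]; exact G.leibniz hx hy hz
  d_d := G.d_d
  d_mul hx y := by rw [add_zero]; exact G.d_mul hx y
  d_bracket hx y := G.d_bracket hx y

/-- The same algebra with the opposite bracket `-[ , ]`. -/
def opp : DGGerstenhaberAlgebra 𝒜 where
  mul := G.mul
  bracket := -G.bracket
  d := G.d
  mul_mem := G.mul_mem
  bracket_mem hx hy := by simpa using G.bracket_mem hx hy
  d_mem := G.d_mem
  mul_comm := G.mul_comm
  mul_assoc := G.mul_assoc
  bracket_antisymm hx hy := by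
    simp only [LinearMap.neg_apply]; rw [G.bracket_antisymm hx hy, smul_neg]
  jacobi hx hy hz := by simpa using G.jacobi hx hy hz
  leibniz hx hy hz := by
    simp only [LinearMap.neg_apply, map_neg, smul_neg]
    rw [G.leibniz hx hy hz, neg_add]
  d_d := G.d_d
  d_mul := G.d_mul
  d_bracket hx y := by
    simp only [LinearMap.neg_apply, map_neg, smul_neg]
    rw [G.d_bracket hx y, neg_add]

/-- `μ(α, β) = (-1)^{dg α} α·β` on `G[1]`. -/
def mu (α β : Letter (shift 𝒜 1)) : A := α.deg.negOnePow • G.mul α.val β.val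

/-- `D = d₁ + μ₁` on packets. -/
noncomputable def D (P : List (Letter (shift 𝒜 1))) : Bar (shift 𝒜 1) :=
  barDiff (fun α => G.d α.val) G.mu P

/-- The bracket of degree `0` on `H` that extends the one of `G[1]` (no extra sign: `c = 0`). -/
noncomputable def bracketH (P R : List (Letter (shift 𝒜 1))) : Bar (shift 𝒜 1) :=
  barBracket 0 (fun α β => G.bracket α.val β.val) P R

/-- `ℓ₂(P, R) = (-1)^p [P, R]`, with `p` the degree of `P` in `H`. -/
noncomputable def ell₂ (P R : List (Letter (shift 𝒜 1))) : Bar (shift 𝒜 1) :=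
  (totalDeg P).negOnePow • G.bracketH P R

/-- The operations `Δ`, `κ`, `m`, `ℓ` of the `G∞` envelope, on `S⁺((⊗⁺ G[1] / shuffles)[1])`. -/
structure IsGInfinityEnvelope (E : EnvOps (shift 𝒜 1) 1) : Prop where
  coproduct : IsCoproduct 1 E.coproduct
  cobracket : IsCobracket 1 (fun x => x) (fun u v => v * u) E.cobracket
  m : IsUnaryExtension 1 G.D E.m
  ell : IsBinaryExtension 1 G.ell₂ E.ell

end DGGerstenhaberAlgebra

/-! ### Poisson algebras and their `P∞` envelope -/

/-- A differential graded Poisson algebra. -/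
structure DGPoissonAlgebra (𝒜 : ℤ → Submodule K A) where
  mul : A →ₗ[K] A →ₗ[K] A
  bracket : A →ₗ[K] A →ₗ[K] A
  d : A →ₗ[K] A
  mul_mem : ∀ {i j x y}, x ∈ 𝒜 i → y ∈ 𝒜 j → mul x y ∈ 𝒜 (i + j)
  bracket_mem : ∀ {i j x y}, x ∈ 𝒜 i → y ∈ 𝒜 j → bracket x y ∈ 𝒜 (i + j)
  d_mem : ∀ {i x}, x ∈ 𝒜 i → d x ∈ 𝒜 (i + 1)
  mul_comm : ∀ {i j x y}, x ∈ 𝒜 i → y ∈ 𝒜 j → mul x y = (i * j).negOnePow • mul y x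
  mul_assoc : ∀ x y z, mul x (mul y z) = mul (mul x y) z
  bracket_antisymm : ∀ {i j x y}, x ∈ 𝒜 i → y ∈ 𝒜 j →
    bracket x y = -((i * j).negOnePow • bracket y x)
  jacobi : ∀ {i j k x y z}, x ∈ 𝒜 i → y ∈ 𝒜 j → z ∈ 𝒜 k →
    (i * k).negOnePow • bracket (bracket x y) z
      + (j * i).negOnePow • bracket (bracket y z) x
      + (k * j).negOnePow • bracket (bracket z x) y = 0
  leibniz : ∀ {i j k x y z}, x ∈ 𝒜 i → y ∈ 𝒜 j → z ∈ 𝒜 k →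
    bracket x (mul y z) = mul (bracket x y) z + (j * i).negOnePow • mul y (bracket x z)
  d_d : ∀ x, d (d x) = 0
  d_mul : ∀ {i x}, x ∈ 𝒜 i → ∀ y, d (mul x y) = mul (d x) y + i.negOnePow • mul x (d y)
  d_bracket : ∀ {i x}, x ∈ 𝒜 i → ∀ y,
    d (bracket x y) = bracket (d x) y + i.negOnePow • bracket x (d y)

namespace DGPoissonAlgebra

variable {𝒜 : ℤ → Submodule K A} (P : DGPoissonAlgebra 𝒜)

/-- A differential graded Poisson algebra is a differential graded `(0,0)`-algebra. -/
def toAB : DGABAlgebra 0 0 𝒜 where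
  mul := P.mul
  bracket := P.bracket
  d := P.d
  mul_mem hx hy := by simpa using P.mul_mem hx hy
  bracket_mem hx hy := by simpa using P.bracket_mem hx hy
  d_mem := P.d_mem
  mul_comm hx hy := by simpa using P.mul_comm hx hy
  mul_assoc := P.mul_assoc
  bracket_antisymm hx hy := by simpa using P.bracket_antisymm hx hy
  jacobi hx hy hz := by simpa using P.jacobi hx hy hz
  leibniz hx hy hz := by simpa using P.leibniz hx hy hz
  d_d := P.d_d
  d_mul hx y := by simpa using P.d_mul hx y
  d_bracket hx y := by simpa using P.d_bracket hx y

/-- The same algebra with the opposite bracket `-{ , }`. -/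
def opp : DGPoissonAlgebra 𝒜 where
  mul := P.mul
  bracket := -P.bracket
  d := P.d
  mul_mem := P.mul_mem
  bracket_mem hx hy := by simpa using P.bracket_mem hx hy
  d_mem := P.d_mem
  mul_comm := P.mul_comm
  mul_assoc := P.mul_assoc
  bracket_antisymm hx hy := by
    simp only [LinearMap.neg_apply]; rw [P.bracket_antisymm hx hy, smul_neg]
  jacobi hx hy hz := by simpa using P.jacobi hx hy hz
  leibniz hx hy hz := by
    simp only [LinearMap.neg_apply, map_neg, smul_neg]
    rw [P.leibniz hx hy hz, neg_add]
  d_d := P.d_d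
  d_mul := P.d_mul
  d_bracket hx y := by
    simp only [LinearMap.neg_apply, map_neg, smul_neg]
    rw [P.d_bracket hx y, neg_add]

/-- `μ(α, β) = (-1)^{dg α} α·β` on `P[1]`. -/
def mu (α β : Letter (shift 𝒜 1)) : A := α.deg.negOnePow • P.mul α.val β.val

/-- `[α, β] = (-1)^{dg α} {α, β}` on `P[1]`. -/
def shiftedBracket (α β : Letter (shift 𝒜 1)) : A := α.deg.negOnePow • P.bracket α.val β.val

/-- `D = d₁ + μ₁` on packets. -/
noncomputable def D (X : List (Letter (shift 𝒜 1))) : Bar (shift 𝒜 1) :=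
  barDiff (fun α => P.d α.val) P.mu X

/-- The bracket of degree `1` on `H` that extends `[ , ]`. -/
noncomputable def bracketH (X Y : List (Letter (shift 𝒜 1))) : Bar (shift 𝒜 1) :=
  barBracket 1 P.shiftedBracket X Y

/-- The operations `Δ`, `δ`, `m`, `ℓ` of the `P∞` envelope, on `S⁺(⊗⁺ P[1] / shuffles)`. -/
structure IsPInfinityEnvelope (E : EnvOps (shift 𝒜 1) 0) : Prop where
  coproduct : IsCoproduct 0 E.coproduct
  cobracket : IsCobracket 0 (fun _ => 0) (fun u v => v * u + 1) E.cobracket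
  m : IsUnaryExtension 0 P.D E.m
  ell : IsBinaryExtension 0 P.bracketH E.ell

end DGPoissonAlgebra

end Algebras

end HomotopyAB

open HomotopyAB

namespace HomotopyAB

open TensorProduct renaming map → tmap, map_map → tmap_map, map_comp → tmap_comp, map_id →
  tmap_id, lift → tlift, assoc → tassoc, mk → tmk, lid → tlid, rid → trid, ext' → text',
  map_smul_left → tmap_smul_left, map_smul_right → tmap_smul_right
open TensorProduct (map_tmul smul_tmul' tmul_add add_tmul tmul_smul zero_tmul tmul_zero neg_tmul)
open LinearMap renaming id → lid, comp_apply → lcomp, congr_fun → lcongr, add_apply → ladd,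
  smul_apply → lsmul, id_apply → lid_apply, ext → lext, id_comp → lid_comp, comp_id → lcomp_id,
  zero_apply → lzero, sub_apply → lsub, mul' → lmul', neg_apply → lneg, mulLeft_apply → lmulLeft
open TensorAlgebra renaming ι → tι
open DirectSum renaming IsInternal → IsInt

noncomputable section

variable {K : Type u} [Field K] {V : Type v} [AddCommGroup V] [Module K V] {Ξ : ℤ → Submodule K V}
  {W : Type v} [AddCommGroup W] [Module K W] {Γ : ℤ → Submodule K W}
  {C : Type*} [AddCommGroup C] [Module K C] {Θ : ℤ → Submodule K C}
  {B : Type w} [AddCommGroup B] [Module K B] {Ψ : ℤ → Submodule K B}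
  {A : Type v} [AddCommGroup A] [Module K A] {𝒜 : ℤ → Submodule K A}
  {M : Type*} [AddCommGroup M] [Module K M]

local notation:25 C " ⊸ " D:0 => C →ₗ[K] D
local notation "TV" => TensorAlgebra K V
local notation "WΞ" => List (Letter Ξ)

/-! ### Signs -/

section Sign

variable (K)

/-- The sign `(-1)^n`, as a scalar. -/
def sg (n : ℤ) : K := ((n.negOnePow : ℤ) : K)

variable {K}

lemma nop_smul (n : ℤ) (x : M) : n.negOnePow • x = sg K n • x := by
  rw [sg, Units.smul_def, Int.cast_smul_eq_zsmul]

lemma sg_congr {m n : ℤ} (h : Even (m - n)) : sg K m = sg K n := by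
  rw [sg, sg, (Int.negOnePow_eq_iff m n).2 h]

lemma sg_add (m n : ℤ) : sg K (m + n) = sg K m * sg K n := by
  simp [sg, Int.negOnePow_add]

lemma sg_mul' (m n : ℤ) : sg K m * sg K n = sg K (m + n) := (sg_add m n).symm

@[simp] lemma sg_zero : sg K 0 = 1 := by simp [sg]

lemma sg_even {m : ℤ} (h : Even m) : sg K m = 1 := by
  rw [← sg_zero]; exact sg_congr (by simpa using h)

lemma sg_mul_self (m : ℤ) : sg K m * sg K m = 1 := by
  rw [sg_mul']; exact sg_even ⟨m, rfl⟩

lemma sg_one : sg K 1 = -1 := by simp [sg]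

lemma neg_sg (m : ℤ) : -sg K m = sg K (m + 1) := by rw [sg_add, sg_one]; ring

end Sign

/-! ### Homogeneous elements -/

section Homogeneous

variable {K : Type*} [Field K] {C D E M : Type*} [AddCommGroup C] [Module K C]
  [AddCommGroup D] [Module K D] [AddCommGroup E] [Module K E] [AddCommGroup M] [Module K M]

lemma hom_induction {Θ : ℤ → Submodule K C} (h : IsInt Θ) {P : C → Prop}
    (hom : ∀ i, ∀ x ∈ Θ i, P x) (add : ∀ x y, P x → P y → P (x + y)) (x : C) : P x := by
  have hx : x ∈ ⨆ i, Θ i := by rw [h.submodule_iSup_eq_top]; trivial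
  induction hx using Submodule.iSup_induction' with
  | mem i x hx => exact hom i x hx
  | zero => exact hom 0 0 (zero_mem _)
  | add x y _ _ hx hy => exact add x y hx hy

lemma hom_ext {Θ : ℤ → Submodule K C} (h : IsInt Θ) {f g : C →ₗ[K] M}
    (H : ∀ i, ∀ x ∈ Θ i, f x = g x) : f = g := by
  ext x
  induction x using hom_induction h with
  | hom i x hx => exact H i x hx
  | add x y hx hy => rw [map_add, map_add, hx, hy]

lemma hom_ext₂ {Θ : ℤ → Submodule K C} {𝒟 : ℤ → Submodule K D} (h : IsInt Θ)
    (h' : IsInt 𝒟) {f g : C ⊗[K] D →ₗ[K] M}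
    (H : ∀ i, ∀ x ∈ Θ i, ∀ j, ∀ y ∈ 𝒟 j, f (x ⊗ₜ y) = g (x ⊗ₜ y)) : f = g :=
  TensorProduct.ext <| hom_ext h fun i x hx => hom_ext h' fun j y hy => by
    simpa using H i x hx j y hy

lemma hom_ext₃ {Θ : ℤ → Submodule K C} {𝒟 : ℤ → Submodule K D} {ℰ : ℤ → Submodule K E}
    (h : IsInt Θ) (h' : IsInt 𝒟) (h'' : IsInt ℰ)
    {f g : (C ⊗[K] D) ⊗[K] E →ₗ[K] M}
    (H : ∀ i, ∀ x ∈ Θ i, ∀ j, ∀ y ∈ 𝒟 j, ∀ k, ∀ z ∈ ℰ k, f ((x ⊗ₜ y) ⊗ₜ z) = g ((x ⊗ₜ y) ⊗ₜ z)) : f = g :=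
  TensorProduct.ext <| hom_ext₂ h h' fun i x hx j y hy => hom_ext h'' fun k z hz => by
    simpa using H i x hx j y hy k z hz

lemma internal_of_coaction {Θ : ℤ → Submodule K C} (top : (⨆ i, Θ i) = ⊤)
    (c : C →ₗ[K] ℤ →₀ C) (hc : ∀ i, ∀ x ∈ Θ i, c x = Finsupp.single i x) :
    IsInt Θ := by
  rw [DirectSum.isInternal_submodule_iff_iSupIndep_and_iSup_eq_top]
  refine ⟨?_, top⟩
  rw [iSupIndep_def]
  intro i
  rw [Submodule.disjoint_def]
  intro x hx hx'
  have key : ∀ y ∈ ⨆ j, ⨆ (_ : j ≠ i), Θ j, c y i = 0 := by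
    intro y hy
    have : (⨆ j, ⨆ (_ : j ≠ i), Θ j) ≤ LinearMap.ker (Finsupp.lapply i ∘ₗ c) := by
      refine iSup_le fun j => iSup_le fun hj z hz => ?_
      simp [hc j z hz, hj]
    simpa using this hy
  simpa [hc i x hx] using key x hx'

lemma shift_int {Θ : ℤ → Submodule K C} (h : IsInt Θ) (k : ℤ) : IsInt (shift Θ k) := by
  rw [DirectSum.isInternal_submodule_iff_iSupIndep_and_iSup_eq_top] at h ⊢
  refine ⟨h.1.comp (f := fun i : ℤ => i + k) (add_left_injective k), ?_⟩
  rw [← h.2]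
  exact (Equiv.addRight k).iSup_comp (g := Θ)

lemma par_apply (Θ : ℤ → Submodule K C) (h : IsInt Θ) (k : ℤ) {i : ℤ} {x : C}
    (hx : x ∈ Θ i) : parity Θ h k x = sg K (k * i) • x := by
  rw [parity_of_mem Θ h k hx, nop_smul (K := K)]

lemma kflip_apply (Θ : ℤ → Submodule K C) (h : IsInt Θ) {i j : ℤ} {x y : C} (hx : x ∈ Θ i) (hy : y ∈ Θ j) :
    koszulFlip Θ h (x ⊗ₜ[K] y) = sg K (i * j) • (y ⊗ₜ[K] x) := by
  rw [koszulFlip_tmul_of_mem Θ h hx hy, nop_smul (K := K)]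

lemma parity_zero (Θ : ℤ → Submodule K C) (h : IsInt Θ) : parity Θ h 0 = lid :=
  hom_ext h fun i x hx => by simp [par_apply Θ h 0 hx]

lemma parity_comp (Θ : ℤ → Submodule K C) (h : IsInt Θ) (k l : ℤ) :
    parity Θ h k ∘ₗ parity Θ h l = parity Θ h (k + l) :=
  hom_ext h fun i x hx => by
    simp [par_apply Θ h _ hx, smul_smul, sg_mul', add_mul, add_comm]

lemma parity_congr (Θ : ℤ → Submodule K C) (h : IsInt Θ) {k l : ℤ}
    (e : Even (k - l)) : parity Θ h k = parity Θ h l :=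
  hom_ext h fun i x hx => by
    rw [par_apply Θ h _ hx, par_apply Θ h _ hx, sg_congr]
    rw [← sub_mul]; exact e.mul_right i

lemma parity_parity (Θ : ℤ → Submodule K C) (h : IsInt Θ) (k : ℤ) (x : C) :
    parity Θ h k (parity Θ h k x) = x := by
  rw [← lcomp, parity_comp, parity_congr Θ h (l := 0) (by simp), parity_zero]; rfl

lemma parity_mem {Θ : ℤ → Submodule K C} (h : IsInt Θ) (k : ℤ) {i : ℤ} {x : C}
    (hx : x ∈ Θ i) : parity Θ h k x ∈ Θ i := by
  rw [par_apply Θ h k hx]; exact Submodule.smul_mem _ _ hx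

lemma koszulFlip_koszulFlip (Θ : ℤ → Submodule K C) (h : IsInt Θ) : koszulFlip Θ h ∘ₗ koszulFlip Θ h = lid :=
  hom_ext₂ h h fun i x hx j y hy => by
    simp [kflip_apply Θ h hx hy, kflip_apply Θ h hy hx, smul_smul, mul_comm j i, sg_mul_self]

lemma parity_natural {Θ : ℤ → Submodule K C} (h : IsInt Θ)
    {𝒟 : ℤ → Submodule K D} (h' : IsInt 𝒟) {f : C →ₗ[K] D}
    (hf : ∀ i, ∀ x ∈ Θ i, f x ∈ 𝒟 i) (k : ℤ) :
    parity 𝒟 h' k ∘ₗ f = f ∘ₗ parity Θ h k :=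
  hom_ext h fun i x hx => by
    simp [par_apply Θ h k hx, par_apply 𝒟 h' k (hf i x hx)]

lemma flip_natural {Θ : ℤ → Submodule K C} (h : IsInt Θ)
    {𝒟 : ℤ → Submodule K D} (h' : IsInt 𝒟) {f g : C →ₗ[K] D}
    (hf : ∀ i, ∀ x ∈ Θ i, f x ∈ 𝒟 i) (hg : ∀ i, ∀ x ∈ Θ i, g x ∈ 𝒟 i) :
    koszulFlip 𝒟 h' ∘ₗ tmap f g = tmap g f ∘ₗ koszulFlip Θ h :=
  hom_ext₂ h h fun i x hx j y hy => by
    simp [kflip_apply Θ h hx hy, kflip_apply 𝒟 h' (hf i x hx) (hg j y hy)]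

lemma tmul_mem_tgr {Θ : ℤ → Submodule K C} {i j n : ℤ} {x y : C} (hx : x ∈ Θ i)
    (hy : y ∈ Θ j) (e : i + j = n) : x ⊗ₜ[K] y ∈ tensorGrading Θ n := by
  refine Submodule.mem_iSup_of_mem i (Submodule.apply_mem_map₂ _ hx ?_)
  rwa [← e, add_sub_cancel_left]

lemma tgr_ind {Θ : ℤ → Submodule K C} {n : ℤ} {P : C ⊗[K] C → Prop}
    (tmul : ∀ i j, i + j = n → ∀ x ∈ Θ i, ∀ y ∈ Θ j, P (x ⊗ₜ y))
    (add : ∀ x y, P x → P y → P (x + y)) {z : C ⊗[K] C} (hz : z ∈ tensorGrading Θ n) : P z := by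
  have zero : P 0 := by simpa using tmul n 0 (add_zero n) 0 (zero_mem _) 0 (zero_mem _)
  induction hz using Submodule.iSup_induction' with
  | mem i x hx =>
    rw [tensorSub, Submodule.map₂] at hx
    induction hx using Submodule.iSup_induction' with
    | mem x y hy =>
      obtain ⟨y, hy, rfl⟩ := hy
      exact tmul i (n - i) (by ring) x x.2 y hy
    | zero => exact zero
    | add x y _ _ hx hy => exact add x y hx hy
  | zero => exact zero
  | add x y _ _ hx hy => exact add x y hx hy

lemma map_mem_tgr {Θ : ℤ → Submodule K C} {𝒟 : ℤ → Submodule K D} {f g : C →ₗ[K] D}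
    {k l n m : ℤ} (hf : ∀ i, ∀ x ∈ Θ i, f x ∈ 𝒟 (i + k)) (hg : ∀ i, ∀ x ∈ Θ i, g x ∈ 𝒟 (i + l))
    (e : n + k + l = m) {z : C ⊗[K] C} (hz : z ∈ tensorGrading Θ n) :
    tmap f g z ∈ tensorGrading 𝒟 m := by
  refine tgr_ind (P := fun z => tmap f g z ∈ tensorGrading 𝒟 m)
    (fun i j h x hx y hy => ?_) (fun x y hx hy => ?_) hz
  · exact tmul_mem_tgr (hf i x hx) (hg j y hy) (by omega)
  · rw [map_add]; exact add_mem hx hy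

end Homogeneous

/-! ### Tensors from components, locally finite sums, filtrations -/

section Local

variable {K : Type*} [Field K] {B C M N : Type*} [AddCommGroup B] [Module K B]
  [AddCommGroup C] [Module K C] [AddCommGroup M] [Module K M] [AddCommGroup N] [Module K N]

/-- The sum of a locally finite sequence of linear maps. -/
def locSum (f : ℕ → B →ₗ[K] M) (h : ∀ b, ∃ N, ∀ n, N ≤ n → f n b = 0) : B →ₗ[K] M where
  toFun b := ∑ᶠ n, f n b
  map_add' x y := by
    have fin : ∀ b, (Function.support fun n => f n b).Finite := fun b => by
      obtain ⟨N, hN⟩ := h b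
      refine (Set.finite_lt_nat N).subset fun n hn => ?_
      by_contra hn'
      exact hn (hN n (not_lt.1 hn'))
    simp_rw [map_add]
    exact finsum_add_distrib (fin x) (fin y)
  map_smul' r x := by simp [smul_finsum]

lemma locSum_apply {f : ℕ → B →ₗ[K] M} {h : ∀ b, ∃ N, ∀ n, N ≤ n → f n b = 0} {b : B} {N : ℕ}
    (hN : ∀ n, N ≤ n → f n b = 0) : locSum f h b = ∑ n ∈ Finset.range N, f n b := by
  refine finsum_eq_sum_of_support_subset _ fun n hn => ?_
  by_contra hn'
  exact hn (hN n (by simpa using hn'))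

lemma eq_zero_of_components {e : ℕ → C →ₗ[K] C}
    (he : ∀ x, ∃ N, ∀ m, N ≤ m → ∑ n ∈ Finset.range m, e n x = x) {y : C ⊗[K] C}
    (hy : ∀ i j, tmap (e i) (e j) y = 0) : y = 0 := by
  have key : ∀ y : C ⊗[K] C, ∃ N, ∀ m, N ≤ m →
      ∑ i ∈ Finset.range m, ∑ j ∈ Finset.range m, tmap (e i) (e j) y = y := by
    intro y
    induction y with
    | zero => exact ⟨0, by simp⟩
    | tmul a b =>
      obtain ⟨N, hN⟩ := he a
      obtain ⟨N', hN'⟩ := he b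
      refine ⟨max N N', fun m hm => ?_⟩
      simp_rw [map_tmul, ← TensorProduct.tmul_sum, ← TensorProduct.sum_tmul]
      rw [hN m (le_of_max_le_left hm), hN' m (le_of_max_le_right hm)]
    | add x y hx hy =>
      obtain ⟨N, hN⟩ := hx
      obtain ⟨N', hN'⟩ := hy
      refine ⟨max N N', fun m hm => ?_⟩
      simp_rw [map_add, Finset.sum_add_distrib]
      rw [hN m (le_of_max_le_left hm), hN' m (le_of_max_le_right hm)]
  obtain ⟨N, hN⟩ := key y
  rw [← hN N le_rfl]
  simp [hy]

/-- The subspace `∑_{i+j=n} F_i ⊗ F_j`. -/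
def tenFil (F : ℕ → Submodule K C) (n : ℕ) : Submodule K (C ⊗[K] C) :=
  ⨆ (i : ℕ) (j : ℕ) (_ : i + j = n), tensorSub (F i) (F j)

lemma tenFil_le {F : ℕ → Submodule K C} {n : ℕ} {P : Submodule K (C ⊗[K] C)}
    (H : ∀ i j, i + j = n → ∀ x ∈ F i, ∀ y ∈ F j, x ⊗ₜ y ∈ P) : tenFil F n ≤ P :=
  iSup_le fun i => iSup_le fun j => iSup_le fun h => Submodule.map₂_le.2 fun x hx y hy =>
    H i j h x hx y hy

lemma tmul_mem_tenFil {F : ℕ → Submodule K C} {n i j : ℕ} (h : i + j = n) {x y : C}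
    (hx : x ∈ F i) (hy : y ∈ F j) : x ⊗ₜ y ∈ tenFil F n :=
  Submodule.mem_iSup_of_mem i <| Submodule.mem_iSup_of_mem j <| Submodule.mem_iSup_of_mem h <|
    Submodule.apply_mem_map₂ _ hx hy

lemma map_congr_left {F : ℕ → Submodule K C} (F0 : F 0 = ⊥) {n : ℕ} {f f' : C →ₗ[K] M}
    (g : C →ₗ[K] N) (h : ∀ i < n, ∀ x ∈ F i, f x = f' x) {z : C ⊗[K] C}
    (hz : z ∈ tenFil F n) : tmap f g z = tmap f' g z := by
  suffices tenFil F n ≤ LinearMap.eqLocus (tmap f g) (tmap f' g) from this hz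
  refine tenFil_le fun i j e x hx y hy => ?_
  simp only [LinearMap.mem_eqLocus, map_tmul]
  rcases Nat.eq_zero_or_pos j with rfl | hj
  · rw [F0, Submodule.mem_bot] at hy; simp [hy]
  · rw [h i (by omega) x hx]

lemma map_congr_right {F : ℕ → Submodule K C} (F0 : F 0 = ⊥) {n : ℕ} {f f' : C →ₗ[K] M}
    (g : C →ₗ[K] N) (h : ∀ i < n, ∀ x ∈ F i, f x = f' x) {z : C ⊗[K] C}
    (hz : z ∈ tenFil F n) : tmap g f z = tmap g f' z := by
  suffices tenFil F n ≤ LinearMap.eqLocus (tmap g f) (tmap g f') from this hz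
  refine tenFil_le fun i j e x hx y hy => ?_
  simp only [LinearMap.mem_eqLocus, map_tmul]
  rcases Nat.eq_zero_or_pos i with rfl | hi
  · rw [F0, Submodule.mem_bot] at hx; simp [hx]
  · rw [h j (by omega) y hy]

end Local

/-! ### Words in the tensor algebra -/

section Words

/-- The linear map `T(V) → M` with `1 ↦ m₀` that turns left multiplication by `v` into `A v`. -/
def tensorFold (A : V ⊸ Module.End K M) (m₀ : M) : TV ⊸ M :=
  LinearMap.applyₗ m₀ ∘ₗ (TensorAlgebra.lift K A).toLinearMap

@[simp] lemma tensorFold_one (A : V ⊸ Module.End K M) (m₀ : M) : tensorFold A m₀ 1 = m₀ := by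
  simp [tensorFold]

@[simp] lemma tensorFold_mul (A : V ⊸ Module.End K M) (m₀ : M) (v : V) (t : TV) :
    tensorFold A m₀ (tι K v * t) = A v (tensorFold A m₀ t) := by
  simp [tensorFold]

/-- The tensor of a word of homogeneous vectors. -/
def word (X : WΞ) : TV := tensorWord K (vals X)

@[simp] lemma word_nil : word ([] : WΞ) = 1 := rfl

@[simp] lemma word_cons (α : Letter Ξ) (X : WΞ) : word (α :: X) = tι K α.val * word X := by
  simp [word, tensorWord, vals]

@[simp] lemma word_append (X Y : WΞ) : word (X ++ Y) = word X * word Y := by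
  simp [word, tensorWord, vals]

@[simp] lemma deg_nil : totalDeg ([] : WΞ) = 0 := rfl

@[simp] lemma deg_cons (α : Letter Ξ) (X : WΞ) : totalDeg (α :: X) = α.deg + totalDeg X := by simp [totalDeg]

@[simp] lemma deg_append (X Y : WΞ) : totalDeg (X ++ Y) = totalDeg X + totalDeg Y := by simp [totalDeg]

lemma span_words (h : IsInt Ξ) : Submodule.span K (Set.range (word : WΞ → TV)) = ⊤ := by
  set p := Submodule.span K (Set.range (word : WΞ → TV)) with hp
  have hmul : ∀ a b, a ∈ p → b ∈ p → a * b ∈ p := by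
    intro a b ha hb
    have := Submodule.mul_mem_mul ha hb
    rw [hp, Submodule.span_mul_span] at this
    refine Submodule.span_mono ?_ this
    rintro _ ⟨_, ⟨X, rfl⟩, _, ⟨Y, rfl⟩, rfl⟩
    exact ⟨X ++ Y, by simp⟩
  have hone : (1 : TV) ∈ p := Submodule.subset_span ⟨[], rfl⟩
  rw [eq_top_iff]
  rintro a -
  induction a using TensorAlgebra.induction with
  | algebraMap r => rw [Algebra.algebraMap_eq_smul_one]; exact p.smul_mem _ hone
  | ι v =>
    induction v using hom_induction h with
    | hom i x hx => exact Submodule.subset_span ⟨[⟨i, x, hx⟩], by simp⟩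
    | add x y hx hy => rw [map_add]; exact p.add_mem hx hy
  | mul a b ha hb => exact hmul a b ha hb
  | add a b ha hb => exact p.add_mem ha hb

lemma word_ext (h : IsInt Ξ) {f g : TV ⊸ M} (H : ∀ X : WΞ, f (word X) = g (word X)) : f = g :=
  LinearMap.ext_on_range (span_words h) H

lemma tensor_ext (h : IsInt Ξ) {f g : TV ⊸ M} (one : f 1 = g 1) (mul : ∀ i, ∀ v ∈ Ξ i, ∀ t, f t = g t →
      f (tι K v * t) = g (tι K v * t)) : f = g := by
  refine word_ext h fun X => ?_
  induction X with
  | nil => exact one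
  | cons α X ih => rw [word_cons]; exact mul α.deg α.val α.mem _ ih

/-- The action of `V` on `ℤ →₀ T(V)` that shifts the index by the degree. -/
def gradedMul (h : IsInt Ξ) : V ⊸ Module.End K (ℤ →₀ TV) := (DirectSum.toModule K ℤ _ fun i =>
    (LinearMap.mk₂ K (fun (v : V) (m : ℤ →₀ TV) =>
      Finsupp.lmapDomain _ K (· + i) (Finsupp.mapRange.linearMap (LinearMap.mulLeft K (tι K v)) m))
      (fun v v' m => by
        rw [← map_add]; congr 1; ext j; simp [add_mul])
      (fun c v m => by
        rw [← map_smul]; congr 1; ext j; simp)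
      (fun v m m' => by simp only [map_add])
      (fun c v m => by simp only [map_smul])) ∘ₗ (Ξ i).subtype) ∘ₗ
  (components Ξ h).toLinearMap

lemma gradedMul_single (h : IsInt Ξ) {i : ℤ} {v : V} (hv : v ∈ Ξ i) (j : ℤ) (t : TV) :
    gradedMul h v (Finsupp.single j t) = Finsupp.single (j + i) (tι K v * t) := by
  simp only [gradedMul, lcomp, LinearEquiv.coe_coe, components_of_mem Ξ h hv,
    DirectSum.toModule_lof, Submodule.subtype_apply, LinearMap.mk₂_apply,
    Finsupp.mapRange.linearMap_apply, Finsupp.mapRange_single, Finsupp.lmapDomain_apply,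
    Finsupp.mapDomain_single, lmulLeft]

/-- The coaction of `T(V)` given by its grading. -/
def degCoact (h : IsInt Ξ) : TV ⊸ ℤ →₀ TV := tensorFold (gradedMul h) (Finsupp.single 0 1)

lemma degCoact_word (h : IsInt Ξ) (X : WΞ) : degCoact h (word X) = Finsupp.single (totalDeg X) (word X) := by
  induction X with
  | nil => simp [degCoact]
  | cons α X ih =>
    rw [word_cons, degCoact, tensorFold_mul, ← degCoact, ih, gradedMul_single h α.mem, deg_cons, add_comm]

/-- The grading of a quotient of `T(V)` induced by the one of `V`. -/
def quotGrading (Ξ : ℤ → Submodule K V) (N : Submodule K TV) (n : ℤ) : Submodule K (TV ⧸ N) :=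
  Submodule.span K {s | ∃ X : List (Letter Ξ), totalDeg X = n ∧ s = N.mkQ (word X)}

lemma mkQ_word_mem (N : Submodule K TV) (X : WΞ) :
    N.mkQ (word X) ∈ quotGrading Ξ N (totalDeg X) := Submodule.subset_span ⟨X, rfl, rfl⟩

lemma quot_internal (h : IsInt Ξ) {N : Submodule K TV} {G : Set TV} (hN : N = Submodule.span K G)
    (hG : ∀ s ∈ G, Finsupp.mapRange.linearMap N.mkQ (degCoact h s) = 0) :
    IsInt (quotGrading Ξ N) := by
  have hle : N ≤ LinearMap.ker (Finsupp.mapRange.linearMap (α := ℤ) N.mkQ ∘ₗ degCoact h) := by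
    conv_lhs => rw [hN]
    exact Submodule.span_le.2 fun s hs => hG s hs
  refine internal_of_coaction ?_ (N.liftQ _ hle) fun n x hx => ?_
  · rw [eq_top_iff, ← N.range_mkQ, LinearMap.range_eq_map, ← span_words h, Submodule.map_span]
    refine Submodule.span_le.2 ?_
    rintro _ ⟨_, ⟨X, rfl⟩, rfl⟩
    exact Submodule.mem_iSup_of_mem _ (mkQ_word_mem N X)
  · induction hx using Submodule.span_induction with
    | mem x hx =>
      obtain ⟨X, rfl, rfl⟩ := hx
      simp [degCoact_word]
    | zero => simp
    | add x y _ _ hx hy => simp [hx, hy]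
    | smul c x _ hx => simp [hx]

end Words

/-! ### The graded symmetric algebra as a module over its generators -/

section SymHat

/-- The generators of the ideal of graded commutators. -/
def commutators (Γ : ℤ → Submodule K W) : Set (TensorAlgebra K W) :=
  {s | ∃ (x y : Letter Γ) (p q : TensorAlgebra K W), s = p * (tι K x.val * tι K y.val
        - (x.deg * y.deg).negOnePow • (tι K y.val * tι K x.val)) * q}

def symIdeal (Γ : ℤ → Submodule K W) : Submodule K (TensorAlgebra K W) := Submodule.span K (commutators Γ)

/-- The graded symmetric algebra (with its constants), as a vector space. -/
def SymHat (Γ : ℤ → Submodule K W) : Type (max u v) := TensorAlgebra K W ⧸ symIdeal Γ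

local notation "SΓ" => SymHat Γ

instance (Γ : ℤ → Submodule K W) : AddCommGroup (SymHat Γ) :=
  inferInstanceAs (AddCommGroup (TensorAlgebra K W ⧸ symIdeal Γ))

instance (Γ : ℤ → Submodule K W) : Module K (SymHat Γ) :=
  inferInstanceAs (Module K (TensorAlgebra K W ⧸ symIdeal Γ))

def hatMk (Γ : ℤ → Submodule K W) : TensorAlgebra K W ⊸ SymHat Γ := (symIdeal Γ).mkQ

def hatGr (Γ : ℤ → Submodule K W) (n : ℤ) : Submodule K (SymHat Γ) :=
  Submodule.span K {s | ∃ X : List (Letter Γ), totalDeg X = n ∧ s = hatMk Γ (word X)}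

lemma hatMk_surjective (Γ : ℤ → Submodule K W) : Function.Surjective (hatMk Γ) := (symIdeal Γ).mkQ_surjective

lemma hatMk_eq_zero {Γ : ℤ → Submodule K W} {t : TensorAlgebra K W} :
    hatMk Γ t = 0 ↔ t ∈ symIdeal Γ := Submodule.Quotient.mk_eq_zero _

lemma hatMk_word_mem {Γ : ℤ → Submodule K W} (X : List (Letter Γ)) :
    hatMk Γ (word X) ∈ hatGr Γ (totalDeg X) := Submodule.subset_span ⟨X, rfl, rfl⟩

lemma hatMk_ext {Γ : ℤ → Submodule K W} {f g : SymHat Γ ⊸ M}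
    (h : f ∘ₗ hatMk Γ = g ∘ₗ hatMk Γ) : f = g := Submodule.linearMap_qext _ h

/-- A linear map on `T(W)` that comes from supercommuting operators kills graded commutators. -/
lemma symIdeal_le_ker {A : W ⊸ Module.End K M} (m₀ : M)
    (hA : ∀ i, ∀ x ∈ Γ i, ∀ j, ∀ y ∈ Γ j, ∀ m, A x (A y m) = sg K (i * j) • A y (A x m)) :
    symIdeal Γ ≤ LinearMap.ker (tensorFold A m₀) := by
  refine Submodule.span_le.2 ?_
  rintro _ ⟨x, y, p, q, rfl⟩
  rw [nop_smul (K := K)]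
  simp [tensorFold, hA x.deg x.val x.mem y.deg y.val y.mem]

/-- The linear map out of the symmetric algebra given by supercommuting operators. -/
def hatLift (A : W ⊸ Module.End K M) (m₀ : M)
    (hA : ∀ i, ∀ x ∈ Γ i, ∀ j, ∀ y ∈ Γ j, ∀ m, A x (A y m) = sg K (i * j) • A y (A x m)) :
    SΓ ⊸ M :=
  (symIdeal Γ).liftQ (tensorFold A m₀) (symIdeal_le_ker m₀ hA)

variable (Γ) in
def hatOne : SΓ := hatMk Γ 1

lemma symIdeal_le_comap (w : W) : symIdeal Γ ≤ (symIdeal Γ).comap (LinearMap.mulLeft K (tι K w)) := by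
  refine Submodule.span_le.2 ?_
  rintro _ ⟨x, y, p, q, rfl⟩
  exact Submodule.subset_span ⟨x, y, tι K w * p, q, by simp [mul_assoc]⟩

variable (Γ) in
def lam : W ⊸ Module.End K SΓ where
  toFun w := (symIdeal Γ).mapQ (symIdeal Γ) (LinearMap.mulLeft K (tι K w)) (symIdeal_le_comap w)
  map_add' w w' := by
    refine hatMk_ext (lext fun _ => ?_)
    change hatMk Γ _ = hatMk Γ _ + hatMk Γ _
    rw [← map_add]; simp [add_mul]
  map_smul' c w := by
    refine hatMk_ext (lext fun _ => ?_)
    change hatMk Γ _ = c • hatMk Γ _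
    rw [← map_smul]; simp

lemma lam_hatMk (w : W) (t : TensorAlgebra K W) : lam Γ w (hatMk Γ t) = hatMk Γ (tι K w * t) := rfl

@[simp] lemma hatLift_one (A : W ⊸ Module.End K M) (m₀ : M) (hA) :
    hatLift (Γ := Γ) A m₀ hA (hatOne Γ) = m₀ := by
  exact tensorFold_one A m₀

@[simp] lemma hatLift_lam (A : W ⊸ Module.End K M) (m₀ : M) (hA) (w : W) (x : SΓ) :
    hatLift (Γ := Γ) A m₀ hA (lam Γ w x) = A w (hatLift (Γ := Γ) A m₀ hA x) := by
  obtain ⟨t, rfl⟩ := hatMk_surjective Γ x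
  exact tensorFold_mul A m₀ w t

lemma lam_lam {i j : ℤ} {x y : W} (hx : x ∈ Γ i) (hy : y ∈ Γ j) (s : SΓ) :
    lam Γ x (lam Γ y s) = sg K (i * j) • lam Γ y (lam Γ x s) := by
  obtain ⟨t, rfl⟩ := hatMk_surjective Γ s
  rw [lam_hatMk, lam_hatMk, lam_hatMk, lam_hatMk, ← map_smul, ← sub_eq_zero, ← map_sub]
  rw [hatMk_eq_zero]
  refine Submodule.subset_span ⟨⟨i, x, hx⟩, ⟨j, y, hy⟩, 1, t, ?_⟩
  rw [nop_smul (K := K)]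
  simp [sub_mul, mul_assoc]

lemma hat_ext (h : IsInt Γ) {f g : SΓ ⊸ M} (one : f (hatOne Γ) = g (hatOne Γ))
    (mul : ∀ i, ∀ w ∈ Γ i, ∀ x, f x = g x → f (lam Γ w x) = g (lam Γ w x)) : f = g :=
  hatMk_ext <| tensor_ext h one fun i v hv t ht => mul i v hv _ ht

lemma degCoact_commutator (h : IsInt Γ) {s : TensorAlgebra K W} (hs : s ∈ commutators Γ) :
    Finsupp.mapRange.linearMap (symIdeal Γ).mkQ (degCoact h s) = 0 := by
  obtain ⟨x, y, p, q, rfl⟩ := hs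
  rw [nop_smul (K := K)]
  set f := Finsupp.mapRange.linearMap (α := ℤ) (symIdeal Γ).mkQ ∘ₗ degCoact h
  set g := tι K x.val * tι K y.val - sg K (x.deg * y.deg) • (tι K y.val * tι K x.val) with hg
  rw [← lcomp]
  have key : f ∘ₗ LinearMap.mulRight K q ∘ₗ LinearMap.mulRight K g = 0 := by
    refine word_ext h fun P => ?_
    simp only [lcomp, LinearMap.mulRight_apply, lzero]
    have : f ∘ₗ LinearMap.mulLeft K (word P * g) = 0 := by
      refine word_ext h fun Q => ?_
      have e : word P * g * word Q = word (P ++ [x, y] ++ Q)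
          - sg K (x.deg * y.deg) • word (P ++ [y, x] ++ Q) := by
        simp [hg, mul_sub, sub_mul, mul_assoc]
      simp only [lcomp, lmulLeft, lzero]
      rw [e, map_sub, map_smul]
      simp only [f, lcomp, degCoact_word, Finsupp.mapRange.linearMap_apply, Finsupp.mapRange_single]
      have e' : totalDeg (P ++ [y, x] ++ Q) = totalDeg (P ++ [x, y] ++ Q) := by
        simp; ring
      rw [e', Finsupp.smul_single, ← Finsupp.single_sub, ← map_smul, ← map_sub, ← e]
      rw [Submodule.mkQ_apply, (Submodule.Quotient.mk_eq_zero _).2, Finsupp.single_zero]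
      refine Submodule.subset_span ⟨x, y, word P, word Q, ?_⟩
      rw [nop_smul (K := K)]
    exact lcongr this q
  exact lcongr key p

lemma hat_int (h : IsInt Γ) : IsInt (hatGr Γ) :=
  quot_internal h (N := symIdeal Γ) rfl fun _ hs => degCoact_commutator h hs

lemma lam_mem {i n : ℤ} {w : W} (hw : w ∈ Γ i) {x : SΓ} (hx : x ∈ hatGr Γ n) : lam Γ w x ∈ hatGr Γ (n + i) := by
  induction hx using Submodule.span_induction with
  | mem x hx =>
    obtain ⟨X, rfl, rfl⟩ := hx
    rw [lam_hatMk]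
    exact Submodule.subset_span ⟨⟨i, w, hw⟩ :: X, by simp [add_comm], by rw [word_cons]⟩
  | zero => simp
  | add x y _ _ hx hy => rw [map_add]; exact add_mem hx hy
  | smul c x _ hx => rw [map_smul]; exact Submodule.smul_mem _ _ hx

lemma hatOne_mem : hatOne Γ ∈ hatGr Γ 0 := Submodule.subset_span ⟨[], rfl, rfl⟩

/-- Homogeneous elements of the symmetric algebra, by multiplication with generators. -/
lemma hat_induction {N : ℤ → Submodule K SΓ} (one : hatOne Γ ∈ N 0)
    (mul : ∀ i, ∀ w ∈ Γ i, ∀ n, ∀ x ∈ hatGr Γ n, x ∈ N n → lam Γ w x ∈ N (n + i)) {n : ℤ}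
    {x : SΓ} (hx : x ∈ hatGr Γ n) : x ∈ N n := by
  refine (Submodule.span_le (p := N n)).2 ?_ hx
  rintro _ ⟨X, rfl, rfl⟩
  clear hx
  induction X with
  | nil => exact one
  | cons α X ih =>
    rw [word_cons, ← lam_hatMk, deg_cons, add_comm]
    exact mul _ _ α.mem _ _ (hatMk_word_mem X) ih

variable (Γ) in
/-- The counit and the projection to the generators. -/
def counitPr : SΓ ⊸ K × W :=
  hatLift (LinearMap.mk₂ K (fun w (m : K × W) => ((0 : K), m.1 • w)) (by intros; ext <;> simp)
    (by intro c w m; ext; exacts [(mul_zero c).symm, smul_comm _ _ _])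
    (by intros; ext <;> simp [add_smul]) (by intros; ext <;> simp [mul_smul])) (1, 0) (by
      intros; simp only [LinearMap.mk₂_apply, zero_smul, ← Prod.zero_eq_mk, smul_zero])

variable (Γ) in
def counit : SΓ ⊸ K := LinearMap.fst K K W ∘ₗ counitPr Γ

variable (Γ) in
def hatPr : SΓ ⊸ W := LinearMap.snd K K W ∘ₗ counitPr Γ

@[simp] lemma counit_one : counit Γ (hatOne Γ) = 1 := by simp [counit, counitPr]

@[simp] lemma counit_lam (w : W) (x : SΓ) : counit Γ (lam Γ w x) = 0 := by
  simp [counit, counitPr]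

@[simp] lemma hatPr_one : hatPr Γ (hatOne Γ) = 0 := by simp [hatPr, counitPr]

@[simp] lemma hatPr_lam (w : W) (x : SΓ) : hatPr Γ (lam Γ w x) = counit Γ x • w := by
  simp [hatPr, counit, counitPr]

variable (Γ) in
/-- The components of a given weight (number of factors). -/
def weightPart : SΓ ⊸ ℕ → SΓ :=
  hatLift (LinearMap.mk₂ K (fun w (f : ℕ → SΓ) n => Nat.casesOn n 0 fun k => lam Γ w (f k))
    (by intro a b f; ext n; cases n <;> simp) (by intro a b f; ext n; cases n <;> simp)
    (by intro a b f; ext n; cases n <;> simp) (by intro a b f; ext n; cases n <;> simp))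
    (Pi.single 0 (hatOne Γ)) (by
      intro i x hx j y hy m
      ext n
      rcases n with _ | _ | n <;> simp
      exact lam_lam hx hy _)

variable (Γ) in
def weightProj (n : ℕ) : SΓ ⊸ SΓ := LinearMap.proj n ∘ₗ weightPart Γ

@[simp] lemma weightProj_one (n : ℕ) : weightProj Γ n (hatOne Γ) = if n = 0 then hatOne Γ else 0 := by
  simp [weightProj, weightPart, Pi.single_apply]

@[simp] lemma weightProj_lam_zero (w : W) (x : SΓ) : weightProj Γ 0 (lam Γ w x) = 0 := by
  simp [weightProj, weightPart]

@[simp] lemma weightProj_lam_succ (n : ℕ) (w : W) (x : SΓ) :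
    weightProj Γ (n + 1) (lam Γ w x) = lam Γ w (weightProj Γ n x) := by
  simp [weightProj, weightPart]

lemma weightProj_zero_apply (h : IsInt Γ) (x : SΓ) : weightProj Γ 0 x = counit Γ x • hatOne Γ := by
  have : weightProj Γ 0 = (counit Γ).smulRight (hatOne Γ) := hat_ext h (by simp) (by simp)
  rw [this, LinearMap.smulRight_apply]

lemma sum_weightProj (h : IsInt Γ) (x : SΓ) : ∃ N, ∀ m, N ≤ m → ∑ n ∈ Finset.range m, weightProj Γ n x = x := by
  obtain ⟨t, rfl⟩ := hatMk_surjective Γ x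
  have ht : t ∈ Submodule.span K (Set.range (word : List (Letter Γ) → TensorAlgebra K W)) := by
    rw [span_words h]; trivial
  induction ht using Submodule.span_induction with
  | mem t ht =>
    obtain ⟨X, rfl⟩ := ht
    induction X with
    | nil =>
      refine ⟨1, fun m hm => ?_⟩
      change ∑ n ∈ Finset.range m, weightProj Γ n (hatOne Γ) = hatOne Γ
      simp [show m ≠ 0 by omega]
    | cons α X ih =>
      obtain ⟨N, hN⟩ := ih
      refine ⟨N + 1, fun m hm => ?_⟩
      obtain ⟨m, rfl⟩ : ∃ k, m = k + 1 := ⟨m - 1, by omega⟩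
      rw [word_cons, ← lam_hatMk, Finset.sum_range_succ']
      simp only [weightProj_lam_succ, weightProj_lam_zero, add_zero]
      rw [← map_sum, hN m (by omega)]
  | zero => exact ⟨0, by simp⟩
  | add x y _ _ hx hy =>
    obtain ⟨N, hN⟩ := hx
    obtain ⟨N', hN'⟩ := hy
    refine ⟨max N N', fun m hm => ?_⟩
    simp_rw [map_add, Finset.sum_add_distrib]
    rw [hN m (le_of_max_le_left hm), hN' m (le_of_max_le_right hm)]
  | smul c x _ hx =>
    obtain ⟨N, hN⟩ := hx
    refine ⟨N, fun m hm => ?_⟩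
    simp_rw [map_smul, ← Finset.smul_sum]
    rw [hN m hm]

end SymHat

local notation "SΓ" => SymHat Γ

/-! ### Coproduct and cobracket of the graded symmetric algebra -/

section HatCoalgebra

lemma parity_lam (h : IsInt Γ) (k : ℤ) {i : ℤ} {w : W} (hw : w ∈ Γ i)
    (x : SΓ) : parity (hatGr Γ) (hat_int h) k (lam Γ w x)
      = sg K (k * i) • lam Γ w (parity (hatGr Γ) (hat_int h) k x) := by
  induction x using hom_induction (hat_int h) with
  | hom n x hx =>
    rw [par_apply _ _ _ (lam_mem hw hx), par_apply _ _ _ hx, map_smul, smul_smul, sg_mul']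
    congr 2; ring
  | add x y hx hy => simp only [map_add, smul_add, hx, hy]

lemma parity_one (h : IsInt Γ) (k : ℤ) : parity (hatGr Γ) (hat_int h) k (hatOne Γ) = hatOne Γ := by
  simp [par_apply _ _ _ (hatOne_mem (Γ := Γ))]

variable (Γ) in
/-- Left multiplication by generators on the left factor. -/
def lam1 : W ⊸ Module.End K (SΓ ⊗[K] SΓ) := LinearMap.rTensorHom SΓ ∘ₗ lam Γ

def lam2 (h : IsInt Γ) : W ⊸ Module.End K (SΓ ⊗[K] SΓ) where
  toFun w := koszulFlip _ (hat_int h) ∘ₗ lam1 Γ w ∘ₗ koszulFlip _ (hat_int h)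
  map_add' w w' := by ext z; simp
  map_smul' c w := by ext z; simp

@[simp] lemma lam1_tmul (w : W) (x y : SΓ) : lam1 Γ w (x ⊗ₜ y) = lam Γ w x ⊗ₜ y := rfl

lemma lam2_eq (h : IsInt Γ) {i : ℤ} {w : W} (hw : w ∈ Γ i) :
    lam2 h w = tmap (parity (hatGr Γ) (hat_int h) i) (lam Γ w) :=
  hom_ext₂ (hat_int h) (hat_int h) fun m x hx n y hy => by
    simp only [lam2, LinearMap.coe_mk, AddHom.coe_mk, lcomp,
      kflip_apply _ _ hx hy, map_smul, lam1_tmul, kflip_apply _ _ (lam_mem hw hy) hx,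
      map_tmul, par_apply _ _ _ hx, ← smul_tmul', smul_smul,
      sg_mul']
    congr 1
    apply sg_congr; simp only [parity_simps]; tauto

lemma lam2_tmul (h : IsInt Γ) {i : ℤ} {w : W} (hw : w ∈ Γ i) (x y : SΓ) :
    lam2 h w (x ⊗ₜ y) = parity (hatGr Γ) (hat_int h) i x ⊗ₜ lam Γ w y := by
  rw [lam2_eq h hw, map_tmul]

lemma flip_flip (h : IsInt Γ) (z : SΓ ⊗[K] SΓ) : koszulFlip _ (hat_int h) (koszulFlip _ (hat_int h) z) = z :=
  lcongr (koszulFlip_koszulFlip _ (hat_int h)) z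

lemma flip_lam1 (h : IsInt Γ) (w : W) (z : SΓ ⊗[K] SΓ) :
    koszulFlip _ (hat_int h) (lam1 Γ w z) = lam2 h w (koszulFlip _ (hat_int h) z) := by
  simp [lam2, flip_flip h]

lemma flip_lam2 (h : IsInt Γ) (w : W) (z : SΓ ⊗[K] SΓ) :
    koszulFlip _ (hat_int h) (lam2 h w z) = lam1 Γ w (koszulFlip _ (hat_int h) z) := by
  simp [lam2, flip_flip h]

lemma lam1_lam1 {i j : ℤ} {x y : W} (hx : x ∈ Γ i) (hy : y ∈ Γ j) (z : SΓ ⊗[K] SΓ) :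
    lam1 Γ x (lam1 Γ y z) = sg K (i * j) • lam1 Γ y (lam1 Γ x z) := by
  induction z with
  | zero => simp
  | tmul a b => simp [lam_lam hx hy, smul_tmul']
  | add a b ha hb => simp only [map_add, smul_add, ha, hb]

lemma lam2_lam2 (h : IsInt Γ) {i j : ℤ} {x y : W} (hx : x ∈ Γ i) (hy : y ∈ Γ j) (z : SΓ ⊗[K] SΓ) :
    lam2 h x (lam2 h y z) = sg K (i * j) • lam2 h y (lam2 h x z) := by
  simp [lam2, flip_flip h, lam1_lam1 hx hy]

lemma lam1_lam2 (h : IsInt Γ) {i j : ℤ} {x y : W} (hx : x ∈ Γ i) (hy : y ∈ Γ j) (z : SΓ ⊗[K] SΓ) :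
    lam1 Γ x (lam2 h y z) = sg K (i * j) • lam2 h y (lam1 Γ x z) := by
  induction z with
  | zero => simp
  | tmul a b =>
    simp only [lam2_tmul h hy, lam1_tmul, parity_lam h j hx, ← smul_tmul', smul_smul, sg_mul', mul_comm j i]
    rw [sg_even (by simp), one_smul]
  | add a b ha hb => simp only [map_add, smul_add, ha, hb]

def diag (h : IsInt Γ) : W ⊸ Module.End K (SΓ ⊗[K] SΓ) := lam1 Γ + lam2 h

lemma diag_apply (h : IsInt Γ) (w : W) (z : SΓ ⊗[K] SΓ) : diag h w z = lam1 Γ w z + lam2 h w z := rfl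

lemma lam2_lam1 (h : IsInt Γ) {i j : ℤ} {x y : W} (hx : x ∈ Γ i) (hy : y ∈ Γ j) (z : SΓ ⊗[K] SΓ) :
    lam2 h x (lam1 Γ y z) = sg K (i * j) • lam1 Γ y (lam2 h x z) := by
  rw [lam1_lam2 h hy hx, smul_smul, mul_comm j i, sg_mul_self, one_smul]

lemma diag_diag (h : IsInt Γ) {i j : ℤ} {x y : W} (hx : x ∈ Γ i) (hy : y ∈ Γ j) (z : SΓ ⊗[K] SΓ) :
    diag h x (diag h y z) = sg K (i * j) • diag h y (diag h x z) := by
  simp only [diag_apply, map_add, smul_add, lam1_lam1 hx hy, lam2_lam2 h hx hy, lam1_lam2 h hx hy,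
    lam2_lam1 h hx hy]
  abel

lemma lam1_mem {i n : ℤ} {w : W} (hw : w ∈ Γ i) {z : SΓ ⊗[K] SΓ}
    (hz : z ∈ tensorGrading (hatGr Γ) n) : lam1 Γ w z ∈ tensorGrading (hatGr Γ) (n + i) :=
  map_mem_tgr (k := i) (l := 0) (fun _ _ => lam_mem hw) (fun i x hx => by simpa using hx) (by ring) hz

lemma lam2_mem (h : IsInt Γ) {i n : ℤ} {w : W} (hw : w ∈ Γ i)
    {z : SΓ ⊗[K] SΓ} (hz : z ∈ tensorGrading (hatGr Γ) n) :
    lam2 h w z ∈ tensorGrading (hatGr Γ) (n + i) := by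
  rw [lam2_eq h hw]
  exact map_mem_tgr (k := 0) (l := i)
    (fun i x hx => by rw [add_zero]; exact parity_mem _ _ hx) (fun _ _ => lam_mem hw) (by ring) hz

def hatΔ (h : IsInt Γ) : SΓ ⊸ SΓ ⊗[K] SΓ :=
  hatLift (diag h) (hatOne Γ ⊗ₜ hatOne Γ) fun _ _ hx _ _ hy => diag_diag h hx hy

@[simp] lemma hatΔ_one (h : IsInt Γ) : hatΔ h (hatOne Γ) = hatOne Γ ⊗ₜ hatOne Γ := by simp [hatΔ]

@[simp] lemma hatΔ_lam (h : IsInt Γ) (w : W) (x : SΓ) :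
    hatΔ h (lam Γ w x) = diag h w (hatΔ h x) := by simp [hatΔ]

lemma hatΔ_mem (h : IsInt Γ) {n : ℤ} {x : SΓ} (hx : x ∈ hatGr Γ n) : hatΔ h x ∈ tensorGrading (hatGr Γ) n := by
  refine hat_induction (N := fun n => (tensorGrading (hatGr Γ) n).comap (hatΔ h)) ?_ ?_ hx
  · simpa using tmul_mem_tgr hatOne_mem hatOne_mem (add_zero 0)
  · intro i w hw n x _ hx
    simp only [Submodule.mem_comap, hatΔ_lam, diag_apply] at hx ⊢
    exact add_mem (lam1_mem hw hx) (lam2_mem h hw hx)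

lemma parity_cooperation {C : Type*} [AddCommGroup C] [Module K C] {Θ : ℤ → Submodule K C}
    (h : IsInt Θ) {p : ℤ} {f : C ⊸ C ⊗[K] C}
    (hf : ∀ i, ∀ x ∈ Θ i, f x ∈ tensorGrading Θ (i - p)) (k : ℤ) (x : C) :
    tmap (parity Θ h k) (parity Θ h k) (f x) = sg K (k * p) • f (parity Θ h k x) := by
  have key : ∀ n, ∀ z ∈ tensorGrading Θ n, tmap (parity Θ h k) (parity Θ h k) z = sg K (k * n) • z := by
    intro n z hz
    refine tgr_ind (P := fun z => tmap (parity Θ h k)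
      (parity Θ h k) z = sg K (k * n) • z) (fun i j e x hx y hy => ?_) (fun x y hx hy => ?_) hz
    · simp only [map_tmul, par_apply Θ h k hx, par_apply Θ h k hy, TensorProduct.smul_tmul_smul, sg_mul']
      rw [← mul_add, e]
    · rw [map_add, hx, hy, smul_add]
  induction x using hom_induction h with
  | hom i x hx =>
    rw [key _ _ (hf i x hx), par_apply Θ h k hx, map_smul, smul_smul, sg_mul']
    congr 1
    apply sg_congr; simp only [parity_simps]; tauto
  | add x y hx hy => simp only [map_add, smul_add, hx, hy]

lemma hatΔ_cocomm (h : IsInt Γ) (x : SΓ) : koszulFlip _ (hat_int h) (hatΔ h x) = hatΔ h x := by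
  suffices koszulFlip _ (hat_int h) ∘ₗ hatΔ h = hatΔ h from lcongr this x
  refine hat_ext h ?_ fun i w hw x hx => ?_
  · simp [kflip_apply _ _ (hatOne_mem (Γ := Γ)) hatOne_mem]
  · rw [lcomp] at hx ⊢
    rw [hatΔ_lam, diag_apply, map_add, flip_lam1 h, flip_lam2 h, hx, add_comm]

lemma hatΔ_counit (h : IsInt Γ) (x : SΓ) : tlid K _ (tmap (counit Γ) lid (hatΔ h x)) = x := by
  suffices (tlid K _).toLinearMap ∘ₗ tmap (counit Γ) lid ∘ₗ hatΔ h = lid from lcongr this x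
  refine hat_ext h (by simp) fun i w hw x hx => ?_
  have h1 : tmap (counit Γ) lid ∘ₗ lam1 Γ w = 0 := text' fun a b => by simp
  have hpar : counit Γ ∘ₗ parity (hatGr Γ) (hat_int h) i = counit Γ :=
    hat_ext h (by simp [parity_one h]) fun j v hv x _ => by simp [parity_lam h i hv]
  have h2 : (tlid K _).toLinearMap ∘ₗ tmap (counit Γ) lid ∘ₗ lam2 h w = lam Γ w ∘ₗ
      (tlid K _).toLinearMap ∘ₗ tmap (counit Γ) lid :=
    text' fun a b => by
      have := lcongr hpar a
      simp only [lcomp] at this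
      simp [lam2_tmul h hw, this]
  have h2' := lcongr h2 (hatΔ h x)
  have h1' := lcongr h1 (hatΔ h x)
  simp only [lcomp, LinearEquiv.coe_coe, lid_apply, lzero] at hx h1' h2' ⊢
  rw [hatΔ_lam, diag_apply, map_add, map_add, h1', h2', hx, map_zero, zero_add]

/-- The operators `A u ∘ B v`, as a function of `u ⊗ v`. -/
def mulMap (A B : W ⊸ Module.End K M) : W ⊗[K] W ⊸ Module.End K M :=
  tlift ((LinearMap.mul K (Module.End K M)).compl₁₂ A B)

@[simp] lemma mulMap_tmul (A B : W ⊸ Module.End K M) (u v : W) (m : M) :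
    mulMap A B (u ⊗ₜ v) m = A u (B v m) := by
  simp [mulMap]

lemma hatPr_mem {n : ℤ} {x : SΓ} (hx : x ∈ hatGr Γ n) : hatPr Γ x ∈ Γ n := by
  refine (hat_induction (N := fun n => (Γ n).comap (hatPr Γ) ⊓
    (if n = 0 then ⊤ else LinearMap.ker (counit Γ))) (by simp) ?_ hx).1
  intro i w hw n x _ hx
  simp only [Submodule.mem_inf, Submodule.mem_comap, hatPr_lam] at hx ⊢
  split_ifs at hx with h0
  · subst h0
    refine ⟨?_, by split_ifs <;> simp⟩
    rw [zero_add]; exact Submodule.smul_mem _ _ hw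
  · rw [LinearMap.mem_ker] at hx
    rw [hx.2, zero_smul]
    exact ⟨zero_mem _, by split_ifs <;> simp⟩

/-- The cobracket of the symmetric algebra that extends the one of the generators. -/
def hatδ (h : IsInt Γ) (δ : W ⊸ W ⊗[K] W) : SΓ ⊸ SΓ ⊗[K] SΓ :=
  tlift ((mulMap (lam1 Γ) (lam2 h) ∘ₗ δ ∘ₗ hatPr Γ).compl₂ (hatΔ h)) ∘ₗ hatΔ h

variable {δ : W →ₗ[K] W ⊗[K] W} {p : ℤ}

@[simp] lemma hatδ_one (h : IsInt Γ) : hatδ h δ (hatOne Γ) = 0 := by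
  simp [hatδ]

lemma mulMap_diag (h : IsInt Γ) {i k : ℤ} {w : W} (hw : w ∈ Γ i) {t : W ⊗[K] W}
    (ht : t ∈ tensorGrading Γ k) (z : SΓ ⊗[K] SΓ) :
    mulMap (lam1 Γ) (lam2 h) t (diag h w z) = sg K (i * k) • diag h w (mulMap (lam1 Γ) (lam2 h) t z) := by
  refine tgr_ind (P := fun t => mulMap (lam1 Γ) (lam2 h) t (diag h w z)
      = sg K (i * k) • diag h w (mulMap (lam1 Γ) (lam2 h) t z))
    (fun a b e x hx y hy => ?_) (fun x y hx hy => ?_) ht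
  · simp only [mulMap_tmul, diag_apply, map_add, lam2_lam1 h hy hw, lam1_lam1 hx hw, map_smul,
      lam2_lam2 h hy hw, lam1_lam2 h hx hw, smul_smul, sg_mul', smul_add]
    rw [← e]
    congr 2 <;> (apply sg_congr; simp only [parity_simps]; tauto)
  · rw [map_add, ladd, ladd, hx, hy, map_add, smul_add]

lemma hatδ_lam (h : IsInt Γ) (hδ : ∀ i, ∀ x ∈ Γ i, δ x ∈ tensorGrading Γ (i - p)) {i : ℤ} {w : W} (hw : w ∈ Γ i)
    (x : SΓ) : hatδ h δ (lam Γ w x) = mulMap (lam1 Γ) (lam2 h) (δ w) (hatΔ h x)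
      + sg K (p * i) • diag h w (hatδ h δ x) := by
  set F := tlift ((mulMap (lam1 Γ) (lam2 h) ∘ₗ δ ∘ₗ hatPr Γ).compl₂ (hatΔ h)) with hF
  have h1 : F ∘ₗ lam1 Γ w = mulMap (lam1 Γ) (lam2 h) (δ w) ∘ₗ hatΔ h ∘ₗ
      (tlid K _).toLinearMap ∘ₗ tmap (counit Γ) lid :=
    text' fun a b => by simp [hF]
  have h2 : F ∘ₗ lam2 h w = sg K (p * i) • (diag h w ∘ₗ F) :=
    hom_ext₂ (hat_int h) (hat_int h) fun k a ha l b hb => by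
      simp only [hF, lcomp, lam2_tmul h hw, par_apply _ _ _ ha,
        ← smul_tmul', map_smul, TensorProduct.lift.tmul, LinearMap.compl₂_apply,
        hatΔ_lam, mulMap_diag h hw (hδ _ _ (hatPr_mem ha)), lsmul, smul_smul,
        sg_mul']
      congr 1
      apply sg_congr; simp only [parity_simps]; tauto
  have h1' := lcongr h1 (hatΔ h x)
  have h2' := lcongr h2 (hatΔ h x)
  simp only [lcomp, LinearEquiv.coe_coe, hatΔ_counit] at h1' h2'
  rw [hatδ, lcomp, lcomp, ← hF, hatΔ_lam, diag_apply, map_add, h1', h2']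
  rfl

lemma hatδ_mem (h : IsInt Γ) (hδ : ∀ i, ∀ x ∈ Γ i, δ x ∈ tensorGrading Γ (i - p)) {n : ℤ} {x : SΓ}
    (hx : x ∈ hatGr Γ n) : hatδ h δ x ∈ tensorGrading (hatGr Γ) (n - p) := by
  refine hat_induction (N := fun n => (tensorGrading (hatGr Γ) (n - p)).comap (hatδ h δ)) (by simp) ?_ hx
  intro i w hw n x hx0 hx
  simp only [Submodule.mem_comap, hatδ_lam h hδ hw, diag_apply] at hx ⊢
  have e : n + i - p = n - p + i := by ring
  rw [e]
  refine add_mem ?_ (Submodule.smul_mem _ _ (add_mem (lam1_mem hw hx) (lam2_mem h hw hx)))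
  refine tgr_ind (P := fun t => mulMap (lam1 Γ) (lam2 h) t (hatΔ h x) ∈ tensorGrading (hatGr Γ) (n - p + i))
    (fun a b e' u hu v hv => ?_) (fun u v hu hv => ?_) (hδ i w hw)
  · rw [mulMap_tmul, show n - p + i = n + b + a by omega]
    exact lam1_mem hu (lam2_mem h hv (hatΔ_mem h hx0))
  · rw [map_add]; exact add_mem hu hv

lemma flip_diag (h : IsInt Γ) (w : W) (z : SΓ ⊗[K] SΓ) :
    koszulFlip _ (hat_int h) (diag h w z) = diag h w (koszulFlip _ (hat_int h) z) := by
  rw [diag_apply, map_add, flip_lam1 h, flip_lam2 h, add_comm, diag_apply]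

lemma flip_mulMap (h : IsInt Γ) (t : W ⊗[K] W) (z : SΓ ⊗[K] SΓ) :
    koszulFlip _ (hat_int h) (mulMap (lam1 Γ) (lam2 h) t z)
      = mulMap (lam1 Γ) (lam2 h) (koszulFlip Γ h t) (koszulFlip _ (hat_int h) z) := by
  suffices (LinearMap.llcomp K _ _ _ (koszulFlip _ (hat_int h))) ∘ₗ mulMap (lam1 Γ) (lam2 h)
    = (LinearMap.llcomp K _ _ _).flip (koszulFlip _ (hat_int h)) ∘ₗ mulMap (lam1 Γ) (lam2 h) ∘ₗ koszulFlip Γ h from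
    lcongr (lcongr this t) z
  refine hom_ext₂ h h fun i u hu j v hv => lext fun z => ?_
  simp [flip_lam1 h, flip_lam2 h, kflip_apply Γ h hu hv, lam2_lam1 h hu hv]

lemma hatδ_coantisymm (h : IsInt Γ) (hδ : ∀ i, ∀ x ∈ Γ i, δ x ∈ tensorGrading Γ (i - p))
    (anti : ∀ w, koszulFlip Γ h (δ w) = -sg K p • δ w) (x : SΓ) :
    koszulFlip _ (hat_int h) (hatδ h δ x) = -sg K p • hatδ h δ x := by
  suffices koszulFlip _ (hat_int h) ∘ₗ hatδ h δ = -sg K p • hatδ h δ from lcongr this x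
  refine hat_ext h (by simp) fun i w hw x hx => ?_
  simp only [lcomp, lsmul] at hx ⊢
  rw [hatδ_lam h hδ hw, map_add, flip_mulMap h, anti, hatΔ_cocomm h, map_smul, map_smul, flip_diag h, hx]
  simp [smul_smul, mul_comm]

end HatCoalgebra

/-! ### Permutations of three factors -/

section Triple

lemma flip12_tmul (h : IsInt Θ) {i j : ℤ} {x y : C} (hx : x ∈ Θ i) (hy : y ∈ Θ j) (z : C) :
    flip12 Θ h ((x ⊗ₜ y) ⊗ₜ z) = sg K (i * j) • ((y ⊗ₜ x) ⊗ₜ z) := by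
  simp [flip12, kflip_apply Θ h hx hy, smul_tmul']

lemma flip23_tmul (h : IsInt Θ) {i j : ℤ} (x : C) {y z : C} (hy : y ∈ Θ i) (hz : z ∈ Θ j) :
    flip23 Θ h ((x ⊗ₜ y) ⊗ₜ z) = sg K (i * j) • ((x ⊗ₜ z) ⊗ₜ y) := by
  simp [flip23, kflip_apply Θ h hy hz]

lemma flip12_flip12 (h : IsInt Θ) (z : (C ⊗[K] C) ⊗[K] C) : flip12 Θ h (flip12 Θ h z) = z := by
  suffices flip12 Θ h ∘ₗ flip12 Θ h = lid from lcongr this z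
  rw [flip12, ← tmap_comp, koszulFlip_koszulFlip, lid_comp, tmap_id]

lemma flip23_flip23 (h : IsInt Θ) (z : (C ⊗[K] C) ⊗[K] C) : flip23 Θ h (flip23 Θ h z) = z := by
  suffices flip23 Θ h ∘ₗ flip23 Θ h = lid from lcongr this z
  refine hom_ext₃ h h h fun i x hx j y hy k z hz => ?_
  simp only [lcomp, flip23_tmul h x hy hz, flip23_tmul h x hz hy, map_smul,
    smul_smul, mul_comm k j, sg_mul_self, one_smul, lid_apply]

lemma flip_braid (h : IsInt Θ) (z : (C ⊗[K] C) ⊗[K] C) :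
    flip23 Θ h (flip12 Θ h (flip23 Θ h z)) = flip12 Θ h (flip23 Θ h (flip12 Θ h z)) := by
  suffices flip23 Θ h ∘ₗ flip12 Θ h ∘ₗ flip23 Θ h = flip12 Θ h ∘ₗ flip23 Θ h ∘ₗ flip12 Θ h from lcongr this z
  refine hom_ext₃ h h h fun i x hx j y hy k z hz => ?_
  simp only [lcomp, flip23_tmul h _ hx hy, flip23_tmul h _ hx hz, flip23_tmul h _ hy hz,
    flip12_tmul h hx hy, flip12_tmul h hx hz, flip12_tmul h hy hz, map_smul,
    smul_smul, sg_mul']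
  congr 2; ring

/-- A graded Lie coalgebra with a cobracket of degree `-p`. -/
structure IsLieCoalg (p : ℤ) (Θ : ℤ → Submodule K C) (h : IsInt Θ)
    (δ : C ⊸ C ⊗[K] C) : Prop where
  mem : ∀ i, ∀ x ∈ Θ i, δ x ∈ tensorGrading Θ (i - p)
  antisymm : ∀ x, koszulFlip Θ h (δ x) = -sg K p • δ x
  jacobi : ∀ x, onLeft δ (δ x) + flip12 Θ h (flip23 Θ h (onLeft δ (δ x)))
    + flip23 Θ h (flip12 Θ h (onLeft δ (δ x))) = 0

lemma isLieCoalg_of_bicoalgebra {p : ℤ} {Δ δ : C ⊸ C ⊗[K] C}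
    (H : IsGradedBicoalgebra p Θ Δ δ) : IsLieCoalg p Θ H.internal δ where
  mem := H.cobracket_mem
  antisymm x := by
    have := lcongr H.coantisymmetric x
    simpa [nop_smul (K := K)] using this
  jacobi x := lcongr H.coJacobi x

lemma flip12_onLeft (h : IsInt Θ) {f : C ⊸ C ⊗[K] C} {c : K}
    (hf : ∀ x, koszulFlip Θ h (f x) = c • f x) (z : C ⊗[K] C) :
    flip12 Θ h (onLeft f z) = c • onLeft f z := by
  suffices flip12 Θ h ∘ₗ onLeft f = c • onLeft f from lcongr this z
  exact text' fun x y => by simp [flip12, onLeft, hf, smul_tmul']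

/-- `id ⊗ f` is `f ⊗ id` conjugated by the flips. -/
lemma onRight_flip (h : IsInt Θ) {p : ℤ} {f : C ⊸ C ⊗[K] C}
    (hf : ∀ i, ∀ x ∈ Θ i, f x ∈ tensorGrading Θ (i - p)) (z : C ⊗[K] C) :
    onRight Θ h p f (koszulFlip Θ h z) = flip12 Θ h (flip23 Θ h (onLeft f z)) := by
  suffices onRight Θ h p f ∘ₗ koszulFlip Θ h = flip12 Θ h ∘ₗ flip23 Θ h ∘ₗ onLeft f from lcongr this z
  refine hom_ext₂ h h fun i x hx j y hy => ?_
  simp only [lcomp, kflip_apply Θ h hx hy, map_smul, onRight, onLeft,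
    map_tmul, par_apply Θ h p hy, lid_apply, LinearEquiv.coe_coe]
  rw [← smul_tmul', map_smul, smul_smul, sg_mul']
  refine tgr_ind (P := fun t => sg K (i * j + p * j) •
    (tassoc K C C C).symm (y ⊗ₜ[K] t) = flip12 Θ h (flip23 Θ h (t ⊗ₜ[K] y)))
    (fun a b e u hu v hv => ?_) (fun u v hu hv => ?_) (hf i x hx)
  · simp only [flip23_tmul h _ hv hy, map_smul, flip12_tmul h hu hy, smul_smul, sg_mul',
      TensorProduct.assoc_symm_tmul]
    congr 1
    obtain rfl : i = a + b + p := by omega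
    apply sg_congr; simp only [parity_simps]; tauto
  · rw [tmul_add, map_add, smul_add, hu, hv, add_tmul, map_add, map_add]

end Triple

section HatTriple

variable (Γ) in
/-- Multiplication by generators on the first of three factors. -/
def tri1 : W ⊸ Module.End K ((SΓ ⊗[K] SΓ) ⊗[K] SΓ) := LinearMap.rTensorHom SΓ ∘ₗ lam1 Γ

def tri2 (h : IsInt Γ) : W ⊸ Module.End K ((SΓ ⊗[K] SΓ) ⊗[K] SΓ) := LinearMap.rTensorHom SΓ ∘ₗ lam2 h

def tri3 (h : IsInt Γ) : W ⊸ Module.End K ((SΓ ⊗[K] SΓ) ⊗[K] SΓ) where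
  toFun w := flip23 _ (hat_int h) ∘ₗ tri2 h w ∘ₗ flip23 _ (hat_int h)
  map_add' w w' := lext fun z => by simp
  map_smul' c w := lext fun z => by simp

variable (h : IsInt Γ)

lemma tri1_tmul (w : W) (z : SΓ ⊗[K] SΓ) (y : SΓ) : tri1 Γ w (z ⊗ₜ y) = lam1 Γ w z ⊗ₜ y := rfl

lemma tri2_tmul (w : W) (z : SΓ ⊗[K] SΓ) (y : SΓ) : tri2 h w (z ⊗ₜ y) = lam2 h w z ⊗ₜ y := rfl

lemma tri3_eq {i : ℤ} {w : W} (hw : w ∈ Γ i) : tri3 h w = tmap (tmap (parity _ (hat_int h) i)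
      (parity _ (hat_int h) i)) (lam Γ w) := by
  refine hom_ext₃ (hat_int h) (hat_int h) (hat_int h) fun a x hx b y hy c z hz => ?_
  simp only [tri3, LinearMap.coe_mk, AddHom.coe_mk, lcomp, flip23_tmul _ x hy hz,
    map_smul, tri2_tmul, lam2_tmul h hw, par_apply _ _ _ hx, par_apply _ _ _ hy,
    flip23_tmul _ _ (lam_mem hw hz) hy, map_tmul, ← smul_tmul',
    tmul_smul, smul_smul, sg_mul']
  congr 1; apply sg_congr; simp only [parity_simps]; tauto

lemma tri3_tmul {i : ℤ} {w : W} (hw : w ∈ Γ i) (z : SΓ ⊗[K] SΓ) (y : SΓ) :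
    tri3 h w (z ⊗ₜ y) = tmap (parity _ (hat_int h) i) (parity _ (hat_int h) i) z ⊗ₜ lam Γ w y := by
  rw [tri3_eq h hw, map_tmul]

lemma flip12_tri1 (w : W) (z : (SΓ ⊗[K] SΓ) ⊗[K] SΓ) :
    flip12 _ (hat_int h) (tri1 Γ w z) = tri2 h w (flip12 _ (hat_int h) z) := by
  induction z with
  | zero => simp
  | tmul x y => simp [flip12, tri1_tmul, tri2_tmul, flip_lam1 h]
  | add x y hx hy => simp only [map_add, hx, hy]

lemma flip12_tri2 (w : W) (z : (SΓ ⊗[K] SΓ) ⊗[K] SΓ) :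
    flip12 _ (hat_int h) (tri2 h w z) = tri1 Γ w (flip12 _ (hat_int h) z) := by
  induction z with
  | zero => simp
  | tmul x y => simp [flip12, tri1_tmul, tri2_tmul, flip_lam2 h]
  | add x y hx hy => simp only [map_add, hx, hy]

lemma flip23_tri2 (w : W) (z : (SΓ ⊗[K] SΓ) ⊗[K] SΓ) :
    flip23 _ (hat_int h) (tri2 h w z) = tri3 h w (flip23 _ (hat_int h) z) := by
  simp [tri3, flip23_flip23 (hat_int h)]

lemma flip23_tri3 (w : W) (z : (SΓ ⊗[K] SΓ) ⊗[K] SΓ) :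
    flip23 _ (hat_int h) (tri3 h w z) = tri2 h w (flip23 _ (hat_int h) z) := by
  simp [tri3, flip23_flip23 (hat_int h)]

lemma hom_apply (h : IsInt Γ) {f g : W ⊸ M} (H : ∀ i, ∀ w ∈ Γ i, f w = g w) (w : W) : f w = g w :=
  lcongr (hom_ext h H) w

lemma flip23_tri1 (w : W) (z : (SΓ ⊗[K] SΓ) ⊗[K] SΓ) :
    flip23 _ (hat_int h) (tri1 Γ w z) = tri1 Γ w (flip23 _ (hat_int h) z) := by
  suffices flip23 _ (hat_int h) ∘ₗ tri1 Γ w = tri1 Γ w ∘ₗ flip23 _ (hat_int h) from lcongr this z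
  refine hom_ext₃ (hat_int h) (hat_int h) (hat_int h) fun a x hx b y hy c z hz => ?_
  simp only [lcomp, tri1_tmul, lam1_tmul, flip23_tmul _ _ hy hz, map_smul]

lemma flip12_tri3_hom {i : ℤ} {w : W} (hw : w ∈ Γ i) (z : (SΓ ⊗[K] SΓ) ⊗[K] SΓ) :
    flip12 _ (hat_int h) (tri3 h w z) = tri3 h w (flip12 _ (hat_int h) z) := by
  suffices flip12 _ (hat_int h) ∘ₗ tri3 h w = tri3 h w ∘ₗ flip12 _ (hat_int h) from lcongr this z
  refine hom_ext₃ (hat_int h) (hat_int h) (hat_int h) fun a x hx b y hy c z hz => ?_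
  simp only [lcomp, tri3_tmul h hw, map_tmul,
    flip12_tmul _ (parity_mem _ _ hx) (parity_mem _ _ hy), flip12_tmul _ hx hy, map_smul]

lemma flip12_tri3 (w : W) (z : (SΓ ⊗[K] SΓ) ⊗[K] SΓ) :
    flip12 _ (hat_int h) (tri3 h w z) = tri3 h w (flip12 _ (hat_int h) z) :=
  hom_apply h (f := flip12 _ (hat_int h) ∘ₗ (tri3 h).flip z)
    (g := (tri3 h).flip (flip12 _ (hat_int h) z)) (fun _ _ hw => flip12_tri3_hom h hw z) w

lemma tri1_tri2 {i j : ℤ} {x y : W} (hx : x ∈ Γ i) (hy : y ∈ Γ j) (z : (SΓ ⊗[K] SΓ) ⊗[K] SΓ) :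
    tri1 Γ x (tri2 h y z) = sg K (i * j) • tri2 h y (tri1 Γ x z) := by
  induction z with
  | zero => simp
  | tmul a b => simp only [tri1_tmul, tri2_tmul, lam1_lam2 h hx hy, smul_tmul']
  | add a b ha hb => simp only [map_add, smul_add, ha, hb]

lemma tri1_tri3 {i j : ℤ} {x y : W} (hx : x ∈ Γ i) (hy : y ∈ Γ j) (z : (SΓ ⊗[K] SΓ) ⊗[K] SΓ) :
    tri1 Γ x (tri3 h y z) = sg K (i * j) • tri3 h y (tri1 Γ x z) := by
  rw [← flip23_flip23 (hat_int h) (tri1 Γ x _), flip23_tri1 h, flip23_tri3 h,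
    tri1_tri2 h hx hy, map_smul, flip23_tri2 h, flip23_tri1 h, flip23_flip23 (hat_int h)]

lemma tri1_assoc (w : W) (x : SΓ) (z : SΓ ⊗[K] SΓ) : tri1 Γ w ((tassoc K _ _ _).symm (x ⊗ₜ z))
      = (tassoc K _ _ _).symm (lam Γ w x ⊗ₜ z) := by
  induction z with
  | zero => simp
  | tmul a b => rfl
  | add a b ha hb => simp only [tmul_add, map_add, ha, hb]

lemma tri2_assoc {i : ℤ} {w : W} (hw : w ∈ Γ i) (x : SΓ) (z : SΓ ⊗[K] SΓ) :
    tri2 h w ((tassoc K _ _ _).symm (x ⊗ₜ z))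
      = (tassoc K _ _ _).symm (parity _ (hat_int h) i x ⊗ₜ lam1 Γ w z) := by
  induction z with
  | zero => simp
  | tmul a b => simp [tri2_tmul, lam2_tmul h hw]
  | add a b ha hb => simp only [tmul_add, map_add, ha, hb]

lemma tri3_assoc {i : ℤ} {w : W} (hw : w ∈ Γ i) (x : SΓ) (z : SΓ ⊗[K] SΓ) :
    tri3 h w ((tassoc K _ _ _).symm (x ⊗ₜ z))
      = (tassoc K _ _ _).symm (parity _ (hat_int h) i x ⊗ₜ lam2 h w z) := by
  induction z with
  | zero => simp
  | tmul a b => simp [tri3_tmul h hw, lam2_tmul h hw]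
  | add a b ha hb => simp only [tmul_add, map_add, ha, hb]

/-! Passing multiplications through the cooperations. -/

lemma onLeft_hatΔ_lam1 (w : W) (z : SΓ ⊗[K] SΓ) :
    onLeft (hatΔ h) (lam1 Γ w z) = tri1 Γ w (onLeft (hatΔ h) z) + tri2 h w (onLeft (hatΔ h) z) := by
  induction z with
  | zero => simp
  | tmul a b => simp [onLeft, tri1_tmul, tri2_tmul, diag_apply, add_tmul]
  | add a b ha hb => simp only [map_add, ha, hb]; abel

lemma onLeft_hatΔ_lam2 {i : ℤ} {w : W} (hw : w ∈ Γ i) (z : SΓ ⊗[K] SΓ) :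
    onLeft (hatΔ h) (lam2 h w z) = tri3 h w (onLeft (hatΔ h) z) := by
  induction z with
  | zero => simp
  | tmul a b =>
    simp only [onLeft, lam2_tmul h hw, map_tmul, tri3_tmul h hw]
    rw [parity_cooperation (hat_int h) (p := 0) (fun i x hx => by rw [sub_zero]; exact hatΔ_mem h hx)]
    simp
  | add a b ha hb => simp only [map_add, ha, hb]

lemma onRight_hatΔ_lam1 (w : W) (z : SΓ ⊗[K] SΓ) : onRight _ (hat_int h) 0 (hatΔ h) (lam1 Γ w z)
      = tri1 Γ w (onRight _ (hat_int h) 0 (hatΔ h) z) := by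
  induction z with
  | zero => simp
  | tmul a b => simp [onRight, tri1_assoc, parity_zero]
  | add a b ha hb => simp only [map_add, ha, hb]

lemma onRight_hatΔ_lam2 {i : ℤ} {w : W} (hw : w ∈ Γ i) (z : SΓ ⊗[K] SΓ) :
    onRight _ (hat_int h) 0 (hatΔ h) (lam2 h w z) = tri2 h w (onRight _ (hat_int h) 0 (hatΔ h) z)
        + tri3 h w (onRight _ (hat_int h) 0 (hatΔ h) z) := by
  induction z with
  | zero => simp
  | tmul a b =>
    simp [onRight, tri2_assoc h hw, tri3_assoc h hw, parity_zero, lam2_tmul h hw, diag_apply, tmul_add]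
  | add a b ha hb => simp only [map_add, ha, hb]; abel

lemma hatΔ_coassoc (x : SΓ) : onLeft (hatΔ h) (hatΔ h x) = onRight _ (hat_int h) 0 (hatΔ h) (hatΔ h x) := by
  suffices onLeft (hatΔ h) ∘ₗ hatΔ h = onRight _ (hat_int h) 0 (hatΔ h) ∘ₗ hatΔ h from lcongr this x
  refine hat_ext h (by simp [onLeft, onRight, parity_one h]) fun i w hw x hx => ?_
  simp only [lcomp, hatΔ_lam, diag_apply, map_add] at hx ⊢
  rw [onLeft_hatΔ_lam1, onLeft_hatΔ_lam2 h hw, onRight_hatΔ_lam1 h w, onRight_hatΔ_lam2 h hw, hx]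
  abel

variable {δ : W →ₗ[K] W ⊗[K] W} {p : ℤ}

lemma onLeft_mulMap (t : W ⊗[K] W) (z : SΓ ⊗[K] SΓ) (y : SΓ) :
    mulMap (tri1 Γ) (tri2 h) t (z ⊗ₜ y) = mulMap (lam1 Γ) (lam2 h) t z ⊗ₜ y := by
  induction t with
  | zero => simp
  | tmul a b => simp [tri1_tmul, tri2_tmul]
  | add a b ha hb => simp only [map_add, ladd, ha, hb, add_tmul]

lemma onLeft_hatδ_lam1 (hδ : ∀ i, ∀ x ∈ Γ i, δ x ∈ tensorGrading Γ (i - p))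
    {i : ℤ} {w : W} (hw : w ∈ Γ i) (z : SΓ ⊗[K] SΓ) :
    onLeft (hatδ h δ) (lam1 Γ w z) = mulMap (tri1 Γ) (tri2 h) (δ w) (onLeft (hatΔ h) z)
      + sg K (p * i) • (tri1 Γ w (onLeft (hatδ h δ) z) + tri2 h w (onLeft (hatδ h δ) z)) := by
  induction z with
  | zero => simp
  | tmul a b =>
    simp [onLeft, hatδ_lam h hδ hw, tri1_tmul, tri2_tmul, diag_apply, add_tmul, onLeft_mulMap, smul_tmul']
  | add a b ha hb => simp only [map_add, ha, hb, smul_add]; abel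

lemma onLeft_hatδ_lam2 (hδ : ∀ i, ∀ x ∈ Γ i, δ x ∈ tensorGrading Γ (i - p))
    {i : ℤ} {w : W} (hw : w ∈ Γ i) (z : SΓ ⊗[K] SΓ) :
    onLeft (hatδ h δ) (lam2 h w z) = sg K (p * i) • tri3 h w (onLeft (hatδ h δ) z) := by
  induction z with
  | zero => simp
  | tmul a b =>
    simp only [onLeft, lam2_tmul h hw, map_tmul, tri3_tmul h hw]
    rw [parity_cooperation (hat_int h) (p := p) (fun i x hx => hatδ_mem h hδ hx),
      ← smul_tmul', smul_smul, mul_comm i p, sg_mul_self, one_smul,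
      lid_apply, lid_apply]
  | add a b ha hb => simp only [map_add, ha, hb, smul_add]

lemma onRight_hatδ_lam1 {i : ℤ} {w : W} (hw : w ∈ Γ i) (z : SΓ ⊗[K] SΓ) :
    onRight _ (hat_int h) p (hatδ h δ) (lam1 Γ w z)
      = sg K (p * i) • tri1 Γ w (onRight _ (hat_int h) p (hatδ h δ) z) := by
  induction z with
  | zero => simp
  | tmul a b =>
    simp [onRight, tri1_assoc, parity_lam h p hw, ← smul_tmul']
  | add a b ha hb => simp only [map_add, ha, hb, smul_add]

lemma mulMap_assoc {t : W ⊗[K] W} {n : ℤ} (ht : t ∈ tensorGrading Γ n) (x : SΓ) (z : SΓ ⊗[K] SΓ) :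
    mulMap (tri2 h) (tri3 h) t ((tassoc K _ _ _).symm (x ⊗ₜ z)) = (tassoc K _ _ _).symm
        (parity _ (hat_int h) n x ⊗ₜ mulMap (lam1 Γ) (lam2 h) t z) := by
  refine tgr_ind (P := fun t => mulMap (tri2 h) (tri3 h) t
    ((tassoc K _ _ _).symm (x ⊗ₜ z)) = (tassoc K _ _ _).symm
        (parity _ (hat_int h) n x ⊗ₜ mulMap (lam1 Γ) (lam2 h) t z))
    (fun a b e u hu v hv => ?_) (fun u v hu hv => ?_) ht
  · rw [mulMap_tmul, mulMap_tmul, tri3_assoc h hv, tri2_assoc h hu, ← e, ← parity_comp]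
    rfl
  · simp only [map_add, ladd, hu, hv, tmul_add]

lemma onRight_hatδ_lam2 (hδ : ∀ i, ∀ x ∈ Γ i, δ x ∈ tensorGrading Γ (i - p))
    {i : ℤ} {w : W} (hw : w ∈ Γ i) (z : SΓ ⊗[K] SΓ) :
    onRight _ (hat_int h) p (hatδ h δ) (lam2 h w z)
      = mulMap (tri2 h) (tri3 h) (δ w) (onRight _ (hat_int h) 0 (hatΔ h) z)
        + sg K (p * i) • (tri2 h w (onRight _ (hat_int h) p (hatδ h δ) z)
          + tri3 h w (onRight _ (hat_int h) p (hatδ h δ) z)) := by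
  induction z with
  | zero => simp
  | tmul a b =>
    have e1 : parity (hatGr Γ) (hat_int h) p (parity _ (hat_int h) i a) = parity _ (hat_int h) (i - p) a := by
      rw [← lcomp, parity_comp, parity_congr _ _ (l := i - p) ⟨p, by ring⟩]
    have e2 : parity (hatGr Γ) (hat_int h) p (parity _ (hat_int h) i a)
        = parity _ (hat_int h) i (parity _ (hat_int h) p a) := by
      rw [← lcomp, parity_comp, add_comm, ← parity_comp]; rfl
    simp only [onRight, lam2_tmul h hw, lcomp, map_tmul,
      hatδ_lam h hδ hw, parity_zero, lid_apply, LinearEquiv.coe_coe,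
      mulMap_assoc h (hδ i w hw), tmul_add, map_add, e1, tmul_smul,
      map_smul, diag_apply, tri2_assoc h hw, tri3_assoc h hw]
    rw [← e1, e2]
  | add a b ha hb => simp only [map_add, ha, hb, smul_add]; abel

lemma hatδ_coLeibniz (hδ : ∀ i, ∀ x ∈ Γ i, δ x ∈ tensorGrading Γ (i - p)) (x : SΓ) :
    onRight _ (hat_int h) 0 (hatΔ h) (hatδ h δ x) = onLeft (hatδ h δ) (hatΔ h x)
      + flip12 _ (hat_int h) (onRight _ (hat_int h) p (hatδ h δ) (hatΔ h x)) := by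
  suffices onRight _ (hat_int h) 0 (hatΔ h) ∘ₗ hatδ h δ = onLeft (hatδ h δ) ∘ₗ hatΔ h
      + flip12 _ (hat_int h) ∘ₗ onRight _ (hat_int h) p (hatδ h δ) ∘ₗ hatΔ h from
    lcongr this x
  refine hat_ext h (by simp [onLeft, onRight]) fun i w hw x hx => ?_
  simp only [lcomp, ladd] at hx ⊢
  have e1 : onRight _ (hat_int h) 0 (hatΔ h) (mulMap (lam1 Γ) (lam2 h) (δ w) (hatΔ h x))
      = mulMap (tri1 Γ) (tri2 h) (δ w) (onRight _ (hat_int h) 0 (hatΔ h) (hatΔ h x))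
        + mulMap (tri1 Γ) (tri3 h) (δ w) (onRight _ (hat_int h) 0 (hatΔ h) (hatΔ h x)) := by
    refine tgr_ind (P := fun t => onRight _ (hat_int h) 0 (hatΔ h)
      (mulMap (lam1 Γ) (lam2 h) t (hatΔ h x)) = mulMap (tri1 Γ) (tri2 h) t
        (onRight _ (hat_int h) 0 (hatΔ h) (hatΔ h x)) + mulMap (tri1 Γ) (tri3 h) t
        (onRight _ (hat_int h) 0 (hatΔ h) (hatΔ h x)))
      (fun a b e u hu v hv => ?_) (fun u v hu hv => ?_) (hδ i w hw)
    · simp only [mulMap_tmul, onRight_hatΔ_lam1 h, onRight_hatΔ_lam2 h hv, map_add]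
    · simp only [map_add, ladd, hu, hv]; abel
  have e2 : flip12 _ (hat_int h) (mulMap (tri2 h) (tri3 h) (δ w)
      (onRight _ (hat_int h) 0 (hatΔ h) (hatΔ h x))) = mulMap (tri1 Γ) (tri3 h) (δ w)
        (onRight _ (hat_int h) 0 (hatΔ h) (hatΔ h x)) := by
    have e : flip12 _ (hat_int h) (onRight _ (hat_int h) 0 (hatΔ h) (hatΔ h x))
        = onRight _ (hat_int h) 0 (hatΔ h) (hatΔ h x) := by
      rw [← hatΔ_coassoc, flip12_onLeft (c := 1) (hat_int h) (fun x => by rw [hatΔ_cocomm, one_smul]), one_smul]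
    conv_rhs => rw [← e]
    generalize δ w = t
    induction t with
    | zero => simp
    | tmul u v => simp only [mulMap_tmul, flip12_tri2 h, flip12_tri3 h]
    | add u v hu hv => simp only [map_add, ladd, hu, hv]
  rw [hatδ_lam h hδ hw, hatΔ_lam, diag_apply, diag_apply]
  simp only [map_add, map_smul, e1, onRight_hatΔ_lam1 h, onRight_hatΔ_lam2 h hw,
    onLeft_hatδ_lam1 h hδ hw, onLeft_hatδ_lam2 h hδ hw, onRight_hatδ_lam1 h hw,
    onRight_hatδ_lam2 h hδ hw, flip12_tri1 h, flip12_tri2 h, flip12_tri3 h, e2, hx, hatΔ_coassoc]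
  simp only [smul_add]
  abel

def rot (h : IsInt Γ) : (SΓ ⊗[K] SΓ) ⊗[K] SΓ ⊸ (SΓ ⊗[K] SΓ) ⊗[K] SΓ :=
  flip12 _ (hat_int h) ∘ₗ flip23 _ (hat_int h)

lemma rot_apply (z : (SΓ ⊗[K] SΓ) ⊗[K] SΓ) : rot h z = flip12 _ (hat_int h) (flip23 _ (hat_int h) z) := rfl

lemma rot_mulMap {A B A' B' : W ⊸ Module.End K ((SΓ ⊗[K] SΓ) ⊗[K] SΓ)}
    (hA : ∀ w z, rot h (A w z) = A' w (rot h z)) (hB : ∀ w z, rot h (B w z) = B' w (rot h z))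
    (t : W ⊗[K] W) (z : (SΓ ⊗[K] SΓ) ⊗[K] SΓ) :
    rot h (mulMap A B t z) = mulMap A' B' t (rot h z) := by
  induction t with
  | zero => simp
  | tmul u v => simp only [mulMap_tmul, hA, hB]
  | add u v hu hv =>
    simp only [map_add, ladd, hu, hv]

lemma rot_tri1 (w : W) (z : (SΓ ⊗[K] SΓ) ⊗[K] SΓ) : rot h (tri1 Γ w z) = tri2 h w (rot h z) := by
  rw [rot_apply, flip23_tri1 h, flip12_tri1 h]; rfl

lemma rot_tri2 (w : W) (z : (SΓ ⊗[K] SΓ) ⊗[K] SΓ) : rot h (tri2 h w z) = tri3 h w (rot h z) := by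
  rw [rot_apply, flip23_tri2 h, flip12_tri3 h]; rfl

lemma rot_tri3 (w : W) (z : (SΓ ⊗[K] SΓ) ⊗[K] SΓ) : rot h (tri3 h w z) = tri1 Γ w (rot h z) := by
  rw [rot_apply, flip23_tri3 h, flip12_tri2 h]; rfl

lemma mulMap_swap {A B : W ⊸ Module.End K ((SΓ ⊗[K] SΓ) ⊗[K] SΓ)}
    (hAB : ∀ i, ∀ x ∈ Γ i, ∀ j, ∀ y ∈ Γ j, ∀ z, A x (B y z) = sg K (i * j) • B y (A x z))
    (t : W ⊗[K] W) (z : (SΓ ⊗[K] SΓ) ⊗[K] SΓ) :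
    mulMap A B t z = mulMap B A (koszulFlip Γ h t) z := by
  suffices (mulMap A B).flip z = (mulMap B A).flip z ∘ₗ koszulFlip Γ h from lcongr this t
  refine hom_ext₂ h h fun i u hu j v hv => ?_
  simp [kflip_apply Γ h hu hv, hAB i u hu j v hv]

/-- The operators `A u ∘ B v ∘ C w`, as a function of `u ⊗ v ⊗ w`. -/
def mulMap₃ (A B C : W ⊸ Module.End K M) : (W ⊗[K] W) ⊗[K] W ⊸ Module.End K M :=
  tlift ((LinearMap.mul K (Module.End K M)).compl₁₂ (mulMap A B) C)

@[simp] lemma mulMap₃_tmul (A B C : W ⊸ Module.End K M) (t : W ⊗[K] W) (w : W) (m : M) :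
    mulMap₃ A B C (t ⊗ₜ w) m = mulMap A B t (C w m) := by
  simp [mulMap₃]

lemma rot_mulMap₃ (t : (W ⊗[K] W) ⊗[K] W) (z : (SΓ ⊗[K] SΓ) ⊗[K] SΓ) :
    rot h (mulMap₃ (tri1 Γ) (tri2 h) (tri3 h) t z)
      = mulMap₃ (tri1 Γ) (tri2 h) (tri3 h) (flip12 Γ h (flip23 Γ h t)) (rot h z) := by
  suffices rot h ∘ₗ (mulMap₃ (tri1 Γ) (tri2 h) (tri3 h)).flip z
      = (mulMap₃ (tri1 Γ) (tri2 h) (tri3 h)).flip (rot h z) ∘ₗ flip12 Γ h ∘ₗ flip23 Γ h from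
    lcongr this t
  refine hom_ext₃ h h h fun i u hu j v hv k w hw => ?_
  simp only [lcomp, LinearMap.flip_apply, mulMap₃_tmul, mulMap_tmul,
    flip23_tmul h u hv hw, flip12_tmul h hu hw, map_smul]
  rw [rot_tri1, rot_tri2, rot_tri3, tri1_tri2 h hw hu, tri1_tri3 h hw hv, map_smul, smul_smul,
    smul_smul, smul_smul, sg_mul', sg_mul', sg_mul',
    sg_even (by simp only [parity_simps]; tauto), one_smul]

/-- The sum over the cyclic rotations of three factors. -/
def cyc (h : IsInt Γ) : (SΓ ⊗[K] SΓ) ⊗[K] SΓ ⊸ (SΓ ⊗[K] SΓ) ⊗[K] SΓ := lid + rot h + rot h ∘ₗ rot h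

lemma cyc_apply (z : (SΓ ⊗[K] SΓ) ⊗[K] SΓ) : cyc h z = z + rot h z + rot h (rot h z) := rfl

lemma rot_rot (z : (SΓ ⊗[K] SΓ) ⊗[K] SΓ) : rot h (rot h z) = flip23 _ (hat_int h) (flip12 _ (hat_int h) z) := by
  rw [rot_apply, rot_apply, flip_braid (hat_int h), flip12_flip12 (hat_int h)]

lemma rot_rot_rot (z : (SΓ ⊗[K] SΓ) ⊗[K] SΓ) : rot h (rot h (rot h z)) = z := by
  rw [rot_rot, rot_apply, flip12_flip12 (hat_int h), flip23_flip23 (hat_int h)]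

lemma cyc_rot (z : (SΓ ⊗[K] SΓ) ⊗[K] SΓ) :
    cyc h (rot h z) = cyc h z := by simp only [cyc_apply, rot_rot_rot]; abel

lemma onLeft_hatδ_mulMap (hδ : ∀ i, ∀ x ∈ Γ i, δ x ∈ tensorGrading Γ (i - p))
    {n : ℤ} {t : W ⊗[K] W} (ht : t ∈ tensorGrading Γ n) (z : SΓ ⊗[K] SΓ) :
    onLeft (hatδ h δ) (mulMap (lam1 Γ) (lam2 h) t z)
      = mulMap₃ (tri1 Γ) (tri2 h) (tri3 h) (onLeft δ t) (onLeft (hatΔ h) z)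
        + sg K (p * n) • (mulMap (tri1 Γ) (tri3 h) t (onLeft (hatδ h δ) z)
          + mulMap (tri2 h) (tri3 h) t (onLeft (hatδ h δ) z)) := by
  refine tgr_ind (P := fun t => onLeft (hatδ h δ) (mulMap (lam1 Γ) (lam2 h) t z)
      = mulMap₃ (tri1 Γ) (tri2 h) (tri3 h) (onLeft δ t) (onLeft (hatΔ h) z)
        + sg K (p * n) • (mulMap (tri1 Γ) (tri3 h) t (onLeft (hatδ h δ) z)
          + mulMap (tri2 h) (tri3 h) t (onLeft (hatδ h δ) z)))
    (fun a b e u hu v hv => ?_) (fun u v hu hv => ?_) ht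
  · have e1 : onLeft δ (u ⊗ₜ[K] v) = δ u ⊗ₜ v := rfl
    simp only [mulMap_tmul, onLeft_hatδ_lam1 h hδ hu, onLeft_hatΔ_lam2 h hv,
      onLeft_hatδ_lam2 h hδ hv, e1, mulMap₃_tmul, map_smul, ← smul_add, smul_smul, sg_mul']
    rw [← e, mul_add]
  · simp only [map_add, ladd, smul_add, hu, hv]; abel

lemma hatδ_coJacobi (H : IsLieCoalg p Γ h δ) (x : SΓ) : cyc h (onLeft (hatδ h δ) (hatδ h δ x)) = 0 := by
  have hδ := H.mem
  suffices cyc h ∘ₗ onLeft (hatδ h δ) ∘ₗ hatδ h δ = 0 from lcongr this x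
  refine hat_ext h (by simp [onLeft]) fun i w hw x hx => ?_
  simp only [lcomp, lzero] at hx ⊢
  set a := onLeft (hatδ h δ) (hatΔ h x) with ha
  set e := onLeft (hatΔ h) (hatδ h δ x) with he
  set X := onLeft (hatΔ h) (hatΔ h x) with hX
  have flipδ : koszulFlip _ (hat_int h) (hatδ h δ x) = -sg K p • hatδ h δ x := hatδ_coantisymm h hδ H.antisymm x
  have rotX : rot h X = X := by
    rw [rot_apply, hX, ← onRight_flip (hat_int h) (p := 0)
      (fun i x hx => by rw [sub_zero]; exact hatΔ_mem h hx), hatΔ_cocomm h, hatΔ_coassoc]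
  have flip12a : flip12 _ (hat_int h) a = -sg K p • a :=
    flip12_onLeft (hat_int h) (hatδ_coantisymm h hδ H.antisymm) _
  have flip23a : flip23 _ (hat_int h) a = -sg K p • rot h (rot h a) := by
    rw [rot_rot, flip12a, map_smul, smul_smul, neg_mul_neg, sg_mul_self, one_smul]
  have hb : onRight _ (hat_int h) p (hatδ h δ) (hatΔ h x) = rot h a := by
    conv_lhs => rw [← hatΔ_cocomm h]
    exact onRight_flip (hat_int h) (fun i x hx => hatδ_mem h hδ hx) _
  have hre : rot h e = -sg K p • (a + flip23 _ (hat_int h) a) := by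
    have h1 := hatδ_coLeibniz h hδ x
    rw [hb, rot_apply, flip12_flip12 (hat_int h)] at h1
    rw [← h1, ← map_smul, ← flipδ, onRight_flip (hat_int h) (p := 0)
      (fun i x hx => by rw [sub_zero]; exact hatΔ_mem h hx)]
    rfl
  have hee : e = rot h a - sg K p • rot h (rot h a) := by
    rw [← rot_rot_rot h e, hre, flip23a]
    rw [smul_add, smul_smul, neg_mul_neg, sg_mul_self, one_smul]
    simp only [map_add, map_smul, rot_rot_rot]
    module
  have r12 : ∀ z, rot h (mulMap (tri1 Γ) (tri2 h) (δ w) z) = mulMap (tri2 h) (tri3 h) (δ w) (rot h z) :=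
    rot_mulMap h (rot_tri1 h) (rot_tri2 h) _
  have r23 : ∀ z, rot h (mulMap (tri2 h) (tri3 h) (δ w) z) = mulMap (tri3 h) (tri1 Γ) (δ w) (rot h z) :=
    rot_mulMap h (rot_tri2 h) (rot_tri3 h) _
  have s31 : ∀ z, mulMap (tri3 h) (tri1 Γ) (δ w) z = -sg K p • mulMap (tri1 Γ) (tri3 h) (δ w) z := fun z => by
    rw [mulMap_swap h (fun i x hx j y hy z => ?_), H.antisymm, map_smul, lsmul]
    rw [tri1_tri3 h hy hx, smul_smul, mul_comm j i, sg_mul_self, one_smul]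
  have c1 : cyc h (mulMap (tri1 Γ) (tri2 h) (δ w) (rot h a))
      = -sg K p • cyc h (mulMap (tri1 Γ) (tri3 h) (δ w) a) := by
    rw [← cyc_rot, r12, ← cyc_rot, r23, rot_rot_rot, s31, map_smul]
  have c2 : cyc h (mulMap (tri1 Γ) (tri2 h) (δ w) (rot h (rot h a)))
      = cyc h (mulMap (tri2 h) (tri3 h) (δ w) a) := by
    rw [← cyc_rot, r12, rot_rot_rot]
  have c3 : cyc h (mulMap₃ (tri1 Γ) (tri2 h) (tri3 h) (onLeft δ (δ w)) X) = 0 := by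
    rw [cyc_apply, rot_mulMap₃, rot_mulMap₃, rotX, rotX, ← ladd, ← ladd, ← map_add, ← map_add]
    have := H.jacobi w
    rw [show flip12 Γ h (flip23 Γ h (flip12 Γ h (flip23 Γ h (onLeft δ (δ w)))))
      = flip23 Γ h (flip12 Γ h (onLeft δ (δ w))) by rw [flip_braid h, flip12_flip12 h], this]
    simp
  have c4 : ∀ z, cyc h (tri1 Γ w z + tri2 h w z + tri3 h w z)
      = tri1 Γ w (cyc h z) + tri2 h w (cyc h z) + tri3 h w (cyc h z) := fun z => by
    simp only [cyc_apply, map_add, rot_tri1, rot_tri2, rot_tri3]; abel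
  have main : onLeft (hatδ h δ) (hatδ h δ (lam Γ w x)) = mulMap₃ (tri1 Γ) (tri2 h) (tri3 h) (onLeft δ (δ w)) X
        + sg K (p * (i - p)) • (mulMap (tri1 Γ) (tri3 h) (δ w) a + mulMap (tri2 h) (tri3 h) (δ w) a)
        + sg K (p * i) • mulMap (tri1 Γ) (tri2 h) (δ w) e
        + (tri1 Γ w (onLeft (hatδ h δ) (hatδ h δ x)) + tri2 h w (onLeft (hatδ h δ) (hatδ h δ x))
          + tri3 h w (onLeft (hatδ h δ) (hatδ h δ x))) := by
    simp only [hatδ_lam h hδ hw, map_add, onLeft_hatδ_mulMap h hδ (hδ i w hw), map_smul, diag_apply,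
      onLeft_hatδ_lam1 h hδ hw, onLeft_hatδ_lam2 h hδ hw, ← ha, ← he, ← hX, smul_add, smul_smul,
      sg_mul_self, one_smul]
    abel
  rw [main, map_add, map_add, map_add, c3, map_smul, map_smul, map_add, c4, hx, hee]
  rw [show sg K (p * (i - p)) = sg K (p * i) * sg K p by
    rw [sg_mul']; apply sg_congr; simp only [parity_simps]; tauto]
  simp only [map_sub, map_smul, c1, c2, map_zero]
  module

end HatTriple

/-! ### Naturality of operations on tensor powers -/

section Natural

variable {D : Type w} [AddCommGroup D] [Module K D] {𝒟 : ℤ → Submodule K D}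

lemma flip12_natural (h : IsInt Θ) (h' : IsInt 𝒟) {f : C ⊸ D}
    (hf : ∀ i, ∀ x ∈ Θ i, f x ∈ 𝒟 i) (z : (C ⊗[K] C) ⊗[K] C) :
    flip12 𝒟 h' (tmap (tmap f f) f z) = tmap (tmap f f) f (flip12 Θ h z) := by
  suffices flip12 𝒟 h' ∘ₗ tmap (tmap f f) f = tmap (tmap f f) f ∘ₗ flip12 Θ h from lcongr this z
  refine hom_ext₃ h h h fun i x hx j y hy k z hz => ?_
  simp [flip12_tmul h hx hy, flip12_tmul h' (hf i x hx) (hf j y hy)]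

lemma flip23_natural (h : IsInt Θ) (h' : IsInt 𝒟) {f : C ⊸ D}
    (hf : ∀ i, ∀ x ∈ Θ i, f x ∈ 𝒟 i) (z : (C ⊗[K] C) ⊗[K] C) :
    flip23 𝒟 h' (tmap (tmap f f) f z) = tmap (tmap f f) f (flip23 Θ h z) := by
  suffices flip23 𝒟 h' ∘ₗ tmap (tmap f f) f = tmap (tmap f f) f ∘ₗ flip23 Θ h from lcongr this z
  refine hom_ext₃ h h h fun i x hx j y hy k z hz => ?_
  simp [flip23_tmul h x hy hz, flip23_tmul h' (f x) (hf j y hy) (hf k z hz)]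

lemma onLeft_natural {f : C ⊸ D} {a : C ⊸ C ⊗[K] C} {b : D ⊸ D ⊗[K] D}
    (hab : ∀ x, b (f x) = tmap f f (a x)) (z : C ⊗[K] C) :
    onLeft b (tmap f f z) = tmap (tmap f f) f (onLeft a z) := by
  induction z with
  | zero => simp
  | tmul x y => simp [onLeft, hab]
  | add x y hx hy => simp only [map_add, hx, hy]

lemma map_map_assoc_symm (f : C ⊸ D) (x : C) (z : C ⊗[K] C) : tmap (tmap f f) f ((tassoc K C C C).symm (x ⊗ₜ z))
      = (tassoc K D D D).symm (f x ⊗ₜ tmap f f z) := by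
  induction z with
  | zero => simp
  | tmul y z => simp
  | add x y hx hy => simp only [tmul_add, map_add, hx, hy]

lemma onRight_natural (h : IsInt Θ) (h' : IsInt 𝒟) {f : C ⊸ D}
    (hf : ∀ i, ∀ x ∈ Θ i, f x ∈ 𝒟 i) {a : C ⊸ C ⊗[K] C} {b : D ⊸ D ⊗[K] D}
    (hab : ∀ x, b (f x) = tmap f f (a x)) (p : ℤ) (z : C ⊗[K] C) :
    onRight 𝒟 h' p b (tmap f f z) = tmap (tmap f f) f (onRight Θ h p a z) := by
  induction z with
  | zero => simp
  | tmul x y =>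
    have := lcongr (parity_natural h h' hf p) x
    simp only [lcomp] at this
    simp [onRight, hab, map_map_assoc_symm, this]
  | add x y hx hy => simp only [map_add, hx, hy]

lemma map_tgr_mem {f : C ⊸ D} (hf : ∀ i, ∀ x ∈ Θ i, f x ∈ 𝒟 i) {n : ℤ}
    {z : C ⊗[K] C} (hz : z ∈ tensorGrading Θ n) :
    tmap f f z ∈ tensorGrading 𝒟 n :=
  map_mem_tgr (k := 0) (l := 0) (fun i x hx => by simpa using hf i x hx)
    (fun i x hx => by simpa using hf i x hx) (by ring) hz

lemma flip_map (h : IsInt Θ) (h' : IsInt 𝒟) {f : C ⊸ D} (hf : ∀ i, ∀ x ∈ Θ i, f x ∈ 𝒟 i) (z : C ⊗[K] C) :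
    koszulFlip 𝒟 h' (tmap f f z) = tmap f f (koszulFlip Θ h z) :=
  lcongr (flip_natural h h' hf hf) z

lemma IsLieCoalg.of_surjective {p : ℤ} (h : IsInt Θ) (h' : IsInt 𝒟) {δ : C ⊸ C ⊗[K] C} {δ' : D ⊸ D ⊗[K] D}
    (H : IsLieCoalg p Θ h δ) {f : C ⊸ D} (hf : ∀ i, ∀ x ∈ Θ i, f x ∈ 𝒟 i)
    (surj : ∀ i, ∀ y ∈ 𝒟 i, ∃ x ∈ Θ i, f x = y)
    (hδ : ∀ x, δ' (f x) = tmap f f (δ x)) : IsLieCoalg p 𝒟 h' δ' where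
  mem i y hy := by
    obtain ⟨x, hx, rfl⟩ := surj i y hy
    rw [hδ]
    exact map_tgr_mem hf (H.mem i x hx)
  antisymm y := by
    induction y using hom_induction h' with
    | hom i y hy =>
      obtain ⟨x, hx, rfl⟩ := surj i y hy
      rw [hδ, flip_map h h' hf, H.antisymm, map_smul]
    | add x y hx hy => rw [map_add, map_add, hx, hy, smul_add]
  jacobi y := by
    induction y using hom_induction h' with
    | hom i y hy =>
      obtain ⟨x, hx, rfl⟩ := surj i y hy
      rw [hδ, onLeft_natural hδ, flip23_natural h h' hf, flip12_natural h h' hf,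
        flip12_natural h h' hf, flip23_natural h h' hf, ← map_add, ← map_add, H.jacobi, map_zero]
    | add x y hx hy =>
      have e := congrArg₂ (· + ·) hx hy
      simp only [add_zero] at e
      rw [← e]
      simp only [map_add]
      abel

lemma IsGradedBicoalgebra.of_surjective {p : ℤ} (h' : IsInt 𝒟) {Δ δ : C ⊸ C ⊗[K] C} {Δ' δ' : D ⊸ D ⊗[K] D}
    (H : IsGradedBicoalgebra p Θ Δ δ) {f : C ⊸ D} (hf : ∀ i, ∀ x ∈ Θ i, f x ∈ 𝒟 i)
    (surj : ∀ i, ∀ y ∈ 𝒟 i, ∃ x ∈ Θ i, f x = y)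
    (hΔ : ∀ x, Δ' (f x) = tmap f f (Δ x))
    (hδ : ∀ x, δ' (f x) = tmap f f (δ x)) : IsGradedBicoalgebra p 𝒟 Δ' δ' where
  internal := h'
  coproduct_mem i y hy := by
    obtain ⟨x, hx, rfl⟩ := surj i y hy
    rw [hΔ]; exact map_tgr_mem hf (H.coproduct_mem i x hx)
  cobracket_mem i y hy := by
    obtain ⟨x, hx, rfl⟩ := surj i y hy
    rw [hδ]; exact map_tgr_mem hf (H.cobracket_mem i x hx)
  cocommutative := hom_ext h' fun i y hy => by
    obtain ⟨x, hx, rfl⟩ := surj i y hy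
    rw [lcomp, hΔ, flip_map H.internal h' hf, ← lcomp (koszulFlip _ _), H.cocommutative]
  coassociative := hom_ext h' fun i y hy => by
    obtain ⟨x, hx, rfl⟩ := surj i y hy
    rw [lcomp, lcomp, hΔ, onLeft_natural hΔ, onRight_natural H.internal h' hf hΔ, ← lcomp (onLeft _),
      ← lcomp (onRight _ _ _ _), H.coassociative]
  coantisymmetric := hom_ext h' fun i y hy => by
    obtain ⟨x, hx, rfl⟩ := surj i y hy
    have := lcongr H.coantisymmetric x
    simp only [lcomp, lneg, lsmul, nop_smul (K := K)] at this ⊢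
    rw [hδ, flip_map H.internal h' hf, this, map_neg, map_smul]
  coJacobi := hom_ext h' fun i y hy => by
    obtain ⟨x, hx, rfl⟩ := surj i y hy
    have := lcongr H.coJacobi x
    simp only [lcomp, ladd, lid_apply, lzero] at this ⊢
    rw [hδ, onLeft_natural hδ, flip23_natural H.internal h' hf, flip12_natural H.internal h' hf,
      flip12_natural H.internal h' hf, flip23_natural H.internal h' hf, ← map_add, ← map_add,
      this, map_zero]
  coLeibniz := hom_ext h' fun i y hy => by
    obtain ⟨x, hx, rfl⟩ := surj i y hy
    have := lcongr H.coLeibniz x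
    simp only [lcomp, ladd] at this ⊢
    rw [hδ, hΔ, onRight_natural H.internal h' hf hΔ, this, onLeft_natural hδ,
      onRight_natural H.internal h' hf hδ, flip12_natural H.internal h' hf, map_add]

end Natural

/-! ### The positive part of the symmetric algebra -/

section SymPlus

lemma hat_isGradedBicoalgebra (h : IsInt Γ) {p : ℤ} {δ : W ⊸ W ⊗[K] W} (H : IsLieCoalg p Γ h δ) :
    IsGradedBicoalgebra p (hatGr Γ) (hatΔ h) (hatδ h δ) where
  internal := hat_int h
  coproduct_mem _ _ hx := hatΔ_mem h hx
  cobracket_mem _ _ hx := hatδ_mem h H.mem hx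
  cocommutative := lext (hatΔ_cocomm h)
  coassociative := lext (hatΔ_coassoc h)
  coantisymmetric := lext fun x => by
    simpa [nop_smul (K := K)] using hatδ_coantisymm h H.mem H.antisymm x
  coJacobi := lext fun x => by
    have := hatδ_coJacobi h H x
    rw [cyc_apply, rot_rot, rot_apply] at this
    simpa using this
  coLeibniz := lext (hatδ_coLeibniz h H.mem)

lemma symRel_eq (Γ : ℤ → Submodule K W) : symRel Γ = Submodule.span K ({1} ∪ commutators Γ) :=
  rfl

lemma symIdeal_le_symRel : symIdeal Γ ≤ symRel Γ := Submodule.span_mono Set.subset_union_right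

variable (Γ) in
def toPlus : SΓ ⊸ SymPlus Γ := (symIdeal Γ).mapQ (symRel Γ) lid symIdeal_le_symRel

variable (Γ) in
def ofPlus : SymPlus Γ ⊸ SΓ := (symRel Γ).liftQ (hatMk Γ - (counit Γ ∘ₗ hatMk Γ).smulRight (hatOne Γ)) (by
    rw [symRel_eq, Submodule.span_le]
    rintro s (rfl | hs)
    · have : hatMk Γ 1 = hatOne Γ := rfl
      simp [this]
    · have : hatMk Γ s = 0 := hatMk_eq_zero.2 (Submodule.subset_span hs)
      simp [this])

lemma ofPlus_toPlus (x : SΓ) : ofPlus Γ (toPlus Γ x) = x - counit Γ x • hatOne Γ := by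
  obtain ⟨t, rfl⟩ := hatMk_surjective Γ x
  rfl

@[simp] lemma toPlus_one : toPlus Γ (hatOne Γ) = 0 :=
  (Submodule.Quotient.mk_eq_zero _).2 (Submodule.subset_span (Or.inl rfl))

lemma toPlus_surj : Function.Surjective (toPlus Γ) := fun x => by
  obtain ⟨t, rfl⟩ := (symRel Γ).mkQ_surjective x
  exact ⟨hatMk Γ t, rfl⟩

@[simp] lemma toPlus_ofPlus (x : SymPlus Γ) : toPlus Γ (ofPlus Γ x) = x := by
  obtain ⟨y, rfl⟩ := toPlus_surj x
  rw [ofPlus_toPlus, map_sub, map_smul, toPlus_one, smul_zero, sub_zero]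

@[simp] lemma counit_ofPlus (x : SymPlus Γ) : counit Γ (ofPlus Γ x) = 0 := by
  obtain ⟨y, rfl⟩ := toPlus_surj x
  simp [ofPlus_toPlus]

lemma plus_int (h : IsInt Γ) : IsInt (SymPlus.grading Γ) := by
  refine quot_internal h (symRel_eq Γ) ?_
  rintro s (rfl | hs)
  · have := degCoact_word h ([] : List (Letter Γ))
    rw [word_nil] at this
    rw [this, Finsupp.mapRange.linearMap_apply, Finsupp.mapRange_single]
    exact (Finsupp.single_eq_zero).2 ((Submodule.Quotient.mk_eq_zero _).2 (Submodule.subset_span (Or.inl rfl)))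
  · have : (symRel Γ).mkQ = toPlus Γ ∘ₗ hatMk Γ := rfl
    have e : Finsupp.mapRange.linearMap (hatMk Γ) (degCoact h s) = 0 := degCoact_commutator h hs
    rw [this, Finsupp.mapRange.linearMap_comp, lcomp, e, map_zero]

lemma toPlus_mem {n : ℤ} {x : SΓ} (hx : x ∈ hatGr Γ n) : toPlus Γ x ∈ SymPlus.grading Γ n := by
  induction hx using Submodule.span_induction with
  | mem x hx =>
    obtain ⟨X, rfl, rfl⟩ := hx
    exact Submodule.subset_span ⟨X, rfl, rfl⟩
  | zero => simp
  | add x y _ _ hx hy => rw [map_add]; exact add_mem hx hy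
  | smul c x _ hx => rw [map_smul]; exact Submodule.smul_mem _ _ hx

lemma exists_toPlus {n : ℤ} {y : SymPlus Γ} (hy : y ∈ SymPlus.grading Γ n) :
    ∃ x ∈ hatGr Γ n, toPlus Γ x = y := by
  induction hy using Submodule.span_induction with
  | mem y hy =>
    obtain ⟨X, rfl, rfl⟩ := hy
    exact ⟨_, hatMk_word_mem X, rfl⟩
  | zero => exact ⟨0, zero_mem _, map_zero _⟩
  | add y y' _ _ hy hy' =>
    obtain ⟨x, hx, rfl⟩ := hy
    obtain ⟨x', hx', rfl⟩ := hy'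
    exact ⟨x + x', add_mem hx hx', map_add _ _ _⟩
  | smul c y _ hy =>
    obtain ⟨x, hx, rfl⟩ := hy
    exact ⟨c • x, Submodule.smul_mem _ _ hx, map_smul _ _ _⟩

def plusΔ (h : IsInt Γ) : SymPlus Γ ⊸ SymPlus Γ ⊗[K] SymPlus Γ :=
  tmap (toPlus Γ) (toPlus Γ) ∘ₗ hatΔ h ∘ₗ ofPlus Γ

lemma plusΔ_toPlus (h : IsInt Γ) (x : SΓ) : plusΔ h (toPlus Γ x) = tmap (toPlus Γ) (toPlus Γ) (hatΔ h x) := by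
  simp [plusΔ, ofPlus_toPlus]

def plusδ (h : IsInt Γ) (δ : W ⊸ W ⊗[K] W) : SymPlus Γ ⊸ SymPlus Γ ⊗[K] SymPlus Γ :=
  tmap (toPlus Γ) (toPlus Γ) ∘ₗ hatδ h δ ∘ₗ ofPlus Γ

lemma plusδ_toPlus (h : IsInt Γ) (δ : W ⊸ W ⊗[K] W) (x : SΓ) :
    plusδ h δ (toPlus Γ x) = tmap (toPlus Γ) (toPlus Γ) (hatδ h δ x) := by
  simp [plusδ, ofPlus_toPlus]

lemma plus_isGradedBicoalgebra (h : IsInt Γ) {p : ℤ} {δ : W ⊸ W ⊗[K] W} (H : IsLieCoalg p Γ h δ) :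
    IsGradedBicoalgebra p (SymPlus.grading Γ) (plusΔ h) (plusδ h δ) :=
  (hat_isGradedBicoalgebra h H).of_surjective (plus_int h) (fun _ _ => toPlus_mem)
    (fun _ _ => exists_toPlus) (plusΔ_toPlus h) (plusδ_toPlus h δ)

variable (Γ) in
def plusPr : SymPlus Γ ⊸ W := hatPr Γ ∘ₗ ofPlus Γ

@[simp] lemma plusPr_toPlus (x : SΓ) : plusPr Γ (toPlus Γ x) = hatPr Γ x := by
  simp [plusPr, ofPlus_toPlus]

variable (Γ) in
def plusIncl : W ⊸ SymPlus Γ := toPlus Γ ∘ₗ LinearMap.applyₗ (hatOne Γ) ∘ₗ lam Γ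

lemma plusIncl_apply (w : W) : plusIncl Γ w = toPlus Γ (lam Γ w (hatOne Γ)) := rfl

lemma plusPr_mem {n : ℤ} {y : SymPlus Γ} (hy : y ∈ SymPlus.grading Γ n) : plusPr Γ y ∈ Γ n := by
  obtain ⟨x, hx, rfl⟩ := exists_toPlus hy
  rw [plusPr_toPlus]; exact hatPr_mem hx

lemma counit_parity (h : IsInt Γ) (k : ℤ) (x : SΓ) : counit Γ (parity _ (hat_int h) k x) = counit Γ x := by
  suffices counit Γ ∘ₗ parity _ (hat_int h) k = counit Γ from lcongr this x
  exact hat_ext h (by simp [parity_one h]) fun j v hv x _ => by simp [parity_lam h k hv]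

lemma counit_hatδ (h : IsInt Γ) {p : ℤ} {δ : W ⊸ W ⊗[K] W}
    (hδ : ∀ i, ∀ x ∈ Γ i, δ x ∈ tensorGrading Γ (i - p)) (x : SΓ) :
    tmap (counit Γ) lid (hatδ h δ x) = 0 ∧ tmap lid (counit Γ) (hatδ h δ x) = 0 := by
  have L1 : ∀ w z, tmap (counit Γ) lid (lam1 Γ w z) = 0 := fun w z => by
    induction z with
    | zero => simp
    | tmul a b => simp
    | add a b ha hb => rw [map_add, map_add, ha, hb, add_zero]
  have L2 : ∀ i, ∀ w ∈ Γ i, ∀ z, tmap lid (counit Γ) (lam2 h w z) = 0 := fun i w hw z => by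
      induction z with
      | zero => simp
      | tmul a b => simp [lam2_tmul h hw]
      | add a b ha hb => rw [map_add, map_add, ha, hb, add_zero]
  have L3 : ∀ i, ∀ w ∈ Γ i, ∀ z, tmap (counit Γ) lid (lam2 h w z)
      = tmap lid (lam Γ w) (tmap (counit Γ) lid z) :=
    fun i w hw z => by
      induction z with
      | zero => simp
      | tmul a b => simp [lam2_tmul h hw, counit_parity h]
      | add a b ha hb => simp only [map_add, ha, hb]
  have L4 : ∀ w, ∀ z, tmap lid (counit Γ) (lam1 Γ w z) = tmap (lam Γ w) lid (tmap lid (counit Γ) z) :=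
    fun w z => by
      induction z with
      | zero => simp
      | tmul a b => simp
      | add a b ha hb => simp only [map_add, ha, hb]
  constructor
  · suffices tmap (counit Γ) lid ∘ₗ hatδ h δ = 0 from lcongr this x
    refine hat_ext h (by simp) fun i w hw x hx => ?_
    simp only [lcomp, lzero] at hx ⊢
    rw [hatδ_lam h hδ hw, map_add, map_smul, diag_apply, map_add, L1, L3 i w hw, hx]
    simp only [map_zero, add_zero, smul_zero]
    generalize δ w = t
    induction t with
    | zero => simp
    | tmul u v => rw [mulMap_tmul, L1]
    | add u v hu hv => rw [map_add, ladd, map_add, hu, hv, add_zero]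
  · suffices tmap lid (counit Γ) ∘ₗ hatδ h δ = 0 from lcongr this x
    refine hat_ext h (by simp) fun i w hw x hx => ?_
    simp only [lcomp, lzero] at hx ⊢
    rw [hatδ_lam h hδ hw, map_add, map_smul, diag_apply, map_add, L4, L2 i w hw, hx]
    simp only [map_zero, add_zero, smul_zero]
    refine tgr_ind (P := fun t => tmap lid (counit Γ)
      (mulMap (lam1 Γ) (lam2 h) t (hatΔ h x)) = 0) (fun a b e u hu v hv => ?_)
      (fun u v hu hv => ?_) (hδ i w hw)
    · rw [mulMap_tmul, L4, L2 b v hv, map_zero]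
    · rw [map_add, ladd, map_add, hu, hv, add_zero]

lemma hatPr_lam1 (w : W) (z : SΓ ⊗[K] SΓ) (g : SΓ ⊸ M) : tmap (hatPr Γ) g (lam1 Γ w z)
      = w ⊗ₜ g (tlid K _ (tmap (counit Γ) lid z)) := by
  induction z with
  | zero => simp
  | tmul a b => simp [smul_tmul']
  | add a b ha hb => simp only [map_add, ha, hb, tmul_add]

lemma hatPr_lam2 (h : IsInt Γ) {i : ℤ} {w : W} (hw : w ∈ Γ i) (z : SΓ ⊗[K] SΓ) (g : SΓ ⊸ M) :
    tmap g (hatPr Γ) (lam2 h w z) = (g (parity _ (hat_int h) i (trid K _ (tmap lid (counit Γ) z)))) ⊗ₜ w := by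
  induction z with
  | zero => simp
  | tmul a b => simp [lam2_tmul h hw, smul_tmul']
  | add a b ha hb => simp only [map_add, ha, hb, add_tmul]

lemma hatPr_hatδ (h : IsInt Γ) {p : ℤ} {δ : W ⊸ W ⊗[K] W}
    (hδ : ∀ i, ∀ x ∈ Γ i, δ x ∈ tensorGrading Γ (i - p)) (x : SΓ) :
    tmap (hatPr Γ) (hatPr Γ) (hatδ h δ x) = δ (hatPr Γ x) := by
  suffices tmap (hatPr Γ) (hatPr Γ) ∘ₗ hatδ h δ = δ ∘ₗ hatPr Γ from lcongr this x
  refine hat_ext h (by simp) fun i w hw x hx => ?_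
  simp only [lcomp] at hx ⊢
  rw [hatδ_lam h hδ hw, map_add, map_smul, diag_apply, map_add, hatPr_lam1, hatPr_lam2 h hw,
    (counit_hatδ h hδ x).1, (counit_hatδ h hδ x).2]
  simp only [map_zero, tmul_zero, zero_tmul, add_zero, smul_zero]
  rw [hatPr_lam, map_smul]
  refine tgr_ind (P := fun t => tmap (hatPr Γ) (hatPr Γ)
      (mulMap (lam1 Γ) (lam2 h) t (hatΔ h x)) = counit Γ x • t) (fun a b e u hu v hv => ?_)
      (fun u v hu hv => ?_) (hδ i w hw)
  · rw [mulMap_tmul, hatPr_lam1]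
    have : ∀ z, tlid K _ (tmap (counit Γ) lid (lam2 h v z)) = lam Γ v (tlid K _ (tmap (counit Γ) lid z)) :=
      fun z => by
      induction z with
      | zero => simp
      | tmul a b => simp [lam2_tmul h hv, counit_parity h]
      | add a b ha hb => simp only [map_add, ha, hb]
    rw [this, hatΔ_counit, hatPr_lam, tmul_smul]
  · rw [map_add, ladd, map_add, hu, hv, smul_add]

lemma plusPr_plusδ (h : IsInt Γ) {p : ℤ} {δ : W ⊸ W ⊗[K] W}
    (hδ : ∀ i, ∀ x ∈ Γ i, δ x ∈ tensorGrading Γ (i - p)) (x : SymPlus Γ) :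
    tmap (plusPr Γ) (plusPr Γ) (plusδ h δ x) = δ (plusPr Γ x) := by
  obtain ⟨y, rfl⟩ := toPlus_surj x
  rw [plusδ_toPlus, plusPr_toPlus, ← hatPr_hatδ h hδ, ← lcomp, ← tmap_comp]
  congr 2 <;> exact lext fun x => plusPr_toPlus x

/-- The operator that multiplies a monomial by its number of factors. -/
def hatNum (h : IsInt Γ) : SΓ ⊸ SΓ := tlift (lam Γ) ∘ₗ tmap (hatPr Γ) lid ∘ₗ hatΔ h

lemma hatNum_lam (h : IsInt Γ) {i : ℤ} {w : W} (hw : w ∈ Γ i)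
    (x : SΓ) : hatNum h (lam Γ w x) = lam Γ w x + lam Γ w (hatNum h x) := by
  simp only [hatNum, lcomp, hatΔ_lam, diag_apply, map_add, hatPr_lam1,
    hatΔ_counit, TensorProduct.lift.tmul, lid_apply]
  congr 1
  generalize hatΔ h x = z
  suffices tlift (lam Γ) ∘ₗ tmap (hatPr Γ) lid ∘ₗ lam2 h w = lam Γ w ∘ₗ tlift (lam Γ) ∘ₗ tmap (hatPr Γ) lid from
    lcongr this z
  refine hom_ext₂ (hat_int h) (hat_int h) fun j a ha k b hb => ?_
  simp [lam2_tmul h hw, par_apply _ _ _ ha, lam_lam hw (hatPr_mem ha)]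

lemma weightProj_hatNum (h : IsInt Γ) (n : ℕ) (x : SΓ) :
    weightProj Γ n (hatNum h x) = n • weightProj Γ n x := by
  suffices ∀ n, weightProj Γ n (hatNum h x) = n • weightProj Γ n x from this n
  suffices LinearMap.pi (fun n => weightProj Γ n) ∘ₗ hatNum h = LinearMap.pi (fun n => n • weightProj Γ n) from
    fun n => congrFun (lcongr this x) n
  refine hat_ext h ?_ fun i w hw x hx => ?_
  · ext n
    have : hatNum h (hatOne Γ) = 0 := by simp [hatNum]
    rcases n with _ | n <;> simp [this]
  · ext n
    rcases n with _ | n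
    · simp [hatNum_lam h hw]
    · have := congrFun hx n
      simp only [lcomp, LinearMap.pi_apply, lsmul] at this ⊢
      rw [hatNum_lam h hw, map_add, weightProj_lam_succ, weightProj_lam_succ, this, map_nsmul,
        add_comm, succ_nsmul]

lemma hatΔ_counit' (h : IsInt Γ) (x : SΓ) : tmap lid (counit Γ) (hatΔ h x) = x ⊗ₜ 1 := by
  have e : ∀ z, trid K _ (tmap lid (counit Γ) z) = tlid K _ (tmap (counit Γ) lid
        (koszulFlip _ (hat_int h) z)) := fun z => by
    suffices (trid K _).toLinearMap ∘ₗ tmap lid (counit Γ) = (tlid K _).toLinearMap ∘ₗ tmap (counit Γ) lid ∘ₗ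
        koszulFlip _ (hat_int h) from lcongr this z
    refine hom_ext₂ (hat_int h) (hat_int h) fun j a ha k b hb => ?_
    have := counit_parity h j b
    rw [par_apply _ _ _ hb, map_smul, smul_eq_mul] at this
    simp [kflip_apply _ _ ha hb, smul_smul, this]
  have := e (hatΔ h x)
  rw [hatΔ_cocomm h, hatΔ_counit] at this
  apply (trid K _).injective
  rw [this]; simp

lemma eq_plusIncl_of_plusΔ [CharZero K] (h : IsInt Γ) {x : SymPlus Γ}
    (hx : plusΔ h x = 0) : x = plusIncl Γ (plusPr Γ x) := by
  set y := ofPlus Γ x with hy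
  have hΔ : tmap (hatPr Γ) (lid - (counit Γ).smulRight (hatOne Γ)) (hatΔ h y) = 0 := by
    have e1 : hatPr Γ = plusPr Γ ∘ₗ toPlus Γ := lext fun z => by simp
    have e2 : lid - (counit Γ).smulRight (hatOne Γ) = ofPlus Γ ∘ₗ toPlus Γ :=
      lext fun z => by simp [ofPlus_toPlus]
    have : tmap (toPlus Γ) (toPlus Γ) (hatΔ h y) = 0 := hx
    rw [e1, e2, tmap_comp, lcomp, this, map_zero]
  have hN : hatNum h y = lam Γ (hatPr Γ y) (hatOne Γ) := by
    have e3 : tmap (hatPr Γ) lid (hatΔ h y) = hatPr Γ y ⊗ₜ hatOne Γ := by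
      have sub : ∀ g g' : SΓ ⊸ SΓ, tmap (hatPr Γ) (g - g') = tmap (hatPr Γ) g - tmap (hatPr Γ) g' := fun g g' =>
        text' fun a b => by simp [TensorProduct.tmul_sub]
      rw [sub, lsub, sub_eq_zero] at hΔ
      rw [hΔ]
      have : tmap (hatPr Γ) ((counit Γ).smulRight (hatOne Γ))
        = tmap (hatPr Γ) (LinearMap.toSpanSingleton K _ (hatOne Γ)) ∘ₗ tmap lid (counit Γ) := by
        rw [← tmap_comp]; rfl
      rw [this, lcomp, hatΔ_counit']
      simp
    simp [hatNum, e3]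
  have key : ∀ n, weightProj Γ n y = weightProj Γ n (lam Γ (hatPr Γ y) (hatOne Γ)) := by
    intro n
    rcases n with _ | n
    · rw [weightProj_zero_apply h, hy, counit_ofPlus]; simp
    · have := weightProj_hatNum h (n + 1) y
      rw [hN] at this
      rcases n with _ | n
      · simpa using this.symm
      · simp only [weightProj_lam_succ, weightProj_one] at this ⊢
        simp only [Nat.succ_ne_zero, if_false, map_zero] at this ⊢
        rw [← Nat.cast_smul_eq_nsmul K] at this
        exact (smul_eq_zero.1 this.symm).resolve_left (Nat.cast_ne_zero.2 (Nat.succ_ne_zero _))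
  have : y = lam Γ (hatPr Γ y) (hatOne Γ) := by
    obtain ⟨N, hN⟩ := sum_weightProj h y
    obtain ⟨N', hN'⟩ := sum_weightProj h (lam Γ (hatPr Γ y) (hatOne Γ))
    exact (hN (max N N') (le_max_left _ _)).symm.trans
      ((Finset.sum_congr rfl fun n _ => key n).trans (hN' (max N N') (le_max_right _ _)))
  rw [← toPlus_ofPlus x, ← hy, this, plusPr_toPlus]
  simp [plusIncl_apply]

end SymPlus

/-! ### Conilpotent filtrations -/

section Filtration

variable {K : Type u} [Field K] {B : Type w} [AddCommGroup B] [Module K B]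
  {M N : Type*} [AddCommGroup M] [Module K M] [AddCommGroup N] [Module K N]

/-- The filtrations that witness conilpotence. -/
structure IsConilFil (Δ δ : B →ₗ[K] B ⊗[K] B) (F : ℕ → Submodule K B) : Prop where
  mono : Monotone F
  zero : F 0 = ⊥
  sup : (⨆ n, F n) = ⊤
  coproduct : ∀ n, ∀ x ∈ F n, Δ x ∈ tenFil F n
  cobracket : ∀ n, ∀ x ∈ F n, δ x ∈ tenFil F n

lemma isConilpotent_iff {Δ δ : B →ₗ[K] B ⊗[K] B} : IsConilpotent Δ δ ↔ ∃ F, IsConilFil Δ δ F :=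
  ⟨fun ⟨F, h1, h2, h3, h4⟩ => ⟨F, h1, h2, h3, fun n x hx => (h4 n x hx).1,
    fun n x hx => (h4 n x hx).2⟩, fun ⟨F, h⟩ => ⟨F, h.mono, h.zero, h.sup,
      fun n x hx => ⟨h.coproduct n x hx, h.cobracket n x hx⟩⟩⟩

variable {Δ δ : B →ₗ[K] B ⊗[K] B} {F : ℕ → Submodule K B}

lemma IsConilFil.exists_mem (hF : IsConilFil Δ δ F) (x : B) : ∃ n, x ∈ F n := by
  rw [← Submodule.mem_iSup_of_directed _ hF.mono.directed_le, hF.sup]; trivial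

lemma IsConilFil.ext (hF : IsConilFil Δ δ F) {f f' : B →ₗ[K] M}
    (H : ∀ n, (∀ i < n, ∀ x ∈ F i, f x = f' x) → ∀ x ∈ F n, f x = f' x) : f = f' := by
  have key : ∀ n, ∀ x ∈ F n, f x = f' x := fun n => by
    induction n using Nat.strong_induction_on with
    | _ n ih => exact H n ih
  ext x
  obtain ⟨n, hn⟩ := hF.exists_mem x
  exact key n x hn

lemma map_congr_both {F : ℕ → Submodule K B} (F0 : F 0 = ⊥) {n : ℕ} {f f' : B →ₗ[K] M} {g g' : B →ₗ[K] N}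
    (h : ∀ i < n, ∀ x ∈ F i, f x = f' x) (h' : ∀ i < n, ∀ x ∈ F i, g x = g' x) {z : B ⊗[K] B}
    (hz : z ∈ tenFil F n) : tmap f g z = tmap f' g' z := by
  rw [map_congr_left F0 g h hz, map_congr_right F0 f' h' hz]

end Filtration

/-! ### Morphisms to the symmetric coalgebra -/

section CoalgebraLift

variable (Γ) in
/-- The components of the morphism of coalgebras with given projection `φ` to the generators. -/
def liftSeq (Δ : B ⊸ B ⊗[K] B) (φ : B ⊸ W) : ℕ → B ⊸ SΓ
  | 0 => LinearMap.applyₗ (hatOne Γ) ∘ₗ lam Γ ∘ₗ φ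
  | n + 1 => ((n + 2 : ℕ) : K)⁻¹ • (tlift (lam Γ) ∘ₗ
      tmap φ (liftSeq Δ φ n) ∘ₗ Δ)

variable {Δ δ : B →ₗ[K] B ⊗[K] B} {φ : B →ₗ[K] W}

lemma liftSeq_succ [CharZero K] (n : ℕ) (x : B) : tlift (lam Γ) (tmap φ (liftSeq Γ Δ φ n) (Δ x))
      = (n + 2) • liftSeq Γ Δ φ (n + 1) x := by
  rw [liftSeq, lsmul, ← Nat.cast_smul_eq_nsmul K, smul_smul, mul_inv_cancel₀, one_smul]
  · rfl
  · exact Nat.cast_ne_zero.2 (Nat.succ_ne_zero _)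

lemma liftSeq_mem (hΔ : ∀ i, ∀ x ∈ Ψ i, Δ x ∈ tensorGrading Ψ i) (hφ : ∀ i, ∀ x ∈ Ψ i, φ x ∈ Γ i) (n : ℕ) :
    ∀ i, ∀ x ∈ Ψ i, liftSeq Γ Δ φ n x ∈ hatGr Γ i := by
  induction n with
  | zero =>
    intro i x hx
    have := lam_mem (hφ i x hx) (hatOne_mem (Γ := Γ))
    rwa [zero_add] at this
  | succ n ih =>
    intro i x hx
    refine Submodule.smul_mem _ _ ?_
    simp only [lcomp]
    refine tgr_ind (P := fun z => tlift (lam Γ)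
      (tmap φ (liftSeq Γ Δ φ n) z) ∈ hatGr Γ i) (fun a b e x hx y hy => ?_)
      (fun x y hx hy => ?_) (hΔ i x hx)
    · rw [← e, add_comm]
      exact lam_mem (hφ _ _ hx) (ih _ _ hy)
    · rw [map_add, map_add]; exact add_mem hx hy

lemma liftSeq_eq_zero {F : ℕ → Submodule K B} (hF : IsConilFil Δ δ F) (n : ℕ) :
    ∀ k ≤ n, ∀ x ∈ F k, liftSeq Γ Δ φ n x = 0 := by
  induction n with
  | zero =>
    intro k hk x hx
    obtain rfl : k = 0 := by omega
    rw [hF.zero, Submodule.mem_bot] at hx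
    rw [hx, map_zero]
  | succ n ih =>
    intro k hk x hx
    rw [liftSeq, lsmul, lcomp, lcomp,
      map_congr_right hF.zero (f' := 0) φ (fun i hi x hx => ih i (by omega) x hx) (hF.coproduct k x hx)]
    simp

/-- The terms of the coproduct of `liftSeq`. -/
def liftTerm (Δ : B ⊸ B ⊗[K] B) (G : ℕ → B ⊸ SΓ) : ℕ → ℕ → B ⊸ SΓ ⊗[K] SΓ
  | 0, 0 => 0
  | i + 1, 0 => (tmk K _ _).flip (hatOne Γ) ∘ₗ G i
  | 0, j + 1 => tmk K _ _ (hatOne Γ) ∘ₗ G j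
  | i + 1, j + 1 => tmap (G i) (G j) ∘ₗ Δ

lemma flip_liftTerm (h : IsInt Γ) {p : ℤ} (HB : IsGradedBicoalgebra p Ψ Δ δ)
    {G : ℕ → B ⊸ SΓ} (hG : ∀ n, ∀ i, ∀ x ∈ Ψ i, G n x ∈ hatGr Γ i) (i j : ℕ) :
    koszulFlip _ (hat_int h) ∘ₗ liftTerm Δ G i j = liftTerm Δ G j i := by
  rcases i with _ | i <;> rcases j with _ | j
  · simp [liftTerm]
  · exact hom_ext HB.internal fun n x hx => by
      simp [liftTerm, kflip_apply _ (hat_int h) (hatOne_mem (Γ := Γ)) (hG j n x hx)]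
  · exact hom_ext HB.internal fun n x hx => by
      simp [liftTerm, kflip_apply _ (hat_int h) (hG i n x hx) (hatOne_mem (Γ := Γ))]
  · rw [liftTerm, liftTerm, ← LinearMap.comp_assoc,
      flip_natural HB.internal (hat_int h) (hG i) (hG j), LinearMap.comp_assoc,
      HB.cocommutative]

lemma lam1_liftTerm [CharZero K] {p : ℤ}
    (HB : IsGradedBicoalgebra p Ψ Δ δ) (i j : ℕ) (hij : i + j ≠ 0) (x : B) :
    tlift (lam1 Γ) (tmap φ (liftTerm Δ (liftSeq Γ Δ φ) i j) (Δ x))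
      = (i + 1) • liftTerm Δ (liftSeq Γ Δ φ) (i + 1) j x := by
  rcases i with _ | i <;> rcases j with _ | j
  · omega
  · rw [zero_add, one_smul]
    simp only [liftTerm, lcomp]
    generalize Δ x = z
    induction z with
    | zero => simp
    | tmul a b => simp [liftSeq]
    | add a b ha hb => simp only [map_add, ha, hb]
  · have := liftSeq_succ (Γ := Γ) (Δ := Δ) (φ := φ) i x
    rw [show liftTerm Δ (liftSeq Γ Δ φ) (i + 1 + 1) 0 x = (tmk K _ _).flip (hatOne Γ)
      (liftSeq Γ Δ φ (i + 1) x) from rfl, ← map_nsmul, ← this]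
    generalize Δ x = z
    induction z with
    | zero => simp
    | tmul a b => simp [liftTerm]
    | add a b ha hb => simp only [map_add, ha, hb]
  · have co := lcongr HB.coassociative x
    simp only [lcomp, onRight, parity_zero, LinearEquiv.coe_coe] at co
    rw [LinearEquiv.eq_symm_apply] at co
    have e1 : tmap φ (liftTerm Δ (liftSeq Γ Δ φ) (i + 1) (j + 1)) (Δ x)
        = tmap φ (tmap (liftSeq Γ Δ φ i) (liftSeq Γ Δ φ j)) (tmap lid Δ (Δ x)) := by
      rw [tmap_map]; rfl
    rw [e1, ← co, onLeft, liftTerm, lcomp]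
    have e2 : ∀ z, tlift (lam1 Γ) (tmap φ (tmap (liftSeq Γ Δ φ i) (liftSeq Γ Δ φ j)) (tassoc K B B B z))
        = tmap (tlift (lam Γ) ∘ₗ tmap φ (liftSeq Γ Δ φ i)) (liftSeq Γ Δ φ j) z := fun z => by
      suffices tlift (lam1 Γ) ∘ₗ tmap φ (tmap (liftSeq Γ Δ φ i) (liftSeq Γ Δ φ j)) ∘ₗ
          (tassoc K B B B).toLinearMap
        = tmap (tlift (lam Γ) ∘ₗ tmap φ (liftSeq Γ Δ φ i)) (liftSeq Γ Δ φ j) from lcongr this z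
      exact TensorProduct.ext_threefold fun a b c => by simp
    rw [e2, ← lcomp, ← tmap_comp, lcomp_id]
    have e3 : (tlift (lam Γ) ∘ₗ tmap φ (liftSeq Γ Δ φ i)) ∘ₗ Δ
        = (i + 2) • liftSeq Γ Δ φ (i + 1) := lext fun x => liftSeq_succ i x
    rw [e3, ← Nat.cast_smul_eq_nsmul K, tmap_smul_left, lsmul, Nat.cast_smul_eq_nsmul]

lemma lam2_liftTerm [CharZero K] (h : IsInt Γ) {p : ℤ}
    (HB : IsGradedBicoalgebra p Ψ Δ δ) (hφ : ∀ i, ∀ x ∈ Ψ i, φ x ∈ Γ i) (i j : ℕ)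
    (hij : i + j ≠ 0) (x : B) :
    tlift (lam2 h) (tmap φ (liftTerm Δ (liftSeq Γ Δ φ) i j) (Δ x))
      = (j + 1) • liftTerm Δ (liftSeq Γ Δ φ) i (j + 1) x := by
  have hG := liftSeq_mem HB.coproduct_mem hφ
  rw [← flip_liftTerm h HB hG j i, ← flip_liftTerm h HB hG (j + 1) i, lcomp,
    ← map_nsmul, ← lam1_liftTerm HB j i (by omega)]
  generalize Δ x = z
  induction z with
  | zero => simp
  | tmul a b => simp [lam2, flip_flip h]
  | add a b ha hb => simp only [map_add, ha, hb]

lemma hatΔ_liftSeq [CharZero K] (h : IsInt Γ) {p : ℤ}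
    (HB : IsGradedBicoalgebra p Ψ Δ δ) (hφ : ∀ i, ∀ x ∈ Ψ i, φ x ∈ Γ i) (n : ℕ) (x : B) :
    hatΔ h (liftSeq Γ Δ φ n x) = ∑ ij ∈ Finset.HasAntidiagonal.antidiagonal (n + 1),
      liftTerm Δ (liftSeq Γ Δ φ) ij.1 ij.2 x := by
  induction n generalizing x with
  | zero =>
    have e : ∀ i, ∀ w ∈ Γ i, hatΔ h (lam Γ w (hatOne Γ))
        = hatOne Γ ⊗ₜ[K] lam Γ w (hatOne Γ) + lam Γ w (hatOne Γ) ⊗ₜ[K] hatOne Γ :=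
      fun i w hw => by
        simp [diag_apply, lam2_tmul h hw, parity_one h, add_comm]
    induction x using hom_induction HB.internal with
    | hom i x hx =>
      rw [zero_add, Finset.Nat.antidiagonal_succ]
      simp [liftTerm, liftSeq, -hatΔ_lam, e i _ (hφ i x hx)]
    | add x y hx hy => simp only [map_add, hx, hy, Finset.sum_add_distrib]
  | succ n ih =>
    have ne : ((n + 2 : ℕ) : K) ≠ 0 := Nat.cast_ne_zero.2 (Nat.succ_ne_zero _)
    rw [← smul_right_inj ne, Nat.cast_smul_eq_nsmul, Nat.cast_smul_eq_nsmul, ← map_nsmul, ← liftSeq_succ]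
    have e1 : hatΔ h ∘ₗ liftSeq Γ Δ φ n = ∑ ij ∈ Finset.HasAntidiagonal.antidiagonal (n + 1),
        liftTerm Δ (liftSeq Γ Δ φ) ij.1 ij.2 := lext fun x => by
      rw [lcomp, ih, LinearMap.sum_apply]
    have e2 : ∀ z, hatΔ h (tlift (lam Γ) (tmap φ (liftSeq Γ Δ φ n) z))
        = tlift (lam1 Γ) (tmap φ (hatΔ h ∘ₗ liftSeq Γ Δ φ n) z)
        + tlift (lam2 h) (tmap φ (hatΔ h ∘ₗ liftSeq Γ Δ φ n) z) :=
      fun z => by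
        induction z with
        | zero => simp
        | tmul a b => simp [diag_apply]
        | add a b ha hb => simp only [map_add, ha, hb]; abel
    have e3 : ∀ (s : Finset (ℕ × ℕ)) (f : ℕ × ℕ → B ⊸ SΓ ⊗[K] SΓ) z,
        tmap φ (∑ ij ∈ s, f ij) z = ∑ ij ∈ s, tmap φ (f ij) z :=
      fun s f z => by
        induction z with
        | zero => simp
        | tmul a b => simp [TensorProduct.tmul_sum]
        | add a b ha hb => simp only [map_add, ha, hb, Finset.sum_add_distrib]
    have l1 : ∀ ij ∈ Finset.HasAntidiagonal.antidiagonal (n + 1), _ := fun ij hij =>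
      lam1_liftTerm HB (φ := φ) (Γ := Γ) ij.1 ij.2
        (by rw [Finset.HasAntidiagonal.mem_antidiagonal.1 hij]; omega) x
    have l2 : ∀ ij ∈ Finset.HasAntidiagonal.antidiagonal (n + 1), _ := fun ij hij =>
      lam2_liftTerm h HB hφ ij.1 ij.2 (by rw [Finset.HasAntidiagonal.mem_antidiagonal.1 hij]; omega) x
    rw [e2, e1, e3, map_sum, map_sum, Finset.sum_congr rfl l1, Finset.sum_congr rfl l2]
    set Y := fun i j => liftTerm Δ (liftSeq Γ Δ φ) i j x
    have s1 := Finset.Nat.sum_antidiagonal_succ (n := n + 1) (f := fun ij => ij.1 • Y ij.1 ij.2)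
    have s2 := Finset.Nat.sum_antidiagonal_succ' (n := n + 1) (f := fun ij => ij.2 • Y ij.1 ij.2)
    simp only [zero_smul, zero_add, add_zero] at s1 s2
    change (∑ ij ∈ Finset.HasAntidiagonal.antidiagonal (n + 1), (ij.1 + 1) • Y (ij.1 + 1) ij.2)
      + ∑ ij ∈ Finset.HasAntidiagonal.antidiagonal (n + 1), (ij.2 + 1) • Y ij.1 (ij.2 + 1)
      = (n + 2) • ∑ ij ∈ Finset.HasAntidiagonal.antidiagonal (n + 1 + 1), Y ij.1 ij.2
    rw [← s1, ← s2, ← Finset.sum_add_distrib, Finset.smul_sum]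
    refine Finset.sum_congr rfl fun ij hij => ?_
    rw [← add_smul, Finset.HasAntidiagonal.mem_antidiagonal.1 hij]

variable (Γ) in
/-- The morphism of coalgebras to `S⁺(W)` with given projection to the generators. -/
def plusLift (φ : B ⊸ W) {F : ℕ → Submodule K B} (hF : IsConilFil Δ δ F) : B ⊸ SymPlus Γ :=
  toPlus Γ ∘ₗ locSum (liftSeq Γ Δ φ) fun b => by
    obtain ⟨n, hn⟩ := hF.exists_mem b
    exact ⟨n, fun m hm => liftSeq_eq_zero hF m n hm b hn⟩

lemma plusLift_apply {F : ℕ → Submodule K B} (hF : IsConilFil Δ δ F) {n : ℕ} {x : B} (hx : x ∈ F n) :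
    plusLift Γ φ hF x = ∑ k ∈ Finset.range n, toPlus Γ (liftSeq Γ Δ φ k x) := by
  rw [plusLift, lcomp, locSum_apply (N := n) fun m hm => liftSeq_eq_zero hF m n hm x hx, map_sum]

lemma plusLift_mem {F : ℕ → Submodule K B} (hF : IsConilFil Δ δ F)
    (hΔ : ∀ i, ∀ x ∈ Ψ i, Δ x ∈ tensorGrading Ψ i) (hφ : ∀ i, ∀ x ∈ Ψ i, φ x ∈ Γ i) :
    ∀ i, ∀ x ∈ Ψ i, plusLift Γ φ hF x ∈ SymPlus.grading Γ i := fun i x hx => by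
  obtain ⟨n, hn⟩ := hF.exists_mem x
  rw [plusLift_apply hF hn]
  exact Submodule.sum_mem _ fun k _ => toPlus_mem (liftSeq_mem hΔ hφ k i x hx)

lemma plusPr_plusLift {F : ℕ → Submodule K B} (hF : IsConilFil Δ δ F) (x : B) :
    plusPr Γ (plusLift Γ φ hF x) = φ x := by
  obtain ⟨n, hn⟩ := hF.exists_mem x
  rw [plusLift_apply hF (hF.mono (Nat.le_succ n) hn), map_sum, Finset.sum_range_succ',
    Finset.sum_eq_zero, zero_add]
  · simp [liftSeq]
  · intro k _
    rw [plusPr_toPlus, liftSeq, lsmul, map_smul]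
    have : ∀ k z, counit Γ (liftSeq Γ Δ φ k z) = 0 := fun k z => by
      rcases k with _ | k
      · simp [liftSeq]
      · rw [liftSeq, lsmul, map_smul, lcomp, lcomp]
        generalize Δ z = t
        induction t with
        | zero => simp
        | tmul a b => simp
        | add a b ha hb => simp only [map_add, smul_add, ha, hb, add_zero]
    simp only [lcomp]
    generalize Δ x = t
    induction t with
    | zero => simp
    | tmul a b => simp [this]
    | add a b ha hb => simp only [map_add, smul_add, ha, hb, add_zero]

lemma plusΔ_plusLift [CharZero K] (h : IsInt Γ) {p : ℤ}
    (HB : IsGradedBicoalgebra p Ψ Δ δ) (hφ : ∀ i, ∀ x ∈ Ψ i, φ x ∈ Γ i)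
    {F : ℕ → Submodule K B} (hF : IsConilFil Δ δ F) (x : B) :
    plusΔ h (plusLift Γ φ hF x) = tmap (plusLift Γ φ hF) (plusLift Γ φ hF) (Δ x) := by
  obtain ⟨k, hk⟩ := hF.exists_mem x
  set g : ℕ → B ⊸ SymPlus Γ := fun n => toPlus Γ ∘ₗ liftSeq Γ Δ φ n with hg
  set Y : ℕ → ℕ → SymPlus Γ ⊗[K] SymPlus Γ := fun i j =>
    tmap (toPlus Γ) (toPlus Γ) (liftTerm Δ (liftSeq Γ Δ φ) i j x) with hY
  have Y1 : ∀ i, Y i 0 = 0 := fun i => by rcases i with _ | i <;> simp [hY, liftTerm]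
  have Y2 : ∀ j, Y 0 j = 0 := fun j => by rcases j with _ | j <;> simp [hY, liftTerm]
  have Y3 : ∀ i j, Y (i + 1) (j + 1) = tmap (g i) (g j) (Δ x) := fun i j => by
    simp only [hY, hg, liftTerm, lcomp, tmap_comp]
  have Y4 : ∀ i j, k < i + j → Y i j = 0 := fun i j hij => by
    rcases i with _ | i
    · exact Y2 j
    rcases j with _ | j
    · exact Y1 _
    rw [Y3]
    have : tenFil F k ≤ LinearMap.ker (tmap (g i) (g j)) := by
      refine tenFil_le fun s t e a ha b hb => ?_
      rw [LinearMap.mem_ker, map_tmul]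
      rcases Nat.lt_or_ge i s with hs | hs
      · rw [hg]
        simp [liftSeq_eq_zero hF j t (by omega) b hb]
      · rw [hg]
        simp [liftSeq_eq_zero hF i s hs a ha]
    exact this (hF.coproduct k x hk)
  have L : plusΔ h (plusLift Γ φ hF x)
      = ∑ n ∈ Finset.range (k + 1), ∑ ij ∈ Finset.HasAntidiagonal.antidiagonal n, Y ij.1 ij.2 := by
    rw [plusLift_apply hF hk, map_sum, Finset.sum_range_succ']
    simp only [plusΔ_toPlus, hatΔ_liftSeq h HB hφ, map_sum]
    simp [← Y1 0, hY]
  have R : tmap (plusLift Γ φ hF) (plusLift Γ φ hF) (Δ x)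
      = ∑ i ∈ Finset.range (k + 1), ∑ j ∈ Finset.range (k + 1), Y i j := by
    have : ∀ i < k, ∀ x ∈ F i, plusLift Γ φ hF x = (∑ n ∈ Finset.range k, g n) x := fun i hi x hx => by
        rw [plusLift_apply hF (hF.mono hi.le hx), LinearMap.sum_apply]; rfl
    rw [map_congr_both hF.zero this this (hF.coproduct k x hk), Finset.sum_range_succ']
    simp only [Finset.sum_range_succ', Y1, Y2, Y3, Finset.sum_const_zero, add_zero]
    generalize Δ x = z
    induction z with
    | zero => simp
    | tmul a b =>
      simp only [map_tmul, LinearMap.sum_apply, TensorProduct.tmul_sum, TensorProduct.sum_tmul]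
      exact Finset.sum_comm
    | add a b ha hb => simp only [map_add, ha, hb, Finset.sum_add_distrib]
  rw [L, R]
  simp only [Finset.Nat.sum_antidiagonal_eq_sum_range_succ Y]
  rw [Finset.sum_range_diag_flip]
  refine Finset.sum_congr rfl fun i hi => ?_
  refine Finset.sum_subset (Finset.range_mono (Nat.sub_le _ _)) fun j _ hj => Y4 i j ?_
  simp at hi hj; omega

/-- A morphism of coalgebras to `S⁺(W)` is determined by its projection to the generators. -/
lemma eq_of_plusPr_eq [CharZero K] (h : IsInt Γ) {F : ℕ → Submodule K B}
    (hF : IsConilFil Δ δ F) {f g : B ⊸ SymPlus Γ}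
    (hf : ∀ x, plusΔ h (f x) = tmap f f (Δ x))
    (hg : ∀ x, plusΔ h (g x) = tmap g g (Δ x))
    (e : ∀ x, plusPr Γ (f x) = plusPr Γ (g x)) : f = g := by
  refine hF.ext fun n ih x hx => ?_
  have : plusΔ h (f x - g x) = 0 := by
    rw [map_sub, hf, hg, map_congr_both hF.zero ih ih (hF.coproduct n x hx), sub_self]
  have := eq_plusIncl_of_plusΔ h this
  rw [map_sub, e, sub_self, map_zero] at this
  exact sub_eq_zero.1 this

lemma exists_section_plusΔ [CharZero K] (h : IsInt Γ) : ∃ E : SymPlus Γ ⊗[K] SymPlus Γ ⊸ SymPlus Γ,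
      ∀ x, E (plusΔ h x) = x - plusIncl Γ (plusPr Γ x) := by
  have hk : LinearMap.ker (plusΔ h) ≤ LinearMap.ker (lid - plusIncl Γ ∘ₗ plusPr Γ) := fun x hx => by
    have := eq_plusIncl_of_plusΔ h hx
    simp [← this]
  obtain ⟨E, hE⟩ := LinearMap.exists_extend
    ((LinearMap.ker (plusΔ h)).liftQ _ hk ∘ₗ (plusΔ h).quotKerEquivRange.symm.toLinearMap)
  refine ⟨E, fun x => ?_⟩
  have := lcongr hE ⟨plusΔ h x, LinearMap.mem_range_self _ x⟩
  simp only [lcomp, Submodule.subtype_apply, LinearEquiv.coe_coe] at this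
  rw [this]
  have e : (⟨plusΔ h x, LinearMap.mem_range_self _ x⟩ : LinearMap.range (plusΔ h))
    = (plusΔ h).quotKerEquivRange (Submodule.Quotient.mk x) := rfl
  rw [e, LinearEquiv.symm_apply_apply]
  rfl

/-- If `φ` is compatible with cobrackets, so is the induced morphism of coalgebras. -/
lemma plusδ_of_plusΔ [CharZero K] (h : IsInt Γ) {p : ℤ} {δW : W ⊸ W ⊗[K] W}
    (H : IsLieCoalg p Γ h δW) (HB : IsGradedBicoalgebra p Ψ Δ δ)
    {F : ℕ → Submodule K B} (hF : IsConilFil Δ δ F) {f : B ⊸ SymPlus Γ}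
    (hf0 : ∀ i, ∀ x ∈ Ψ i, f x ∈ SymPlus.grading Γ i)
    (hf : ∀ x, plusΔ h (f x) = tmap f f (Δ x))
    (hφ : ∀ x, δW (plusPr Γ (f x)) = tmap (plusPr Γ ∘ₗ f) (plusPr Γ ∘ₗ f) (δ x))
    (x : B) : plusδ h δW (f x) = tmap f f (δ x) := by
  have HS := plus_isGradedBicoalgebra h H
  obtain ⟨E, hE⟩ := exists_section_plusΔ h
  suffices plusδ h δW ∘ₗ f = tmap f f ∘ₗ δ from lcongr this x
  refine hF.ext fun n ih x hx => ?_
  simp only [lcomp] at ih ⊢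
  set z := plusδ h δW (f x) - tmap f f (δ x) with hz
  have lS := lcongr HS.coLeibniz (f x)
  have lB := lcongr HB.coLeibniz x
  simp only [lcomp, ladd] at lS lB
  have hl : onLeft (plusδ h δW) (tmap f f (Δ x)) = tmap (tmap f f) f (onLeft δ (Δ x)) := by
    rw [onLeft, onLeft, tmap_map, tmap_map]
    exact map_congr_left hF.zero _ ih (hF.coproduct n x hx)
  have hr : onRight _ HS.internal p (plusδ h δW) (tmap f f (Δ x))
      = tmap (tmap f f) f (onRight _ HB.internal p δ (Δ x)) := by
    have e : ∀ z : B ⊗[K] (B ⊗[K] B), tmap (tmap f f) f ((tassoc K B B B).symm z)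
        = (tassoc K _ _ _).symm (tmap f (tmap f f) z) :=
      fun z => by
        induction z with
        | zero => simp
        | tmul a b => exact map_map_assoc_symm f a b
        | add a b ha hb => simp only [map_add, ha, hb]
    rw [onRight, onRight, lcomp, lcomp, LinearEquiv.coe_coe, LinearEquiv.coe_coe, e, tmap_map, tmap_map,
      parity_natural HB.internal HS.internal hf0]
    rw [map_congr_right hF.zero (f := plusδ h δW ∘ₗ f) (f' := tmap f f ∘ₗ δ) _ ih (hF.coproduct n x hx)]
  have h1 : onRight _ HS.internal 0 (plusΔ h) z = 0 := by
    rw [hz, map_sub, lS, hf, hl, hr, flip12_natural HB.internal HS.internal hf0,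
      onRight_natural HB.internal HS.internal hf0 hf, lB, map_add, sub_self]
  have h2 : z = tmap lid (plusIncl Γ ∘ₗ plusPr Γ) z := by
    have : tmap lid E (tmap lid (plusΔ h) z) = 0 := by
      simp only [onRight, lcomp, parity_zero, LinearEquiv.coe_coe, LinearEquiv.map_eq_zero_iff] at h1
      rw [h1, map_zero]
    rw [← lcomp, ← tmap_comp, lcomp_id] at this
    have e : E ∘ₗ plusΔ h = lid - plusIncl Γ ∘ₗ plusPr Γ := lext hE
    have sub : tmap (lid : SymPlus Γ ⊸ SymPlus Γ) (lid - plusIncl Γ ∘ₗ plusPr Γ)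
        = lid - tmap lid (plusIncl Γ ∘ₗ plusPr Γ) :=
      text' fun a b => by simp [TensorProduct.tmul_sub]
    rw [e, sub, lsub, lid_apply] at this
    exact sub_eq_zero.1 this
  have h3 : koszulFlip _ HS.internal z = -sg K p • z := by
    have a1 := (isLieCoalg_of_bicoalgebra HS).antisymm (f x)
    have a2 := (isLieCoalg_of_bicoalgebra HB).antisymm x
    rw [hz, map_sub, a1, flip_map HB.internal HS.internal hf0, a2, map_smul, smul_sub]
  have hP : ∀ i, ∀ y ∈ SymPlus.grading Γ i, (plusIncl Γ ∘ₗ plusPr Γ) y ∈ SymPlus.grading Γ i := fun i y hy => by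
      have := toPlus_mem (lam_mem (plusPr_mem hy) (hatOne_mem (Γ := Γ)))
      rw [zero_add] at this
      exact this
  have h4 : z = tmap (plusIncl Γ ∘ₗ plusPr Γ) lid z := by
    have e := lcongr (flip_natural HS.internal HS.internal
      (f := lid) (g := plusIncl Γ ∘ₗ plusPr Γ) (fun _ _ h => h) hP) z
    rw [lcomp, lcomp, ← h2, h3, map_smul] at e
    have hs : -sg K p ≠ 0 := fun h0 => by
      have := sg_mul_self (K := K) p
      rw [neg_eq_zero.1 h0] at this
      simp at this
    exact (smul_right_inj hs).1 e
  have h5 : z = tmap (plusIncl Γ) (plusIncl Γ) (tmap (plusPr Γ) (plusPr Γ) z) := by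
    conv_lhs => rw [h4, h2]
    rw [← lcomp, ← tmap_comp, ← lcomp, ← tmap_comp, lcomp_id, lid_comp]
  rw [← sub_eq_zero, ← hz, h5, hz, map_sub, plusPr_plusδ h H.mem, hφ, tmap_comp, lcomp, sub_self, map_zero]

end CoalgebraLift

/-! ### Interleavings of lists and shuffle permutations -/

section Interleave

def interleave {ι : Type*} : List ι → List ι → List (List ι)
  | [], B => [B]
  | A, [] => [A]
  | a :: A, b :: B => (interleave A (b :: B)).map (a :: ·) ++ (interleave (a :: A) B).map (b :: ·)
  termination_by A B => A.length + B.length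

variable {ι : Type*}

@[simp] lemma interleave_nil_left (B : List ι) : interleave [] B = [B] := by
  rw [interleave]

@[simp] lemma interleave_nil_right (A : List ι) : interleave A [] = [A] := by
  cases A <;> rw [interleave]; simp

lemma interleave_cons (a b : ι) (A B : List ι) : interleave (a :: A) (b :: B)
    = (interleave A (b :: B)).map (a :: ·) ++ (interleave (a :: A) B).map (b :: ·) := by
  rw [interleave]

/-- Induction on pairs of lists that follows the recursion of `interleave`. -/
lemma inter_ind {P : List ι → List ι → Prop} (nil_left : ∀ B, P [] B)
    (nil_right : ∀ A, P A []) (cons : ∀ a A b B, P A (b :: B) → P (a :: A) B → P (a :: A) (b :: B))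
    (A B : List ι) : P A B := by
  induction A generalizing B with
  | nil => exact nil_left B
  | cons a A ihA =>
    induction B with
    | nil => exact nil_right _
    | cons b B ihB => exact cons a A b B (ihA _) ihB

lemma mem_interleave (p : ι → Bool) (A B L : List ι) (hA : ∀ a ∈ A, p a = true) (hB : ∀ b ∈ B, p b = false) :
    L ∈ interleave A B ↔ L.filter p = A ∧ L.filter (fun i => !p i) = B := by
  have filter_nil : ∀ L : List ι, L.filter p = [] → L.filter (fun i => !p i) = L := fun L h => by
    rw [List.filter_eq_nil_iff] at h
    exact List.filter_eq_self.2 fun a ha => by simpa using h a ha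
  have filter_nil' : ∀ L : List ι, L.filter (fun i => !p i) = [] → L.filter p = L := fun L h => by
    rw [List.filter_eq_nil_iff] at h
    exact List.filter_eq_self.2 fun a ha => by simpa using h a ha
  induction A, B using inter_ind generalizing L with
  | nil_left B =>
    rw [interleave_nil_left, List.mem_singleton]
    constructor
    · rintro rfl
      exact ⟨List.filter_eq_nil_iff.2 fun a ha => by simp [hB a ha],
        List.filter_eq_self.2 fun a ha => by simp [hB a ha]⟩
    · rintro ⟨h1, h2⟩
      rw [← h2, filter_nil L h1]
  | nil_right A =>
    rw [interleave_nil_right, List.mem_singleton]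
    constructor
    · rintro rfl
      exact ⟨List.filter_eq_self.2 fun a ha => by simp [hA a ha],
        List.filter_eq_nil_iff.2 fun a ha => by simp [hA a ha]⟩
    · rintro ⟨h1, h2⟩
      rw [← h1, filter_nil' L h2]
  | cons a A b B ih1 ih2 =>
    have ha := hA a (by simp)
    have hb := hB b (by simp)
    rw [interleave_cons, List.mem_append, List.mem_map, List.mem_map]
    rcases L with _ | ⟨c, L⟩
    · simp
    · have e1 : L ∈ interleave A (b :: B) ↔ L.filter p = A ∧ L.filter (fun i => !p i) = b :: B :=
        ih1 L (fun x hx => hA x (List.mem_cons_of_mem _ hx)) hB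
      have e2 : L ∈ interleave (a :: A) B ↔ L.filter p = a :: A ∧ L.filter (fun i => !p i) = B :=
        ih2 L hA (fun x hx => hB x (List.mem_cons_of_mem _ hx))
      by_cases hc : p c = true
      · have hcb : c ≠ b := fun h => by rw [h, hb] at hc; exact absurd hc (by simp)
        simp only [List.cons.injEq, exists_eq_right_right, List.filter_cons, hc, if_true,
          Bool.not_true, Bool.false_eq_true, if_false]
        rw [e1]
        constructor
        · rintro (⟨⟨h1, h2⟩, rfl⟩ | ⟨_, rfl⟩)
          · exact ⟨⟨rfl, h1⟩, h2⟩
          · exact absurd rfl hcb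
        · rintro ⟨⟨rfl, h1⟩, h2⟩
          exact Or.inl ⟨⟨h1, h2⟩, rfl⟩
      · have hca : c ≠ a := fun h => hc (h ▸ ha)
        have hc' : p c = false := by simpa using hc
        simp only [List.cons.injEq, exists_eq_right_right, List.filter_cons, hc', if_true,
          Bool.not_false, Bool.false_eq_true, if_false]
        rw [e2]
        constructor
        · rintro (⟨_, rfl⟩ | ⟨⟨h1, h2⟩, rfl⟩)
          · exact absurd rfl hca
          · exact ⟨h1, rfl, h2⟩
        · rintro ⟨h1, rfl, h2⟩
          exact Or.inr ⟨⟨h1, h2⟩, rfl⟩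

lemma nodup_interleave (A B : List ι) (h : ∀ a ∈ A, ∀ b ∈ B, a ≠ b) : (interleave A B).Nodup := by
  induction A, B using inter_ind with
  | nil_left B => simp
  | nil_right A => simp
  | cons a A b B ih1 ih2 =>
    rw [interleave_cons]
    refine List.Nodup.append ((ih1 fun x hx y hy => h x (by simp [hx]) y hy).map
      (List.cons_injective)) ((ih2 fun x hx y hy => h x hx y (by simp [hy])).map
      (List.cons_injective)) ?_
    intro L h1 h2
    rw [List.mem_map] at h1 h2
    obtain ⟨_, _, rfl⟩ := h1
    obtain ⟨_, _, h2⟩ := h2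
    simp only [List.cons.injEq] at h2
    exact h a (by simp) b (by simp) h2.1.symm

def leftIdx (p q : ℕ) : List (Fin (p + q)) := (List.finRange p).map (Fin.castAdd q)

def rightIdx (p q : ℕ) : List (Fin (p + q)) := (List.finRange q).map (Fin.natAdd p)

lemma mem_leftIdx {p q : ℕ} {i : Fin (p + q)} : i ∈ leftIdx p q ↔ i.val < p := by
  rw [leftIdx, List.mem_map]
  constructor
  · rintro ⟨j, -, rfl⟩; exact j.2
  · exact fun h => ⟨⟨i, h⟩, List.mem_finRange _, rfl⟩

lemma mem_rightIdx {p q : ℕ} {i : Fin (p + q)} : i ∈ rightIdx p q ↔ p ≤ i.val := by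
  rw [rightIdx, List.mem_map]
  constructor
  · rintro ⟨j, -, rfl⟩; exact Nat.le_add_right _ _
  · exact fun h => ⟨⟨i - p, by omega⟩, List.mem_finRange _, Fin.ext (by simp; omega)⟩

lemma leftIdx_pairwise (p q : ℕ) : (leftIdx p q).Pairwise (· < ·) := by
  rw [leftIdx, List.pairwise_map]
  exact (List.pairwise_lt_finRange p).imp fun h => h

lemma rightIdx_pairwise (p q : ℕ) : (rightIdx p q).Pairwise (· < ·) := by
  rw [rightIdx, List.pairwise_map]
  exact (List.pairwise_lt_finRange q).imp fun h => by simpa using h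

lemma isBat_iff {p q : ℕ} (σ : Equiv.Perm (Fin (p + q))) :
    IsBat p q σ ↔ (List.ofFn fun i => σ.symm i) ∈ interleave (leftIdx p q) (rightIdx p q) := by
  set L := List.ofFn fun i => σ.symm i with hL
  have nodup : L.Nodup := List.nodup_ofFn.2 σ.symm.injective
  have mem : ∀ i, i ∈ L := fun i => by
    rw [hL, List.mem_ofFn]; exact ⟨σ i, by simp⟩
  have pw : ∀ r : Fin (p + q) → Bool, (∀ i, r i = true ↔ i ∈ leftIdx p q) ∨
      (∀ i, r i = true ↔ i ∈ rightIdx p q) → ((L.filter r).Pairwise (· < ·) ↔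
        ∀ i j, i < j → r i = true → r j = true → σ i < σ j) := by
    intro r _
    rw [List.pairwise_filter, hL, List.pairwise_ofFn]
    constructor
    · intro h i j hij hi hj
      by_contra hn
      rcases lt_or_eq_of_le (not_lt.1 hn) with hlt | heq
      · have := h hlt (by simpa using hj) (by simpa using hi)
        simp only [Equiv.symm_apply_apply] at this
        exact absurd this hij.not_gt
      · exact hij.ne (σ.injective heq.symm)
    · intro h i j hij hi hj
      by_contra hn
      rcases lt_or_eq_of_le (not_lt.1 hn) with hlt | heq
      · have := h _ _ hlt hj hi
        simp only [Equiv.apply_symm_apply] at this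
        exact absurd this hij.not_gt
      · exact hij.ne (σ.symm.injective heq.symm)
  rw [mem_interleave (fun i => decide (i.val < p)) _ _ _ (fun a ha => by simpa using mem_leftIdx.1 ha)
    (fun b hb => by simpa using mem_rightIdx.1 hb)]
  have e1 : L.filter (fun i => decide (i.val < p)) = leftIdx p q
      ↔ (L.filter (fun i => decide (i.val < p))).Pairwise (· < ·) := by
    constructor
    · intro h; rw [h]; exact leftIdx_pairwise p q
    · intro h
      refine List.Perm.eq_of_pairwise (fun a b _ _ h1 h2 => (lt_asymm h1 h2).elim) h (leftIdx_pairwise p q) ?_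
      rw [List.perm_ext_iff_of_nodup (nodup.filter _) ((leftIdx_pairwise p q).imp (fun h => h.ne))]
      intro a
      simp [mem_leftIdx, mem a]
  have e2 : L.filter (fun i => !decide (i.val < p)) = rightIdx p q
      ↔ (L.filter (fun i => !decide (i.val < p))).Pairwise (· < ·) := by
    constructor
    · intro h; rw [h]; exact rightIdx_pairwise p q
    · intro h
      refine List.Perm.eq_of_pairwise (fun a b _ _ h1 h2 => (lt_asymm h1 h2).elim) h (rightIdx_pairwise p q) ?_
      rw [List.perm_ext_iff_of_nodup (nodup.filter _) ((rightIdx_pairwise p q).imp (fun h => h.ne))]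
      intro a
      simp [mem_rightIdx, mem a]
  rw [e1, e2, pw _ (Or.inl fun i => by simp [mem_leftIdx]), pw _ (Or.inr fun i => by simp [mem_rightIdx])]
  simp only [decide_eq_true_eq, Bool.not_eq_true', decide_eq_false_iff_not, not_lt]
  constructor
  · exact fun h => ⟨fun i j hij hi hj => h i j hij (Or.inl hj), fun i j hij hi hj => h i j hij (Or.inr hi)⟩
  · rintro ⟨h1, h2⟩ i j hij (hj | hi)
    · exact h1 i j hij (lt_trans hij hj) hj
    · exact h2 i j hij hi (le_trans hi (le_of_lt hij))

/-- A sum over shuffle permutations is a sum over interleavings. -/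
lemma sum_isBat {M : Type*} [AddCommMonoid M] (p q : ℕ) (Φ : List (Fin (p + q)) → M) :
    ∑ σ with IsBat p q σ, Φ (List.ofFn fun i => σ.symm i)
      = ((interleave (leftIdx p q) (rightIdx p q)).map Φ).sum := by
  rw [← List.sum_toFinset Φ (nodup_interleave _ _ fun a ha b hb h => by
    subst h; have := mem_leftIdx.1 ha; have := mem_rightIdx.1 hb; omega)]
  refine Finset.sum_bij (fun σ _ => List.ofFn fun i => σ.symm i) (fun σ hσ => ?_) (fun σ _ τ _ h => ?_)
    (fun L hL => ?_) (fun _ _ => rfl)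
  · rw [List.mem_toFinset]
    exact (isBat_iff σ).1 (Finset.mem_filter.1 hσ).2
  · have := List.ofFn_injective h
    exact Equiv.symm_bijective.injective (Equiv.ext fun i => congrFun this i)
  · rw [List.mem_toFinset] at hL
    have hL' := (mem_interleave (fun i => decide (i.val < p)) _ _ _
      (fun a ha => by simpa using mem_leftIdx.1 ha)
      (fun b hb => by simpa using mem_rightIdx.1 hb)).1 hL
    have perm : L.Perm (leftIdx p q ++ rightIdx p q) := by
      rw [← hL'.1, ← hL'.2]; exact (List.filter_append_perm _ _).symm
    have hnodup : L.Nodup := by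
      rw [perm.nodup_iff]
      refine List.Nodup.append ((leftIdx_pairwise p q).imp fun h => h.ne)
        ((rightIdx_pairwise p q).imp fun h => h.ne) fun a ha hb => ?_
      have := mem_leftIdx.1 ha; have := mem_rightIdx.1 hb; omega
    have hlen : L.length = p + q := by rw [perm.length_eq]; simp [leftIdx, rightIdx]
    let f : Fin (p + q) → Fin (p + q) := fun i => L.get (i.cast hlen.symm)
    have hf : Function.Injective f := fun i j h => by
      have := List.nodup_iff_injective_get.1 hnodup h
      simpa [Fin.ext_iff] using this
    let σ : Equiv.Perm (Fin (p + q)) := (Equiv.ofBijective f (Finite.injective_iff_bijective.1 hf)).symm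
    have e : (List.ofFn fun i => σ.symm i) = L := by
      refine List.ext_getElem (by simp [hlen]) fun i h1 h2 => ?_
      simp [σ, f]
    refine ⟨σ, Finset.mem_filter.2 ⟨Finset.mem_univ _, (isBat_iff σ).2 (e ▸ hL)⟩, e⟩

end Interleave

/-! ### The shuffle product -/

section Shuffle

/-- The shuffle product of two words, by recursion on the first letters. -/
def sh : WΞ → WΞ → TV
  | [], Y => word Y
  | X, [] => word X
  | α :: X, β :: Y => tι K α.val * sh X (β :: Y)
      + sg K (β.deg * (α.deg + totalDeg X)) • (tι K β.val * sh (α :: X) Y)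
  termination_by X Y => X.length + Y.length

@[simp] lemma sh_nil_left (Y : WΞ) : sh [] Y = word Y := by rw [sh]

@[simp] lemma sh_nil_right (X : WΞ) : sh X [] = word X := by
  cases X <;> rw [sh]; simp

lemma sh_cons (α β : Letter Ξ) (X Y : WΞ) : sh (α :: X) (β :: Y) = tι K α.val * sh X (β :: Y)
      + sg K (β.deg * (α.deg + totalDeg X)) • (tι K β.val * sh (α :: X) Y) := by
  rw [sh]

lemma word_concat (X : WΞ) (α : Letter Ξ) : word (X ++ [α]) = word X * tι K α.val := by
  rw [word_append, word_cons, word_nil, mul_one]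

lemma shuffle_rearrange {R : Type*} [Ring R] [Algebra K R] (γ η α β x y z w : R)
    {s s' c c' : K} (h : s * c' = c * s') :
    γ * (c • (x * α) + y * β) + s • (η * (c' • (z * α) + w * β))
      = c • ((γ * x + s' • (η * z)) * α) + (γ * y + s • (η * w)) * β := by
  simp only [mul_add, add_mul, mul_smul_comm, smul_add, smul_smul, mul_assoc, smul_mul_assoc, h]
  abel

lemma sh_last (α β : Letter Ξ) (X Y : WΞ) : sh (X ++ [α]) (Y ++ [β])
    = sg K (α.deg * (totalDeg Y + β.deg)) • (sh X (Y ++ [β]) * tι K α.val) + sh (X ++ [α]) Y * tι K β.val := by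
  induction X, Y using inter_ind with
  | nil_left Y =>
    induction Y with
    | nil =>
      rw [List.nil_append, List.nil_append, sh_cons, sh_nil_left, sh_nil_right,
        add_comm, word_cons, word_cons, word_nil, mul_one, mul_one, deg_nil, add_zero,
        zero_add, mul_comm β.deg]
    | cons η Y ih =>
      rw [List.nil_append] at ih ⊢
      have := shuffle_rearrange (tι K α.val) (tι K η.val)
        (tι K α.val) (tι K β.val) 0 (word (η :: Y)) (word (Y ++ [β]))
        (sh [α] Y) (s := sg K (η.deg * (α.deg + totalDeg ([] : WΞ)))) (s' := 1)
        (c := sg K (α.deg * (totalDeg (η :: Y) + β.deg)))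
        (c' := sg K (α.deg * (totalDeg Y + β.deg))) (by
          rw [sg_mul', mul_one, deg_cons, deg_nil]; congr 1; ring)
      rw [zero_mul, smul_zero, zero_add, mul_zero, zero_add, one_smul, ← word_concat (η :: Y),
        List.cons_append, ← word_cons η (Y ++ [β])] at this
      rw [List.cons_append, sh_cons, ih, sh_nil_left, sh_nil_left, sh_cons, sh_nil_left]
      exact this
  | nil_right X =>
    induction X with
    | nil =>
      rw [List.nil_append, List.nil_append, sh_cons, sh_nil_left, sh_nil_right,
        add_comm, word_cons, word_cons, word_nil, mul_one, mul_one, deg_nil, add_zero,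
        zero_add, mul_comm β.deg]
    | cons γ X ih =>
      rw [List.nil_append] at ih ⊢
      have := shuffle_rearrange (tι K γ.val) (tι K β.val) (tι K α.val) (tι K β.val) (sh X [β]) (word (X ++ [α]))
        (word (γ :: X)) 0 (s := sg K (β.deg * (γ.deg + totalDeg (X ++ [α]))))
        (s' := sg K (β.deg * (γ.deg + totalDeg X)))
        (c := sg K (α.deg * (totalDeg ([] : WΞ) + β.deg))) (c' := 1) (by
          rw [sg_mul', mul_one, deg_append, deg_cons, deg_nil]; congr 1; ring)
      rw [zero_mul, add_zero, mul_zero, smul_zero, add_zero, one_smul, ← word_concat (γ :: X),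
        List.cons_append] at this
      rw [List.cons_append, sh_cons, ih, sh_nil_right, sh_nil_right, sh_cons, sh_nil_right,
        word_cons γ (X ++ [α])]
      rw [word_cons γ (X ++ [α])] at this
      exact this
  | cons γ X η Y ih1 ih2 =>
    simp only [List.cons_append] at ih1 ih2 ⊢
    rw [sh_cons, ih1, ih2, sh_cons γ η X (Y ++ [β]), sh_cons γ η (X ++ [α]) Y]
    apply shuffle_rearrange
    rw [sg_mul', sg_mul', deg_append, deg_cons, deg_cons, deg_nil]
    congr 1; ring

lemma interleave_perm {ι : Type*} {A B L : List ι} (h : L ∈ interleave A B) : L.Perm (A ++ B) := by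
  induction A, B using inter_ind generalizing L with
  | nil_left B => rw [interleave_nil_left, List.mem_singleton] at h; rw [h, List.nil_append]
  | nil_right A => rw [interleave_nil_right, List.mem_singleton] at h; rw [h, List.append_nil]
  | cons a A b B ih1 ih2 =>
    rw [interleave_cons, List.mem_append, List.mem_map, List.mem_map] at h
    rcases h with ⟨L, hL, rfl⟩ | ⟨L, hL, rfl⟩
    · exact (ih1 hL).cons a
    · exact ((ih2 hL).cons b).trans List.perm_middle.symm

lemma koszulExp_sorted {ι : Type*} [LinearOrder ι] (deg : ι → ℤ) {L : List ι}
    (h : L.Pairwise (· < ·)) : koszulExp deg L = 0 := by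
  induction L with
  | nil => rfl
  | cons i L ih =>
    rw [List.pairwise_cons] at h
    rw [koszulExp, ih h.2, List.filter_eq_nil_iff.2 fun j hj => by simpa using (h.1 j hj).le]
    rfl

lemma list_sum_map {ι : Type*} {M N : Type*} [AddCommGroup M] [Module K M] [AddCommGroup N]
    [Module K N] (f : M ⊸ N) (Φ : ι → M) (l : List ι) :
    (l.map fun L => f (Φ L)).sum = f (l.map Φ).sum := by
  rw [map_list_sum, List.map_map]; rfl

lemma koszulExp_cons_left {ι : Type*} [LinearOrder ι] (deg : ι → ℤ) {a : ι} {A B L : List ι}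
    (h : (a :: A ++ B).Pairwise (· < ·)) (hL : L ∈ interleave A B) :
    koszulExp deg (a :: L) = koszulExp deg L := by
  rw [List.cons_append, List.pairwise_cons] at h
  rw [koszulExp, List.filter_eq_nil_iff.2 fun j hj => by
    simpa using (h.1 j ((interleave_perm hL).mem_iff.1 hj)).le]
  simp

lemma koszulExp_cons_right {ι : Type*} [LinearOrder ι] (deg : ι → ℤ) {b : ι} {A B L : List ι}
    (h : (A ++ b :: B).Pairwise (· < ·)) (hL : L ∈ interleave A B) :
    koszulExp deg (b :: L) = deg b * (A.map deg).sum + koszulExp deg L := by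
  rw [List.pairwise_append, List.pairwise_cons] at h
  have e : ((L.filter (· < b)).map fun j => deg b * deg j).sum = deg b * (A.map deg).sum := by
    rw [((interleave_perm hL).filter _ |>.map _).sum_eq, List.filter_append,
      List.filter_eq_self.2 fun a ha => by simpa using h.2.2 a ha b (by simp),
      List.filter_eq_nil_iff.2 fun c hc => by simpa using (h.2.1.1 c hc).le, List.append_nil,
      List.sum_map_mul_left]
  rw [koszulExp, e]

lemma tensorWord_cons (v : V) (l : List V) : tensorWord K (v :: l) = tι K v * tensorWord K l := by
  simp [tensorWord]

lemma sum_interleave_eq_sh {ι : Type*} [LinearOrder ι] (J : ι → Letter Ξ) (A B : List ι)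
    (h : (A ++ B).Pairwise (· < ·)) :
    ((interleave A B).map fun L => sg K (koszulExp (fun i => (J i).deg) L) • word (L.map J)).sum
      = sh (A.map J) (B.map J) := by
  induction A, B using inter_ind with
  | nil_left B =>
    rw [List.nil_append] at h
    simp [koszulExp_sorted _ h]
  | nil_right A =>
    rw [List.append_nil] at h
    simp [koszulExp_sorted _ h]
  | cons a A b B ih1 ih2 =>
    have h1 : (A ++ b :: B).Pairwise (· < ·) := (List.pairwise_cons.1 h).2
    have h2 : (a :: A ++ B).Pairwise (· < ·) := h.sublist ((List.sublist_cons_self b B).append_left _)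
    rw [interleave_cons, List.map_append, List.sum_append, List.map_map, List.map_map,
      List.map_cons, List.map_cons, sh_cons, ← List.map_cons, ← List.map_cons, ← ih1 h1, ← ih2 h2]
    congr 1
    · rw [← lmulLeft (R := K), ← list_sum_map]
      refine congrArg List.sum (List.map_congr_left fun L hL => ?_)
      rw [Function.comp_apply, koszulExp_cons_left _ h hL, List.map_cons, word_cons, map_smul, lmulLeft]
    · rw [← lmulLeft (R := K) (tι K (J b).val), ← lsmul, ← list_sum_map]
      refine congrArg List.sum (List.map_congr_left fun L hL => ?_)
      rw [Function.comp_apply, koszulExp_cons_right _ h hL, List.map_cons (f := J),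
        word_cons, lsmul, map_smul, lmulLeft, smul_smul, sg_mul']
      simp [totalDeg, Function.comp_def]

lemma leftIdx_append_pairwise (p q : ℕ) : (leftIdx p q ++ rightIdx p q).Pairwise (· < ·) := by
  rw [List.pairwise_append]
  refine ⟨leftIdx_pairwise p q, rightIdx_pairwise p q, fun a ha b hb => ?_⟩
  have := mem_leftIdx.1 ha; have := mem_rightIdx.1 hb
  exact Fin.lt_def.2 (by omega)

lemma leftIdx_joined (X Y : WΞ) : (leftIdx X.length Y.length).map (joined X Y) = X := by
  rw [leftIdx, List.map_map]
  conv_rhs => rw [← List.map_get_finRange X]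
  refine List.map_congr_left fun i _ => ?_
  simp [joined]

lemma rightIdx_joined (X Y : WΞ) : (rightIdx X.length Y.length).map (joined X Y) = Y := by
  rw [rightIdx, List.map_map]
  conv_rhs => rw [← List.map_get_finRange Y]
  refine List.map_congr_left fun i _ => ?_
  simp [joined]

lemma bat_eq_sh (X Y : WΞ) : bat X Y = sh X Y := by
  have e : ∀ σ : Equiv.Perm (Fin (X.length + Y.length)), rearranged X Y σ
      = (List.ofFn fun i => σ.symm i).map (joined X Y) := fun σ => by
    rw [rearranged, List.map_ofFn]; rfl
  simp only [bat, rearrangedSign, koszulSign, e, nop_smul (K := K)]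
  rw [sum_isBat X.length Y.length fun L => sg K (koszulExp (fun i => (joined X Y i).deg) L) •
    tensorWord K (vals (L.map (joined X Y)))]
  have := sum_interleave_eq_sh (K := K) (joined X Y) _ _ (leftIdx_append_pairwise X.length Y.length)
  rw [leftIdx_joined, rightIdx_joined] at this
  exact this

/-! ### Dynkin elements -/

/-- Exponent of the sign of the reversal of a word, with an additional `-1` for every letter. -/
def revExp : WΞ → ℤ
  | [] => 0
  | α :: X => revExp X + α.deg * totalDeg X + 1

lemma revExp_concat (X : WΞ) (β : Letter Ξ) : revExp (X ++ [β]) = revExp X + β.deg * totalDeg X + 1 := by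
  induction X with
  | nil => simp [revExp]
  | cons α X ih => simp only [List.cons_append, revExp, ih, deg_append, deg_cons, deg_nil]; ring

lemma totalDeg_reverse (X : WΞ) : totalDeg X.reverse = totalDeg X := by
  simp [totalDeg]

/-- The part of the Dynkin element of `U α X` that ends with the letter `α`. -/
def dynkinTerm (U : WΞ) (α : Letter Ξ) (X : WΞ) : TV :=
  sg K (revExp X + α.deg * totalDeg X) • (sh U X.reverse * tι K α.val)

/-- The part of the Dynkin element of `U X` of terms that end with a letter of `X`. -/
def dynkinPart : WΞ → WΞ → TV
  | _, [] => 0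
  | U, α :: X => dynkinTerm U α X + dynkinPart (U ++ [α]) X

/-- Neighbouring terms of a Dynkin element differ by a shuffle. -/
lemma dynkinTerm_sub (U : WΞ) (α β : Letter Ξ) (X : WΞ) : dynkinTerm U α (β :: X) - dynkinTerm (U ++ [α]) β X
      = sg K (revExp (β :: X)) • sh (U ++ [α]) (β :: X).reverse := by
  rw [List.reverse_cons, sh_last, smul_add, smul_smul, sg_mul', totalDeg_reverse]
  rw [dynkinTerm, dynkinTerm, List.reverse_cons, revExp, deg_cons, sub_eq_add_neg, ← neg_smul, neg_sg]
  congr 3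
  rw [add_comm β.deg]

lemma dynkinTerm_nil (U : WΞ) (α : Letter Ξ) : dynkinTerm U α [] = word (U ++ [α]) := by
  rw [dynkinTerm, List.reverse_nil, sh_nil_right, word_concat, revExp, deg_nil, mul_zero,
    add_zero, sg_zero, one_smul]

lemma mul_rearrange {R : Type*} [Ring R] [Algebra K R] (α β γ x y : R) {c c' s t : K} (h : c * s = -(t * c')) :
    c • ((α * x + s • (β * y)) * γ) = α * (c • (x * γ)) - t • (β * (c' • (y * γ))) := by
  simp only [add_mul, smul_add, smul_smul, smul_mul_assoc, mul_assoc, mul_smul_comm, h, neg_smul,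
    sub_eq_add_neg]

lemma dynkinTerm_cons_concat (α β γ : Letter Ξ) (U X : WΞ) :
    dynkinTerm (α :: U) γ (X ++ [β]) = tι K α.val * dynkinTerm U γ (X ++ [β])
      - sg K (β.deg * (α.deg + totalDeg U + γ.deg + totalDeg X)) • (tι K β.val * dynkinTerm (α :: U) γ X) := by
  rw [dynkinTerm, dynkinTerm, dynkinTerm, List.reverse_append, List.reverse_singleton,
    List.singleton_append, sh_cons]
  refine mul_rearrange (tι K α.val) (tι K β.val) (tι K γ.val) (sh U (β :: X.reverse)) (sh (α :: U) X.reverse) ?_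
  rw [sg_mul', sg_mul', neg_sg]
  rw [revExp_concat, deg_append, deg_cons, deg_nil]
  congr 1; ring

lemma dynkinTerm_nil_concat (α β : Letter Ξ) (X : WΞ) :
    dynkinTerm [] α (X ++ [β]) = - sg K (β.deg * (α.deg + totalDeg X)) • (tι K β.val * dynkinTerm [] α X) := by
  simp only [dynkinTerm, List.reverse_append, List.reverse_cons, List.reverse_nil, List.nil_append,
    List.singleton_append, sh_nil_left, word_cons, mul_smul_comm, smul_smul, mul_assoc, neg_sg,
    sg_mul']
  congr 1
  apply sg_congr
  simp only [revExp_concat, deg_append, deg_cons, deg_nil, parity_simps]; tauto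

lemma dynkinPart_cons_concat (α β : Letter Ξ) (U X : WΞ) :
    dynkinPart (α :: U) (X ++ [β]) = tι K α.val * dynkinPart U (X ++ [β])
      - sg K (β.deg * (α.deg + totalDeg U + totalDeg X)) • (tι K β.val * dynkinPart (α :: U) X) := by
  induction X generalizing U with
  | nil => simp [dynkinPart, dynkinTerm_nil]
  | cons γ X ih =>
    rw [List.cons_append, dynkinPart, dynkinPart, dynkinPart, dynkinTerm_cons_concat,
      List.cons_append, ih, deg_append, deg_cons, deg_cons, deg_nil]
    simp only [mul_add, smul_add, ← add_assoc, add_zero]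
    abel

lemma dynkinPart_rec (α β : Letter Ξ) (X : WΞ) :
    dynkinPart [] (α :: (X ++ [β])) = tι K α.val * dynkinPart [] (X ++ [β])
      - sg K (β.deg * (α.deg + totalDeg X)) • (tι K β.val * dynkinPart [] (α :: X)) := by
  rw [dynkinPart, dynkinPart, List.nil_append, dynkinPart_cons_concat, dynkinTerm_nil_concat,
    deg_nil, add_zero, mul_add (tι K β.val), smul_add, neg_smul]
  abel

lemma mkQ_dynkinTerm (U : WΞ) (α : Letter Ξ) (X : WΞ) :
    (shuffleRel Ξ).mkQ (dynkinTerm U α X) = (shuffleRel Ξ).mkQ (word (U ++ α :: X)) := by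
  induction X generalizing U α with
  | nil => rw [dynkinTerm_nil]
  | cons β X ih =>
    have e : (shuffleRel Ξ).mkQ (dynkinTerm U α (β :: X)) = (shuffleRel Ξ).mkQ (dynkinTerm (U ++ [α]) β X) := by
      rw [← sub_eq_zero, ← map_sub, dynkinTerm_sub, map_smul, Submodule.mkQ_apply,
        (Submodule.Quotient.mk_eq_zero _).2, smul_zero]
      exact Submodule.subset_span (Or.inr ⟨U ++ [α], (β :: X).reverse, by simp, by simp, (bat_eq_sh _ _).symm⟩)
    rw [e, ih, List.append_assoc]; rfl

lemma mkQ_dynkinPart (U X : WΞ) :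
    (shuffleRel Ξ).mkQ (dynkinPart U X) = X.length • (shuffleRel Ξ).mkQ (word (U ++ X)) := by
  induction X generalizing U with
  | nil => simp [dynkinPart]
  | cons α X ih =>
    rw [dynkinPart, map_add, mkQ_dynkinTerm, ih, List.append_assoc, List.length_cons, succ_nsmul, add_comm]
    rfl

end Shuffle

/-! ### Deconcatenation -/

section CoassocToLie

/-- The graded commutator of a coassociative coproduct is a Lie cobracket. -/
lemma isLieCoalg_of_coassoc (h : IsInt Θ) {f : C ⊸ C ⊗[K] C} (hf : ∀ i, ∀ x ∈ Θ i, f x ∈ tensorGrading Θ i)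
    (coassoc : ∀ x, onLeft f (f x) = onRight Θ h 0 f (f x)) :
    IsLieCoalg 0 Θ h (f - koszulFlip Θ h ∘ₗ f) where
  mem i x hx := by
    rw [sub_zero]
    refine Submodule.sub_mem _ (hf i x hx) ?_
    refine tgr_ind (P := fun z => koszulFlip Θ h z ∈ tensorGrading Θ i)
      (fun a b e u hu v hv => ?_) (fun u v hu hv => ?_) (hf i x hx)
    · rw [kflip_apply Θ h hu hv]
      exact Submodule.smul_mem _ _ (tmul_mem_tgr hv hu (by omega))
    · rw [map_add]; exact Submodule.add_mem _ hu hv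
  antisymm x := by
    have := lcongr (koszulFlip_koszulFlip Θ h) (f x)
    simp only [lcomp, lid_apply] at this
    simp [this]
  jacobi x := by
    set A := onLeft f (f x) with hA
    have e1 : onLeft (f - koszulFlip Θ h ∘ₗ f) = onLeft f - flip12 Θ h ∘ₗ onLeft f :=
      text' fun u v => by simp [onLeft, flip12, TensorProduct.sub_tmul]
    have e2 : onLeft f (koszulFlip Θ h (f x)) = flip23 Θ h (flip12 Θ h A) := by
      have := onRight_flip h (p := 0) (f := f) (fun i x hx => by rw [sub_zero]; exact hf i x hx)
        (koszulFlip Θ h (f x))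
      have ff := lcongr (koszulFlip_koszulFlip Θ h) (f x)
      rw [lcomp, lid_apply] at ff
      rw [ff, ← coassoc, ← hA] at this
      rw [this, flip12_flip12, flip23_flip23]
    have e3 : onLeft (f - koszulFlip Θ h ∘ₗ f) ((f - koszulFlip Θ h ∘ₗ f) x)
        = A - flip12 Θ h A - (flip23 Θ h (flip12 Θ h A) - flip12 Θ h (flip23 Θ h (flip12 Θ h A))) := by
      rw [e1, lsub, lcomp, lsub, lcomp, map_sub, map_sub, e2]
      abel
    rw [e3]
    simp only [map_sub, flip12_flip12, flip23_flip23, flip_braid]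
    have b : ∀ z, flip23 Θ h (flip12 Θ h (flip23 Θ h z))
      = flip12 Θ h (flip23 Θ h (flip12 Θ h z)) := flip_braid h
    rw [← b A]
    abel

end CoassocToLie

section TensorRec

/-- The linear map `F` on the tensor algebra with `F(1) = m₀` and `F(v t) = P v t + Q v F(t)`. -/
def tensorRec (P : V ⊸ TV ⊸ M) (Q : V ⊸ Module.End K M) (m₀ : M) : TV ⊸ M :=
  LinearMap.snd K TV M ∘ₗ tensorFold (M := TV × M)
    (LinearMap.mk₂ K (fun v s => (tι K v * s.1, P v s.1 + Q v s.2))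
      (fun v w s => by ext <;> simp [add_mul]; abel) (fun c v s => by ext <;> simp)
      (fun v s t => by ext <;> simp [mul_add]; abel) (fun c v s => by ext <;> simp)) (1, m₀)

@[simp] lemma tensorRec_one (P : V ⊸ TV ⊸ M) (Q : V ⊸ Module.End K M)
    (m₀ : M) : tensorRec P Q m₀ 1 = m₀ := by simp [tensorRec]

lemma tensorRec_mul (P : V ⊸ TV ⊸ M) (Q : V ⊸ Module.End K M) (m₀ : M) (v : V) (t : TV) :
    tensorRec P Q m₀ (tι K v * t) = P v t + Q v (tensorRec P Q m₀ t) := by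
  rw [tensorRec, lcomp, tensorFold_mul, LinearMap.mk₂_apply]
  set A : V ⊸ Module.End K (TV × M) := LinearMap.mk₂ K (fun v s => (tι K v * s.1, P v s.1 + Q v s.2))
      (fun v w s => by ext <;> simp [add_mul]; abel) (fun c v s => by ext <;> simp)
      (fun v s t => by ext <;> simp [mul_add]; abel) (fun c v s => by ext <;> simp) with hA
  have key : ∀ (t : TV) (s : TV × M), (TensorAlgebra.lift K A t s).1 = t * s.1 := by
    intro t
    induction t using TensorAlgebra.induction with
    | algebraMap r => intro s; simp [Algebra.smul_def]
    | ι x => intro s; simp [hA]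
    | mul a b ha hb => intro s; rw [map_mul, Module.End.mul_apply, ha, hb, mul_assoc]
    | add a b ha hb => intro s; simp [ha, hb, add_mul]
  have : (tensorFold A (1, m₀) t).1 = t := by
    simp [tensorFold, key]
  simp [this]

end TensorRec

section Deconcatenation

def mulι : V ⊸ Module.End K TV := LinearMap.mul K TV ∘ₗ tι K

lemma mulι_apply (v : V) (t : TV) : mulι v t = tι K v * t := rfl

variable (K V) in
/-- The deconcatenation coproduct of the tensor algebra. -/
def dec : TV ⊸ TV ⊗[K] TV := tensorRec ((LinearMap.compr₂ mulι (tmk K _ _ 1)))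
    (LinearMap.rTensorHom TV ∘ₗ mulι) (1 ⊗ₜ 1)

@[simp] lemma dec_one : dec K V 1 = 1 ⊗ₜ 1 := by simp [dec]

lemma dec_mul (v : V) (t : TV) : dec K V (tι K v * t) = 1 ⊗ₜ (tι K v * t) + tmap (mulι v) lid (dec K V t) := by
  rw [dec, tensorRec_mul]; rfl

variable (K V) in
def tenCounit : TV ⊸ K := tensorRec 0 0 1

@[simp] lemma tenCounit_one : tenCounit K V 1 = 1 := by simp [tenCounit]

@[simp] lemma tenCounit_mul (v : V) (t : TV) : tenCounit K V (tι K v * t) = 0 := by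
  rw [tenCounit, tensorRec_mul]; simp

variable (K V) in
def tensorPr : TV ⊸ V := tensorRec ((LinearMap.lsmul K V).flip.compl₂ (tenCounit K V)) 0 0

@[simp] lemma tensorPr_one : tensorPr K V 1 = 0 := by simp [tensorPr]

@[simp] lemma tensorPr_mul (v : V) (t : TV) : tensorPr K V (tι K v * t) = tenCounit K V t • v := by
  rw [tensorPr, tensorRec_mul]; simp

variable (K V) in
def tenNum : TV ⊸ TV := tensorRec mulι mulι 0

@[simp] lemma tenNum_one : tenNum K V 1 = 0 := by simp [tenNum]

lemma tenNum_mul (v : V) (t : TV) : tenNum K V (tι K v * t) = tι K v * t + tι K v * tenNum K V t := by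
  rw [tenNum, tensorRec_mul]; rfl

variable (Ξ) in
/-- The grading of the tensor algebra by total degree. -/
def wordGr (n : ℤ) : Submodule K TV := Submodule.span K {s | ∃ X : WΞ, totalDeg X = n ∧ s = word X}

lemma word_mem (X : WΞ) : word X ∈ wordGr Ξ (totalDeg X) := Submodule.subset_span ⟨X, rfl, rfl⟩

lemma wordGr_le {n : ℤ} {N : Submodule K TV} (H : ∀ X : WΞ, totalDeg X = n → word X ∈ N) : wordGr Ξ n ≤ N :=
  Submodule.span_le.2 (by rintro _ ⟨X, hX, rfl⟩; exact H X hX)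

lemma word_int (h : IsInt Ξ) : IsInt (wordGr Ξ) := by
  refine internal_of_coaction (eq_top_iff.2 ?_) (degCoact h) fun i x hx => ?_
  · rw [← span_words h, Submodule.span_le]
    rintro _ ⟨X, rfl⟩
    exact Submodule.mem_iSup_of_mem (totalDeg X) (word_mem X)
  · refine (wordGr_le (N := LinearMap.eqLocus (degCoact h) (Finsupp.lsingle i)) fun X hX => ?_) hx
    rw [LinearMap.mem_eqLocus, degCoact_word, hX]; rfl

lemma mulι_mem {i n : ℤ} {v : V} (hv : v ∈ Ξ i) {t : TV}
    (ht : t ∈ wordGr Ξ n) : tι K v * t ∈ wordGr Ξ (n + i) := by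
  refine (wordGr_le (N := (wordGr Ξ (n + i)).comap (mulι v)) fun X hX => ?_) ht
  have := word_mem (⟨i, v, hv⟩ :: X)
  rwa [deg_cons, hX, add_comm i n, word_cons] at this

lemma one_mem_wordGr : (1 : TV) ∈ wordGr Ξ 0 := Submodule.subset_span ⟨[], rfl, rfl⟩

lemma wordGr_induction {N : ℤ → Submodule K TV} (one : 1 ∈ N 0)
    (mul : ∀ i, ∀ v ∈ Ξ i, ∀ n, ∀ t ∈ wordGr Ξ n, t ∈ N n → tι K v * t ∈ N (n + i))
    {n : ℤ} {t : TV} (ht : t ∈ wordGr Ξ n) : t ∈ N n := by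
  refine wordGr_le (fun X hX => ?_) ht
  subst hX
  clear ht
  induction X with
  | nil => exact one
  | cons α X ih =>
    rw [word_cons, deg_cons, add_comm]
    exact mul _ _ α.mem _ _ (word_mem X) ih

lemma dec_mem {n : ℤ} {t : TV} (ht : t ∈ wordGr Ξ n) : dec K V t ∈ tensorGrading (wordGr Ξ) n := by
  refine wordGr_induction (N := fun n => (tensorGrading (wordGr Ξ) n).comap (dec K V))
    ?_ (fun i v hv n t ht' ht => ?_) ht
  · rw [Submodule.mem_comap, dec_one]
    exact tmul_mem_tgr one_mem_wordGr one_mem_wordGr (add_zero 0)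
  · rw [Submodule.mem_comap] at ht ⊢
    rw [dec_mul]
    refine Submodule.add_mem _ (tmul_mem_tgr one_mem_wordGr (mulι_mem hv ht') (zero_add _)) ?_
    exact map_mem_tgr (k := i) (l := 0) (fun _ _ => mulι_mem hv) (fun i x hx => by simpa using hx) (by ring) ht

lemma tenCounit_mem {n : ℤ} {t : TV} (ht : t ∈ wordGr Ξ n) (hn : n ≠ 0) : tenCounit K V t = 0 := by
  refine (wordGr_le (N := LinearMap.ker (tenCounit K V)) fun X hX => ?_) ht
  cases X with
  | nil => exact absurd hX.symm hn
  | cons α X => rw [LinearMap.mem_ker, word_cons, tenCounit_mul]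

lemma tensorPr_mem {n : ℤ} {t : TV} (ht : t ∈ wordGr Ξ n) : tensorPr K V t ∈ Ξ n := by
  refine wordGr_induction (N := fun n => (Ξ n).comap (tensorPr K V)) (by simp) (fun i v hv n t ht' ht => ?_) ht
  rw [Submodule.mem_comap, tensorPr_mul]
  by_cases hn : n = 0
  · subst hn; rw [zero_add]; exact Submodule.smul_mem _ _ hv
  · rw [tenCounit_mem ht' hn, zero_smul]; exact Submodule.zero_mem _

lemma dec_coassoc (h : IsInt Ξ) (t : TV) : onLeft (dec K V) (dec K V t)
      = (tassoc K TV TV TV).symm (tmap lid (dec K V) (dec K V t)) := by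
  suffices onLeft (dec K V) ∘ₗ dec K V = (tassoc K TV TV TV).symm.toLinearMap ∘ₗ
    tmap lid (dec K V) ∘ₗ dec K V from lcongr this t
  refine tensor_ext (M := (TV ⊗[K] TV) ⊗[K] TV) h ?_ fun i v hv t ht => ?_
  · simp [onLeft]
  · have h1 : ∀ z, onLeft (dec K V) (tmap (mulι v) lid z) = (tassoc K TV TV TV).symm (1 ⊗ₜ tmap (mulι v) lid z)
          + tmap (tmap (mulι v) lid) lid (onLeft (dec K V) z) := fun z => by
      induction z with
      | zero => simp
      | tmul x y =>
        simp only [onLeft, map_tmul, mulι_apply, dec_mul, lid_apply, add_tmul, TensorProduct.assoc_symm_tmul]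
      | add x y hx hy => simp only [map_add, hx, hy, tmul_add]; abel
    have h2 : ∀ z : TV ⊗[K] TV, (tassoc K TV TV TV).symm (tmap lid (dec K V) (tmap (mulι v) lid z))
        = tmap (tmap (mulι v) lid) lid ((tassoc K TV TV TV).symm (tmap lid (dec K V) z)) :=
        fun z => by
      induction z with
      | zero => simp
      | tmul x y =>
        simp only [map_tmul, lid_apply]
        generalize dec K V y = w
        induction w with
        | zero => simp
        | tmul a b => simp
        | add a b ha hb => simp only [tmul_add, map_add, ha, hb]
      | add x y hx hy => simp only [map_add, hx, hy]
    simp only [lcomp, LinearEquiv.coe_coe] at ht ⊢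
    rw [dec_mul, map_add, map_add, map_add, h1, h2, ht, map_tmul, dec_mul,
      tmul_add, map_add, lid_apply, onLeft, map_tmul, dec_one,
      lid_apply, TensorProduct.assoc_symm_tmul]
    abel

/-- The Lie cobracket of the tensor algebra. -/
def tenCob (h : IsInt Ξ) : TV ⊸ TV ⊗[K] TV := dec K V - koszulFlip _ (word_int h) ∘ₗ dec K V

lemma tenCob_apply (h : IsInt Ξ) (t : TV) :
    tenCob h t = dec K V t - koszulFlip _ (word_int h) (dec K V t) := rfl

lemma tensor_isLieCoalg (h : IsInt Ξ) : IsLieCoalg 0 (wordGr Ξ) (word_int h) (tenCob h) :=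
  isLieCoalg_of_coassoc _ (fun _ _ => dec_mem) fun x => by
    rw [dec_coassoc h, onRight, parity_zero]; rfl

end Deconcatenation

/-! ### Cuts of words -/

section Cuts

variable {ι : Type*} {M N : Type*} [AddCommMonoid M] [AddCommMonoid N]

/-- The sum of `f A B` over all cuts `X = A ++ B`. -/
def cutSum : List ι → (List ι → List ι → M) → M
  | [], f => f [] []
  | α :: X, f => f [] (α :: X) + cutSum X fun A B => f (α :: A) B

lemma cutSum_congr {X : List ι} {f g : List ι → List ι → M}
    (h : ∀ A B, A ++ B = X → f A B = g A B) : cutSum X f = cutSum X g := by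
  induction X generalizing f g with
  | nil => exact h _ _ rfl
  | cons α X ih =>
    rw [cutSum, cutSum, h _ _ rfl, ih fun A B e => h _ _ (by rw [List.cons_append, e])]

lemma cutSum_add (X : List ι) (f g : List ι → List ι → M) :
    cutSum X (fun A B => f A B + g A B) = cutSum X f + cutSum X g := by
  induction X generalizing f g with
  | nil => rfl
  | cons α X ih => simp only [cutSum, ih]; abel

lemma map_cutSum {F : Type*} [FunLike F M N] [AddMonoidHomClass F M N] (φ : F) (X : List ι)
    (f : List ι → List ι → M) : φ (cutSum X f) = cutSum X fun A B => φ (f A B) := by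
  induction X generalizing f with
  | nil => rfl
  | cons α X ih => simp only [cutSum, ih, map_add]

lemma cutSum_zero (X : List ι) : cutSum X (fun _ _ => (0 : M)) = 0 := by
  induction X with
  | nil => rfl
  | cons α X ih => simp only [cutSum, ih, add_zero]

lemma cutSum_last {X : List ι} {f : List ι → List ι → M}
    (h : ∀ A B, A ++ B = X → B ≠ [] → f A B = 0) : cutSum X f = f X [] := by
  induction X generalizing f with
  | nil => rfl
  | cons α X ih =>
    rw [cutSum, h _ _ rfl (by simp), zero_add, ih fun A B e hB => h _ _ (by rw [List.cons_append, e]) hB]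

lemma cutSum_ends {X : List ι} (hX : X ≠ []) {f : List ι → List ι → M}
    (h : ∀ A B, A ++ B = X → A ≠ [] → B ≠ [] → f A B = 0) : cutSum X f = f [] X + f X [] := by
  cases X with
  | nil => exact absurd rfl hX
  | cons α X => rw [cutSum, cutSum_last fun A B e hB => h _ _ (by rw [List.cons_append, e]) (by simp) hB]

end Cuts

section DecShuffle

lemma dec_word (X : WΞ) : dec K V (word X) = cutSum X fun A B => word A ⊗ₜ word B := by
  induction X with
  | nil => simp [cutSum]
  | cons α X ih =>
    rw [word_cons, dec_mul, ih, map_cutSum, cutSum, word_nil, word_cons]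
    rfl

/-- Deconcatenation is a morphism for the shuffle product. -/
lemma dec_sh (X Y : WΞ) : dec K V (sh X Y) = cutSum X fun A B => cutSum Y fun C D =>
    sg K (totalDeg B * totalDeg C) • (sh A C ⊗ₜ[K] sh B D) := by
  induction X, Y using inter_ind with
  | nil_left Y =>
    rw [sh_nil_left, dec_word, cutSum]
    exact cutSum_congr fun A B _ => by simp
  | nil_right X =>
    rw [sh_nil_right, dec_word]
    exact cutSum_congr fun A B _ => by simp [cutSum]
  | cons α X β Y ih1 ih2 =>
    rw [sh_cons, map_add, map_smul, dec_mul, dec_mul, ih1, ih2]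
    have e0 : (1 : TV) ⊗ₜ[K] sh (α :: X) (β :: Y)
      = 1 ⊗ₜ (tι K α.val * sh X (β :: Y)) + sg K (β.deg * (α.deg + totalDeg X)) •
        (1 ⊗ₜ[K] (tι K β.val * sh (α :: X) Y)) := by
      rw [sh_cons, tmul_add, tmul_smul]
    simp only [map_cutSum, cutSum, cutSum_add, map_add, map_smul, map_tmul,
      mulι_apply, lid_apply, sh_nil_left, sh_nil_right, word_nil, word_cons, deg_nil,
      deg_cons, mul_zero, sg_zero, one_smul, sh_cons, add_tmul, smul_add]
    have e1 : cutSum X (fun A B => cutSum Y fun C D =>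
          sg K (totalDeg B * (β.deg + totalDeg C)) •
            ((sg K (β.deg * (α.deg + totalDeg A)) • (tι K β.val * sh (α :: A) C)) ⊗ₜ[K] sh B D))
        = sg K (β.deg * (α.deg + totalDeg X)) • cutSum X fun A B => cutSum Y fun C D =>
          sg K (totalDeg B * totalDeg C) • ((tι K β.val * sh (α :: A) C) ⊗ₜ[K] sh B D) := by
      rw [← LinearMap.lsmul_apply, map_cutSum]
      refine cutSum_congr fun A B e => ?_
      rw [map_cutSum]
      refine cutSum_congr fun C D _ => ?_
      rw [LinearMap.lsmul_apply, ← smul_tmul', smul_smul, smul_smul, sg_mul', sg_mul', ← e, deg_append]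
      congr 2
      ring
    have e2 : cutSum Y (fun C D => sg K ((α.deg + totalDeg X) * (β.deg + totalDeg C)) •
            ((tι K β.val * word C) ⊗ₜ[K] sh (α :: X) D))
        = sg K (β.deg * (α.deg + totalDeg X)) • cutSum Y fun C D =>
          sg K ((α.deg + totalDeg X) * totalDeg C) • ((tι K β.val * word C) ⊗ₜ[K] sh (α :: X) D) := by
      rw [← LinearMap.lsmul_apply, map_cutSum]
      refine cutSum_congr fun C D _ => ?_
      rw [LinearMap.lsmul_apply, smul_smul, sg_mul']
      congr 2
      ring
    rw [e1, e2, ← sh_cons, e0]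
    abel

end DecShuffle

section BarLie

lemma sh_mem (X Y : WΞ) : sh X Y ∈ wordGr Ξ (totalDeg X + totalDeg Y) := by
  induction X, Y using inter_ind with
  | nil_left Y => simpa using word_mem Y
  | nil_right X => simpa using word_mem X
  | cons α X β Y ih1 ih2 =>
    rw [sh_cons]
    refine Submodule.add_mem _ ?_ (Submodule.smul_mem _ _ ?_)
    · have := mulι_mem α.mem ih1
      rwa [deg_cons α X, add_assoc, add_comm α.deg]
    · have := mulι_mem β.mem ih2
      rwa [deg_cons β Y, add_comm β.deg, ← add_assoc]

variable (Ξ) in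
def barMk : TV ⊸ Bar Ξ := (shuffleRel Ξ).mkQ

lemma packet_eq (X : WΞ) : packet X = barMk Ξ (word X) := rfl

lemma barMk_surjective : Function.Surjective (barMk Ξ) := Submodule.mkQ_surjective _

@[simp] lemma barMk_one : barMk Ξ 1 = 0 :=
  (Submodule.Quotient.mk_eq_zero _).2 (Submodule.subset_span (Or.inl rfl))

lemma barMk_sh {X Y : WΞ} (hX : X ≠ []) (hY : Y ≠ []) : barMk Ξ (sh X Y) = 0 :=
  (Submodule.Quotient.mk_eq_zero _).2 (Submodule.subset_span (Or.inr ⟨X, Y, hX, hY, (bat_eq_sh _ _).symm⟩))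

lemma shuffleRel_le {N : Submodule K TV} (one : 1 ∈ N)
    (H : ∀ X Y : WΞ, X ≠ [] → Y ≠ [] → sh X Y ∈ N) : shuffleRel Ξ ≤ N := by
  refine Submodule.span_le.2 ?_
  rintro s (rfl | ⟨X, Y, hX, hY, rfl⟩)
  · exact one
  · rw [bat_eq_sh]; exact H X Y hX hY

lemma degCoact_mem (h : IsInt Ξ) {n : ℤ} {t : TV}
    (ht : t ∈ wordGr Ξ n) : degCoact h t = Finsupp.single n t := by
  refine wordGr_le (N := LinearMap.eqLocus (degCoact h) (Finsupp.lsingle n)) (fun X hX => ?_) ht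
  rw [LinearMap.mem_eqLocus, degCoact_word, hX]; rfl

lemma bar_int (h : IsInt Ξ) : IsInt (Bar.grading Ξ) := by
  refine quot_internal (Ξ := Ξ) h (N := shuffleRel Ξ) rfl fun s hs => ?_
  have : ∃ n, s ∈ wordGr Ξ n := by
    rcases hs with rfl | ⟨X, Y, -, -, rfl⟩
    · exact ⟨0, one_mem_wordGr⟩
    · exact ⟨_, bat_eq_sh X Y ▸ sh_mem X Y⟩
  obtain ⟨n, hn⟩ := this
  rw [degCoact_mem h hn, Finsupp.mapRange.linearMap_apply, Finsupp.mapRange_single]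
  exact (congrArg (Finsupp.single n)
    ((Submodule.Quotient.mk_eq_zero _).2 (Submodule.subset_span hs))).trans (Finsupp.single_zero _)

lemma barMk_mem {n : ℤ} {t : TV} (ht : t ∈ wordGr Ξ n) : barMk Ξ t ∈ Bar.grading Ξ n := by
  refine wordGr_le (N := (Bar.grading Ξ n).comap (barMk Ξ)) (fun X hX => ?_) ht
  exact Submodule.subset_span ⟨X, hX, rfl⟩

lemma exists_barMk {n : ℤ} {y : Bar Ξ} (hy : y ∈ Bar.grading Ξ n) : ∃ x ∈ wordGr Ξ n, barMk Ξ x = y := by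
  have : Bar.grading Ξ n ≤ (wordGr Ξ n).map (barMk Ξ) := by
    refine Submodule.span_le.2 ?_
    rintro _ ⟨X, rfl, rfl⟩
    exact ⟨word X, word_mem X, rfl⟩
  exact this hy

/-- The deconcatenation of a shuffle, modulo shuffles. -/
lemma barMk_dec_sh {X Y : WΞ} (hX : X ≠ []) (hY : Y ≠ []) : tmap (barMk Ξ) (barMk Ξ) (dec K V (sh X Y))
      = barMk Ξ (word X) ⊗ₜ barMk Ξ (word Y)
        + sg K (totalDeg X * totalDeg Y) • (barMk Ξ (word Y) ⊗ₜ barMk Ξ (word X)) := by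
  have hz : ∀ A B C D : WΞ, (A ≠ [] ∧ C ≠ []) ∨ (B ≠ [] ∧ D ≠ []) →
      barMk Ξ (sh A C) ⊗ₜ[K] barMk Ξ (sh B D) = 0 := by
    rintro A B C D (⟨h1, h2⟩ | ⟨h1, h2⟩)
    · rw [barMk_sh h1 h2, zero_tmul]
    · rw [barMk_sh h1 h2, tmul_zero]
  rw [dec_sh]
  simp only [map_cutSum, map_smul, map_tmul]
  rw [cutSum_ends hX fun A B _ hA hB => ?_]
  · rw [cutSum_ends hY fun C D _ hC hD => by rw [hz _ _ _ _ (Or.inr ⟨hX, hD⟩), smul_zero],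
      cutSum_ends hY fun C D _ hC hD => by rw [hz _ _ _ _ (Or.inl ⟨hX, hC⟩), smul_zero]]
    simp
    abel
  · rw [cutSum_ends hY fun C D _ hC hD => by rw [hz _ _ _ _ (Or.inr ⟨hB, hD⟩), smul_zero],
      hz _ _ _ _ (Or.inr ⟨hB, hY⟩), hz _ _ _ _ (Or.inl ⟨hA, hY⟩), smul_zero, smul_zero, add_zero]

lemma barMk_tenCob (h : IsInt Ξ) (t : TV) : tmap (barMk Ξ) (barMk Ξ) (tenCob h t)
      = tmap (barMk Ξ) (barMk Ξ) (dec K V t) - koszulFlip _ (bar_int h)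
        (tmap (barMk Ξ) (barMk Ξ) (dec K V t)) := by
  rw [tenCob_apply, map_sub, flip_map (word_int h) (bar_int h) (fun _ _ => barMk_mem)]

/-- The Lie cobracket on the space of tensors modulo shuffles. -/
def barCob (h : IsInt Ξ) : Bar Ξ ⊸ Bar Ξ ⊗[K] Bar Ξ :=
  (shuffleRel Ξ).liftQ (tmap (barMk Ξ) (barMk Ξ) ∘ₗ tenCob h) <| shuffleRel_le (by simp [tenCob_apply,
        kflip_apply _ (word_int h) (one_mem_wordGr (Ξ := Ξ)) one_mem_wordGr])
      fun X Y hX hY => by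
        rw [LinearMap.mem_ker, lcomp, barMk_tenCob, barMk_dec_sh hX hY,
          map_add, map_smul, kflip_apply _ _ (barMk_mem (word_mem X)) (barMk_mem (word_mem Y)),
          kflip_apply _ _ (barMk_mem (word_mem Y)) (barMk_mem (word_mem X)), smul_smul,
          mul_comm (totalDeg Y), sg_mul_self, one_smul]
        abel

lemma barCob_barMk (h : IsInt Ξ) (t : TV) : barCob h (barMk Ξ t) = tmap (barMk Ξ) (barMk Ξ) (tenCob h t) := rfl

lemma bar_isLieCoalg (h : IsInt Ξ) : IsLieCoalg 0 (Bar.grading Ξ) (bar_int h) (barCob h) :=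
  (tensor_isLieCoalg h).of_surjective _ _ (fun _ _ => barMk_mem) (fun _ _ => exists_barMk) (barCob_barMk h)

lemma tenCounit_sh {X Y : WΞ} (hY : Y ≠ []) : tenCounit K V (sh X Y) = 0 := by
  cases Y with
  | nil => exact absurd rfl hY
  | cons β Y =>
    cases X with
    | nil => rw [sh_nil_left, word_cons, tenCounit_mul]
    | cons α X => rw [sh_cons, map_add, map_smul, tenCounit_mul, tenCounit_mul]; simp

lemma tensorPr_sh {X Y : WΞ} (hX : X ≠ []) (hY : Y ≠ []) : tensorPr K V (sh X Y) = 0 := by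
  cases X with
  | nil => exact absurd rfl hX
  | cons α X =>
    cases Y with
    | nil => exact absurd rfl hY
    | cons β Y =>
      have e : tenCounit K V (sh (α :: X) Y) = 0 := by
        cases Y with
        | nil => rw [sh_nil_right, word_cons, tenCounit_mul]
        | cons γ Y => exact tenCounit_sh (by simp)
      rw [sh_cons, map_add, map_smul, tensorPr_mul, tensorPr_mul, tenCounit_sh (by simp), e]
      simp

variable (Ξ) in
def barPr : Bar Ξ ⊸ V := (shuffleRel Ξ).liftQ (tensorPr K V) <|
    shuffleRel_le (by simp) fun X Y hX hY => LinearMap.mem_ker.2 (tensorPr_sh hX hY)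

lemma barPr_barMk (t : TV) : barPr Ξ (barMk Ξ t) = tensorPr K V t := rfl

lemma barPr_mem {n : ℤ} {y : Bar Ξ} (hy : y ∈ Bar.grading Ξ n) : barPr Ξ y ∈ Ξ n := by
  obtain ⟨x, hx, rfl⟩ := exists_barMk hy
  exact tensorPr_mem hx

end BarLie

/-! ### Iterated cobrackets -/

section DynkinSeq

/-- The iterated cobrackets followed by a linear map to the letters in every factor. -/
def dynSeq (δ : B ⊸ B ⊗[K] B) (f : B ⊸ V) : ℕ → B ⊸ TV
  | 0 => tι K ∘ₗ f
  | n + 1 => lmul' K TV ∘ₗ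
      tmap (tι K ∘ₗ f) (dynSeq δ f n) ∘ₗ δ

lemma dynSeq_zero (δ : B ⊸ B ⊗[K] B) (f : B ⊸ V) : dynSeq δ f 0 = tι K ∘ₗ f := rfl

lemma dynSeq_succ (δ : B ⊸ B ⊗[K] B) (f : B ⊸ V) (n : ℕ) (x : B) : dynSeq δ f (n + 1) x = lmul' K TV
      (tmap (dynSeq δ f 0) (dynSeq δ f n) (δ x)) := rfl

lemma dynSeq_natural {δ : B ⊸ B ⊗[K] B} {δ' : C ⊸ C ⊗[K] C} {g : B ⊸ C}
    (hg : ∀ x, δ' (g x) = tmap g g (δ x)) (f : C ⊸ V) (n : ℕ) :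
    dynSeq δ' f n ∘ₗ g = dynSeq δ (f ∘ₗ g) n := by
  induction n with
  | zero => rfl
  | succ n ih =>
    ext x
    rw [lcomp, dynSeq_succ, dynSeq_succ, hg, tmap_map, ih]
    rfl

lemma mul_mem_wordGr {i j : ℤ} {s t : TV} (hs : s ∈ wordGr Ξ i)
    (ht : t ∈ wordGr Ξ j) : s * t ∈ wordGr Ξ (i + j) := by
  refine wordGr_induction (N := fun i =>
    (wordGr Ξ (i + j)).comap (LinearMap.mulRight K t)) ?_ (fun k v hv n s _ hs => ?_) hs
  · simpa using ht
  · rw [Submodule.mem_comap, LinearMap.mulRight_apply] at hs ⊢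
    rw [mul_assoc, add_right_comm]
    exact mulι_mem hv hs

lemma mul'_mem {n : ℤ} {z : TV ⊗[K] TV} (hz : z ∈ tensorGrading (wordGr Ξ) n) : lmul' K _ z ∈ wordGr Ξ n := by
  refine tgr_ind (P := fun z => lmul' K _ z ∈ wordGr Ξ n) (fun i j e s hs t ht => ?_) (fun s t hs ht => ?_) hz
  · rw [LinearMap.mul'_apply, ← e]; exact mul_mem_wordGr hs ht
  · rw [map_add]; exact Submodule.add_mem _ hs ht

lemma ι_mem {i : ℤ} {v : V} (hv : v ∈ Ξ i) : tι K v ∈ wordGr Ξ i := by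
  have := mulι_mem hv (one_mem_wordGr (Ξ := Ξ))
  rwa [mul_one, zero_add] at this

lemma dynSeq_mem {δ : B ⊸ B ⊗[K] B} (hδ : ∀ i, ∀ x ∈ Ψ i, δ x ∈ tensorGrading Ψ (i - 0))
    {f : B ⊸ V} (hf : ∀ i, ∀ x ∈ Ψ i, f x ∈ Ξ i) (n : ℕ) :
    ∀ i, ∀ x ∈ Ψ i, dynSeq δ f n x ∈ wordGr Ξ i := by
  induction n with
  | zero => exact fun i x hx => ι_mem (hf i x hx)
  | succ n ih =>
    intro i x hx
    rw [dynSeq_succ]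
    refine mul'_mem (map_mem_tgr (Θ := Ψ) (k := 0) (l := 0) (n := i - 0) (fun i x hx => ?_)
      (fun i x hx => ?_) (by ring) (hδ i x hx))
    · rw [add_zero]; exact ι_mem (hf i x hx)
    · rw [add_zero]; exact ih i x hx

/-! #### Letters -/

@[simp] lemma tensorPr_ι (v : V) : tensorPr K V (tι K v) = v := by
  rw [← mul_one (tι K v), tensorPr_mul, tenCounit_one, one_smul]

lemma tenNum_dynSeq (δ : B ⊸ B ⊗[K] B) (f : B ⊸ V) (n : ℕ) (x : B) :
    tenNum K V (dynSeq δ f n x) = (n + 1) • dynSeq δ f n x := by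
  induction n generalizing x with
  | zero =>
    rw [dynSeq_zero, lcomp]
    have := tenNum_mul (f x) (1 : TV)
    rw [mul_one, tenNum_one, mul_zero, add_zero] at this
    rw [this, zero_add, one_smul]
  | succ n ih =>
    rw [dynSeq_succ]
    generalize δ x = z
    induction z with
    | zero => simp
    | tmul a b =>
      rw [map_tmul, LinearMap.mul'_apply, dynSeq_zero, lcomp,
        tenNum_mul, ih, mul_smul_comm, succ_nsmul' _ (n + 1)]
    | add a b ha hb => simp only [map_add, ha, hb, smul_add]

lemma tenCounit_dec (h : IsInt Ξ) (t : TV) : tmap (tenCounit K V) lid (dec K V t) = 1 ⊗ₜ t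
      ∧ tmap lid (tenCounit K V) (dec K V t) = t ⊗ₜ 1 := by
  constructor
  · suffices tmap (tenCounit K V) lid ∘ₗ dec K V = tmk K K TV 1 from lcongr this t
    refine tensor_ext (M := K ⊗[K] TV) h (by simp) fun i v hv t _ => ?_
    have e : tenCounit K V ∘ₗ mulι v = 0 := lext fun s => by simp [mulι_apply]
    rw [lcomp, dec_mul, map_add, tmap_map, e, map_tmul, tenCounit_one]
    simp [TensorProduct.map_zero_left]
  · suffices tmap lid (tenCounit K V) ∘ₗ dec K V = (tmk K TV K).flip 1 from lcongr this t
    refine tensor_ext (M := TV ⊗[K] K) h (by simp) fun i v hv t ht => ?_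
    rw [lcomp] at ht ⊢
    have e : tmap lid (tenCounit K V) ∘ₗ tmap (mulι v) lid = tmap (mulι v) lid ∘ₗ
        tmap lid (tenCounit K V) := text' fun _ _ => rfl
    have e' := lcongr e (dec K V t)
    rw [lcomp, lcomp] at e'
    rw [dec_mul, map_add, e', ht, map_tmul, tenCounit_mul]
    simp [mulι_apply]

lemma tensorPr_dec_mul (h : IsInt Ξ) (v : V) (t : TV) : tmap (tι K ∘ₗ tensorPr K V) lid
      (dec K V (tι K v * t)) = tι K v ⊗ₜ t := by
  have e : (tι K ∘ₗ tensorPr K V) ∘ₗ mulι v = LinearMap.toSpanSingleton K _ (tι K v) ∘ₗ tenCounit K V :=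
    lext fun s => by simp [mulι_apply]
  have e' : tmap ((tι K ∘ₗ tensorPr K V) ∘ₗ mulι v) lid = tmap (LinearMap.toSpanSingleton K _ (tι K v)) lid ∘ₗ
        tmap (tenCounit K V) (lid : TV ⊸ _) := by
    rw [e, ← tmap_comp, lid_comp]
  rw [dec_mul, map_add, tmap_map, lid_comp, e', lcomp, (tenCounit_dec h t).1]
  simp

lemma tensorPr_dec_word (X : WΞ) (v : V) : tmap lid (tι K ∘ₗ tensorPr K V)
      (dec K V (word X * tι K v)) = word X ⊗ₜ tι K v := by
  induction X with
  | nil =>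
    have := dec_mul v (1 : TV)
    rw [mul_one] at this
    rw [word_nil, one_mul, this]
    simp [mulι_apply]
  | cons α X ih =>
    have e : tmap lid (tι K ∘ₗ tensorPr K V) ∘ₗ tmap (mulι α.val) lid = tmap (mulι α.val) lid ∘ₗ
        tmap lid (tι K ∘ₗ tensorPr K V) :=
      text' fun _ _ => rfl
    have e' := lcongr e (dec K V (word X * tι K v))
    rw [lcomp, lcomp, ih] at e'
    have e0 : tenCounit K V (word X * tι K v) = 0 := by
      cases X with
      | nil => rw [word_nil, one_mul, ← mul_one (tι K v), tenCounit_mul]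
      | cons β X => rw [word_cons, mul_assoc, tenCounit_mul]
    rw [word_cons, mul_assoc, dec_mul, map_add, e', map_tmul, lcomp, tensorPr_mul, e0]
    simp [mulι_apply]

lemma dec_tenNum (h : IsInt Ξ) (t : TV) : dec K V (tenNum K V t) = tmap (tenNum K V) lid (dec K V t)
      + tmap lid (tenNum K V) (dec K V t) := by
  suffices dec K V ∘ₗ tenNum K V = (tmap (tenNum K V) lid + tmap lid (tenNum K V)) ∘ₗ dec K V from lcongr this t
  refine tensor_ext (M := TV ⊗[K] TV) h (by simp) fun i v hv t ht => ?_
  simp only [lcomp, ladd] at ht ⊢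
  have e1 : tmap (tenNum K V) lid ∘ₗ tmap (mulι v) lid = tmap (mulι v) (lid : TV ⊸ _) + tmap (mulι v) lid ∘ₗ
          tmap (tenNum K V) lid := text' fun _ _ => by
    simp [mulι_apply, tenNum_mul, add_tmul]
  have e2 : tmap lid (tenNum K V) ∘ₗ tmap (mulι v) lid = tmap (mulι v) lid ∘ₗ
          tmap lid (tenNum K V) := text' fun _ _ => rfl
  have e1' := lcongr e1 (dec K V t)
  have e2' := lcongr e2 (dec K V t)
  simp only [lcomp, ladd] at e1' e2'
  rw [tenNum_mul, map_add, dec_mul, dec_mul, ht, map_add, map_add, map_add, e1', e2',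
    map_tmul, map_tmul, tenNum_one, tenNum_mul]
  simp only [zero_tmul, tmul_add, lid_apply]
  abel

lemma tenNum_mem {n : ℤ} {t : TV} (ht : t ∈ wordGr Ξ n) : tenNum K V t ∈ wordGr Ξ n := by
  refine wordGr_induction (N := fun n => (wordGr Ξ n).comap (tenNum K V)) (by simp)
    (fun i v hv n t ht' ht => ?_) ht
  rw [Submodule.mem_comap, tenNum_mul]
  exact Submodule.add_mem _ (mulι_mem hv ht') (mulι_mem hv ht)

lemma tenCob_tenNum (h : IsInt Ξ) (t : TV) : tenCob h (tenNum K V t) = tmap (tenNum K V) lid (tenCob h t)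
      + tmap lid (tenNum K V) (tenCob h t) := by
  have hN : ∀ i, ∀ t ∈ wordGr Ξ i, tenNum K V t ∈ wordGr Ξ i := fun _ _ => tenNum_mem
  have e1 := lcongr (flip_natural (word_int h) (word_int h) hN (g := lid) (fun i x hx => hx)) (dec K V t)
  have e2 := lcongr (flip_natural (word_int h) (word_int h) (f := lid) (fun i x hx => hx) hN) (dec K V t)
  rw [lcomp, lcomp] at e1 e2
  rw [tenCob_apply, tenCob_apply, dec_tenNum h, map_add, e1, e2, map_sub, map_sub]
  abel

/-- The iterated cobrackets of the tensor algebra, projected to the letters. -/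
abbrev dynOp (h : IsInt Ξ) (n : ℕ) : TV ⊸ TV := dynSeq (tenCob h) (tensorPr K V) n

lemma dynOp_mem (h : IsInt Ξ) (n : ℕ) : ∀ i, ∀ t ∈ wordGr Ξ i, dynOp h n t ∈ wordGr Ξ i :=
  dynSeq_mem (tensor_isLieCoalg h).mem (fun _ _ => tensorPr_mem) n

lemma dynOp_tenNum (h : IsInt Ξ) (n : ℕ) (t : TV) : dynOp h n (tenNum K V t) = (n + 1) • dynOp h n t := by
  have h0 : ∀ t, tenCounit K V (tenNum K V t) = 0 := fun t => by
    suffices tenCounit K V ∘ₗ tenNum K V = 0 from lcongr this t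
    exact tensor_ext h (by simp) fun i v hv t _ => by simp [tenNum_mul]
  have h1 : tensorPr K V ∘ₗ tenNum K V = tensorPr K V :=
    tensor_ext h (by simp) fun i v hv t _ => by simp [tenNum_mul, h0]
  have z : dynOp h 0 ∘ₗ tenNum K V = dynOp h 0 := by
    rw [dynOp, dynSeq_zero, LinearMap.comp_assoc, h1]
  induction n generalizing t with
  | zero => simpa using lcongr z t
  | succ n ih =>
    have ih' : dynOp h n ∘ₗ tenNum K V = (n + 1) • dynOp h n := lext ih
    rw [dynOp, dynSeq_succ, tenCob_tenNum, map_add, tmap_map,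
      tmap_map, z, ih', dynSeq_succ, ← Nat.cast_smul_eq_nsmul K (n + 1),
      tmap_smul_right, lcomp_id, lcomp_id, map_add,
      lsmul, map_smul, Nat.cast_smul_eq_nsmul K, succ_nsmul' _ (n + 1)]

lemma dynOp_one (h : IsInt Ξ) (n : ℕ) : dynOp h n 1 = 0 := by
  cases n with
  | zero => simp [dynOp, dynSeq_zero]
  | succ n =>
    have : tenCob h (1 : TV) = 0 := by
      simp [tenCob_apply, kflip_apply _ (word_int h) (one_mem_wordGr (Ξ := Ξ)) one_mem_wordGr]
    rw [dynOp, dynSeq_succ, this, map_zero, map_zero]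

lemma dynOp_succ (h : IsInt Ξ) (n : ℕ) (t : TV) : dynOp h (n + 1) t = lmul' K _
        (tmap (dynOp h 0) (dynOp h n) (dec K V t))
      - lmul' K _ (koszulFlip _ (word_int h) (tmap (dynOp h n) (dynOp h 0) (dec K V t))) := by
  have e := lcongr (flip_natural (word_int h) (word_int h) (dynOp_mem h n) (dynOp_mem h 0)) (dec K V t)
  rw [lcomp, lcomp] at e
  rw [e, ← map_sub, ← map_sub]
  rfl

lemma dynOp_word (h : IsInt Ξ) (n : ℕ) (X : WΞ) :
    dynOp h n (word X) = if n + 1 = X.length then dynkinPart [] X else 0 := by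
  have comp : ∀ f g : TV ⊸ TV, tmap f g = tmap lid g ∘ₗ tmap f lid := fun f g => by
    rw [← tmap_comp]; simp
  have comp' : ∀ f g : TV ⊸ TV, tmap f g = tmap f lid ∘ₗ tmap lid g := fun f g => by
    rw [← tmap_comp]; simp
  have key : ∀ n (α β : Letter Ξ) (X : WΞ), dynOp h (n + 1) (word (α :: (X ++ [β])))
      = tι K α.val * dynOp h n (word (X ++ [β])) - sg K (β.deg * (α.deg + totalDeg X)) •
          (tι K β.val * dynOp h n (word (α :: X))) := by
    intro n α β X
    have e1 : tmap (dynOp h 0) lid (dec K V (word (α :: (X ++ [β])))) = tι K α.val ⊗ₜ word (X ++ [β]) := by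
      rw [word_cons]; exact tensorPr_dec_mul h _ _
    have e2 : tmap lid (dynOp h 0) (dec K V (word (α :: (X ++ [β])))) = word (α :: X) ⊗ₜ tι K β.val := by
      rw [← List.cons_append, word_concat]; exact tensorPr_dec_word _ _
    rw [dynOp_succ, comp, comp' (dynOp h n), lcomp, lcomp, e1, e2, map_tmul, map_tmul, LinearMap.mul'_apply,
      lid_apply, lid_apply,
      kflip_apply _ _ (dynOp_mem h n _ _ (word_mem (α :: X))) (ι_mem β.mem), map_smul,
      LinearMap.mul'_apply, deg_cons, mul_comm (α.deg + totalDeg X)]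
  induction n generalizing X with
  | zero =>
    rcases X with _ | ⟨α, _ | ⟨β, X⟩⟩
    · rw [word_nil, dynOp_one, if_neg (by simp)]
    · rw [if_pos (by simp), dynkinPart, dynkinPart, dynkinTerm_nil, add_zero, List.nil_append]
      simp [dynOp, dynSeq_zero]
    · rw [if_neg (by simp), dynOp, dynSeq_zero, lcomp, word_cons, tensorPr_mul]
      simp
  | succ n ih =>
    rcases X with _ | ⟨α, X⟩
    · rw [word_nil, dynOp_one, if_neg (by simp)]
    rcases List.eq_nil_or_concat X with rfl | ⟨X, β, rfl⟩
    · rw [if_neg (by simp), dynOp, dynSeq_succ]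
      have : tenCob h (word [α]) = 0 := by
        rw [tenCob_apply, dec_word, cutSum, cutSum, word_nil, map_add,
          kflip_apply _ (word_int h) (one_mem_wordGr (Ξ := Ξ)) (word_mem [α]),
          kflip_apply _ (word_int h) (word_mem [α]) (one_mem_wordGr (Ξ := Ξ)),
          zero_mul, mul_zero, sg_zero, one_smul, one_smul, add_comm, sub_self]
      rw [this, map_zero, map_zero]
    rw [List.concat_eq_append, key, ih, ih]
    by_cases hn : n = X.length
    · rw [if_pos (by simp [hn]), if_pos (by simp [hn]), if_pos (by simp [hn]), dynkinPart_rec]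
    · rw [if_neg (by simpa using hn), if_neg (by simpa using hn), if_neg (by simpa using hn)]
      simp

end DynkinSeq

/-! ### The space of tensors modulo shuffles is a cofree Lie coalgebra -/

section LieLift

/-- The coJacobi identity in coLeibniz form. -/
lemma IsLieCoalg.onRight_sub {h : IsInt Ψ} {δ : B ⊸ B ⊗[K] B} (H : IsLieCoalg 0 Ψ h δ) (x : B) :
    onRight Ψ h 0 δ (δ x) - flip12 Ψ h (onRight Ψ h 0 δ (δ x)) = onLeft δ (δ x) := by
  have anti : ∀ x, koszulFlip Ψ h (δ x) = - δ x := fun x => by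
    rw [H.antisymm, sg_zero, neg_smul, one_smul]
  have e1 : onRight Ψ h 0 δ (δ x) = - flip12 Ψ h (flip23 Ψ h (onLeft δ (δ x))) := by
    have := onRight_flip h H.mem (δ x)
    rw [anti, map_neg] at this
    rw [← this, neg_neg]
  have e2 : flip12 Ψ h (onLeft δ (δ x)) = - onLeft δ (δ x) := by
    rw [flip12_onLeft h (c := (-1 : K)) (fun x => by rw [anti, neg_smul, one_smul])]
    exact neg_one_smul K (onLeft δ (δ x))
  have e3 := H.jacobi x
  rw [e2, map_neg, add_assoc] at e3
  rw [e1, map_neg, flip12_flip12, sub_neg_eq_add]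
  refine Eq.trans ?_ (eq_neg_of_add_eq_zero_left e3).symm
  rw [neg_add, neg_neg]

/-- The recursion of the total Dynkin series. -/
def IsDynSeries (δ : B ⊸ B ⊗[K] B) (f : B ⊸ V) (Λ : B ⊸ TV) : Prop := ∀ x, Λ x = tι K (f x) + lmul' K _
    (tmap (tι K ∘ₗ f) Λ (δ x))

variable {δ : B →ₗ[K] B ⊗[K] B} {f : B →ₗ[K] V} {Λ : B →ₗ[K] TensorAlgebra K V}

lemma tensorPr_dec_mul' (h : IsInt Ξ) (g : B ⊸ TV) (z : B ⊗[K] B) : tmap (tι K ∘ₗ tensorPr K V) lid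
      (dec K V (lmul' K _ (tmap (tι K ∘ₗ f) g z)))
    = tmap (tι K ∘ₗ f) g z := by
  induction z with
  | zero => simp
  | tmul a b =>
    rw [map_tmul, LinearMap.mul'_apply, lcomp, tensorPr_dec_mul h]
  | add a b ha hb => simp only [map_add, ha, hb]

lemma IsDynSeries.first (h : IsInt Ξ) (H : IsDynSeries δ f Λ) (x : B) : tmap (dynOp h 0) lid (dec K V (Λ x))
      = tι K (f x) ⊗ₜ 1 + tmap (tι K ∘ₗ f) Λ (δ x) := by
  rw [H x, map_add, map_add, dynOp, dynSeq_zero, tensorPr_dec_mul' h,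
    ← mul_one (tι K (f x)), tensorPr_dec_mul h, mul_one]

lemma map_assoc_symm {C D E : Type*} [AddCommGroup C] [Module K C] [AddCommGroup D] [Module K D]
    [AddCommGroup E] [Module K E] (a : B ⊸ C) (b : B ⊸ D) (c : B ⊸ E)
    (z : B ⊗[K] (B ⊗[K] B)) :
    tmap (tmap a b) c ((tassoc K B B B).symm z) = (tassoc K C D E).symm (tmap a (tmap b c) z) := by
  suffices tmap (tmap a b) c ∘ₗ (tassoc K B B B).symm.toLinearMap
      = (tassoc K C D E).symm.toLinearMap ∘ₗ tmap a (tmap b c)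
    from lcongr this z
  exact TensorProduct.ext_threefold' fun x y z => by simp

lemma flip12_map_map {C : Type*} [AddCommGroup C] [Module K C] {Θ : ℤ → Submodule K C}
    (h : IsInt Ψ) (h' : IsInt Θ) {a b c : B ⊸ C}
    (ha : ∀ i, ∀ x ∈ Ψ i, a x ∈ Θ i) (hb : ∀ i, ∀ x ∈ Ψ i, b x ∈ Θ i)
    (z : (B ⊗[K] B) ⊗[K] B) :
    flip12 Θ h' (tmap (tmap a b) c z) = tmap (tmap b a) c (flip12 Ψ h z) := by
  rw [flip12, flip12, tmap_map, tmap_map, flip_natural h h' ha hb]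
  rfl

lemma dynOp_succ_map (h : IsInt Ξ) (k : ℕ) (z : TV ⊗[K] TV) : tmap (dynOp h (k + 1)) lid z
      = tmap (lmul' K _) lid (tmap (tmap (dynOp h 0) (dynOp h k)) lid (onLeft (dec K V) z))
        - tmap (lmul' K _) lid (flip12 _ (word_int h) (tmap (tmap (dynOp h k) (dynOp h 0)) lid
            (onLeft (dec K V) z))) := by
  induction z with
  | zero => simp
  | tmul s t =>
    rw [map_tmul, dynOp_succ, TensorProduct.sub_tmul]
    rfl
  | add s t hs ht => simp only [map_add, hs, ht]; abel

lemma map_dec_assoc (h : IsInt Ξ) (a b : TV ⊸ TV) (t : TV) : tmap (tmap a b) lid (onLeft (dec K V) (dec K V t))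
      = (tassoc K _ _ _).symm (tmap lid (tmap b lid ∘ₗ dec K V) (tmap a lid (dec K V t))) := by
  rw [dec_coassoc h, map_assoc_symm, tmap_map, tmap_map]
  rfl

lemma IsDynSeries.dynOp_dec (h : IsInt Ξ) {hB : IsInt Ψ}
    (HB : IsLieCoalg 0 Ψ hB δ) (hf : ∀ i, ∀ x ∈ Ψ i, f x ∈ Ξ i)
    (H : IsDynSeries δ f Λ) (k : ℕ) (x : B) :
    tmap (dynOp h k) lid (dec K V (Λ x)) = tmap (dynSeq δ f k) Λ (δ x) + (k + 1) • (dynSeq δ f k x ⊗ₜ 1) := by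
  induction k generalizing x with
  | zero => rw [H.first h, zero_add, one_smul, add_comm]; rfl
  | succ k ih =>
    set F := dynSeq δ f 0 with hF
    set L := dynSeq δ f k with hL
    have hF' : ∀ i, ∀ x ∈ Ψ i, F x ∈ wordGr Ξ i := dynSeq_mem HB.mem hf 0
    have hL' : ∀ i, ∀ x ∈ Ψ i, L x ∈ wordGr Ξ i := dynSeq_mem HB.mem hf k
    let one : TV ⊸ TV ⊗[K] TV := (tmk K _ _).flip 1
    have g1 : (tmap (dynOp h k) lid ∘ₗ dec K V) ∘ₗ Λ = tmap L Λ ∘ₗ δ + (k + 1) • (one ∘ₗ L) := lext ih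
    have g2 : (tmap (dynOp h 0) lid ∘ₗ dec K V) ∘ₗ Λ = one ∘ₗ F + tmap F Λ ∘ₗ δ := lext (H.first h)
    have z : ∀ k, (tmap (dynOp h k) lid ∘ₗ dec K V) 1 = 0 := fun k => by
      rw [lcomp, dec_one, map_tmul, dynOp_one, zero_tmul]
    have a1 : ∀ (a b : B ⊸ TV) (y : B ⊗[K] B), (tassoc K _ _ _).symm
        (tmap a (one ∘ₗ b) y) = tmap a b y ⊗ₜ 1 := fun a b y => by
      induction y with
      | zero => simp
      | tmul u v => simp [one]
      | add u v hu hv => simp only [map_add, hu, hv, add_tmul]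
    have a2 : ∀ (a b : B ⊸ TV) (y : B ⊗[K] B), (tassoc K _ _ _).symm (tmap a (tmap b Λ ∘ₗ δ) y)
          = tmap (tmap a b) Λ (onRight Ψ hB 0 δ y) := fun a b y => by
      rw [onRight, parity_zero, lcomp, LinearEquiv.coe_coe, map_assoc_symm, tmap_map, lcomp_id]
    have W1 : tmap (tmap (dynOp h 0) (dynOp h k)) lid (onLeft (dec K V) (dec K V (Λ x)))
        = tmap (tmap F L) Λ (onRight Ψ hB 0 δ (δ x)) + (k + 1) • (tmap F L (δ x) ⊗ₜ 1) := by
      rw [map_dec_assoc h, H.first h, map_add, map_tmul, z, tmul_zero,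
        zero_add, tmap_map, lid_comp, g1, TensorProduct.map_add_right,
        ladd, map_add, a2, ← Nat.cast_smul_eq_nsmul K,
        tmap_smul_right, lsmul, map_smul, a1, Nat.cast_smul_eq_nsmul]
      rfl
    have W2 : tmap (tmap (dynOp h k) (dynOp h 0)) lid (onLeft (dec K V) (dec K V (Λ x))) = tmap L F (δ x) ⊗ₜ 1
          + tmap (tmap L F) Λ (onRight Ψ hB 0 δ (δ x)) := by
      rw [map_dec_assoc h, ih, map_add, map_nsmul, map_tmul, z,
        tmul_zero, smul_zero, add_zero, tmap_map, lid_comp, g2,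
        TensorProduct.map_add_right, ladd, map_add, a1, a2]
    have anti : koszulFlip _ (word_int h) (tmap L F (δ x)) = - tmap F L (δ x) := by
      have := lcongr (flip_natural hB (word_int h) hL' hF') (δ x)
      rw [lcomp, lcomp, HB.antisymm, sg_zero, neg_smul, one_smul, map_neg] at this
      exact this
    have e1 : flip12 _ (word_int h) (tmap L F (δ x) ⊗ₜ[K] (1 : TV)) = - (tmap F L (δ x) ⊗ₜ 1) := by
      rw [flip12, map_tmul, anti, neg_tmul, lid_apply]
    have e2 : tmap (tmap F L) Λ (onRight Ψ hB 0 δ (δ x))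
        - tmap (tmap F L) Λ (flip12 Ψ hB (onRight Ψ hB 0 δ (δ x)))
        = tmap (tmap F L ∘ₗ δ) Λ (δ x) := by
      refine (map_sub (tmap (tmap F L) Λ) _ _).symm.trans ?_
      rw [HB.onRight_sub, onLeft, tmap_map, lcomp_id]
    have e3 : tmap (dynSeq δ f (k + 1)) Λ (δ x) = tmap (lmul' K _) lid (tmap (tmap F L ∘ₗ δ) Λ (δ x)) := by
      rw [tmap_map]; rfl
    have e4 : tmap (lmul' K _) lid (-(tmap F L (δ x) ⊗ₜ[K] (1 : TV))) = - (dynSeq δ f (k + 1) x ⊗ₜ 1) := by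
      rw [← neg_tmul, map_tmul, map_neg, neg_tmul]; rfl
    rw [dynOp_succ_map, W1, W2, map_add (flip12 _ _), e1, flip12_map_map hB _ hL' hF', e3, ← e2,
      map_sub, map_add, map_add, e4, map_nsmul, map_tmul, lid_apply,
      ← dynSeq_succ, succ_nsmul _ (k + 1)]
    abel

end LieLift

section BarComponents

/-- The iterated cobrackets on tensors modulo shuffles. -/
def barDynkin (h : IsInt Ξ) (n : ℕ) : Bar Ξ ⊸ TV := dynSeq (barCob h) (barPr Ξ) n

lemma barDynkin_comp (h : IsInt Ξ) (n : ℕ) : barDynkin h n ∘ₗ barMk Ξ = dynOp h n :=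
  dynSeq_natural (barCob_barMk h) (barPr Ξ) n

lemma barDynkin_barMk (h : IsInt Ξ) (n : ℕ) (t : TV) :
    barDynkin h n (barMk Ξ t) = dynOp h n t := lcongr (barDynkin_comp h n) t

/-- The projection to the words with `n + 1` letters. -/
def barProj (h : IsInt Ξ) (n : ℕ) : Bar Ξ ⊸ Bar Ξ := ((n + 1 : ℕ) : K)⁻¹ • (barMk Ξ ∘ₗ barDynkin h n)

lemma barProj_barMk (h : IsInt Ξ) (n : ℕ) (t : TV) :
    barProj h n (barMk Ξ t) = ((n + 1 : ℕ) : K)⁻¹ • barMk Ξ (dynOp h n t) := by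
  rw [barProj, lsmul, lcomp, barDynkin_barMk]

lemma barProj_word [CharZero K] (h : IsInt Ξ) (n : ℕ) (X : WΞ) :
    barProj h n (barMk Ξ (word X)) = if n + 1 = X.length then barMk Ξ (word X) else 0 := by
  rw [barProj_barMk, dynOp_word]
  split_ifs with hn
  · have : barMk Ξ (dynkinPart [] X) = X.length • barMk Ξ (word X) := mkQ_dynkinPart [] X
    rw [this, ← hn, ← Nat.cast_smul_eq_nsmul K, smul_smul, inv_mul_cancel₀, one_smul]
    exact_mod_cast Nat.succ_ne_zero n
  · rw [map_zero, smul_zero]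

lemma bar_induction (h : IsInt Ξ) {P : Bar Ξ → Prop} (word : ∀ X : WΞ, P (barMk Ξ (word X))) (zero : P 0)
    (add : ∀ x y, P x → P y → P (x + y)) (smul : ∀ (c : K) x, P x → P (c • x)) (x : Bar Ξ) :
    P x := by
  obtain ⟨t, rfl⟩ := barMk_surjective x
  have ht : t ∈ Submodule.span K (Set.range (HomotopyAB.word : WΞ → _)) := by
    rw [span_words h]; trivial
  induction ht using Submodule.span_induction with
  | mem s hs => obtain ⟨X, rfl⟩ := hs; exact word X
  | zero => rw [map_zero]; exact zero
  | add s t _ _ hs ht => rw [map_add]; exact add _ _ hs ht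
  | smul c s _ hs => rw [map_smul]; exact smul _ _ hs

lemma sum_barProj [CharZero K] (h : IsInt Ξ) (x : Bar Ξ) :
    ∃ N, ∀ m, N ≤ m → ∑ n ∈ Finset.range m, barProj h n x = x := by
  induction x using bar_induction h with
  | word X =>
    refine ⟨X.length, fun m hm => ?_⟩
    simp_rw [barProj_word]
    cases X with
    | nil => simp
    | cons α X =>
      simp only [List.length_cons, add_left_inj, Finset.sum_ite_eq', Finset.mem_range]
      rw [if_pos]
      rw [List.length_cons] at hm
      omega
  | zero => exact ⟨0, by simp⟩
  | add x y hx hy =>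
    obtain ⟨N, hN⟩ := hx
    obtain ⟨N', hN'⟩ := hy
    refine ⟨max N N', fun m hm => ?_⟩
    simp_rw [map_add, Finset.sum_add_distrib]
    rw [hN m (le_of_max_le_left hm), hN' m (le_of_max_le_right hm)]
  | smul c x hx =>
    obtain ⟨N, hN⟩ := hx
    refine ⟨N, fun m hm => ?_⟩
    simp_rw [map_smul, ← Finset.smul_sum]
    rw [hN m hm]

/-- A tensor modulo shuffles with zero cobracket is a letter. -/
lemma bar_eq_zero [CharZero K] (h : IsInt Ξ) {x : Bar Ξ}
    (hδ : barCob h x = 0) (hπ : barPr Ξ x = 0) : x = 0 := by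
  have z : ∀ n, barProj h n x = 0 := fun n => by
    rw [barProj, lsmul, lcomp, barDynkin]
    cases n with
    | zero => rw [dynSeq_zero, lcomp, hπ, map_zero, map_zero, smul_zero]
    | succ n => rw [dynSeq_succ, hδ, map_zero, map_zero, map_zero, smul_zero]
  obtain ⟨N, hN⟩ := sum_barProj h x
  rw [← hN N le_rfl]
  exact Finset.sum_eq_zero fun n _ => z n

end BarComponents

section LieCofree

variable {Δ δ : B →ₗ[K] B ⊗[K] B} {F : ℕ → Submodule K B}

lemma dynSeq_eq_zero (hF : IsConilFil Δ δ F) (f : B ⊸ V) (n : ℕ) : ∀ k ≤ n, ∀ x ∈ F k, dynSeq δ f n x = 0 := by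
  induction n with
  | zero =>
    intro k hk x hx
    rw [Nat.le_zero.1 hk, hF.zero, Submodule.mem_bot] at hx
    rw [hx, map_zero]
  | succ n ih =>
    intro k hk x hx
    rw [dynSeq_succ, map_congr_right (f' := 0) hF.zero _ (fun i hi y hy => ?_)
      (hF.cobracket k x hx), TensorProduct.map_zero_right, lzero, map_zero]
    exact ih i (by omega) y hy

lemma exists_dynSeq_eq_zero (hF : IsConilFil Δ δ F) (f : B ⊸ V) (x : B) :
    ∃ N, ∀ n, N ≤ n → dynSeq δ f n x = 0 := by
  obtain ⟨N, hN⟩ := hF.exists_mem x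
  exact ⟨N, fun n hn => dynSeq_eq_zero hF f n N hn x hN⟩

def dynkinTotal (hF : IsConilFil Δ δ F) (f : B ⊸ V) : B ⊸ TV := locSum (dynSeq δ f) (exists_dynSeq_eq_zero hF f)

def dynkinMean (hF : IsConilFil Δ δ F) (f : B ⊸ V) : B ⊸ TV :=
  locSum (fun n => ((n + 1 : ℕ) : K)⁻¹ • dynSeq δ f n) fun x => by
    obtain ⟨N, hN⟩ := exists_dynSeq_eq_zero hF f x
    exact ⟨N, fun n hn => by rw [lsmul, hN n hn, smul_zero]⟩

lemma dynkinTotal_apply (hF : IsConilFil Δ δ F) (f : B ⊸ V) {n m : ℕ} (h : n ≤ m)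
    {x : B} (hx : x ∈ F n) : dynkinTotal hF f x = ∑ k ∈ Finset.range m, dynSeq δ f k x :=
  locSum_apply fun k hk => dynSeq_eq_zero hF f k n (h.trans hk) x hx

lemma dynkinMean_apply (hF : IsConilFil Δ δ F) (f : B ⊸ V) {n : ℕ} {x : B} (hx : x ∈ F n) : dynkinMean hF f x
      = ∑ k ∈ Finset.range n, ((k + 1 : ℕ) : K)⁻¹ • dynSeq δ f k x :=
  locSum_apply fun k hk => by
    rw [lsmul, dynSeq_eq_zero hF f k n hk x hx, smul_zero]

lemma isDynkinSeries_dynkinTotal (hF : IsConilFil Δ δ F) (f : B ⊸ V) :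
    IsDynSeries δ f (dynkinTotal hF f) := fun x => by
  obtain ⟨n, hn⟩ := hF.exists_mem x
  have e : tmap (tι K ∘ₗ f) (dynkinTotal hF f) (δ x)
      = tmap (tι K ∘ₗ f) (∑ k ∈ Finset.range n, dynSeq δ f k) (δ x) :=
    map_congr_right hF.zero _ (fun i hi y hy => by
      rw [dynkinTotal_apply hF f hi.le hy, LinearMap.sum_apply]) (hF.cobracket n x hn)
  have e' : tmap (tι K ∘ₗ f) (∑ k ∈ Finset.range n, dynSeq δ f k)
      = ∑ k ∈ Finset.range n, tmap (tι K ∘ₗ f) (dynSeq δ f k) :=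
    map_sum (TensorProduct.mapBilinear (RingHom.id K) B B _ _ (tι K ∘ₗ f)) _ _
  rw [e, e', LinearMap.sum_apply, map_sum, dynkinTotal_apply hF f (Nat.le_succ n) hn,
    Finset.sum_range_succ', add_comm]
  rfl

lemma tenNum_dynkinMean [CharZero K] (hF : IsConilFil Δ δ F) (f : B ⊸ V)
    (x : B) : tenNum K V (dynkinMean hF f x) = dynkinTotal hF f x := by
  obtain ⟨n, hn⟩ := hF.exists_mem x
  rw [dynkinMean_apply hF f hn, dynkinTotal_apply hF f le_rfl hn, map_sum]
  refine Finset.sum_congr rfl fun k _ => ?_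
  rw [map_smul, tenNum_dynSeq, ← Nat.cast_smul_eq_nsmul K, smul_smul, inv_mul_cancel₀, one_smul]
  exact_mod_cast Nat.succ_ne_zero k

lemma dynkinMean_mem (hF : IsConilFil Δ δ F) (hδ : ∀ i, ∀ x ∈ Ψ i, δ x ∈ tensorGrading Ψ (i - 0)) {f : B ⊸ V}
    (hf : ∀ i, ∀ x ∈ Ψ i, f x ∈ Ξ i) : ∀ i, ∀ x ∈ Ψ i, dynkinMean hF f x ∈ wordGr Ξ i := by
  intro i x hx
  obtain ⟨n, hn⟩ := hF.exists_mem x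
  rw [dynkinMean_apply hF f hn]
  exact Submodule.sum_mem _ fun k _ => Submodule.smul_mem _ _ (dynSeq_mem hδ hf k i x hx)

lemma nsmul_cancel [CharZero K] {n : ℕ} (hn : n ≠ 0) {x y : M} (h : n • x = n • y) : x = y := by
  rw [← Nat.cast_smul_eq_nsmul K, ← Nat.cast_smul_eq_nsmul K] at h
  exact smul_right_injective M (Nat.cast_ne_zero.2 hn : (n : K) ≠ 0) h

variable (h : IsInt Ξ) {hB : IsInt Ψ} {f : B →ₗ[K] V}

lemma dynOp_dynkinTotal (HB : IsLieCoalg 0 Ψ hB δ) (hF : IsConilFil Δ δ F)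
    (hf : ∀ i, ∀ x ∈ Ψ i, f x ∈ Ξ i) (n : ℕ) (x : B) :
    dynOp h n (dynkinTotal hF f x) = (n + 1) • dynSeq δ f n x := by
  have H := isDynkinSeries_dynkinTotal hF f
  have e0 : tenCounit K V ∘ₗ dynkinTotal hF f = 0 := lext fun x => by
    rw [lcomp, H x, map_add]
    have : ∀ z : B ⊗[K] B, tenCounit K V (lmul' K _ (tmap (tι K ∘ₗ f) (dynkinTotal hF f) z)) = 0 := fun z => by
      induction z with
      | zero => simp
      | tmul a b => simp
      | add a b ha hb => rw [map_add, map_add, map_add, ha, hb, add_zero]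
    rw [this, ← mul_one (tι K (f x)), tenCounit_mul, add_zero, lzero]
  have e1 := congrArg (tmap lid (tenCounit K V)) (H.dynOp_dec h HB hf n x)
  have e2 : tmap lid (tenCounit K V) ∘ₗ tmap (dynOp h n) lid = tmap (dynOp h n) lid ∘ₗ
      tmap lid (tenCounit K V) := text' fun _ _ => rfl
  have e3 := lcongr e2 (dec K V (dynkinTotal hF f x))
  rw [lcomp, lcomp, (tenCounit_dec h _).2] at e3
  rw [e3, map_add, tmap_map, e0, TensorProduct.map_zero_right, lzero,
    zero_add, map_nsmul, map_tmul, map_tmul, tenCounit_one] at e1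
  have e4 := congrArg (trid K TV) e1
  rw [map_nsmul] at e4
  simpa using e4

lemma dynOp_dynkinMean [CharZero K] (HB : IsLieCoalg 0 Ψ hB δ)
    (hF : IsConilFil Δ δ F) (hf : ∀ i, ∀ x ∈ Ψ i, f x ∈ Ξ i) (n : ℕ) :
    dynOp h n ∘ₗ dynkinMean hF f = dynSeq δ f n := lext fun x => by
  have := dynOp_dynkinTotal h HB hF hf n x
  rw [← tenNum_dynkinMean, dynOp_tenNum] at this
  exact nsmul_cancel (K := K) (Nat.succ_ne_zero n) this

lemma dynOp_dec_dynkinMean [CharZero K] (HB : IsLieCoalg 0 Ψ hB δ)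
    (hF : IsConilFil Δ δ F) (hf : ∀ i, ∀ x ∈ Ψ i, f x ∈ Ξ i) (i j : ℕ) (x : B) :
    (i + j + 2) • tmap (dynOp h i) (dynOp h j) (dec K V (dynkinMean hF f x))
      = (j + 1) • tmap (dynSeq δ f i) (dynSeq δ f j) (δ x) := by
  have e1 := congrArg (tmap lid (dynOp h j)) ((isDynkinSeries_dynkinTotal hF f).dynOp_dec h HB hf i x)
  have e2 : dynOp h j ∘ₗ dynkinTotal hF f = (j + 1) • dynSeq δ f j :=
    lext fun x => dynOp_dynkinTotal h HB hF hf j x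
  have e3 : ∀ i, dynOp h i ∘ₗ tenNum K V = (i + 1) • dynOp h i := fun i =>
    lext fun x => dynOp_tenNum h i x
  rw [map_add, tmap_map, tmap_map, map_nsmul, map_tmul, dynOp_one, tmul_zero, smul_zero, add_zero, e2, lid_comp,
    lid_comp, lcomp_id, ← tenNum_dynkinMean, dec_tenNum h, map_add,
    tmap_map, tmap_map, e3, e3, lcomp_id, lcomp_id,
    ← Nat.cast_smul_eq_nsmul K, ← Nat.cast_smul_eq_nsmul K, ← Nat.cast_smul_eq_nsmul K (j + 1),
    tmap_smul_left, tmap_smul_right, tmap_smul_right,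
    lsmul, lsmul, lsmul, ← add_smul] at e1
  rw [← Nat.cast_smul_eq_nsmul K, ← Nat.cast_smul_eq_nsmul K, ← e1]
  congr 1
  push_cast
  ring

lemma dynOp_tenCob_dynkinMean [CharZero K] (HB : IsLieCoalg 0 Ψ hB δ)
    (hF : IsConilFil Δ δ F) (hf : ∀ i, ∀ x ∈ Ψ i, f x ∈ Ξ i) (i j : ℕ) (x : B) :
    tmap (dynOp h i) (dynOp h j) (tenCob h (dynkinMean hF f x)) = tmap (dynSeq δ f i) (dynSeq δ f j) (δ x) := by
  have n1 := lcongr (flip_natural (word_int h) (word_int h)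
    (dynOp_mem h j) (dynOp_mem h i)) (dec K V (dynkinMean hF f x))
  have n2 := lcongr (flip_natural hB (word_int h) (dynSeq_mem HB.mem hf j) (dynSeq_mem HB.mem hf i)) (δ x)
  rw [lcomp, lcomp] at n1 n2
  rw [HB.antisymm, sg_zero, neg_smul, one_smul, map_neg] at n2
  refine nsmul_cancel (K := K) (n := i + j + 2) (by omega) ?_
  rw [tenCob_apply, map_sub, ← n1, smul_sub, dynOp_dec_dynkinMean h HB hF hf i j x,
    ← map_nsmul (koszulFlip _ _), add_comm i j, dynOp_dec_dynkinMean h HB hF hf j i x, map_nsmul, n2, smul_neg,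
    sub_neg_eq_add, ← add_smul]
  congr 1
  omega

/-- The morphism of Lie coalgebras that lifts a linear map to the letters. -/
def lieLift (Ξ : ℤ → Submodule K V) (hF : IsConilFil Δ δ F)
    (f : B ⊸ V) : B ⊸ Bar Ξ := barMk Ξ ∘ₗ dynkinMean hF f

lemma lieLift_mem (hF : IsConilFil Δ δ F) (hδ : ∀ i, ∀ x ∈ Ψ i, δ x ∈ tensorGrading Ψ (i - 0))
    (hf : ∀ i, ∀ x ∈ Ψ i, f x ∈ Ξ i) : ∀ i, ∀ x ∈ Ψ i, lieLift Ξ hF f x ∈ Bar.grading Ξ i :=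
  fun i x hx => barMk_mem (dynkinMean_mem hF hδ hf i x hx)

lemma barPr_lieLift [CharZero K] (h : IsInt Ξ) (HB : IsLieCoalg 0 Ψ hB δ)
    (hF : IsConilFil Δ δ F) (hf : ∀ i, ∀ x ∈ Ψ i, f x ∈ Ξ i) (x : B) :
    barPr Ξ (lieLift Ξ hF f x) = f x := by
  have := lcongr (dynOp_dynkinMean h HB hF hf 0) x
  exact TensorAlgebra.ι_leftInverse.injective this

lemma barCob_lieLift [CharZero K] (HB : IsLieCoalg 0 Ψ hB δ)
    (hF : IsConilFil Δ δ F) (hf : ∀ i, ∀ x ∈ Ψ i, f x ∈ Ξ i) (x : B) :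
    barCob h (lieLift Ξ hF f x) = tmap (lieLift Ξ hF f) (lieLift Ξ hF f) (δ x) := by
  rw [← sub_eq_zero]
  refine eq_zero_of_components (sum_barProj h) fun i j => ?_
  have e : ∀ n, (barMk Ξ ∘ₗ barDynkin h n) ∘ₗ lieLift Ξ hF f = barMk Ξ ∘ₗ dynSeq δ f n := fun n => by
    rw [← dynOp_dynkinMean h HB hF hf n, ← barDynkin_comp]; rfl
  have e' : ∀ n, (barMk Ξ ∘ₗ barDynkin h n) ∘ₗ barMk Ξ = barMk Ξ ∘ₗ dynOp h n := fun n => by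
    rw [← barDynkin_comp]; rfl
  rw [barProj, barProj, tmap_smul_left, tmap_smul_right, lsmul, lsmul, map_sub, tmap_map, e, e,
    show lieLift Ξ hF f x = barMk Ξ (dynkinMean hF f x) from rfl, barCob_barMk,
    tmap_map, e', e', tmap_comp, tmap_comp,
    lcomp, lcomp, dynOp_tenCob_dynkinMean h HB hF hf,
    sub_self, smul_zero, smul_zero]

end LieCofree

/-! ### Suspension of Lie coalgebras -/

section Suspension

variable {p : ℤ} {δ : C →ₗ[K] C ⊗[K] C}

lemma mem_shift {i q : ℤ} {x : C} (hx : x ∈ Θ i) : x ∈ shift Θ q (i - q) := by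
  rw [shift, sub_add_cancel]; exact hx

/-- The cobracket of the shifted Lie coalgebra. -/
def suspend (h : IsInt Θ) (q : ℤ) (δ : C ⊸ C ⊗[K] C) : C ⊸ C ⊗[K] C :=
  tmap (parity (shift Θ q) (shift_int h q) q) lid ∘ₗ δ

lemma suspend_apply (h : IsInt Θ) (q : ℤ) (δ : C ⊸ C ⊗[K] C) (x : C) :
    suspend h q δ x = tmap (parity (shift Θ q) (shift_int h q) q) lid (δ x) := rfl

lemma koszulFlip_suspend (h : IsInt Θ) (q : ℤ) (z : C ⊗[K] C) : koszulFlip _ (shift_int h q) (tmap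
        (parity (shift Θ q) (shift_int h q) q) lid z)
      = sg K q • tmap (parity (shift Θ q) (shift_int h q) q) lid (koszulFlip Θ h z) := by
  suffices koszulFlip _ (shift_int h q) ∘ₗ tmap (parity (shift Θ q) (shift_int h q) q) lid
    = sg K q • tmap (parity (shift Θ q) (shift_int h q) q) lid ∘ₗ koszulFlip Θ h from lcongr this z
  refine hom_ext₂ h h fun i x hx j y hy => ?_
  have hx' := mem_shift (q := q) hx
  have hy' := mem_shift (q := q) hy
  simp only [lcomp, lsmul, map_tmul, kflip_apply _ _ hx hy, par_apply _ _ q hx', map_smul, ← smul_tmul',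
    kflip_apply _ _ hx' hy', par_apply _ _ q hy', lid_apply, smul_smul, sg_mul']
  congr 1; apply sg_congr; simp only [parity_simps]; tauto

lemma onLeft_suspend (h : IsInt Θ) (q : ℤ) (hδ : ∀ i, ∀ x ∈ Θ i, δ x ∈ tensorGrading Θ (i - p)) (z : C ⊗[K] C) :
    onLeft (suspend h q δ) (tmap (parity (shift Θ q) (shift_int h q) q)
        lid z) = sg K (q * (p + q)) • tmap (tmap lid
      (parity (shift Θ q) (shift_int h q) q)) lid (onLeft δ z) := by
  suffices onLeft (suspend h q δ) ∘ₗ tmap (parity (shift Θ q) (shift_int h q) q) lid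
    = sg K (q * (p + q)) • tmap (tmap lid (parity (shift Θ q) (shift_int h q) q)) lid ∘ₗ onLeft δ from
    lcongr this z
  refine hom_ext₂ h h fun i x hx j y _ => ?_
  simp only [lcomp, lsmul, map_tmul, onLeft, par_apply _ _ q (mem_shift (q := q) hx), map_smul, ← smul_tmul',
    lid_apply, suspend_apply]
  rw [smul_tmul', smul_tmul']
  congr 1
  refine tgr_ind (P := fun z => sg K (q * (i - q)) • tmap
    (parity (shift Θ q) (shift_int h q) q) lid z = sg K (q * (p + q)) •
      tmap lid (parity (shift Θ q) (shift_int h q) q) z)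
    (fun a b e u hu v hv => ?_) (fun u v hu hv => ?_) (hδ i x hx)
  · simp only [map_tmul, lid_apply,
      par_apply _ _ q (mem_shift (q := q) hu), par_apply _ _ q (mem_shift (q := q) hv),
      tmul_smul, ← smul_tmul', smul_smul, sg_mul']
    obtain rfl : i = a + b + p := by omega
    congr 1; apply sg_congr; simp only [parity_simps]; tauto
  · simp only [map_add, smul_add, hu, hv]

lemma rot_suspend (h : IsInt Θ) (q : ℤ) (z : (C ⊗[K] C) ⊗[K] C) :
    flip12 _ (shift_int h q) (flip23 _ (shift_int h q) (tmap (tmap lid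
          (parity (shift Θ q) (shift_int h q) q)) lid z))
      = tmap (tmap lid (parity (shift Θ q) (shift_int h q) q)) lid (flip12 Θ h (flip23 Θ h z)) := by
  suffices flip12 _ (shift_int h q) ∘ₗ flip23 _ (shift_int h q) ∘ₗ tmap (tmap lid
        (parity (shift Θ q) (shift_int h q) q)) lid
      = tmap (tmap lid (parity (shift Θ q) (shift_int h q) q)) lid ∘ₗ flip12 Θ h ∘ₗ flip23 Θ h from
    lcongr this z
  refine hom_ext₃ h h h fun i x hx j y hy k z hz => ?_
  have hx' := mem_shift (q := q) hx
  have hy' := mem_shift (q := q) hy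
  have hz' := mem_shift (q := q) hz
  rw [lcomp, lcomp, lcomp, lcomp, map_tmul, map_tmul, par_apply _ _ q hy', tmul_smul,
    lid_apply, lid_apply, ← smul_tmul', map_smul, map_smul,
    flip23_tmul _ _ hy' hz', map_smul, flip12_tmul _ hx' hz', flip23_tmul h _ hy hz, map_smul,
    flip12_tmul h hx hz, map_smul, map_smul, map_tmul, map_tmul,
    par_apply _ _ q hx', tmul_smul, lid_apply, lid_apply,
    ← smul_tmul', smul_smul, smul_smul, smul_smul, smul_smul, sg_mul', sg_mul',
    sg_mul', sg_mul']
  congr 1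
  exact sg_congr ⟨q * q - q * k - q * i, by ring⟩

lemma IsLieCoalg.suspend {h : IsInt Θ} (H : IsLieCoalg p Θ h δ) (q : ℤ) :
    IsLieCoalg (p + q) (shift Θ q) (shift_int h q) (suspend h q δ) where
  mem i x hx := by
    have hp : ∀ i, ∀ x ∈ Θ i, parity (shift Θ q) (shift_int h q) q x ∈ shift Θ q (i + -q) :=
      fun i x hx => parity_mem (shift_int h q) q (mem_shift hx)
    exact map_mem_tgr (k := -q) (l := -q) hp (fun i x hx => mem_shift hx) (by ring) (H.mem _ x hx)
  antisymm x := by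
    rw [suspend_apply, koszulFlip_suspend h q, H.antisymm, map_smul, smul_smul, sg_add]
    congr 1; ring
  jacobi x := by
    have c2 : ∀ z, flip23 _ (shift_int h q) (flip12 _ (shift_int h q) (tmap (tmap lid
          (parity (shift Θ q) (shift_int h q) q)) lid z))
        = tmap (tmap lid (parity (shift Θ q) (shift_int h q) q)) lid (flip23 Θ h (flip12 Θ h z)) := by
      intro z
      have := rot_suspend h q (flip23 Θ h (flip12 Θ h z))
      rw [flip23_flip23 h, flip12_flip12 h] at this
      rw [← this, flip12_flip12, flip23_flip23]
    rw [suspend_apply, onLeft_suspend h q H.mem, map_smul, map_smul, map_smul, map_smul,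
      rot_suspend h q, c2, ← smul_add, ← smul_add, ← map_add, ← map_add, H.jacobi, map_zero,
      smul_zero]

lemma IsLieCoalg.smul {h : IsInt Θ} (H : IsLieCoalg p Θ h δ) (c : K) : IsLieCoalg p Θ h (c • δ) where
  mem i x hx := Submodule.smul_mem _ _ (H.mem i x hx)
  antisymm x := by
    rw [lsmul, map_smul, H.antisymm, smul_comm]
  jacobi x := by
    have e : onLeft (c • δ) = c • onLeft δ := tmap_smul_left _ _ _
    rw [lsmul, e, lsmul]
    simp only [map_smul]
    rw [← smul_add, ← smul_add, ← smul_add, ← smul_add, H.jacobi, smul_zero, smul_zero]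

lemma suspend_injective (h : IsInt Θ) (q : ℤ) {x : C} (hx : suspend h q δ x = 0) : δ x = 0 := by
  have e := congrArg (tmap (parity (shift Θ q) (shift_int h q) q) lid) hx
  have i : parity (shift Θ q) (shift_int h q) q ∘ₗ parity (shift Θ q) (shift_int h q) q
      = lid := lext (parity_parity _ _ q)
  rwa [suspend_apply, tmap_map, i, lid_comp, tmap_id, map_zero] at e

/-- A filtration that witnesses conilpotence can be chosen stable under the parities. -/
lemma IsConilFil.parity_stable {h : IsInt Θ} {Δ : C ⊸ C ⊗[K] C} (hΔ : ∀ i, ∀ x ∈ Θ i, Δ x ∈ tensorGrading Θ i)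
    (hδ : ∀ i, ∀ x ∈ Θ i, δ x ∈ tensorGrading Θ (i - p)) {F : ℕ → Submodule K C}
    (hF : IsConilFil Δ δ F) :
    ∃ G, IsConilFil Δ δ G ∧ ∀ k n, ∀ x ∈ G n, parity Θ h k x ∈ G n := by
  set P := parity Θ h 1 with hP
  have hle : ∀ n, F n ≤ F n ⊔ (F n).map P := fun n => le_sup_left
  have cop : ∀ (p : ℤ) (f : C ⊸ C ⊗[K] C), (∀ i, ∀ x ∈ Θ i, f x ∈ tensorGrading Θ (i - p)) →
      (∀ n, ∀ x ∈ F n, f x ∈ tenFil F n) →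
      ∀ n, ∀ x ∈ F n ⊔ (F n).map P, f x ∈ tenFil (fun n => F n ⊔ (F n).map P) n := by
    intro p f hf hfF n x hx
    refine (sup_le (fun y hy => ?_) ?_ : F n ⊔ (F n).map P ≤ (tenFil (fun n => F n ⊔ (F n).map P) n).comap f) hx
    · exact (tenFil_le fun i j e a ha b hb =>
        tmul_mem_tenFil e (hle i ha) (hle j hb)) (hfF n y hy)
    · rintro _ ⟨y, hy, rfl⟩
      rw [Submodule.mem_comap]
      have key : f (P y) = sg K p • tmap P P (f y) := by
        rw [hP, parity_cooperation h hf, smul_smul, one_mul, sg_mul_self, one_smul]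
      rw [key]
      refine Submodule.smul_mem _ _ ?_
      refine (tenFil_le (P := (tenFil (fun n => F n ⊔ (F n).map P) n).comap
        (tmap P P)) fun i j e a ha b hb => ?_) (hfF n y hy)
      exact tmul_mem_tenFil e (le_sup_right (a := F i) ⟨a, ha, rfl⟩) (le_sup_right (a := F j) ⟨b, hb, rfl⟩)
  refine ⟨fun n => F n ⊔ (F n).map P, ⟨fun m n e => sup_le_sup (hF.mono e)
    (Submodule.map_mono (hF.mono e)), ?_, ?_, cop 0 Δ (fun i x hx => by
      rw [sub_zero]; exact hΔ i x hx) hF.coproduct, cop p δ hδ hF.cobracket⟩, ?_⟩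
  · simp only [hF.zero, Submodule.map_bot, sup_bot_eq]
  · rw [eq_top_iff, ← hF.sup]; exact iSup_mono hle
  · intro k n x hx
    rcases Int.even_or_odd k with hk | hk
    · rw [parity_congr Θ h (l := 0) (by simpa using hk), parity_zero]; exact hx
    · rw [parity_congr Θ h (l := 1) (hk.sub_odd odd_one), ← hP]
      refine (sup_le (fun y hy => ?_) ?_ : F n ⊔ (F n).map P ≤ (F n ⊔ (F n).map P).comap P) hx
      · exact le_sup_right (a := F n) ⟨y, hy, rfl⟩
      · rintro _ ⟨y, hy, rfl⟩
        rw [Submodule.mem_comap, hP, parity_parity]; exact hle n hy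

end Suspension

/-! ### Cofreeness -/

lemma exists_plusLift {K : Type u} [Field K] [CharZero K] {W : Type v} [AddCommGroup W]
    [Module K W] {Γ : ℤ → Submodule K W} (h : IsInt Γ) {p : ℤ}
    {δ₀ : W →ₗ[K] W ⊗[K] W} (H : IsLieCoalg p Γ h δ₀) {B : Type w} [AddCommGroup B]
    [Module K B] {Ψ : ℤ → Submodule K B} {Δ δ : B →ₗ[K] B ⊗[K] B} (HB : IsGradedBicoalgebra p Ψ Δ δ)
    {F : ℕ → Submodule K B} (hF : IsConilFil Δ δ F) {φ : B →ₗ[K] W}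
    (hφ : ∀ i, ∀ x ∈ Ψ i, φ x ∈ Γ i) (hδ : ∀ x, δ₀ (φ x) = tmap φ φ (δ x)) :
    ∃ G : B →ₗ[K] SymPlus Γ, (∀ i, ∀ x ∈ Ψ i, G x ∈ SymPlus.grading Γ i) ∧
      (∀ x, plusΔ h (G x) = tmap G G (Δ x)) ∧
      (∀ x, plusδ h δ₀ (G x) = tmap G G (δ x)) ∧ ∀ x, plusPr Γ (G x) = φ x := by
  have hm := plusLift_mem hF HB.coproduct_mem hφ
  have hΔ := plusΔ_plusLift h HB hφ hF
  have hp := plusPr_plusLift (Γ := Γ) (φ := φ) hF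
  generalize plusLift Γ φ hF = G at hm hΔ hp
  have e : plusPr Γ ∘ₗ G = φ := lext hp
  have hφ' : ∀ x, δ₀ (plusPr Γ (G x)) = tmap (plusPr Γ ∘ₗ G) (plusPr Γ ∘ₗ G) (δ x) := fun x => by rw [hp, e, hδ]
  have hG := plusδ_of_plusΔ h H HB hF hm hΔ hφ'
  exact ⟨G, hm, hΔ, hG, hp⟩

section Cofree

lemma env_int (h : IsInt Ξ) (p : ℤ) : IsInt (shift (Bar.grading Ξ) p) := shift_int (bar_int h) p

/-- The Lie cobracket on the shifted space of tensors modulo shuffles. -/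
abbrev envδ (h : IsInt Ξ) (p : ℤ) : Bar Ξ ⊸ Bar Ξ ⊗[K] Bar Ξ := suspend (bar_int h) p (barCob h)

lemma envδ_isLieCoalg (h : IsInt Ξ) (p : ℤ) :
    IsLieCoalg p (shift (Bar.grading Ξ) p) (env_int h p) (envδ h p) := by
  have := (bar_isLieCoalg h).suspend p
  rwa [zero_add] at this

abbrev envCop (h : IsInt Ξ) (p : ℤ) : Env Ξ p ⊸ Env Ξ p ⊗[K] Env Ξ p := plusΔ (env_int h p)

abbrev envCob (h : IsInt Ξ) (p : ℤ) : Env Ξ p ⊸ Env Ξ p ⊗[K] Env Ξ p := plusδ (env_int h p) (envδ h p)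

lemma env_isGradedBicoalgebra (h : IsInt Ξ) (p : ℤ) :
    IsGradedBicoalgebra p (SymPlus.grading (shift (Bar.grading Ξ) p)) (envCop h p) (envCob h p) := by
  apply plus_isGradedBicoalgebra (env_int h p) (envδ_isLieCoalg h p)

variable (Ξ) in
/-- The projection of the envelope to the letters. -/
def envPr (p : ℤ) : Env Ξ p ⊸ V := barPr Ξ ∘ₗ plusPr (shift (Bar.grading Ξ) p)

lemma envPr_mem {p i : ℤ} {x : Env Ξ p} (hx : x ∈ Env.grading Ξ p i) : envPr Ξ p x ∈ shift Ξ p i := by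
  have : plusPr (shift (Bar.grading Ξ) p) x ∈ Bar.grading Ξ (i + p) := plusPr_mem hx
  exact barPr_mem this

variable {Δ δ : B →ₗ[K] B ⊗[K] B} {p : ℤ}

lemma env_lift_unique [CharZero K] (h : IsInt Ξ) (hB : IsConilpotent Δ δ) {f g : B ⊸ Env Ξ p}
    (hf : ∀ x, envCop h p (f x) = tmap f f (Δ x))
    (hg : ∀ x, envCop h p (g x) = tmap g g (Δ x))
    (hf' : ∀ x, envCob h p (f x) = tmap f f (δ x))
    (hg' : ∀ x, envCob h p (g x) = tmap g g (δ x))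
    (e : ∀ x, envPr Ξ p (f x) = envPr Ξ p (g x)) : f = g := by
  obtain ⟨F, hF⟩ := isConilpotent_iff.1 hB
  refine eq_of_plusPr_eq _ hF hf hg (lcongr (hF.ext
    (f := plusPr _ ∘ₗ f) (f' := plusPr _ ∘ₗ g) fun n ih x hx => ?_))
  have key : ∀ f : B ⊸ Env Ξ p, (∀ x, envCob h p (f x) = tmap f f (δ x)) →
      envδ h p (plusPr _ (f x)) = tmap (plusPr _ ∘ₗ f) (plusPr _ ∘ₗ f) (δ x) := by
    intro f hf
    rw [← plusPr_plusδ (env_int h p) (envδ_isLieCoalg h p).mem, hf, tmap_map]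
  rw [lcomp, lcomp, ← sub_eq_zero]
  refine bar_eq_zero h (suspend_injective (bar_int h) p ?_) ?_
  · rw [map_sub, sub_eq_zero]
    exact (key f hf').trans ((map_congr_both (f := plusPr _ ∘ₗ f) (f' := plusPr _ ∘ₗ g)
      (g := plusPr _ ∘ₗ f) (g' := plusPr _ ∘ₗ g) hF.zero ih ih
      (hF.cobracket n x hx)).trans (key g hg').symm)
  · rw [map_sub, sub_eq_zero]; exact e x

lemma env_lift [CharZero K] (h : IsInt Ξ) (HB : IsGradedBicoalgebra p Ψ Δ δ)
    (hB : IsConilpotent Δ δ) {f : B ⊸ V} (hf : ∀ i, ∀ x ∈ Ψ i, f x ∈ shift Ξ p i) :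
    ∃ F : B ⊸ Env Ξ p, (∀ i, ∀ x ∈ Ψ i, F x ∈ Env.grading Ξ p i) ∧ (∀ x, envCop h p (F x) = tmap F F (Δ x)) ∧
      (∀ x, envCob h p (F x) = tmap F F (δ x)) ∧
      ∀ x, envPr Ξ p (F x) = f x := by
  obtain ⟨F₀, hF₀⟩ := isConilpotent_iff.1 hB
  obtain ⟨F, hF, hFP⟩ := hF₀.parity_stable (h := HB.internal) HB.coproduct_mem HB.cobracket_mem
  set h' := shift_int HB.internal (-p)
  have HL := ((isLieCoalg_of_bicoalgebra HB).suspend (-p)).smul (sg K p)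
  rw [add_neg_cancel] at HL
  have e' : sg K p • suspend HB.internal (-p) δ = tmap (parity Ψ HB.internal p) lid ∘ₗ δ := by
    have : parity (shift Ψ (-p)) h' (-p) = sg K p • parity Ψ HB.internal p := by
      refine hom_ext HB.internal fun i x hx => ?_
      rw [lsmul, par_apply _ _ p hx, smul_smul, sg_mul', par_apply _ _ (-p) (mem_shift (q := -p) hx)]
      congr 1
      refine (sg_congr (n := p * p + p * i) ⟨-(p * p) - p * i, by ring⟩).trans ?_
      exact sg_congr (by simp only [parity_simps]; tauto)
    rw [suspend, this, tmap_smul_left, LinearMap.smul_comp, smul_smul, sg_mul_self, one_smul]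
  rw [e'] at HL
  have hF' : IsConilFil Δ (tmap (parity Ψ HB.internal p) lid ∘ₗ δ) F := by
    refine ⟨hF.mono, hF.zero, hF.sup, hF.coproduct, fun n x hx => ?_⟩
    refine (tenFil_le (P := (tenFil F n).comap (tmap
      (parity Ψ HB.internal p) lid)) fun i j e a ha b hb => ?_) (hF.cobracket n x hx)
    exact tmul_mem_tenFil e (hFP _ _ _ ha) hb
  have hf' : ∀ i, ∀ x ∈ shift Ψ (-p) i, f x ∈ Ξ i := fun i x hx => by
    have := hf _ x hx
    rwa [shift, neg_add_cancel_right] at this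
  obtain ⟨φ, hφ, hφδ, hφπ⟩ : ∃ φ : B ⊸ Bar Ξ, (∀ i, ∀ x ∈ Ψ i, φ x ∈ shift (Bar.grading Ξ) p i) ∧
      (∀ x, barCob h (φ x) = tmap φ φ (tmap (parity Ψ HB.internal p) lid (δ x))) ∧
      ∀ x, barPr Ξ (φ x) = f x :=
    ⟨lieLift Ξ hF' f, fun i x hx => lieLift_mem hF' HL.mem hf' (i + p) x (by
      have := mem_shift (q := -p) hx
      rwa [sub_neg_eq_add] at this), barCob_lieLift h HL hF' hf', barPr_lieLift h HL hF' hf'⟩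
  have hφ' : ∀ x, envδ h p (φ x) = tmap φ φ (δ x) := fun x => by
    have hn : parity (shift (Bar.grading Ξ) p) (env_int h p) p ∘ₗ φ
        = φ ∘ₗ parity Ψ HB.internal p := parity_natural HB.internal (env_int h p) hφ p
    have hid : parity Ψ HB.internal p ∘ₗ parity Ψ HB.internal p = lid := lext (parity_parity _ _ p)
    rw [suspend_apply, hφδ, tmap_map, tmap_map, lid_comp, lcomp_id]
    refine congrArg (fun g => tmap g φ (δ x)) ?_
    refine (congrArg (· ∘ₗ parity Ψ HB.internal p) hn).trans ?_
    rw [LinearMap.comp_assoc, hid, lcomp_id]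
  obtain ⟨G, hm, hΔ, hδ, hG⟩ := exists_plusLift (env_int h p) (envδ_isLieCoalg h p) HB hF hφ hφ'
  exact ⟨G, hm, hΔ, hδ, fun x => (congrArg (barPr Ξ) (hG x)).trans (hφπ x)⟩

end Cofree

/-! ### Monomials in packets, conilpotence -/

section Monomials

variable {p : ℤ}

lemma packet_mem (X : WΞ) : packet X ∈ Bar.grading Ξ (totalDeg X) := Submodule.subset_span ⟨X, rfl, rfl⟩

lemma packet_mem_shift (X : WΞ) :
    packet X ∈ shift (Bar.grading Ξ) p (totalDeg X - p) := mem_shift (packet_mem X)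

@[simp] lemma packet_nil : packet ([] : WΞ) = 0 := barMk_one

lemma barMk_map_dec (X : WΞ) : tmap (barMk Ξ) (barMk Ξ)
    (dec K V (word X)) = cutSum X fun A B => packet A ⊗ₜ packet B := by
  rw [dec_word, map_cutSum]; rfl

lemma barCob_packet (h : IsInt Ξ) (X : WΞ) : barCob h (packet X) = cutSum X fun A B => packet A ⊗ₜ packet B
      - sg K (totalDeg A * totalDeg B) • (packet B ⊗ₜ packet A) := by
  rw [packet_eq, barCob_barMk, barMk_tenCob, barMk_map_dec, map_cutSum, sub_eq_iff_eq_add, ← cutSum_add]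
  exact cutSum_congr fun A B _ => by
    rw [kflip_apply _ _ (packet_mem A) (packet_mem B), sub_add_cancel]

lemma envδ_packet (h : IsInt Ξ) (X : WΞ) :
    envδ h p (packet X) = cutSum X fun A B => sg K (p * (totalDeg A - p)) • (packet A ⊗ₜ packet B)
      - sg K (totalDeg A * totalDeg B + p * (totalDeg B - p)) • (packet B ⊗ₜ packet A) := by
  rw [suspend_apply, barCob_packet, map_cutSum]
  refine cutSum_congr fun A B _ => ?_
  rw [map_sub, map_smul, map_tmul, map_tmul, lid_apply, lid_apply, par_apply _ _ p (packet_mem_shift A),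
    par_apply _ _ p (packet_mem_shift B), ← smul_tmul', ← smul_tmul',
    smul_smul, sg_mul']

variable (p) in
/-- The monomial with given packets in the symmetric algebra. -/
def hatMon (l : List WΞ) : SymHat (shift (Bar.grading Ξ) p) := hatMk _ (tensorWord K (l.map packet))

lemma hatMon_nil : hatMon p ([] : List WΞ) = hatOne _ := rfl

lemma hatMon_cons (X : WΞ) (l : List WΞ) : hatMon p (X :: l) = lam _ (packet X) (hatMon p l) := by
  rw [hatMon, List.map_cons, tensorWord, List.map_cons, List.prod_cons]; rfl

lemma hatMon_mem (l : List WΞ) : hatMon p l ∈ hatGr (shift (Bar.grading Ξ) p) (l.map (degIn p)).sum := by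
  induction l with
  | nil => exact hatOne_mem
  | cons X l ih =>
    rw [hatMon_cons, List.map_cons, List.sum_cons, add_comm]
    exact lam_mem (packet_mem_shift X) ih

lemma hatMon_span (h : IsInt Ξ)
    {N : Submodule K (SymHat (shift (Bar.grading Ξ) p))} (H : ∀ l, hatMon p l ∈ N) : N = ⊤ := by
  set S := Submodule.span K (Set.range (hatMon p : List WΞ → _)) with hS
  have hlam : ∀ w : Bar Ξ, ∀ x ∈ S, lam _ w x ∈ S := by
    intro w x hx
    refine (Submodule.span_le (p := S.comap (lam _ w))).2 ?_ hx
    rintro _ ⟨l, rfl⟩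
    refine bar_induction h (P := fun w => lam _ w (hatMon p l) ∈ S) (fun X => ?_) ?_
      (fun x y hx hy => ?_) (fun c x hx => ?_) w
    · rw [← packet_eq, ← hatMon_cons]; exact Submodule.subset_span ⟨_, rfl⟩
    · rw [map_zero]; exact zero_mem _
    · rw [map_add]; exact add_mem hx hy
    · rw [map_smul]; exact Submodule.smul_mem _ _ hx
  have top : S.mkQ = 0 := hat_ext (env_int h p)
    ((Submodule.Quotient.mk_eq_zero _).2 (Submodule.subset_span ⟨[], rfl⟩)) fun i w _ x hx =>
      (Submodule.Quotient.mk_eq_zero _).2 (hlam w x ((Submodule.Quotient.mk_eq_zero _).1 hx))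
  refine eq_top_iff.2 fun x _ => ?_
  refine (Submodule.span_le.2 (by rintro _ ⟨l, rfl⟩; exact H l) : S ≤ N) ?_
  exact (Submodule.Quotient.mk_eq_zero _).1 (lcongr top x)

lemma hatMon_ext (h : IsInt Ξ)
    {f g : SymHat (shift (Bar.grading Ξ) p) ⊸ M} (H : ∀ l, f (hatMon p l) = g (hatMon p l)) :
    f = g :=
  LinearMap.eqLocus_eq_top.1 (hatMon_span h (N := LinearMap.eqLocus f g) H)

lemma cutSum_mem {ι M : Type*} [AddCommGroup M] [Module K M] {N : Submodule K M} {X : List ι}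
    {f : List ι → List ι → M} (H : ∀ A B, A ++ B = X → f A B ∈ N) : cutSum X f ∈ N := by
  rw [← Submodule.Quotient.mk_eq_zero, ← Submodule.mkQ_apply, map_cutSum, ← cutSum_zero X]
  exact cutSum_congr fun A B e => (Submodule.Quotient.mk_eq_zero _).2 (H A B e)

variable (Ξ p) in
/-- The span of the monomials with at most `n` letters. -/
def letFil (n : ℕ) : Submodule K (SymHat (shift (Bar.grading Ξ) p)) :=
  Submodule.span K {s | ∃ l : List WΞ, (l.map List.length).sum ≤ n ∧ s = hatMon p l}

lemma hatMon_mem_letFil {n : ℕ} {l : List WΞ} (hl : (l.map List.length).sum ≤ n) : hatMon p l ∈ letFil Ξ p n :=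
  Submodule.subset_span ⟨l, hl, rfl⟩

lemma letFil_le {n : ℕ} {N : Submodule K (SymHat (shift (Bar.grading Ξ) p))}
    (H : ∀ l : List WΞ, (l.map List.length).sum ≤ n → hatMon p l ∈ N) :
    letFil Ξ p n ≤ N :=
  Submodule.span_le.2 (by rintro _ ⟨l, hl, rfl⟩; exact H l hl)

lemma letFil_mono : Monotone (letFil Ξ p) := fun _ _ e =>
  letFil_le fun _ hl => hatMon_mem_letFil (hl.trans e)

lemma tenFil_mono {C : Type*} [AddCommGroup C] [Module K C] {F : ℕ → Submodule K C}
    (hF : Monotone F) : Monotone (tenFil F) := fun m n e =>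
  tenFil_le fun i j hij _ hx _ hy =>
    tmul_mem_tenFil (i := i) (j := j + (n - m)) (by omega) hx (hF (by omega) hy)

lemma lam_mem_letFil (X : WΞ) {n : ℕ} {x} (hx : x ∈ letFil Ξ p n) :
    lam _ (packet X) x ∈ letFil Ξ p (X.length + n) := by
  refine letFil_le (N := (letFil Ξ p (X.length + n)).comap (lam _ (packet X))) (fun l hl => ?_) hx
  rw [Submodule.mem_comap, ← hatMon_cons]
  exact hatMon_mem_letFil (by simpa using hl)

lemma parity_mem_letFil (h : IsInt Ξ) (k : ℤ) {n : ℕ} {x} (hx : x ∈ letFil Ξ p n) :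
    parity _ (hat_int (env_int h p)) k x ∈ letFil Ξ p n := by
  refine letFil_le (N := (letFil Ξ p n).comap (parity _ (hat_int (env_int h p)) k)) (fun l hl => ?_) hx
  rw [Submodule.mem_comap, par_apply _ _ k (hatMon_mem l)]
  exact Submodule.smul_mem _ _ (hatMon_mem_letFil hl)

lemma lam1_mem_tenFil (X : WΞ) {n : ℕ} {z} (hz : z ∈ tenFil (letFil Ξ p) n) :
    lam1 _ (packet X) z ∈ tenFil (letFil Ξ p) (X.length + n) := by
  refine tenFil_le (P := (tenFil (letFil Ξ p) (X.length + n)).comap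
    (lam1 _ (packet X))) (fun i j e x hx y hy => ?_) hz
  rw [Submodule.mem_comap, lam1_tmul]
  exact tmul_mem_tenFil (by omega) (lam_mem_letFil X hx) hy

lemma lam2_mem_tenFil (h : IsInt Ξ) (X : WΞ) {n : ℕ} {z} (hz : z ∈ tenFil (letFil Ξ p) n) :
    lam2 (env_int h p) (packet X) z ∈ tenFil (letFil Ξ p) (X.length + n) := by
  refine tenFil_le (P := (tenFil (letFil Ξ p) (X.length + n)).comap
    (lam2 (env_int h p) (packet X))) (fun i j e x hx y hy => ?_) hz
  rw [Submodule.mem_comap, lam2_tmul _ (packet_mem_shift X)]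
  exact tmul_mem_tenFil (i := i) (j := X.length + j) (by omega) (parity_mem_letFil h _ hx) (lam_mem_letFil X hy)

lemma hatΔ_hatMon_mem (h : IsInt Ξ) (l : List WΞ) : hatΔ (env_int h p) (hatMon p l)
      ∈ tenFil (letFil Ξ p) (l.map List.length).sum := by
  induction l with
  | nil =>
    rw [hatMon_nil, hatΔ_one]
    exact tmul_mem_tenFil (i := 0) (j := 0) rfl
      (hatMon_mem_letFil (l := []) le_rfl) (hatMon_mem_letFil (l := []) le_rfl)
  | cons X l ih =>
    rw [hatMon_cons, hatΔ_lam, diag_apply, List.map_cons, List.sum_cons]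
    exact add_mem (lam1_mem_tenFil X ih) (lam2_mem_tenFil h X ih)

lemma hatδ_hatMon_mem (h : IsInt Ξ) (l : List WΞ) : hatδ (env_int h p) (envδ h p) (hatMon p l)
      ∈ tenFil (letFil Ξ p) (l.map List.length).sum := by
  induction l with
  | nil => rw [hatMon_nil, hatδ_one]; exact zero_mem _
  | cons X l ih =>
    rw [hatMon_cons, hatδ_lam _ (envδ_isLieCoalg h p).mem (packet_mem_shift X), diag_apply,
      List.map_cons, List.sum_cons, envδ_packet, map_cutSum]
    refine add_mem ?_ (Submodule.smul_mem _ _ (add_mem (lam1_mem_tenFil X ih) (lam2_mem_tenFil h X ih)))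
    have key : ∀ A B : WΞ, A.length + B.length = X.length →
        mulMap (lam1 _) (lam2 (env_int h p)) (packet A ⊗ₜ packet B)
          (hatΔ (env_int h p) (hatMon p l)) ∈ tenFil (letFil Ξ p)
            (X.length + (l.map List.length).sum) := fun A B e => by
      rw [mulMap_tmul, ← e, add_assoc]
      exact lam1_mem_tenFil A (lam2_mem_tenFil h B (hatΔ_hatMon_mem h l))
    rw [show ∀ f : WΞ → WΞ → Module.End K _, cutSum X f (hatΔ (env_int h p) (hatMon p l)) = cutSum X fun A B =>
        f A B (hatΔ (env_int h p) (hatMon p l)) from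
      fun f => map_cutSum (LinearMap.applyₗ (hatΔ (env_int h p) (hatMon p l))) X f]
    refine cutSum_mem fun A B e => ?_
    rw [map_sub, map_smul, map_smul, lsub, lsmul, lsmul]
    exact sub_mem (Submodule.smul_mem _ _ (key A B (by rw [← e, List.length_append])))
      (Submodule.smul_mem _ _ (key B A (by rw [← e, List.length_append, add_comm])))

lemma isConilpotent_of_surjective {C D : Type*} [AddCommGroup C] [Module K C] [AddCommGroup D]
    [Module K D] {f : C ⊸ D} (hf : Function.Surjective f) {Δ δ : C ⊸ C ⊗[K] C}
    {Δ' δ' : D ⊸ D ⊗[K] D} (hΔ : ∀ x, Δ' (f x) = tmap f f (Δ x))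
    (hδ : ∀ x, δ' (f x) = tmap f f (δ x)) {F : ℕ → Submodule K C} (mono : Monotone F)
    (zero : (F 0).map f = ⊥) (sup : (⨆ n, F n) = ⊤) (hF : ∀ n, ∀ x ∈ F n, Δ x ∈ tenFil F n)
    (hF' : ∀ n, ∀ x ∈ F n, δ x ∈ tenFil F n) : IsConilpotent Δ' δ' := by
  have hM : ∀ {n z}, z ∈ tenFil F n → tmap f f z ∈ tenFil (fun n => (F n).map f) n := fun {n _} hz =>
    tenFil_le (P := (tenFil (fun n => (F n).map f) n).comap (tmap f f))
      (fun i j e x hx y hy => tmul_mem_tenFil e ⟨x, hx, rfl⟩ ⟨y, hy, rfl⟩) hz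
  refine isConilpotent_iff.2 ⟨fun n => (F n).map f, fun m n e => Submodule.map_mono (mono e), zero, ?_, ?_, ?_⟩
  · rw [← Submodule.map_iSup, sup, Submodule.map_top, LinearMap.range_eq_top.2 hf]
  · rintro n _ ⟨x, hx, rfl⟩
    rw [hΔ]; exact hM (hF n x hx)
  · rintro n _ ⟨x, hx, rfl⟩
    rw [hδ]; exact hM (hF' n x hx)

lemma env_isConilpotent (h : IsInt Ξ) (p : ℤ) : IsConilpotent (envCop h p) (envCob h p) := by
  refine isConilpotent_of_surjective (F := letFil Ξ p) toPlus_surj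
    (plusΔ_toPlus (env_int h p)) (plusδ_toPlus (env_int h p) _) letFil_mono ?_ ?_
    (fun n x hx => ?_) (fun n x hx => ?_)
  · rw [eq_bot_iff, Submodule.map_le_iff_le_comap]
    refine letFil_le fun l hl => ?_
    rw [Submodule.mem_comap, Submodule.mem_bot]
    cases l with
    | nil => exact toPlus_one
    | cons X l =>
      have hX : X.length + (l.map List.length).sum ≤ 0 := by simpa using hl
      obtain rfl : X = [] := List.length_eq_zero_iff.1 (by omega)
      rw [hatMon_cons, packet_nil, map_zero, lzero, map_zero]
  · exact hatMon_span h fun l => Submodule.mem_iSup_of_mem _ (hatMon_mem_letFil le_rfl)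
  · refine letFil_le (N := (tenFil (letFil Ξ p) n).comap (hatΔ (env_int h p))) (fun l hl => ?_) hx
    exact tenFil_mono letFil_mono hl (hatΔ_hatMon_mem h l)
  · refine letFil_le (N := (tenFil (letFil Ξ p) n).comap (hatδ (env_int h p) (envδ h p))) (fun l hl => ?_) hx
    exact tenFil_mono letFil_mono hl (hatδ_hatMon_mem h l)

end Monomials

/-! ### Coderivations and dual numbers -/

section Dual

/-- The space `C ⊕ εC`. -/
def Dual (C : Type v) : Type v := C × C

instance : AddCommGroup (Dual C) := inferInstanceAs (AddCommGroup (C × C))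

instance : Module K (Dual C) := inferInstanceAs (Module K (C × C))

variable (K C) in
def dualRe : C ⊸ Dual C := LinearMap.inl K C C

variable (K C) in
def dualIm : C ⊸ Dual C := LinearMap.inr K C C

def dualLift (f g : C ⊸ M) : Dual C ⊸ M := LinearMap.coprod f g

lemma dualLift_apply (f g : C ⊸ M) (x : Dual C) : dualLift f g x = f x.1 + g x.2 := rfl

@[simp] lemma dualLift_re (f g : C ⊸ M) (x : C) : dualLift f g (dualRe K C x) = f x := by
  rw [dualLift_apply]; exact (congrArg (f x + ·) (map_zero g)).trans (add_zero _)

@[simp] lemma dualLift_im (f g : C ⊸ M) (x : C) : dualLift f g (dualIm K C x) = g x := by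
  rw [dualLift_apply]; exact (congrArg (· + g x) (map_zero f)).trans (zero_add _)

lemma dual_eq (x : Dual C) : x = dualRe K C x.1 + dualIm K C x.2 := Prod.ext (add_zero _).symm (zero_add _).symm

def dualSub (F G : Submodule K C) : Submodule K (Dual C) := F.prod G

/-- The grading of `C ⊕ εC`, where `ε` has degree `k`. -/
def dualGrading (Θ : ℤ → Submodule K C) (k i : ℤ) : Submodule K (Dual C) := dualSub (Θ i) (Θ (i - k))

lemma inl_mem (k : ℤ) {i : ℤ} {x : C} (hx : x ∈ Θ i) : dualRe K C x ∈ dualGrading Θ k i := ⟨hx, zero_mem _⟩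

lemma inr_mem (k : ℤ) {i : ℤ} {x : C} (hx : x ∈ Θ i) : dualIm K C x ∈ dualGrading Θ k (i + k) :=
  ⟨zero_mem _, by rw [add_sub_cancel_right]; exact hx⟩

lemma dual_int (h : IsInt Θ) (k : ℤ) : IsInt (dualGrading Θ k) := by
  have hc : ∀ (s : ℤ → C ⊸ ℤ →₀ Dual C) {i : ℤ} {x : C}, x ∈ Θ i →
      (DirectSum.toModule K ℤ _ fun i => s i ∘ₗ (Θ i).subtype) (components Θ h x) = s i x := by
    intro s i x hx
    rw [components_of_mem Θ h hx, DirectSum.toModule_lof]; rfl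
  refine internal_of_coaction ?_ (dualLift ((DirectSum.toModule K ℤ _ fun i =>
      (Finsupp.lsingle i ∘ₗ dualRe K C) ∘ₗ (Θ i).subtype) ∘ₗ (components Θ h).toLinearMap)
    ((DirectSum.toModule K ℤ _ fun i =>
      (Finsupp.lsingle (i + k) ∘ₗ dualIm K C) ∘ₗ (Θ i).subtype) ∘ₗ (components Θ h).toLinearMap)) ?_
  · refine eq_top_iff.2 fun x _ => ?_
    rw [dual_eq (K := K) x]
    refine add_mem (hom_induction h (P := fun y => dualRe K C y ∈ _)
      (fun i y hy => Submodule.mem_iSup_of_mem i (inl_mem k hy)) (fun y z hy hz => ?_) x.1)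
      (hom_induction h (P := fun y => dualIm K C y ∈ _)
      (fun i y hy => Submodule.mem_iSup_of_mem (i + k) (inr_mem k hy)) (fun y z hy hz => ?_) x.2) <;>
    · rw [map_add]; exact add_mem hy hz
  · rintro i x ⟨hx, hy⟩
    rw [dualLift_apply, lcomp, lcomp, LinearEquiv.coe_coe, hc _ hx, hc _ hy, sub_add_cancel, lcomp, lcomp,
      Finsupp.lsingle_apply, Finsupp.lsingle_apply, ← Finsupp.single_add]
    rw [← dual_eq]

lemma dual_ext {f g : Dual C ⊸ M} (h0 : ∀ x, f (dualRe K C x) = g (dualRe K C x))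
    (h1 : ∀ x, f (dualIm K C x) = g (dualIm K C x)) : f = g :=
  lext fun x => by rw [dual_eq (K := K) x, map_add, map_add, h0, h1]

def dual₂ (h : IsInt Θ) (k : ℤ) : C ⊗[K] C ⊸ Dual C ⊗[K] Dual C := tmap (dualIm K C) (dualRe K C)
    + tmap (dualRe K C ∘ₗ parity Θ h k) (dualIm K C)

lemma dual₂_tmul (h : IsInt Θ) (k : ℤ) {i : ℤ} {x : C} (hx : x ∈ Θ i) (y : C) :
    dual₂ h k (x ⊗ₜ y) = dualIm K C x ⊗ₜ dualRe K C y + sg K (k * i) • (dualRe K C x ⊗ₜ dualIm K C y) := by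
  rw [dual₂, ladd, map_tmul, map_tmul, lcomp, par_apply _ _ k hx, map_smul, ← smul_tmul']

def dual₃ (h : IsInt Θ) (k : ℤ) : (C ⊗[K] C) ⊗[K] C ⊸ (Dual C ⊗[K] Dual C) ⊗[K] (Dual C) :=
  tmap (dual₂ h k) (dualRe K C) + tmap (tmap (dualRe K C) (dualRe K C) ∘ₗ
      tmap (parity Θ h k) (parity Θ h k)) (dualIm K C)

lemma dual₃_tmul (h : IsInt Θ) (k : ℤ) {i j : ℤ} {x y : C} (hx : x ∈ Θ i) (hy : y ∈ Θ j) (z : C) :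
    dual₃ h k ((x ⊗ₜ y) ⊗ₜ z) = (dualIm K C x ⊗ₜ dualRe K C y) ⊗ₜ dualRe K C z
      + sg K (k * i) • ((dualRe K C x ⊗ₜ dualIm K C y) ⊗ₜ dualRe K C z)
      + sg K (k * (i + j)) • ((dualRe K C x ⊗ₜ dualRe K C y) ⊗ₜ dualIm K C z) := by
  rw [dual₃, ladd, map_tmul, map_tmul, dual₂_tmul h k hx, lcomp, map_tmul, map_tmul,
    par_apply _ _ k hx, par_apply _ _ k hy, map_smul, map_smul, tmul_smul,
    ← smul_tmul', ← smul_tmul', ← smul_tmul', smul_smul,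
    sg_mul', add_tmul, ← smul_tmul', mul_add, add_comm (k * j)]

/-- The extension of a cooperation of degree `-r` to `C ⊕ εC`. -/
def dualOp (h : IsInt Θ) (k r : ℤ) (f : C ⊸ C ⊗[K] C) : Dual C ⊸ Dual C ⊗[K] Dual C :=
  dualLift (tmap (dualRe K C) (dualRe K C) ∘ₗ f) (sg K (k * r) • dual₂ h k ∘ₗ f)

variable {h : IsInt Θ} {k r : ℤ} {f : C →ₗ[K] C ⊗[K] C}

lemma dualOp_inl (x : C) : dualOp h k r f (dualRe K C x)
    = tmap (dualRe K C) (dualRe K C) (f x) := by simp [dualOp]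

lemma dualOp_inr (x : C) : dualOp h k r f (dualIm K C x) = sg K (k * r) • dual₂ h k (f x) := by simp [dualOp]

lemma flip_dual₂ (z : C ⊗[K] C) : koszulFlip _ (dual_int h k) (dual₂ h k z) = dual₂ h k (koszulFlip Θ h z) := by
  suffices koszulFlip _ (dual_int h k) ∘ₗ dual₂ h k = dual₂ h k ∘ₗ koszulFlip Θ h from lcongr this z
  refine hom_ext₂ h h fun i x hx j y hy => ?_
  rw [lcomp, lcomp, dual₂_tmul h k hx, map_add, map_smul, kflip_apply _ _ (inr_mem k hx) (inl_mem k hy),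
    kflip_apply _ _ (inl_mem k hx) (inr_mem k hy), kflip_apply _ h hx hy, map_smul,
    dual₂_tmul h k hy, smul_add, smul_smul, smul_smul, sg_mul', sg_mul', add_comm]
  congr 2
  · exact sg_congr ⟨k * i, by ring⟩
  · congr 1; ring

lemma onLeft_dual₂ (hf : ∀ i, ∀ x ∈ Θ i, f x ∈ tensorGrading Θ (i - r)) (z : C ⊗[K] C) :
    onLeft (dualOp h k r f) (dual₂ h k z) = sg K (k * r) • dual₃ h k (onLeft f z) := by
  suffices onLeft (dualOp h k r f) ∘ₗ dual₂ h k = sg K (k * r) • dual₃ h k ∘ₗ onLeft f from lcongr this z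
  refine hom_ext₂ h h fun i x hx j y hy => ?_
  have e := parity_cooperation (k := k) h hf x
  rw [lcomp, lsmul, lcomp, dual₂_tmul h k hx, map_add, map_smul, onLeft, onLeft, map_tmul, map_tmul, map_tmul,
    dualOp_inl, dualOp_inr, dual₃, ladd, map_tmul,
    map_tmul, lcomp, e, par_apply _ _ k hx]
  simp only [lid_apply, map_smul, ← smul_tmul', smul_add, smul_smul, ← mul_assoc, sg_mul_self, one_mul]

lemma dual₃_assoc_symm {i : ℤ} {x : C} (hx : x ∈ Θ i) (z : C ⊗[K] C) :
    dual₃ h k ((tassoc K C C C).symm (x ⊗ₜ z)) = (tassoc K _ _ _).symm (dualIm K C x ⊗ₜ tmap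
          (dualRe K C) (dualRe K C) z)
        + sg K (k * i) • (tassoc K _ _ _).symm (dualRe K C x ⊗ₜ dual₂ h k z) := by
  suffices dual₃ h k ∘ₗ (tassoc K C C C).symm.toLinearMap ∘ₗ tmk K C _ x
      = (tassoc K (Dual C) (Dual C) (Dual C)).symm.toLinearMap ∘ₗ (tmk K (Dual C) _ (dualIm K C x) ∘ₗ tmap
          (dualRe K C) (dualRe K C)
        + sg K (k * i) • tmk K (Dual C) _ (dualRe K C x) ∘ₗ dual₂ h k) by
    have := lcongr this z
    simpa only [lcomp, ladd, lsmul, TensorProduct.mk_apply, map_add, map_smul, LinearEquiv.coe_coe] using this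
  refine hom_ext₂ h h fun j y hy l z hz => ?_
  simp only [lcomp, ladd, lsmul,
    TensorProduct.mk_apply, map_add, map_smul, LinearEquiv.coe_coe, TensorProduct.assoc_symm_tmul,
    dual₃_tmul h k hx hy, dual₂_tmul h k hy, map_tmul, smul_add, smul_smul, sg_mul', mul_add, add_assoc]

lemma onRight_dual₂ (z : C ⊗[K] C) : onRight _ (dual_int h k) r (dualOp h k r f) (dual₂ h k z)
      = sg K (k * r) • dual₃ h k (onRight Θ h r f z) := by
  suffices onRight _ (dual_int h k) r (dualOp h k r f) ∘ₗ dual₂ h k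
    = sg K (k * r) • dual₃ h k ∘ₗ onRight Θ h r f from lcongr this z
  refine hom_ext₂ h h fun i x hx j y hy => ?_
  simp only [lcomp, lsmul, dual₂_tmul h k hx, map_add, map_smul,
    onRight, map_tmul, dualOp_inl, dualOp_inr, par_apply _ _ r (inr_mem k hx),
    par_apply _ _ r (inl_mem k hx), par_apply _ _ r hx, LinearEquiv.coe_coe,
    ← smul_tmul', dual₃_assoc_symm hx, smul_add, smul_smul, sg_mul',
    tmul_smul]
  congr 3 <;> ring

lemma flip12_dual₃ (z : (C ⊗[K] C) ⊗[K] C) :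
    flip12 _ (dual_int h k) (dual₃ h k z) = dual₃ h k (flip12 Θ h z) := by
  suffices flip12 _ (dual_int h k) ∘ₗ dual₃ h k = dual₃ h k ∘ₗ flip12 Θ h from lcongr this z
  refine hom_ext₃ h h h fun i x hx j y hy l z hz => ?_
  rw [lcomp, lcomp, dual₃_tmul h k hx hy, map_add, map_add, map_smul,
    map_smul, flip12_tmul _ (inr_mem k hx) (inl_mem k hy),
    flip12_tmul _ (inl_mem k hx) (inr_mem k hy), flip12_tmul _ (inl_mem k hx) (inl_mem k hy),
    flip12_tmul h hx hy, map_smul, dual₃_tmul h k hy hx, smul_add, smul_add, smul_smul, smul_smul,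
    smul_smul, smul_smul, sg_mul', sg_mul', sg_mul', sg_mul']
  rw [add_comm (sg K ((i + k) * j) • _)]
  congr 3
  · exact sg_congr ⟨k * i, by ring⟩
  · congr 1; ring
  · ring_nf

lemma flip23_dual₃ (z : (C ⊗[K] C) ⊗[K] C) :
    flip23 _ (dual_int h k) (dual₃ h k z) = dual₃ h k (flip23 Θ h z) := by
  suffices flip23 _ (dual_int h k) ∘ₗ dual₃ h k = dual₃ h k ∘ₗ flip23 Θ h from lcongr this z
  refine hom_ext₃ h h h fun i x hx j y hy l z hz => ?_
  rw [lcomp, lcomp, dual₃_tmul h k hx hy, map_add, map_add, map_smul,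
    map_smul, flip23_tmul _ _ (inl_mem k hy) (inl_mem k hz),
    flip23_tmul _ _ (inr_mem k hy) (inl_mem k hz), flip23_tmul _ _ (inl_mem k hy) (inr_mem k hz),
    flip23_tmul h _ hy hz, map_smul, dual₃_tmul h k hx hz, smul_add, smul_add, smul_smul, smul_smul,
    smul_smul, smul_smul, sg_mul', sg_mul', sg_mul', sg_mul', add_assoc, add_assoc,
    add_comm (sg K (k * i + (j + k) * l) • _)]
  congr 3
  · exact sg_congr ⟨k * j, by ring⟩
  · congr 1; ring

lemma dual₂_mem {n : ℤ} {z : C ⊗[K] C} (hz : z ∈ tensorGrading Θ n) :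
    dual₂ h k z ∈ tensorGrading (dualGrading Θ k) (n + k) := by
  refine add_mem (map_mem_tgr (k := k) (l := 0) (fun _ _ => inr_mem k)
    (fun i x hx => by rw [add_zero]; exact inl_mem k hx) (by ring) hz)
    (map_mem_tgr (k := 0) (l := k) (fun i x hx => ?_) (fun _ _ => inr_mem k) (by ring) hz)
  rw [add_zero]; exact inl_mem k (parity_mem h k hx)

lemma dualOp_mem (hf : ∀ i, ∀ x ∈ Θ i, f x ∈ tensorGrading Θ (i - r)) (i : ℤ) (x : Dual C)
    (hx : x ∈ dualGrading Θ k i) :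
    dualOp h k r f x ∈ tensorGrading (dualGrading Θ k) (i - r) := by
  refine add_mem (map_tgr_mem (fun _ _ => inl_mem k) (hf i x.1 hx.1)) (Submodule.smul_mem _ _ ?_)
  have := dual₂_mem (h := h) (k := k) (hf _ _ hx.2)
  rwa [show i - k - r + k = i - r by ring] at this

/-- The bicoalgebra of dual numbers, with `ε` of degree `k`. -/
lemma dual_isGradedBicoalgebra {p : ℤ} {Δ δ : C ⊸ C ⊗[K] C} (H : IsGradedBicoalgebra p Θ Δ δ) (k : ℤ) :
    IsGradedBicoalgebra p (dualGrading Θ k) (dualOp H.internal k 0 Δ) (dualOp H.internal k p δ) where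
  internal := dual_int H.internal k
  coproduct_mem i x hx := by
    have := dualOp_mem (h := H.internal) (r := 0) (f := Δ) (fun i x hx => by
      rw [sub_zero]; exact H.coproduct_mem i x hx) i x hx
    rwa [sub_zero] at this
  cobracket_mem := dualOp_mem H.cobracket_mem
  cocommutative := by
    have e := lcongr H.cocommutative
    simp only [lcomp] at e
    refine dual_ext (fun x => ?_) fun x => ?_ <;> rw [lcomp]
    · rw [dualOp_inl, flip_map H.internal _ (fun _ _ => inl_mem k), e]
    · rw [dualOp_inr, map_smul, flip_dual₂, e]
  coassociative := by
    have e := lcongr H.coassociative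
    simp only [lcomp] at e
    have hΔ : ∀ i, ∀ x ∈ Θ i, Δ x ∈ tensorGrading Θ (i - 0) := fun i x hx => by
      rw [sub_zero]; exact H.coproduct_mem i x hx
    refine dual_ext (fun x => ?_) fun x => ?_ <;> rw [lcomp, lcomp]
    · rw [dualOp_inl, onLeft_natural dualOp_inl, onRight_natural H.internal _ (fun _ _ => inl_mem k)
        dualOp_inl, e]
    · rw [dualOp_inr, map_smul, map_smul, onLeft_dual₂ hΔ, onRight_dual₂, e]
  coantisymmetric := by
    have e := lcongr H.coantisymmetric
    simp only [lcomp, lneg, lsmul, nop_smul (K := K)] at e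
    refine dual_ext (fun x => ?_) fun x => ?_ <;> rw [lcomp, lneg, lsmul, nop_smul (K := K)]
    · rw [dualOp_inl, flip_map H.internal _ (fun _ _ => inl_mem k), e, map_neg, map_smul]
    · rw [dualOp_inr, map_smul, flip_dual₂, e, map_neg, map_smul, smul_neg, smul_comm]
  coJacobi := by
    have e := lcongr H.coJacobi
    simp only [lcomp, ladd, lid_apply, lzero] at e
    refine dual_ext (fun x => ?_) fun x => ?_ <;> simp only [lcomp, ladd, lid_apply, lzero]
    · rw [dualOp_inl, onLeft_natural dualOp_inl, flip23_natural H.internal _ (fun _ _ => inl_mem k),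
        flip12_natural H.internal _ (fun _ _ => inl_mem k),
        flip12_natural H.internal _ (fun _ _ => inl_mem k),
        flip23_natural H.internal _ (fun _ _ => inl_mem k), ← map_add, ← map_add, e, map_zero]
    · rw [dualOp_inr, map_smul, onLeft_dual₂ H.cobracket_mem, smul_smul, sg_mul_self, one_smul,
        flip23_dual₃, flip12_dual₃, flip12_dual₃, flip23_dual₃, ← map_add, ← map_add, e, map_zero]
  coLeibniz := by
    have e := lcongr H.coLeibniz
    simp only [lcomp, ladd] at e
    refine dual_ext (fun x => ?_) fun x => ?_ <;> simp only [lcomp, ladd]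
    · rw [dualOp_inl, dualOp_inl, onRight_natural H.internal _ (fun _ _ => inl_mem k) dualOp_inl, e,
        onLeft_natural dualOp_inl, onRight_natural H.internal _ (fun _ _ => inl_mem k) dualOp_inl,
        flip12_natural H.internal _ (fun _ _ => inl_mem k), map_add]
    · rw [dualOp_inr, dualOp_inr, map_smul, map_smul, map_smul, onRight_dual₂,
        onLeft_dual₂ H.cobracket_mem, onRight_dual₂, map_smul, map_smul, flip12_dual₃, e,
        mul_zero, sg_zero, one_smul, one_smul, one_smul, map_add, smul_add]

lemma dual_isConilpotent {p : ℤ} {Δ δ : C ⊸ C ⊗[K] C} (H : IsGradedBicoalgebra p Θ Δ δ)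
    (HC : IsConilpotent Δ δ) (k : ℤ) :
    IsConilpotent (dualOp H.internal k 0 Δ) (dualOp H.internal k p δ) := by
  obtain ⟨F₀, hF₀⟩ := isConilpotent_iff.1 HC
  obtain ⟨F, hF, hP⟩ := hF₀.parity_stable (h := H.internal) H.coproduct_mem H.cobracket_mem
  have key : ∀ (r : ℤ) (f : C ⊸ C ⊗[K] C), (∀ n, ∀ x ∈ F n, f x ∈ tenFil F n) →
      ∀ n, ∀ x ∈ dualSub (F n) (F n), dualOp H.internal k r f x ∈ tenFil (fun n => dualSub (F n) (F n)) n := by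
    rintro r f hf n x ⟨h1, h2⟩
    refine add_mem (tenFil_le (P := (tenFil (fun n => dualSub (F n) (F n)) n).comap
      (tmap (dualRe K C) (dualRe K C)))
      (fun i j e x hx y hy => tmul_mem_tenFil e ⟨hx, zero_mem _⟩ ⟨hy, zero_mem _⟩)
      (hf n _ h1)) (Submodule.smul_mem _ _ (tenFil_le
      (P := (tenFil (fun n => dualSub (F n) (F n)) n).comap (dual₂ H.internal k))
      (fun i j e x hx y hy => ?_) (hf n _ h2)))
    rw [Submodule.mem_comap, dual₂, ladd]
    refine add_mem ?_ ?_
    · exact tmul_mem_tenFil e ⟨zero_mem _, hx⟩ ⟨hy, zero_mem _⟩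
    · exact tmul_mem_tenFil e ⟨hP k _ _ hx, zero_mem _⟩ ⟨zero_mem _, hy⟩
  refine isConilpotent_iff.2 ⟨fun n => dualSub (F n) (F n), fun m n e =>
    Submodule.prod_mono (hF.mono e) (hF.mono e), ?_, ?_, key 0 Δ hF.coproduct, key p δ hF.cobracket⟩
  · rw [eq_bot_iff]
    rintro x ⟨h1, h2⟩
    rw [hF.zero] at h1 h2
    rw [dual_eq (K := K) x, (Submodule.mem_bot K).1 h1, (Submodule.mem_bot K).1 h2, map_zero, map_zero,
      add_zero]
    exact zero_mem _
  · refine eq_top_iff.2 fun x _ => ?_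
    obtain ⟨m, hm⟩ := hF.exists_mem x.1
    obtain ⟨n, hn⟩ := hF.exists_mem x.2
    exact Submodule.mem_iSup_of_mem (max m n) ⟨hF.mono (le_max_left m n) hm, hF.mono (le_max_right m n) hn⟩

end Dual

/-! ### Coderivations -/

section Coderivation

/-- `Q ⊗ id + id ⊗ Q`, for `Q : C → C` of degree `k`. -/
def coder (h : IsInt Θ) (k : ℤ) (Q : C ⊸ C) : C ⊗[K] C ⊸ C ⊗[K] C := tmap Q lid + tmap (parity Θ h k) Q

/-- Coderivations of degree `k` of a bicoalgebra. -/
structure IsCoder (h : IsInt Θ) (p : ℤ) (Δ δ : C ⊸ C ⊗[K] C) (k : ℤ)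
    (Q : C ⊸ C) : Prop where
  mem : ∀ i, ∀ x ∈ Θ i, Q x ∈ Θ (i + k)
  coproduct : ∀ x, Δ (Q x) = coder h k Q (Δ x)
  cobracket : ∀ x, δ (Q x) = sg K (k * p) • coder h k Q (δ x)

variable {h : IsInt Θ} {p : ℤ} {Δ δ : C →ₗ[K] C ⊗[K] C}

lemma map_dualLift {D : Type w} [AddCommGroup D] [Module K D] (f g : C ⊸ D) (k : ℤ)
    (z : C ⊗[K] C) : tmap (dualLift f g) (dualLift f g) (dual₂ h k z)
      = tmap g f z + tmap (f ∘ₗ parity Θ h k) g z := by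
  have e0 : dualLift f g ∘ₗ dualRe K C = f := lext (dualLift_re f g)
  have e1 : dualLift f g ∘ₗ dualIm K C = g := lext (dualLift_im f g)
  rw [dual₂, ladd, map_add, tmap_map, tmap_map, e0, e1, ← LinearMap.comp_assoc, e0]

lemma dualLift_id_op {k r : ℤ} {f : C ⊸ C ⊗[K] C} {Q : C ⊸ C}
    (H : ∀ x, f (Q x) = sg K (k * r) • coder h k Q (f x)) (x : Dual C) :
    f (dualLift lid Q x) = tmap (dualLift lid Q) (dualLift lid Q) (dualOp h k r f x) := by
  suffices f ∘ₗ dualLift lid Q = tmap (dualLift lid Q) (dualLift lid Q) ∘ₗ dualOp h k r f from lcongr this x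
  have e0 : dualLift lid Q ∘ₗ dualRe K _ = lid := lext (dualLift_re _ Q)
  refine dual_ext (fun x => ?_) fun x => ?_ <;> rw [lcomp, lcomp]
  · rw [dualLift_re, dualOp_inl, tmap_map, e0, tmap_id]; rfl
  · rw [dualLift_im, dualOp_inr, map_smul, map_dualLift, H]; rfl

lemma IsCoder.dualLift_coproduct {k : ℤ} {Q : C ⊸ C} (HQ : IsCoder h p Δ δ k Q) (x : Dual C) :
    Δ (dualLift lid Q x) = tmap (dualLift lid Q) (dualLift lid Q) (dualOp h k 0 Δ x) :=
  dualLift_id_op (fun x => by rw [mul_zero, sg_zero, one_smul]; exact HQ.coproduct x) x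

lemma IsCoder.add {k : ℤ} {Q R : C ⊸ C} (HQ : IsCoder h p Δ δ k Q)
    (HR : IsCoder h p Δ δ k R) : IsCoder h p Δ δ k (Q + R) := by
  have e : coder h k (Q + R) = coder h k Q + coder h k R := by
    rw [coder, coder, coder, TensorProduct.map_add_left, TensorProduct.map_add_right]; abel
  refine ⟨fun i x hx => add_mem (HQ.mem i x hx) (HR.mem i x hx), fun x => ?_, fun x => ?_⟩
  · rw [ladd, map_add, HQ.coproduct, HR.coproduct, e, ladd]
  · rw [ladd, map_add, HQ.cobracket, HR.cobracket, e, ladd, smul_add]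

lemma IsCoder.sq {Q : C ⊸ C} (HQ : IsCoder h p Δ δ 1 Q) : IsCoder h p Δ δ 2 (Q ∘ₗ Q) := by
  have anti : Q ∘ₗ parity Θ h 1 = - (parity Θ h 1 ∘ₗ Q) := hom_ext h fun i x hx => by
    rw [lcomp, lneg, lcomp, par_apply _ _ 1 hx, map_smul, par_apply _ _ 1 (HQ.mem i x hx), ← neg_smul, neg_sg]
    congr 1; exact sg_congr ⟨-1, by ring⟩
  have key : ∀ z, coder h 1 Q (coder h 1 Q z) = coder h 2 (Q ∘ₗ Q) z := fun z => by
    have e : parity Θ h 1 ∘ₗ parity Θ h 1 = parity Θ h 2 := parity_comp Θ h 1 1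
    simp only [coder, ladd, map_add, tmap_map, lid_comp, lcomp_id, e, anti]
    rw [show tmap (-(parity Θ h 1 ∘ₗ Q)) Q = -tmap (parity Θ h 1 ∘ₗ Q) Q from text' fun x y => by
        rw [map_tmul, lneg, lneg, map_tmul, neg_tmul], lneg]
    abel
  refine ⟨fun i x hx => ?_, fun x => ?_, fun x => ?_⟩
  · have := HQ.mem _ _ (HQ.mem i x hx)
    rwa [add_assoc] at this
  · rw [lcomp, HQ.coproduct, HQ.coproduct, key]
  · rw [lcomp, HQ.cobracket, HQ.cobracket, map_smul, key, smul_smul, sg_mul']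
    congr 2; ring

end Coderivation

lemma env_gr_int {K : Type u} [Field K] {V : Type v} [AddCommGroup V] [Module K V]
    {Ξ : ℤ → Submodule K V} (h : IsInt Ξ) (p : ℤ) :
    IsInt (Env.grading Ξ p) := plus_int (env_int h p)

section Existence

variable [CharZero K] {p : ℤ}

lemma coderivation_ext (h : IsInt Ξ) {k : ℤ} {Q R : Env Ξ p ⊸ Env Ξ p}
    (HQ : IsCoder (env_gr_int h p) p (envCop h p) (envCob h p) k Q)
    (HR : IsCoder (env_gr_int h p) p (envCop h p) (envCob h p) k R)
    (e : ∀ x, envPr Ξ p (Q x) = envPr Ξ p (R x)) : Q = R := by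
  have H := env_isGradedBicoalgebra h p
  have := env_lift_unique h (dual_isConilpotent H (env_isConilpotent h p) k) HQ.dualLift_coproduct
    HR.dualLift_coproduct
    (dualLift_id_op HQ.cobracket) (dualLift_id_op HR.cobracket)
    (lcongr (f := envPr Ξ p ∘ₗ dualLift lid Q)
      (g := envPr Ξ p ∘ₗ dualLift lid R) (dual_ext (fun x => by simp) fun x => by simp [e]))
  refine lext fun x => ?_
  have e2 := lcongr this (dualIm K _ x)
  rwa [dualLift_im, dualLift_im] at e2

lemma exists_coderivation (h : IsInt Ξ) {k : ℤ} {q : Env Ξ p ⊸ V}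
    (hq : ∀ i, ∀ x ∈ Env.grading Ξ p i, q x ∈ shift Ξ p (i + k)) : ∃ Q,
    IsCoder (env_gr_int h p) p (envCop h p) (envCob h p) k Q ∧ ∀ x, envPr Ξ p (Q x) = q x := by
  have H := env_isGradedBicoalgebra h p
  obtain ⟨G, hG, hΔ, hδ, hπ⟩ := env_lift h (dual_isGradedBicoalgebra H k)
    (dual_isConilpotent H (env_isConilpotent h p) k) (f := dualLift (envPr Ξ p) q) (fun i x hx => by
      refine add_mem (envPr_mem hx.1) ?_
      have := hq _ _ hx.2
      rwa [sub_add_cancel] at this)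
  have hid : G ∘ₗ dualRe K _ = lid := by
    refine env_lift_unique h (env_isConilpotent h p) (fun x => ?_) (fun x => ?_) (fun x => ?_)
      (fun x => ?_) fun x => ?_
    · rw [lcomp, hΔ, dualOp_inl, tmap_map]
    · rw [tmap_id]; rfl
    · rw [lcomp, hδ, dualOp_inl, tmap_map]
    · rw [tmap_id]; rfl
    · rw [lcomp, hπ, dualLift_re]; rfl
  have hl : G = dualLift lid (G ∘ₗ dualIm K _) := dual_ext (fun x => by
    rw [dualLift_re, ← hid]; rfl) fun x => by rw [dualLift_im]; rfl
  have hm : ∀ z, tmap G G (dual₂ H.internal k z) = coder (env_gr_int h p) k (G ∘ₗ dualIm K _) z := fun z => by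
    conv_lhs => rw [hl]
    rw [map_dualLift]; rfl
  refine ⟨G ∘ₗ dualIm K _, ⟨fun i x hx => hG _ _ (inr_mem k hx), fun x => ?_, fun x => ?_⟩, fun x => ?_⟩
  · rw [lcomp, hΔ, dualOp_inr, map_smul, hm, mul_zero, sg_zero, one_smul]
  · rw [lcomp, hδ, dualOp_inr, map_smul, hm]
  · rw [lcomp, hπ, dualLift_im]

end Existence

/-! ### The codifferential -/

section SquareZero

variable {Υ : ℤ → Submodule K V}

/-- The operations of a differential graded `(a,b)`-algebra on the suspension with letters of degree
`|α| + b - 1`, with `p = a - b`. -/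
structure IsSusAlg (h : IsInt Υ) (p : ℤ) (d : V ⊸ V)
    (M L : V ⊗[K] V ⊸ V) : Prop where
  d_mem : ∀ i, ∀ x ∈ Υ i, d x ∈ Υ (i + 1)
  M_mem : ∀ n, ∀ z ∈ tensorGrading Υ n, M z ∈ Υ (n + p + 1)
  L_mem : ∀ n, ∀ z ∈ tensorGrading Υ n, L z ∈ Υ (n + 1)
  M_flip : ∀ z, M (koszulFlip Υ h z) = -sg K p • M z
  L_flip : ∀ z, L (koszulFlip Υ h z) = L z
  d_d : ∀ x, d (d x) = 0
  d_M : ∀ z, d (M z) = -sg K p • M (tensorDeriv Υ h d z)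
  d_L : ∀ z, d (L z) = -L (tensorDeriv Υ h d z)
  M_assoc : ∀ z, M (tmap M lid (flip12 Υ h (flip23 Υ h z))) = M (tmap M lid z)
  L_jacobi : ∀ z, L (tmap L lid (z + flip12 Υ h (flip23 Υ h z) + flip23 Υ h (flip12 Υ h z))) = 0
  leibniz : ∀ z, L (tmap M lid z) = M (tmap L lid (flip23 Υ h (flip12 Υ h z)))
      - sg K p • M (tmap L lid (flip23 Υ h z))

variable {p : ℤ} {Δ δ : C →ₗ[K] C ⊗[K] C} {h : IsInt Υ} {d : V →ₗ[K] V} {M L : V ⊗[K] V →ₗ[K] V}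

lemma flip_map_odd (hC : IsInt Θ) (h : IsInt Υ) {π g : C ⊸ V}
    (hπ : ∀ i, ∀ x ∈ Θ i, π x ∈ Υ i) (hg : ∀ i, ∀ x ∈ Θ i, g x ∈ Υ (i + 1)) (z : C ⊗[K] C) :
    koszulFlip Υ h (tmap (π ∘ₗ parity Θ hC 1) g z) = tmap g π (koszulFlip Θ hC z) := by
  suffices koszulFlip Υ h ∘ₗ tmap (π ∘ₗ parity Θ hC 1) g = tmap g π ∘ₗ koszulFlip Θ hC from lcongr this z
  refine hom_ext₂ hC hC fun i x hx j y hy => ?_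
  rw [lcomp, lcomp, map_tmul, lcomp, par_apply _ _ 1 hx, map_smul, ← smul_tmul', map_smul,
    kflip_apply _ _ (hπ i x hx) (hg j y hy), kflip_apply _ _ hx hy, map_smul,
    map_tmul, smul_smul, sg_mul']
  congr 1; exact sg_congr ⟨i, by ring⟩

/-- The value on generators of the square of the codifferential vanishes. -/
lemma IsSusAlg.sq_eq_zero [CharZero K] (A : IsSusAlg h p d M L)
    (H : IsGradedBicoalgebra p Θ Δ δ) {π : C ⊸ V} (hπ : ∀ i, ∀ x ∈ Θ i, π x ∈ Υ i)
    {Q : C ⊸ C} (HQ : IsCoder H.internal p Δ δ 1 Q)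
    (hQ : ∀ x, π (Q x) = d (π x) + (2⁻¹ : K) • M (tmap π π (δ x))
      + (2⁻¹ : K) • L (tmap π π (Δ x))) (x : C) : π (Q (Q x)) = 0 := by
  have anti : ∀ x, koszulFlip Θ H.internal (δ x) = -sg K p • δ x := (isLieCoalg_of_bicoalgebra H).antisymm
  have comm : ∀ x, koszulFlip Θ H.internal (Δ x) = Δ x := lcongr H.cocommutative
  have hΔ : ∀ i, ∀ x ∈ Θ i, Δ x ∈ tensorGrading Θ (i - 0) := fun i x hx => by
    rw [sub_zero]; exact H.coproduct_mem i x hx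
  -- the two halves of a derivation agree
  have hM : ∀ g : C ⊸ V, (∀ i, ∀ x ∈ Θ i, g x ∈ Υ (i + 1)) → ∀ x, M (tmap (π ∘ₗ parity Θ H.internal 1) g (δ x))
        = M (tmap g π (δ x)) := fun g hg x => by
    have e := congrArg M (flip_map_odd H.internal h hπ hg (δ x))
    rw [A.M_flip, anti, map_smul, map_smul] at e
    have e' := congrArg (-sg K p • ·) e
    simpa only [smul_smul, neg_mul_neg, sg_mul_self, one_smul] using e'
  have hL : ∀ g : C ⊸ V, (∀ i, ∀ x ∈ Θ i, g x ∈ Υ (i + 1)) → ∀ x, L (tmap (π ∘ₗ parity Θ H.internal 1) g (Δ x))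
        = L (tmap g π (Δ x)) := fun g hg x => by
    have e := congrArg L (flip_map_odd H.internal h hπ hg (Δ x))
    rwa [A.L_flip, comm] at e
  have hdπ : ∀ i, ∀ x ∈ Θ i, (d ∘ₗ π) x ∈ Υ (i + 1) := fun i x hx => A.d_mem _ _ (hπ i x hx)
  have hπQ : ∀ i, ∀ x ∈ Θ i, (π ∘ₗ Q) x ∈ Υ (i + 1) := fun i x hx => hπ _ _ (HQ.mem i x hx)
  have hcod : ∀ z, tmap π π (coder H.internal 1 Q z) = tmap (π ∘ₗ Q) π z
        + tmap (π ∘ₗ parity Θ H.internal 1) (π ∘ₗ Q) z := fun z => by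
    rw [coder, ladd, map_add, tmap_map, tmap_map, lcomp_id]
  have hder : ∀ z, tensorDeriv Υ h d (tmap π π z) = tmap (d ∘ₗ π) π z
        + tmap (π ∘ₗ parity Θ H.internal 1) (d ∘ₗ π) z := fun z => by
    rw [tensorDeriv, ladd, tmap_map, tmap_map, lid_comp, parity_natural H.internal h hπ]
  have hq : π ∘ₗ Q = d ∘ₗ π + (2⁻¹ : K) • (M ∘ₗ tmap π π ∘ₗ δ) + (2⁻¹ : K) • (L ∘ₗ tmap π π ∘ₗ Δ) := lext hQ
  have tri : ∀ (N : V ⊗[K] V ⊸ V) (f : C ⊸ C ⊗[K] C) (z : C ⊗[K] C), tmap (N ∘ₗ tmap π π ∘ₗ f) π z = tmap N lid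
          (tmap (tmap π π) π (onLeft f z)) := fun N f z => by
    rw [onLeft, tmap_map, tmap_map, lid_comp, lcomp_id]
    rfl
  set t := tmap (tmap π π) π with ht
  have t12 := flip12_natural H.internal h hπ
  have t23 := flip23_natural H.internal h hπ
  rw [← ht] at t12 t23
  -- the quadratic terms
  have three : ∀ y : V, y + y + y = 0 → y = 0 := fun y hy => by
    rw [← one_smul K y, ← add_smul, ← add_smul] at hy
    exact (smul_eq_zero.1 hy).resolve_left (by norm_num)
  have T4 : M (tmap M lid (t (onLeft δ (δ x)))) = 0 := by
    have e := congrArg (fun z => M (tmap M lid (t z))) ((isLieCoalg_of_bicoalgebra H).jacobi x)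
    have e1 := A.M_assoc (t (onLeft δ (δ x)))
    have e2 := A.M_assoc (t (flip23 Θ H.internal (flip12 Θ H.internal (onLeft δ (δ x)))))
    rw [t23, t12, flip23_flip23 H.internal, flip12_flip12 H.internal] at e2
    rw [t23, t12] at e1
    simp only [map_add, map_zero] at e
    rw [e1, ← e2] at e
    exact three _ e
  have T5 : L (tmap L lid (t (onLeft Δ (Δ x)))) = 0 := by
    have r : flip12 Θ H.internal (flip23 Θ H.internal (onLeft Δ (Δ x))) = onLeft Δ (Δ x) := by
      rw [← onRight_flip H.internal hΔ, comm]
      exact (lcongr H.coassociative x).symm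
    have r' : flip23 Θ H.internal (flip12 Θ H.internal (onLeft Δ (Δ x))) = onLeft Δ (Δ x) := by
      conv_lhs => rw [← r]
      rw [flip12_flip12, flip23_flip23]
    have e := A.L_jacobi (t (onLeft Δ (Δ x)))
    rw [t23, t12, t12, t23, r, r', map_add, map_add, map_add, map_add] at e
    exact three _ e
  have T6 : sg K p • M (tmap L lid (t (onLeft Δ (δ x)))) + L (tmap M lid (t (onLeft δ (Δ x)))) = 0 := by
    have E12 : ∀ w, M (tmap L lid (t (flip12 Θ H.internal w))) = M (tmap L lid (t w)) := fun w => by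
      rw [← t12]
      congr 1
      suffices tmap L lid ∘ₗ flip12 Υ h = tmap L lid from lcongr this (t w)
      rw [flip12, ← tmap_comp, lid_comp]
      congr 1
      exact lext A.L_flip
    have v12 := flip12_onLeft H.internal anti (Δ x)
    have y1 : onRight Θ H.internal 0 Δ (δ x) = onLeft δ (Δ x)
        + flip12 Θ H.internal (onRight Θ H.internal p δ (Δ x)) :=
      lcongr H.coLeibniz x
    have y2 := onRight_flip H.internal hΔ (δ x)
    have y3 := onRight_flip H.internal H.cobracket_mem (Δ x)
    rw [comm] at y3
    rw [anti, map_smul, y1, y3, flip12_flip12] at y2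
    have y4 := congrArg (fun z => flip23 Θ H.internal (flip12 Θ H.internal z)) y2
    simp only [flip12_flip12, flip23_flip23, map_smul, map_add] at y4
    rw [flip_braid, v12, map_smul, map_smul, ← smul_add, smul_smul, neg_mul_neg, sg_mul_self, one_smul] at y4
    have l := A.leibniz (t (onLeft δ (Δ x)))
    rw [t12, t23, t23, v12] at l
    rw [l, ← y4, map_smul, map_smul, map_smul, map_smul, map_add, map_add, map_add, E12]
    module
  have e1 : π (Q (Q x)) = d (π (Q x)) + sg K p • M (tmap (π ∘ₗ Q) π (δ x)) + L (tmap (π ∘ₗ Q) π (Δ x)) := by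
    rw [hQ, HQ.cobracket, HQ.coproduct, map_smul, hcod, hcod, map_smul, map_add, map_add, hM _ hπQ,
      hL _ hπQ, one_mul, ← two_smul K, ← two_smul K]
    module
  rw [e1, hQ, hq]
  simp only [TensorProduct.map_add_left, tmap_smul_left, ladd,
    lsmul, map_add, map_smul, tri, A.d_d, A.d_M, A.d_L, hder, hM _ hdπ, hL _ hdπ, T4,
    T5]
  linear_combination (norm := module) (2⁻¹ : K) • T6

end SquareZero

lemma sg_eq_of_zmod {K : Type u} [Field K] {m n : ℤ} (e : (m : ZMod 2) = n) : sg K m = sg K n :=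
  sg_congr (ZMod.intCast_eq_zero_iff_even.1 (by rw [Int.cast_sub, e, sub_self]))

section AlgebraSuspension

variable {a b : ℤ}

namespace DGABAlgebra

variable (X : DGABAlgebra a b 𝒜) (h : IsInt (shift (shift 𝒜 (-a + 1)) (a - b)))

/-- The product on the suspension, with the signs that make it an operation of degree `p + 1`. -/
def susMul : A ⊗[K] A ⊸ A := sg K (a - b) • (tlift X.mul ∘ₗ tmap (parity _ h (a - b + 1)) lid)

/-- The bracket on the suspension, an operation of degree `1`. -/
def susBr : A ⊗[K] A ⊸ A := -(sg K (a - b) • (tlift X.bracket ∘ₗ tmap (parity _ h 1) lid))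

variable {h}

lemma susMul_tmul {i : ℤ} {x : A} (hx : x ∈ shift (shift 𝒜 (-a + 1)) (a - b) i) (y : A) :
    X.susMul h (x ⊗ₜ y) = sg K (a - b + (a - b + 1) * i) • X.mul x y := by
  rw [susMul, lsmul, lcomp, map_tmul, par_apply _ _ _ hx, ← smul_tmul', map_smul, smul_smul, sg_mul']
  rfl

lemma susBr_tmul {i : ℤ} {x : A} (hx : x ∈ shift (shift 𝒜 (-a + 1)) (a - b) i) (y : A) :
    X.susBr h (x ⊗ₜ y) = sg K (a - b + i + 1) • X.bracket x y := by
  rw [susBr, lneg, lsmul, lcomp, map_tmul, par_apply _ _ _ hx, ← smul_tmul', map_smul, smul_smul,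
    sg_mul', ← neg_smul, neg_sg, one_mul]
  rfl

variable {i j k : ℤ} {x y z : A}

lemma mul_mem_shift (hx : x ∈ shift (shift 𝒜 (-a + 1)) (a - b) i)
    (hy : y ∈ shift (shift 𝒜 (-a + 1)) (a - b) j) :
    X.mul x y ∈ shift (shift 𝒜 (-a + 1)) (a - b) (i + j + (a - b) + 1) := by
  have e := X.mul_mem hx hy
  unfold shift
  convert e using 2; ring

lemma bracket_mem_shift (hx : x ∈ shift (shift 𝒜 (-a + 1)) (a - b) i)
    (hy : y ∈ shift (shift 𝒜 (-a + 1)) (a - b) j) :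
    X.bracket x y ∈ shift (shift 𝒜 (-a + 1)) (a - b) (i + j + 1) := by
  have e := X.bracket_mem hx hy
  unfold shift
  convert e using 2; ring

lemma d_mem_shift (hx : x ∈ shift (shift 𝒜 (-a + 1)) (a - b) i) :
    X.d x ∈ shift (shift 𝒜 (-a + 1)) (a - b) (i + 1) := by
  have e := X.d_mem hx
  unfold shift
  convert e using 2; ring

lemma mul_comm_shift (hx : x ∈ shift (shift 𝒜 (-a + 1)) (a - b) i)
    (hy : y ∈ shift (shift 𝒜 (-a + 1)) (a - b) j) :
    X.mul x y = sg K ((i + (a - b) + 1) * (j + (a - b) + 1)) • X.mul y x := by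
  rw [X.mul_comm hx hy, nop_smul (K := K)]
  congr 1; exact sg_congr ⟨0, by ring⟩

lemma bracket_comm_shift (hx : x ∈ shift (shift 𝒜 (-a + 1)) (a - b) i)
    (hy : y ∈ shift (shift 𝒜 (-a + 1)) (a - b) j) :
    X.bracket x y = sg K ((i + 1) * (j + 1) + 1) • X.bracket y x := by
  rw [X.bracket_antisymm hx hy, nop_smul (K := K), ← neg_smul, ← neg_sg]
  congr 2; exact sg_congr ⟨0, by ring⟩

lemma isSuspendedAlgebra : IsSusAlg h (a - b) X.d (X.susMul h) (X.susBr h) where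
  d_mem i x hx := X.d_mem_shift hx
  M_mem n z hz := by
    refine tgr_ind (P := fun z => X.susMul h z ∈ shift _ _ (n + (a - b) + 1))
      (fun i j e u hu v hv => ?_) (fun u v hu hv => ?_) hz
    · rw [X.susMul_tmul hu]; subst e
      exact Submodule.smul_mem _ _ (X.mul_mem_shift hu hv)
    · rw [map_add]; exact add_mem hu hv
  L_mem n z hz := by
    refine tgr_ind (P := fun z => X.susBr h z ∈ shift _ _ (n + 1))
      (fun i j e u hu v hv => ?_) (fun u v hu hv => ?_) hz
    · rw [X.susBr_tmul hu]; subst e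
      exact Submodule.smul_mem _ _ (X.bracket_mem_shift hu hv)
    · rw [map_add]; exact add_mem hu hv
  M_flip z := by
    suffices X.susMul h ∘ₗ koszulFlip _ h = -sg K (a - b) • X.susMul h from lcongr this z
    refine hom_ext₂ h h fun i x hx j y hy => ?_
    rw [lcomp, lsmul, kflip_apply _ h hx hy, map_smul,
      X.susMul_tmul hx, X.susMul_tmul hy, X.mul_comm_shift hy hx, neg_sg]
    simp only [smul_smul, sg_mul']
    congr 1; exact sg_eq_of_zmod (by
      push_cast; generalize (a : ZMod 2) = a', (b : ZMod 2) = b', (i : ZMod 2) = i', (j : ZMod 2) = j'; decide +revert)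
  L_flip z := by
    suffices X.susBr h ∘ₗ koszulFlip _ h = X.susBr h from lcongr this z
    refine hom_ext₂ h h fun i x hx j y hy => ?_
    rw [lcomp, kflip_apply _ h hx hy, map_smul, X.susBr_tmul hx, X.susBr_tmul hy, X.bracket_comm_shift hy hx]
    simp only [smul_smul, sg_mul']
    congr 1; exact sg_eq_of_zmod (by
      push_cast; generalize (a : ZMod 2) = a', (b : ZMod 2) = b', (i : ZMod 2) = i', (j : ZMod 2) = j'; decide +revert)
  d_d := X.d_d
  d_M z := by
    suffices X.d ∘ₗ X.susMul h = -sg K (a - b) • (X.susMul h ∘ₗ tensorDeriv _ h X.d) from lcongr this z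
    refine hom_ext₂ h h fun i x hx j y hy => ?_
    rw [lcomp, lsmul, lcomp, X.susMul_tmul hx, map_smul,
      X.d_mul hx, nop_smul (K := K), tensorDeriv, ladd, map_add,
      map_tmul, map_tmul, par_apply _ h 1 hx,
      ← smul_tmul', map_smul, X.susMul_tmul hx, lid_apply,
      X.susMul_tmul (X.d_mem_shift hx), neg_sg]
    simp only [smul_add, smul_smul, sg_mul']
    congr 2 <;> exact sg_eq_of_zmod (by
      push_cast; generalize (a : ZMod 2) = a', (b : ZMod 2) = b', (i : ZMod 2) = i', (j : ZMod 2) = j'; decide +revert)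
  d_L z := by
    suffices X.d ∘ₗ X.susBr h = -(X.susBr h ∘ₗ tensorDeriv _ h X.d) from lcongr this z
    refine hom_ext₂ h h fun i x hx j y hy => ?_
    rw [lcomp, lneg, lcomp, X.susBr_tmul hx,
      map_smul, X.d_bracket hx, nop_smul (K := K), tensorDeriv, ladd, map_add,
      map_tmul, map_tmul, par_apply _ h 1 hx,
      ← smul_tmul', map_smul, X.susBr_tmul hx, lid_apply,
      X.susBr_tmul (X.d_mem_shift hx), neg_add, ← neg_smul, ← neg_smul, neg_sg]
    simp only [smul_add, smul_smul, sg_mul', neg_sg]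
    congr 2 <;> exact sg_eq_of_zmod (by
      push_cast; generalize (a : ZMod 2) = a', (b : ZMod 2) = b', (i : ZMod 2) = i', (j : ZMod 2) = j'; decide +revert)
  M_assoc z := by
    suffices X.susMul h ∘ₗ tmap (X.susMul h) lid ∘ₗ flip12 _ h ∘ₗ flip23 _ h
      = X.susMul h ∘ₗ tmap (X.susMul h) lid from lcongr this z
    refine hom_ext₃ h h h fun i x hx j y hy k z hz => ?_
    simp only [lcomp, flip23_tmul h _ hy hz, flip12_tmul h hx hz, map_smul,
      map_tmul, lid_apply, X.susMul_tmul hx, X.susMul_tmul hz,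
      ← smul_tmul', X.susMul_tmul (X.mul_mem_shift hx hy),
      X.susMul_tmul (X.mul_mem_shift hz hx), ← X.mul_assoc]
    rw [X.mul_comm_shift hz (X.mul_mem_shift hx hy), X.mul_assoc]
    simp only [smul_smul, sg_mul']
    congr 1; exact sg_eq_of_zmod (by
      push_cast; generalize (a : ZMod 2) = a', (b : ZMod 2) = b', (i : ZMod 2) = i', (j : ZMod 2) = j', (k : ZMod 2) = k'; decide +revert)
  L_jacobi z := by
    suffices X.susBr h ∘ₗ tmap (X.susBr h) lid ∘ₗ
      (lid + flip12 _ h ∘ₗ flip23 _ h + flip23 _ h ∘ₗ flip12 _ h) = 0 from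
      lcongr this z
    refine hom_ext₃ h h h fun i x hx j y hy k z hz => ?_
    simp only [lcomp, ladd, map_add, flip23_tmul h _ hy hz,
      flip23_tmul h _ hx hz, flip12_tmul h hx hy, flip12_tmul h hx hz, map_smul,
      map_tmul, lid_apply, X.susBr_tmul hx, X.susBr_tmul hz,
      X.susBr_tmul hy, ← smul_tmul',
      X.susBr_tmul (X.bracket_mem_shift hx hy), lzero,
      X.susBr_tmul (X.bracket_mem_shift hz hx), X.susBr_tmul (X.bracket_mem_shift hy hz)]
    have e := congrArg (sg K (j + 1 + (i + 1) * (k + 1)) • ·) (X.jacobi hx hy hz)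
    simp only [nop_smul (K := K), smul_add, smul_smul, sg_mul', smul_zero] at e ⊢
    rw [← e, add_right_comm]
    refine congrArg₂ _ (congrArg₂ _ ?_ ?_) ?_ <;> refine congrArg (· • _) (sg_eq_of_zmod (by
      push_cast; generalize (a : ZMod 2) = a', (b : ZMod 2) = b', (i : ZMod 2) = i', (j : ZMod 2) = j', (k : ZMod 2) = k'; decide +revert))
  leibniz z := by
    suffices X.susBr h ∘ₗ tmap (X.susMul h) lid = X.susMul h ∘ₗ tmap (X.susBr h) lid ∘ₗ flip23 _ h ∘ₗ flip12 _ h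
        - sg K (a - b) • (X.susMul h ∘ₗ tmap (X.susBr h) lid ∘ₗ flip23 _ h) from lcongr this z
    refine hom_ext₃ h h h fun i x hx j y hy k z hz => ?_
    simp only [lcomp, lsub, lsmul, flip23_tmul h _ hy hz, flip23_tmul h _ hx hz, flip12_tmul h hx hy, map_smul,
      map_tmul, lid_apply, X.susBr_tmul hx, X.susMul_tmul hx,
      X.susBr_tmul hy, ← smul_tmul',
      X.susBr_tmul (X.mul_mem_shift hx hy),
      X.susMul_tmul (X.bracket_mem_shift hx hz), X.susMul_tmul (X.bracket_mem_shift hy hz)]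
    rw [X.bracket_comm_shift (X.mul_mem_shift hx hy) hz, X.leibniz hz hx hy,
      X.mul_comm_shift (X.bracket_mem_shift hy hz) hx, X.bracket_comm_shift hy hz,
      X.bracket_comm_shift hx hz, map_smul, map_smul, lsmul, sub_eq_add_neg (_ : A),
      ← neg_smul, neg_sg, nop_smul (K := K)]
    simp only [smul_add, smul_smul, sg_mul']
    rw [add_comm]
    congr 2 <;> exact sg_eq_of_zmod (by
      push_cast; generalize (a : ZMod 2) = a', (b : ZMod 2) = b', (i : ZMod 2) = i', (j : ZMod 2) = j', (k : ZMod 2) = k'; decide +revert)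

end DGABAlgebra

end AlgebraSuspension

section Codifferential

variable [CharZero K] {p : ℤ}

lemma exists_codifferential (h : IsInt Ξ) {d : V ⊸ V}
    {M L : V ⊗[K] V ⊸ V} (A : IsSusAlg (shift_int h p) p d M L) :
    ∃ Q R, IsCoder (env_gr_int h p) p (envCop h p) (envCob h p) 1 Q ∧
      IsCoder (env_gr_int h p) p (envCop h p) (envCob h p) 1 R ∧
      (∀ x, envPr Ξ p (Q x) = d (envPr Ξ p x) + (2⁻¹ : K) • M (tmap (envPr Ξ p) (envPr Ξ p) (envCob h p x))) ∧
      (∀ x, envPr Ξ p (R x) = (2⁻¹ : K) • L (tmap (envPr Ξ p) (envPr Ξ p) (envCop h p x))) ∧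
      (R + Q) ∘ₗ (R + Q) = 0 := by
  have H := env_isGradedBicoalgebra h p
  have hπ : ∀ i, ∀ x ∈ Env.grading Ξ p i, envPr Ξ p x ∈ shift Ξ p i := fun i x => envPr_mem
  obtain ⟨Q, HQ, hQ⟩ := exists_coderivation (k := 1) h (q := d ∘ₗ envPr Ξ p + (2⁻¹ : K) •
    (M ∘ₗ tmap (envPr Ξ p) (envPr Ξ p) ∘ₗ envCob h p)) fun i x hx => by
      refine add_mem (A.d_mem _ _ (hπ i x hx)) (Submodule.smul_mem _ _ ?_)
      have : _ ∈ shift Ξ p _ := A.M_mem _ _ (map_tgr_mem hπ (H.cobracket_mem i x hx))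
      rwa [sub_add_cancel] at this
  obtain ⟨R, HR, hR⟩ := exists_coderivation (k := 1) h (q := (2⁻¹ : K) •
    (L ∘ₗ tmap (envPr Ξ p) (envPr Ξ p) ∘ₗ envCop h p)) fun i x hx =>
      Submodule.smul_mem _ _ (A.L_mem _ _ (map_tgr_mem hπ (H.coproduct_mem i x hx)))
  refine ⟨Q, R, HQ, HR, hQ, hR, ?_⟩
  have hz : IsCoder (env_gr_int h p) p (envCop h p) (envCob h p) 2 (0 : Env Ξ p ⊸ Env Ξ p) := by
    have e : coder (env_gr_int h p) 2 (0 : Env Ξ p ⊸ Env Ξ p) = 0 := by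
      rw [coder, TensorProduct.map_zero_left, TensorProduct.map_zero_right, add_zero]
    refine ⟨fun i x _ => Submodule.zero_mem _, fun x => ?_, fun x => ?_⟩
    · rw [e]; exact map_zero _
    · rw [e]; exact (map_zero _).trans (smul_zero _).symm
  refine coderivation_ext h (HR.add HQ).sq hz fun x => ?_
  refine (A.sq_eq_zero H hπ (HR.add HQ) (fun x => ?_) x).trans (map_zero (envPr Ξ p)).symm
  rw [ladd, map_add, hQ, hR, add_comm]
  rfl

end Codifferential

/-! ### Coderivations of the symmetric coalgebra -/

section Extension

variable {k i : ℤ} {w : W} {R : SymHat Γ →ₗ[K] W}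

/-- The extension of a map to the generators to a coderivation. -/
def hatExt (h : IsInt Γ) (R : SΓ ⊸ W) : SΓ ⊸ SΓ := tlift (lam Γ) ∘ₗ tmap R lid ∘ₗ hatΔ h

lemma hatExt_one (h : IsInt Γ) (R : SΓ ⊸ W) :
    hatExt h R (hatOne Γ) = lam Γ (R (hatOne Γ)) (hatOne Γ) := by simp [hatExt]

lemma hatExt_mem (h : IsInt Γ) (hR : ∀ n, ∀ x ∈ hatGr Γ n, R x ∈ Γ (n + k)) {n : ℤ} {x : SΓ}
    (hx : x ∈ hatGr Γ n) : hatExt h R x ∈ hatGr Γ (n + k) := by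
  refine tgr_ind (P := fun z => tlift (lam Γ) (tmap R lid z) ∈ hatGr Γ (n + k)) (fun a b e x hx y hy => ?_)
    (fun x y hx hy => ?_) (hatΔ_mem h hx)
  · rw [map_tmul, TensorProduct.lift.tmul]
    have := lam_mem (hR a x hx) hy
    rwa [← add_assoc, add_comm b, e] at this
  · rw [map_add, map_add]; exact add_mem hx hy

lemma hatExt_lam (h : IsInt Γ) (hR : ∀ n, ∀ x ∈ hatGr Γ n, R x ∈ Γ (n + k)) (hw : w ∈ Γ i) (x : SΓ) :
    hatExt h R (lam Γ w x) = hatExt h (R ∘ₗ lam Γ w) x + sg K (k * i) • lam Γ w (hatExt h R x) := by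
  simp only [hatExt, lcomp, hatΔ_lam, diag_apply, map_add]
  generalize hatΔ h x = z
  suffices tlift (lam Γ) ∘ₗ tmap R lid ∘ₗ (lam1 Γ w + lam2 h w) = tlift (lam Γ) ∘ₗ tmap (R ∘ₗ lam Γ w) lid
      + sg K (k * i) • (lam Γ w ∘ₗ tlift (lam Γ) ∘ₗ tmap R lid)
    by simpa using lcongr this z
  refine hom_ext₂ (hat_int h) (hat_int h) fun m a ha n b hb => ?_
  simp only [lcomp, ladd, lsmul, map_add, lam1_tmul,
    map_tmul, TensorProduct.lift.tmul, lid_apply, lam2_tmul h hw,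
    par_apply _ _ _ ha, map_smul, lam_lam hw (hR m a ha), smul_smul, sg_mul']
  rw [sg_congr (m := k * i + i * (m + k)) (n := i * m) ⟨k * i, by ring⟩]

lemma hatExt_coproduct (h : IsInt Γ) (X : List (Letter Γ)) :
    ∀ (k : ℤ) (R : SΓ ⊸ W), (∀ n, ∀ x ∈ hatGr Γ n, R x ∈ Γ (n + k)) → hatΔ h (hatExt h R (hatMk Γ (word X)))
        = coder (hat_int h) k (hatExt h R) (hatΔ h (hatMk Γ (word X))) := by
  induction X with
  | nil =>
    intro k R hR
    change hatΔ h (hatExt h R (hatOne Γ)) = coder _ k _ (hatΔ h (hatOne Γ))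
    rw [hatExt_one, hatΔ_lam, hatΔ_one, coder, ladd, map_tmul,
      map_tmul, parity_one h, hatExt_one, diag_apply, lam1_tmul,
      lam2_tmul h (hR 0 _ hatOne_mem), parity_one h]
    rfl
  | cons α X ih =>
    intro k R hR
    have hR' : ∀ n, ∀ x ∈ hatGr Γ n, (R ∘ₗ lam Γ α.val) x ∈ Γ (n + (k + α.deg)) := fun n x hx => by
        have := hR _ _ (lam_mem α.mem hx)
        rwa [add_assoc, add_comm α.deg] at this
    rw [word_cons, ← lam_hatMk, hatExt_lam h hR α.mem, map_add, map_smul, hatΔ_lam, hatΔ_lam,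
      ih _ _ hR', ih _ _ hR]
    generalize hatΔ h (hatMk Γ (word X)) = z
    suffices coder (hat_int h) (k + α.deg) (hatExt h (R ∘ₗ lam Γ α.val))
        + sg K (k * α.deg) • (diag h α.val ∘ₗ coder (hat_int h) k (hatExt h R))
      = coder (hat_int h) k (hatExt h R) ∘ₗ diag h α.val from lcongr this z
    refine hom_ext₂ (hat_int h) (hat_int h) fun m a ha n b hb => ?_
    simp only [coder, lcomp, ladd, lsmul, map_add,
      diag_apply, lam1_tmul, lam2_tmul h α.mem, map_tmul, lid_apply,
      par_apply _ _ _ ha, parity_lam h _ α.mem, hatExt_lam h hR α.mem,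
      par_apply _ _ _ (hatExt_mem h hR ha), map_smul, add_tmul,
      tmul_add, tmul_smul, ← smul_tmul', smul_smul,
      sg_mul', smul_add]
    rw [sg_congr (m := k * α.deg + α.deg * (m + k)) (n := α.deg * m) ⟨k * α.deg, by ring⟩]
    simp only [add_mul, add_comm (k * m)]
    rw [add_left_comm (k * α.deg) (α.deg * m)]
    abel

end Extension

section Unary

variable {k i : ℤ} {w : W} {R : SymHat Γ →ₗ[K] W}

lemma hatPr_hatExt (h : IsInt Γ) (R : SΓ ⊸ W) (x : SΓ) : hatPr Γ (hatExt h R x) = R x := by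
  have e : ∀ z, hatPr Γ (tlift (lam Γ) (tmap R lid z)) = trid K W (tmap R lid
        (tmap lid (counit Γ) z)) := fun z => by
    induction z with
    | zero => simp
    | tmul a b => simp
    | add a b ha hb => simp only [map_add, ha, hb]
  simp only [hatExt, lcomp]
  rw [e, hatΔ_counit', map_tmul, lid_apply, TensorProduct.rid_tmul, one_smul]

lemma hatExt_smulRight (h : IsInt Γ) (u : W) (x : SΓ) : hatExt h ((counit Γ).smulRight u) x = lam Γ u x := by
  have e : ∀ z, tlift (lam Γ) (tmap ((counit Γ).smulRight u) lid z)
      = lam Γ u (tlid K _ (tmap (counit Γ) lid z)) := fun z => by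
    induction z with
    | zero => simp
    | tmul a b => simp
    | add a b ha hb => simp only [map_add, ha, hb]
  simp only [hatExt, lcomp]
  rw [e, hatΔ_counit]

lemma hatExt_unary (h : IsInt Γ) {D : W ⊸ W} (hD : ∀ n, ∀ x ∈ Γ n, D x ∈ Γ (n + k)) (hw : w ∈ Γ i) (x : SΓ) :
    hatExt h (D ∘ₗ hatPr Γ) (lam Γ w x)
      = lam Γ (D w) x + sg K (k * i) • lam Γ w (hatExt h (D ∘ₗ hatPr Γ) x) := by
  have e : (D ∘ₗ hatPr Γ) ∘ₗ lam Γ w = (counit Γ).smulRight (D w) := lext fun x => by simp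
  rw [hatExt_lam h (k := k) (fun n x hx => hD _ _ (hatPr_mem hx)) hw, e, hatExt_smulRight]

variable {p : ℤ} {Δ δ : C →ₗ[K] C ⊗[K] C}

def both (N : C ⊸ C) : C ⊗[K] C ⊸ C ⊗[K] C := tmap N lid + tmap lid N

lemma IsCoder.commutator (h : IsInt Θ) {Q N : C ⊸ C} (HQ : IsCoder h p Δ δ k Q)
    (mem : ∀ i, ∀ x ∈ Θ i, N x ∈ Θ i) (coproduct : ∀ x, Δ (N x) = both N (Δ x))
    (cobracket : ∀ x, δ (N x) = both N (δ x) - δ x) :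
    IsCoder h p Δ δ k (Q ∘ₗ N - N ∘ₗ Q) := by
  have key : ∀ z, coder h k Q (both N z) - both N (coder h k Q z) = coder h k (Q ∘ₗ N - N ∘ₗ Q) z := fun z => by
    suffices coder h k Q ∘ₗ both N - both N ∘ₗ coder h k Q = coder h k (Q ∘ₗ N - N ∘ₗ Q) from lcongr this z
    refine hom_ext₂ h h fun i x hx j y hy => ?_
    simp only [coder, both, lcomp, lsub, ladd, map_tmul, map_add, lid_apply, par_apply _ h k hx,
      par_apply _ h k (mem i x hx), map_smul, TensorProduct.sub_tmul, TensorProduct.tmul_sub]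
    simp only [← smul_tmul']
    abel
  refine ⟨fun i x hx => sub_mem (HQ.mem _ _ (mem i x hx)) (mem _ _ (HQ.mem i x hx)), fun x => ?_, fun x => ?_⟩
  · rw [lsub, map_sub, lcomp, lcomp, HQ.coproduct, coproduct, coproduct, HQ.coproduct, key]
  · rw [lsub, map_sub, lcomp, lcomp, HQ.cobracket,
      cobracket, cobracket, HQ.cobracket, ← key, map_smul, map_sub, smul_sub, smul_sub]
    abel

lemma both_natural {D : Type x} [AddCommGroup D] [Module K D] {f : C ⊸ D} {N : C ⊸ C}
    {M : D ⊸ D} (e : ∀ x, M (f x) = f (N x)) (z : C ⊗[K] C) :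
    both M (tmap f f z) = tmap f f (both N z) := by
  have e' : M ∘ₗ f = f ∘ₗ N := lext e
  simp only [both, ladd, map_add, tmap_map, lid_comp, lcomp_id, e']

lemma hatNum_eq (h : IsInt Γ) : hatNum h = hatExt h (hatPr Γ) := rfl

lemma hatNum_mem (h : IsInt Γ) {n : ℤ} {x : SΓ} (hx : x ∈ hatGr Γ n) : hatNum h x ∈ hatGr Γ n := by
  have := hatExt_mem h (k := 0) (R := hatPr Γ) (fun n x hx => by rw [add_zero]; exact hatPr_mem hx) hx
  rwa [add_zero] at this

lemma both_lam1 (h : IsInt Γ) (hw : w ∈ Γ i) (z : SΓ ⊗[K] SΓ) :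
    both (hatNum h) (lam1 Γ w z) = lam1 Γ w z + lam1 Γ w (both (hatNum h) z) := by
  induction z with
  | zero => simp
  | tmul a b =>
    simp only [both, ladd, lam1_tmul, map_tmul, hatNum_lam h hw, add_tmul, lid_apply, map_add, add_assoc]
  | add a b ha hb => simp only [map_add, ha, hb]; abel

lemma both_lam2 (h : IsInt Γ) (hw : w ∈ Γ i) (z : SΓ ⊗[K] SΓ) :
    both (hatNum h) (lam2 h w z) = lam2 h w z + lam2 h w (both (hatNum h) z) := by
  suffices both (hatNum h) ∘ₗ lam2 h w = lam2 h w + lam2 h w ∘ₗ both (hatNum h) from lcongr this z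
  refine hom_ext₂ (hat_int h) (hat_int h) fun m a ha n b hb => ?_
  simp only [both, lcomp, ladd, lam2_tmul h hw, map_add,
    map_tmul, hatNum_lam h hw, par_apply _ _ i ha, map_smul, lid_apply,
    par_apply _ _ i (hatNum_mem h ha), tmul_add]
  abel

lemma hatΔ_hatNum (h : IsInt Γ) (x : SΓ) : hatΔ h (hatNum h x) = both (hatNum h) (hatΔ h x) := by
  suffices hatΔ h ∘ₗ hatNum h = both (hatNum h) ∘ₗ hatΔ h from lcongr this x
  refine hat_ext h (by simp [hatNum, both]) fun i w hw x hx => ?_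
  simp only [lcomp] at hx ⊢
  rw [hatNum_lam h hw, map_add, hatΔ_lam, hatΔ_lam, hx, diag_apply, diag_apply, map_add,
    both_lam1 h hw, both_lam2 h hw]
  abel

lemma hatδ_hatNum (h : IsInt Γ) {δ : W ⊸ W ⊗[K] W}
    (hδ : ∀ i, ∀ x ∈ Γ i, δ x ∈ tensorGrading Γ (i - p)) (x : SΓ) :
    hatδ h δ (hatNum h x) = both (hatNum h) (hatδ h δ x) - hatδ h δ x := by
  suffices hatδ h δ ∘ₗ hatNum h = both (hatNum h) ∘ₗ hatδ h δ - hatδ h δ from lcongr this x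
  refine hat_ext h (by simp [hatNum]) fun i w hw x hx => ?_
  simp only [lcomp, lsub] at hx ⊢
  have e : both (hatNum h) (mulMap (lam1 Γ) (lam2 h) (δ w) (hatΔ h x))
      = (2 : K) • mulMap (lam1 Γ) (lam2 h) (δ w) (hatΔ h x)
        + mulMap (lam1 Γ) (lam2 h) (δ w) (both (hatNum h) (hatΔ h x)) := by
    refine tgr_ind (P := fun t =>
      both (hatNum h) (mulMap (lam1 Γ) (lam2 h) t (hatΔ h x))
      = (2 : K) • mulMap (lam1 Γ) (lam2 h) t (hatΔ h x)
        + mulMap (lam1 Γ) (lam2 h) t (both (hatNum h) (hatΔ h x))) (fun a b e u hu v hv => ?_)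
      (fun u v hu hv => ?_) (hδ i w hw)
    · rw [mulMap_tmul, mulMap_tmul, both_lam1 h hu, both_lam2 h hv, map_add, two_smul]
      abel
    · simp only [map_add, ladd, hu, hv, smul_add]; abel
  rw [hatNum_lam h hw, map_add, hatδ_lam h hδ hw, hatδ_lam h hδ hw, hx, hatΔ_hatNum, map_add, e,
    map_smul, diag_apply, diag_apply, map_add, both_lam1 h hw, both_lam2 h hw, map_sub, map_sub,
    two_smul]
  module

/-- The operator that multiplies a monomial of the positive part by its number of factors. -/
def plusNum (h : IsInt Γ) : SymPlus Γ ⊸ SymPlus Γ := toPlus Γ ∘ₗ hatNum h ∘ₗ ofPlus Γ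

lemma plusNum_toPlus (h : IsInt Γ) (x : SΓ) : plusNum h (toPlus Γ x) = toPlus Γ (hatNum h x) := by
  have : hatNum h (hatOne Γ) = 0 := by simp [hatNum]
  simp [plusNum, ofPlus_toPlus, this]

lemma plusPr_plusNum (h : IsInt Γ) (x : SymPlus Γ) : plusPr Γ (plusNum h x) = plusPr Γ x := by
  obtain ⟨x, rfl⟩ := toPlus_surj x
  rw [plusNum_toPlus, plusPr_toPlus, plusPr_toPlus, hatNum_eq, hatPr_hatExt]

lemma IsCoder.commutator_plusNum (h : IsInt Γ) {δ : W ⊸ W ⊗[K] W}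
    (hδ : ∀ i, ∀ x ∈ Γ i, δ x ∈ tensorGrading Γ (i - p)) {Q : SymPlus Γ ⊸ SymPlus Γ}
    (HQ : IsCoder (plus_int h) p (plusΔ h) (plusδ h δ) k Q) :
    IsCoder (plus_int h) p (plusΔ h) (plusδ h δ) k (Q ∘ₗ plusNum h - plusNum h ∘ₗ Q) := by
  refine HQ.commutator _ (fun i x hx => ?_) (fun x => ?_) fun x => ?_
  · obtain ⟨y, hy, rfl⟩ := exists_toPlus hx
    rw [plusNum_toPlus]; exact toPlus_mem (hatNum_mem h hy)
  all_goals obtain ⟨y, rfl⟩ := toPlus_surj x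
  · rw [plusNum_toPlus, plusΔ_toPlus, plusΔ_toPlus, hatΔ_hatNum, both_natural (plusNum_toPlus h)]
  · rw [plusNum_toPlus, plusδ_toPlus, plusδ_toPlus, hatδ_hatNum h hδ, map_sub, both_natural (plusNum_toPlus h)]

lemma hatNum_word (h : IsInt Γ) (X : List (Letter Γ)) :
    hatNum h (hatMk Γ (word X)) = (X.length : K) • hatMk Γ (word X) := by
  induction X with
  | nil => exact (show hatNum h (hatOne Γ) = 0 by simp [hatNum]).trans (by simp)
  | cons α X ih =>
    rw [word_cons, ← lam_hatMk, hatNum_lam h α.mem, ih, map_smul, List.length_cons, Nat.cast_succ,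
      add_smul, one_smul, add_comm]

lemma apply_word_eq_zero [CharZero K] (h : IsInt Γ) {m : ℕ}
    (hN : ∀ x, R (hatNum h x) = (m : K) • R x) {X : List (Letter Γ)} (hX : X.length ≠ m) :
    R (hatMk Γ (word X)) = 0 := by
  have := hN (hatMk Γ (word X))
  rw [hatNum_word, map_smul, ← sub_eq_zero, ← sub_smul] at this
  exact (smul_eq_zero.1 this).resolve_left (sub_ne_zero.2 (Nat.cast_injective.ne hX))

lemma hatPr_word [CharZero K] (h : IsInt Γ) {X : List (Letter Γ)}
    (hX : X.length ≠ 1) : hatPr Γ (hatMk Γ (word X)) = 0 :=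
  apply_word_eq_zero h (m := 1) (fun x => by rw [hatNum_eq, hatPr_hatExt, Nat.cast_one, one_smul]) hX

lemma hatMk_word_singleton (α : Letter Γ) : hatMk Γ (word [α]) = lam Γ α.val (hatOne Γ) := by
  rw [word_cons, ← lam_hatMk]; rfl

/-- A map to the generators that vanishes on products of at least two generators. -/
lemma eq_unary [CharZero K] (h : IsInt Γ) (hN : ∀ x, R (hatNum h x) = R x) :
    R = (R ∘ₗ (lam Γ).flip (hatOne Γ)) ∘ₗ hatPr Γ := by
  refine hatMk_ext <| word_ext h fun X => ?_
  rw [lcomp, lcomp, lcomp]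
  by_cases hX : X.length = 1
  · obtain ⟨α, rfl⟩ := List.length_eq_one_iff.1 hX
    rw [hatMk_word_singleton, hatPr_lam, counit_one, one_smul]; rfl
  · rw [hatPr_word h hX, map_zero]
    exact apply_word_eq_zero h (m := 1) (fun x => by rw [hN, Nat.cast_one, one_smul]) hX

/-- A map to the generators that is supported on products of two generators. -/
lemma eq_binary [CharZero K] (h : IsInt Γ) (hN : ∀ x, R (hatNum h x) = (2 : K) • R x) (hw : w ∈ Γ i) :
    R ∘ₗ lam Γ w = (R ∘ₗ lam Γ w ∘ₗ (lam Γ).flip (hatOne Γ)) ∘ₗ hatPr Γ := by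
  refine hatMk_ext <| word_ext h fun X => ?_
  rw [lcomp, lcomp, lcomp, lcomp]
  by_cases hX : X.length = 1
  · obtain ⟨α, rfl⟩ := List.length_eq_one_iff.1 hX
    rw [hatMk_word_singleton, hatPr_lam, counit_one, one_smul]; rfl
  · rw [hatPr_word h hX, map_zero, lam_hatMk, ← word_cons (Ξ := Γ) ⟨i, w, hw⟩]
    exact apply_word_eq_zero h (m := 2) (fun x => hN x) (by simpa using hX)

end Unary

section PlusCoderivation

variable {k p i j : ℤ} {δ : W →ₗ[K] W ⊗[K] W} {h : IsInt Γ} {Q : SymPlus Γ →ₗ[K] SymPlus Γ}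

variable (Q) in
/-- The generators part of an endomorphism of the positive part. -/
def genPart : SΓ ⊸ W := plusPr Γ ∘ₗ Q ∘ₗ toPlus Γ

lemma genPart_one : genPart Q (hatOne Γ) = 0 := by simp [genPart]

lemma IsCoder.genPart_mem (HQ : IsCoder (plus_int h) p (plusΔ h) (plusδ h δ) k Q) :
    ∀ n, ∀ x ∈ hatGr Γ n, genPart Q x ∈ Γ (n + k) :=
  fun _ _ hx => plusPr_mem (HQ.mem _ _ (toPlus_mem hx))

lemma parity_toPlus (h : IsInt Γ) (k : ℤ) :
    parity _ (plus_int h) k ∘ₗ toPlus Γ = toPlus Γ ∘ₗ parity _ (hat_int h) k :=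
  parity_natural (hat_int h) (plus_int h) (fun _ _ => toPlus_mem) k

/-- A coderivation is the extension of its generators part. -/
lemma IsCoder.apply_toPlus [CharZero K] (H : IsLieCoalg p Γ h δ) (HC : IsConilpotent (plusΔ h) (plusδ h δ))
    (HQ : IsCoder (plus_int h) p (plusΔ h) (plusδ h δ) k Q) (x : SΓ) :
    Q (toPlus Γ x) = toPlus Γ (hatExt h (genPart Q) x) := by
  set E : SymPlus Γ ⊸ SymPlus Γ := toPlus Γ ∘ₗ hatExt h (genPart Q) ∘ₗ ofPlus Γ with hE
  have E_toPlus : ∀ x, E (toPlus Γ x) = toPlus Γ (hatExt h (genPart Q) x) := fun x => by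
    simp [hE, ofPlus_toPlus, hatExt_one, genPart_one]
  have hEΔ : ∀ y, plusΔ h (E y) = coder (plus_int h) k E (plusΔ h y) := fun y => by
    obtain ⟨x, rfl⟩ := toPlus_surj y
    have e : hatΔ h ∘ₗ hatExt h (genPart Q) = coder (hat_int h) k (hatExt h (genPart Q)) ∘ₗ hatΔ h :=
      hatMk_ext <| word_ext h fun X => hatExt_coproduct h X k _ HQ.genPart_mem
    have e' : E ∘ₗ toPlus Γ = toPlus Γ ∘ₗ hatExt h (genPart Q) := lext E_toPlus
    rw [E_toPlus, plusΔ_toPlus, plusΔ_toPlus, ← lcomp (hatΔ h), e]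
    simp only [coder, lcomp, ladd, map_add, tmap_map, lid_comp, lcomp_id, e', parity_toPlus h]
  have lift : ∀ F : SymPlus Γ ⊸ SymPlus Γ, (∀ y, plusΔ h (F y) = coder (plus_int h) k F (plusΔ h y)) →
      ∀ x, plusΔ h (dualLift lid F x) = tmap (dualLift lid F)
        (dualLift lid F) (dualOp (plus_int h) k 0 (plusΔ h) x) := fun F hF =>
    dualLift_id_op fun x => by rw [mul_zero, sg_zero, one_smul, hF]
  obtain ⟨F, hF⟩ := isConilpotent_iff.1 (dual_isConilpotent (plus_isGradedBicoalgebra h H) HC k)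
  have := eq_of_plusPr_eq h hF (lift Q HQ.coproduct) (lift E hEΔ) (lcongr (f := plusPr Γ ∘ₗ dualLift lid Q)
      (g := plusPr Γ ∘ₗ dualLift lid E) (dual_ext (fun x => by simp) fun x => by
        obtain ⟨x, rfl⟩ := toPlus_surj x
        rw [lcomp, lcomp, dualLift_im, dualLift_im, E_toPlus, plusPr_toPlus, hatPr_hatExt]; rfl))
  rw [← E_toPlus, ← dualLift_im (K := K) lid Q, this, dualLift_im]

lemma IsCoder.cobracket_genPart (hδ : ∀ i, ∀ x ∈ Γ i, δ x ∈ tensorGrading Γ (i - p))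
    (HQ : IsCoder (plus_int h) p (plusΔ h) (plusδ h δ) k Q) (x : SΓ) :
    δ (genPart Q x) = sg K (k * p) • (tmap (genPart Q) (hatPr Γ) (hatδ h δ x)
      + tmap (parity Γ h k ∘ₗ hatPr Γ) (genPart Q) (hatδ h δ x)) := by
  have e1 : plusPr Γ ∘ₗ toPlus Γ = hatPr Γ := lext plusPr_toPlus
  have e2 : plusPr Γ ∘ₗ Q ∘ₗ toPlus Γ = genPart Q := rfl
  have e3 : plusPr Γ ∘ₗ parity _ (plus_int h) k ∘ₗ toPlus Γ = parity Γ h k ∘ₗ hatPr Γ := by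
    rw [parity_toPlus h, ← LinearMap.comp_assoc, e1]
    exact (parity_natural (hat_int h) h (fun _ _ => hatPr_mem) k).symm
  rw [genPart, lcomp, lcomp, ← plusPr_plusδ h hδ, HQ.cobracket, plusδ_toPlus, map_smul, coder, ladd, map_add]
  simp only [tmap_map, lid_comp, e1, e2, e3]

variable (Q) in
def genUnary : W ⊸ W := genPart Q ∘ₗ (lam Γ).flip (hatOne Γ)

variable (Q) in
def genBinary : W ⊸ W ⊸ W := ((lam Γ).compr₂ (genPart Q)).compl₂ ((lam Γ).flip (hatOne Γ))

lemma genUnary_apply (u : W) : genUnary Q u = genPart Q (lam Γ u (hatOne Γ)) := rfl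

lemma genBinary_apply (u v : W) : genBinary Q u v = genPart Q (lam Γ u (lam Γ v (hatOne Γ))) := rfl

lemma mulMap_one {u v : W} (hv : v ∈ Γ j) : mulMap (lam1 Γ) (lam2 h) (u ⊗ₜ v) (hatOne Γ ⊗ₜ hatOne Γ)
      = lam Γ u (hatOne Γ) ⊗ₜ lam Γ v (hatOne Γ) := by
  rw [mulMap_tmul, lam2_tmul h hv, parity_one h, lam1_tmul]

lemma IsCoder.cobracket_genUnary (hδ : ∀ i, ∀ x ∈ Γ i, δ x ∈ tensorGrading Γ (i - p))
    (HQ : IsCoder (plus_int h) p (plusΔ h) (plusδ h δ) k Q) {x : W}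
    (hx : x ∈ Γ i) : δ (genUnary Q x) = sg K (k * p) • coder h k (genUnary Q) (δ x) := by
  rw [genUnary_apply, HQ.cobracket_genPart hδ, hatδ_lam h hδ hx, hatδ_one, map_zero, smul_zero,
    add_zero, hatΔ_one]
  congr 1
  refine tgr_ind (P := fun t => tmap (genPart Q) (hatPr Γ) (mulMap (lam1 Γ) (lam2 h) t (hatOne Γ ⊗ₜ hatOne Γ))
    + tmap (parity Γ h k ∘ₗ hatPr Γ) (genPart Q)
      (mulMap (lam1 Γ) (lam2 h) t (hatOne Γ ⊗ₜ hatOne Γ)) = coder h k (genUnary Q) t)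
    (fun a b e u hu v hv => ?_) (fun u v hu hv => ?_) (hδ i x hx)
  · rw [mulMap_one hv, coder, ladd]
    simp [genUnary_apply]
  · rw [map_add (coder h k _), ← hu, ← hv]
    simp only [map_add, ladd]
    abel

lemma IsCoder.cobracket_genBinary (hδ : ∀ i, ∀ x ∈ Γ i, δ x ∈ tensorGrading Γ (i - p))
    (HQ : IsCoder (plus_int h) p (plusΔ h) (plusδ h δ) k Q) {x y : W}
    (hx : x ∈ Γ i) (hy : y ∈ Γ j) : δ (genBinary Q x y) = sg K (k * p) •
      (tmap ((genBinary Q).flip y) (parity Γ h j) (δ x) + tmap (parity Γ h k) ((genBinary Q).flip y) (δ x)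
        + sg K (p * i) • (tmap (genBinary Q x) lid (δ y)
          + tmap (parity Γ h (k + i)) (genBinary Q x) (δ y))) := by
  rw [genBinary_apply, HQ.cobracket_genPart hδ, hatδ_lam h hδ hx, hatδ_lam h hδ hy, hatδ_one,
    map_zero, smul_zero, add_zero, hatΔ_lam, hatΔ_one, diag_apply, lam1_tmul, lam2_tmul h hy,
    parity_one h, map_add (tmap (genPart Q) _),
    map_add (tmap (parity Γ h k ∘ₗ hatPr Γ) _), map_smul, map_smul, add_add_add_comm,
    ← smul_add]
  congr 2
  · refine tgr_ind (P := fun t => tmap (genPart Q) (hatPr Γ)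
        (mulMap (lam1 Γ) (lam2 h) t (lam Γ y (hatOne Γ) ⊗ₜ hatOne Γ + hatOne Γ ⊗ₜ lam Γ y (hatOne Γ)))
      + tmap (parity Γ h k ∘ₗ hatPr Γ) (genPart Q) (mulMap (lam1 Γ) (lam2 h) t (lam Γ y (hatOne Γ) ⊗ₜ hatOne Γ
          + hatOne Γ ⊗ₜ lam Γ y (hatOne Γ)))
      = tmap ((genBinary Q).flip y) (parity Γ h j) t + tmap (parity Γ h k) ((genBinary Q).flip y) t)
      (fun a b e u hu v hv => ?_) (fun u v hu hv => ?_) (hδ i x hx)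
    · simp [mulMap_tmul, lam2_tmul h hv, parity_one h, parity_lam h _ hy, genBinary_apply,
        par_apply Γ h j hv, mul_comm b j, smul_tmul']
    · simp only [map_add, ladd] at hu hv ⊢
      rw [add_add_add_comm (tmap ((genBinary Q).flip y) _ u), ← hu, ← hv]
      abel
  · refine congrArg (sg K (p * i) • ·) ?_
    refine tgr_ind (P := fun t => tmap (genPart Q) (hatPr Γ)
        (diag h x (mulMap (lam1 Γ) (lam2 h) t (hatOne Γ ⊗ₜ hatOne Γ)))
      + tmap (parity Γ h k ∘ₗ hatPr Γ) (genPart Q)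
        (diag h x (mulMap (lam1 Γ) (lam2 h) t (hatOne Γ ⊗ₜ hatOne Γ)))
      = tmap (genBinary Q x) lid t + tmap (parity Γ h (k + i)) (genBinary Q x) t)
      (fun a b e u hu v hv => ?_) (fun u v hu hv => ?_) (hδ j y hy)
    · rw [mulMap_one hv, diag_apply, lam1_tmul, lam2_tmul h hx, parity_lam h _ hu, parity_one h]
      simp [genBinary_apply, par_apply Γ h _ hu, ← smul_tmul', smul_smul, sg_mul', add_mul, add_comm]
    · simp only [map_add, ladd] at hu hv ⊢
      rw [add_add_add_comm (tmap (genBinary Q x) _ u), ← hu, ← hv]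
      abel

end PlusCoderivation

section Weights

variable {p : ℤ} {d : V →ₗ[K] V} {M : V ⊗[K] V →ₗ[K] V} {Q : Env Ξ p →ₗ[K] Env Ξ p}

lemma genPart_hatNum {W : Type w} [AddCommGroup W] [Module K W] {Γ : ℤ → Submodule K W}
    {h : IsInt Γ} {Q : SymPlus Γ ⊸ SymPlus Γ} {c : K}
    (e : Q ∘ₗ plusNum h - plusNum h ∘ₗ Q = c • Q) (x : SymHat Γ) :
    genPart Q (hatNum h x) = (1 + c) • genPart Q x := by
  have := congrArg (plusPr Γ) (lcongr e (toPlus Γ x))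
  rw [lsub, map_sub, lcomp, lcomp, plusPr_plusNum, plusNum_toPlus, lsmul, map_smul, sub_eq_iff_eq_add] at this
  rw [add_smul, one_smul, add_comm]
  exact this

lemma map_both {C : Type w} [AddCommGroup C] [Module K C] {N : C ⊸ C} {f : C ⊸ V}
    (e : ∀ x, f (N x) = f x) (z : C ⊗[K] C) :
    tmap f f (both N z) = (2 : K) • tmap f f z := by
  rw [← both_natural (M := lid) (fun x => (e x).symm), both, tmap_id, two_smul]
  rfl

lemma IsCoder.smul {C : Type w} [AddCommGroup C] [Module K C] {Θ : ℤ → Submodule K C}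
    {h : IsInt Θ} {Δ δ : C ⊸ C ⊗[K] C} {k : ℤ} {Q : C ⊸ C}
    (HQ : IsCoder h p Δ δ k Q) (c : K) : IsCoder h p Δ δ k (c • Q) := by
  have e : coder h k (c • Q) = c • coder h k Q := by
    rw [coder, coder, tmap_smul_left, tmap_smul_right, smul_add]
  refine ⟨fun i x hx => Submodule.smul_mem _ _ (HQ.mem i x hx), fun x => ?_, fun x => ?_⟩
  · rw [lsmul, map_smul, HQ.coproduct, e, lsmul]
  · rw [lsmul, map_smul, HQ.cobracket, e, lsmul, smul_comm]

lemma envPr_plusNum (h : IsInt Ξ) (y : Env Ξ p) : envPr Ξ p (plusNum (env_int h p) y) = envPr Ξ p y :=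
  congrArg (barPr Ξ) (plusPr_plusNum (env_int h p) y)

lemma genPart_hatNum_of [CharZero K] (h : IsInt Ξ)
    (HQ : IsCoder (env_gr_int h p) p (envCop h p) (envCob h p) 1 Q)
    {c : K} (hc : ∀ x, envPr Ξ p (Q (plusNum (env_int h p) x))
      = (1 + c) • envPr Ξ p (Q x)) (x : SymHat (shift (Bar.grading Ξ) p)) :
    genPart Q (hatNum (env_int h p) x) = (1 + c) • genPart Q x := by
  refine genPart_hatNum (coderivation_ext h
    (HQ.commutator_plusNum (env_int h p) (envδ_isLieCoalg h p).mem) (HQ.smul c)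
    fun x => ?_) x
  rw [lsub, lcomp, lcomp, map_sub, envPr_plusNum h, hc,
    lsmul, map_smul, add_smul, one_smul, add_sub_cancel_left]

lemma envPr_unary_number (h : IsInt Ξ) (hQ : ∀ x, envPr Ξ p (Q x) = d (envPr Ξ p x) + (2⁻¹ : K) •
      M (tmap (envPr Ξ p) (envPr Ξ p) (envCob h p x))) (x : Env Ξ p) :
    envPr Ξ p (Q (plusNum (env_int h p) x)) = (1 + 0 : K) • envPr Ξ p (Q x) := by
  have e : envCob h p (plusNum (env_int h p) x)
      = both (plusNum (env_int h p)) (envCob h p x) - envCob h p x := by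
    obtain ⟨y, rfl⟩ := toPlus_surj x
    rw [plusNum_toPlus, plusδ_toPlus, plusδ_toPlus, hatδ_hatNum _
      (envδ_isLieCoalg h p).mem, map_sub, both_natural (plusNum_toPlus _)]
  rw [hQ, hQ, envPr_plusNum h, e, map_sub, map_both (envPr_plusNum h), two_smul,
    add_sub_cancel_right, add_zero, one_smul]

lemma envPr_binary_number (h : IsInt Ξ) (hQ : ∀ x, envPr Ξ p (Q x) = (2⁻¹ : K) •
      M (tmap (envPr Ξ p) (envPr Ξ p) (envCop h p x))) (x : Env Ξ p) :
    envPr Ξ p (Q (plusNum (env_int h p) x)) = (1 + 1 : K) • envPr Ξ p (Q x) := by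
  have e : envCop h p (plusNum (env_int h p) x) = both (plusNum (env_int h p)) (envCop h p x) := by
    obtain ⟨y, rfl⟩ := toPlus_surj x
    rw [plusNum_toPlus, plusΔ_toPlus, plusΔ_toPlus, hatΔ_hatNum, both_natural (plusNum_toPlus _)]
  rw [hQ, hQ, e, map_both (envPr_plusNum h), map_smul, smul_comm, one_add_one_eq_two]

/-- The codifferential is computed by its generators part on one generator. -/
lemma unary_toPlus_lam [CharZero K] (h : IsInt Ξ)
    (HQ : IsCoder (env_gr_int h p) p (envCop h p) (envCob h p) 1 Q)
    (hN : ∀ x, genPart Q (hatNum (env_int h p) x) = (1 + 0 : K) • genPart Q x) :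
    ∃ E : SymHat (shift (Bar.grading Ξ) p) ⊸ SymHat (shift (Bar.grading Ξ) p),
      (∀ x, Q (toPlus _ x) = toPlus _ (E x)) ∧ E (hatOne _) = 0 ∧
      ∀ i, ∀ w ∈ shift (Bar.grading Ξ) p i, ∀ x,
        E (lam _ w x) = lam _ (genUnary Q w) x + sg K i • lam _ w (E x) := by
  have e : genPart Q = genUnary Q ∘ₗ hatPr _ := eq_unary (env_int h p) fun x => by
    rw [hN, add_zero, one_smul]
  have hD : ∀ n, ∀ x ∈ shift (Bar.grading Ξ) p n,
      genUnary Q x ∈ shift (Bar.grading Ξ) p (n + 1) := fun n x hx => by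
    have := HQ.genPart_mem _ _ (lam_mem hx hatOne_mem)
    rwa [zero_add] at this
  refine ⟨hatExt (env_int h p) (genPart Q), fun x => HQ.apply_toPlus (envδ_isLieCoalg h p)
    (env_isConilpotent h p) x, ?_, fun i w hw x => ?_⟩
  · rw [hatExt_one, genPart_one, map_zero]; rfl
  · rw [e, hatExt_unary _ hD hw, one_mul]

lemma binary_toPlus_lam [CharZero K] (h : IsInt Ξ)
    (HQ : IsCoder (env_gr_int h p) p (envCop h p) (envCob h p) 1 Q)
    (hN : ∀ x, genPart Q (hatNum (env_int h p) x) = (1 + 1 : K) • genPart Q x) :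
    ∃ (E : SymHat (shift (Bar.grading Ξ) p) ⊸ SymHat (shift (Bar.grading Ξ) p))
      (L : Bar Ξ → SymHat (shift (Bar.grading Ξ) p) ⊸ SymHat (shift (Bar.grading Ξ) p)),
      (∀ x, Q (toPlus _ x) = toPlus _ (E x)) ∧ E (hatOne _) = 0 ∧ (∀ w, L w (hatOne _) = 0) ∧
      (∀ i, ∀ w ∈ shift (Bar.grading Ξ) p i, ∀ x, E (lam _ w x) = L w x + sg K i • lam _ w (E x)) ∧
      ∀ i, ∀ w ∈ shift (Bar.grading Ξ) p i, ∀ j, ∀ y ∈ shift (Bar.grading Ξ) p j, ∀ x,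
        L w (lam _ y x) = lam _ (genBinary Q w y) x + sg K ((1 + i) * j) • lam _ y (L w x) := by
  refine ⟨hatExt (env_int h p) (genPart Q), fun w => hatExt (env_int h p) (genBinary Q w ∘ₗ hatPr _), fun x =>
    HQ.apply_toPlus (envδ_isLieCoalg h p) (env_isConilpotent h p) x, ?_, fun w => ?_,
    fun i w hw x => ?_, fun i w hw j y hy x => ?_⟩
  · rw [hatExt_one, genPart_one, map_zero]; rfl
  · rw [hatExt_one, lcomp, hatPr_one, map_zero, map_zero]; rfl
  · rw [hatExt_lam _ HQ.genPart_mem hw, one_mul, eq_binary (env_int h p) (fun x => by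
      rw [hN, one_add_one_eq_two]) hw]
    rfl
  · rw [hatExt_unary _ (k := 1 + i) (fun n x hx => ?_) hy]
    have := HQ.genPart_mem _ _ (lam_mem hw (lam_mem hx hatOne_mem))
    rwa [zero_add, add_assoc, add_comm i] at this

end Weights

/-! ### The codifferential on packets -/

section UnaryWords

variable (d : Letter Ξ → V) (μ : Letter Ξ → Letter Ξ → V)

/-- The product of a letter with the first letter of a word. -/
def unaryLead (α : Letter Ξ) : WΞ → TV
  | [] => 0
  | β :: X => tι K (μ α β) * word X

/-- The extension of operations of degree `1` with one and two arguments to words. -/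
def unaryWord : WΞ → TV
  | [] => 0
  | α :: X => tι K (d α) * word X + unaryLead μ α X
      + sg K α.deg • (tι K α.val * unaryWord X)

lemma smul_cutSum {ι M : Type*} [AddCommGroup M] [Module K M] (c : K) (X : List ι)
    (f : List ι → List ι → M) : c • cutSum X f = cutSum X fun A B => c • f A B :=
  map_cutSum (LinearMap.lsmul K M c) X f

lemma dec_unaryLead (α : Letter Ξ) (X : WΞ) : dec K V (unaryLead μ α X) = 1 ⊗ₜ unaryLead μ α X
      + cutSum X fun A B => unaryLead μ α A ⊗ₜ word B := by
  cases X with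
  | nil => simp [unaryLead, cutSum]
  | cons β X =>
    rw [cutSum, show unaryLead μ α (β :: X) = tι K (μ α β) * word X from rfl, dec_mul, dec_word, map_cutSum]
    simp [unaryLead, mulι_apply]

lemma dec_unaryWord (X : WΞ) : dec K V (unaryWord d μ X) = cutSum X fun A B => unaryWord d μ A ⊗ₜ word B
      + sg K (totalDeg A) • (word A ⊗ₜ unaryWord d μ B) := by
  induction X with
  | nil => simp [unaryWord, cutSum]
  | cons α X ih =>
    rw [cutSum, show unaryWord d μ (α :: X) = tι K (d α) * word X + unaryLead μ α X
        + sg K α.deg • (tι K α.val * unaryWord d μ X) from rfl, map_add, map_add, map_smul,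
      dec_mul, dec_mul, dec_unaryLead, ih, dec_word,
      map_cutSum, map_cutSum, smul_add, smul_cutSum]
    simp only [unaryWord, zero_tmul, deg_nil, sg_zero, word_nil, one_smul,
      add_tmul, tmul_add, deg_cons, map_add, map_smul, smul_add,
      map_tmul, mulι_apply, lid_apply, tmul_smul, cutSum_add,
      ← smul_tmul', word_cons, sg_add, mul_smul]
    abel

lemma flip_coder {C : Type w} [AddCommGroup C] [Module K C] {Θ : ℤ → Submodule K C}
    (h : IsInt Θ) {G : C ⊸ C} (hG : ∀ i, ∀ x ∈ Θ i, G x ∈ Θ (i + 1))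
    (z : C ⊗[K] C) : koszulFlip Θ h (coder h 1 G z) = coder h 1 G (koszulFlip Θ h z) := by
  suffices koszulFlip Θ h ∘ₗ coder h 1 G = coder h 1 G ∘ₗ koszulFlip Θ h from lcongr this z
  refine hom_ext₂ h h fun i x hx j y hy => ?_
  rw [lcomp, lcomp, kflip_apply _ _ hx hy, map_smul, coder, ladd, ladd, map_add, map_tmul,
    map_tmul, map_tmul, map_tmul, par_apply _ _ _ hx,
    par_apply _ _ _ hy, ← smul_tmul', ← smul_tmul', map_smul,
    kflip_apply _ _ hx (hG j y hy), lid_apply, lid_apply,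
    kflip_apply _ _ (hG i x hx) hy, smul_add, smul_smul, smul_smul, sg_mul', sg_mul',
    add_comm]
  refine congrArg₂ _ ?_ ?_ <;> refine congrArg (· • _) (sg_congr ?_)
  · exact ⟨i, by ring⟩
  · exact ⟨0, by ring⟩

variable {d μ}

/-- A coderivation of the cobracket of tensors modulo shuffles is computed on packets by its
generators part. -/
lemma bar_unary [CharZero K] (h : IsInt Ξ) {G : Bar Ξ ⊸ Bar Ξ}
    (hG : ∀ i, ∀ x ∈ Bar.grading Ξ i, G x ∈ Bar.grading Ξ (i + 1))
    (hδ : ∀ x, barCob h (G x) = coder (bar_int h) 1 G (barCob h x))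
    (hπ : ∀ X, barPr Ξ (G (packet X)) = tensorPr K V (unaryWord d μ X)) (X : WΞ) :
    G (packet X) = barMk Ξ (unaryWord d μ X) := by
  induction hn : X.length using Nat.strong_induction_on generalizing X with
  | _ n ih =>
    refine sub_eq_zero.1 (bar_eq_zero h ?_ ?_)
    · have e : tmap (barMk Ξ) (barMk Ξ) (dec K V (unaryWord d μ X))
          = coder (bar_int h) 1 G (tmap (barMk Ξ) (barMk Ξ) (dec K V (word X))) := by
        rw [dec_unaryWord, barMk_map_dec, map_cutSum, map_cutSum]
        refine cutSum_congr fun A B e => ?_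
        rw [map_add, map_smul, map_tmul, map_tmul, coder, ladd, map_tmul, map_tmul,
          par_apply _ _ _ (packet_mem A), one_mul, ← smul_tmul', ← packet_eq,
          ← packet_eq, lid_apply]
        have l : A.length + B.length = n := by rw [← hn, ← e, List.length_append]
        congr 1
        · rcases eq_or_ne B [] with rfl | hB
          · rw [packet_nil, tmul_zero, tmul_zero]
          · have := List.length_pos_iff.2 hB
            rw [ih _ (by omega) A rfl]
        · rcases eq_or_ne A [] with rfl | hA
          · rw [packet_nil, zero_tmul, zero_tmul]
          · have := List.length_pos_iff.2 hA
            rw [ih _ (by omega) B rfl]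
      rw [map_sub, hδ, packet_eq, barCob_barMk, barCob_barMk, barMk_tenCob,
        barMk_tenCob, e, map_sub, flip_coder _ hG, sub_self]
    · rw [map_sub, hπ, barPr_barMk, sub_self]

end UnaryWords

section GenUnary

variable {p : ℤ} {Q : Env Ξ p →ₗ[K] Env Ξ p}

lemma mem_of_mem_shift {C : Type w} [AddCommGroup C] [Module K C] {Θ : ℤ → Submodule K C}
    {q k : ℤ} {G : C → C} (hG : ∀ i, ∀ x ∈ shift Θ q i, G x ∈ shift Θ q (i + k)) (i : ℤ) (x : C)
    (hx : x ∈ Θ i) : G x ∈ Θ (i + k) := by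
  have := hG _ _ (mem_shift hx)
  rwa [shift, show i - q + k + q = i + k by ring] at this

lemma suspend_coder (h : IsInt Ξ) {G : Bar Ξ ⊸ Bar Ξ}
    (hG : ∀ i, ∀ x ∈ Bar.grading Ξ i, G x ∈ Bar.grading Ξ (i + 1)) (z : Bar Ξ ⊗[K] Bar Ξ) :
    sg K p • coder (env_int h p) 1 G (tmap (parity _ (env_int h p) p) lid z)
      = tmap (parity _ (env_int h p) p) lid (coder (bar_int h) 1 G z) := by
  suffices sg K p • coder (env_int h p) 1 G ∘ₗ tmap (parity _ (env_int h p) p) lid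
      = tmap (parity _ (env_int h p) p) lid ∘ₗ coder (bar_int h) 1 G from
    lcongr this z
  refine hom_ext₂ (bar_int h) (bar_int h) fun i x hx j y hy => ?_
  have hx' := mem_shift (q := p) hx
  rw [lsmul, lcomp, lcomp, map_tmul, par_apply _ _ _ hx', ← smul_tmul', map_smul, coder, coder, ladd,
    ladd, map_add, map_tmul, map_tmul,
    map_tmul, map_tmul, map_tmul, par_apply _ _ _ hx',
    map_tmul, par_apply _ _ _ hx, map_smul,
    par_apply _ _ _ (mem_shift (hG i x hx)), par_apply _ _ _ hx']
  simp only [← smul_tmul', smul_add, smul_smul, sg_mul', lid_apply]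
  refine congrArg₂ _ ?_ ?_ <;> refine congrArg (· • _) (sg_congr ?_)
  · exact ⟨0, by ring⟩
  · exact ⟨0, by ring⟩

lemma genUnary_mem (h : IsInt Ξ) (HQ : IsCoder (env_gr_int h p) p (envCop h p) (envCob h p) 1 Q)
    (i : ℤ) (x : Bar Ξ) (hx : x ∈ Bar.grading Ξ i) : genUnary Q x ∈ Bar.grading Ξ (i + 1) :=
  mem_of_mem_shift (q := p) (fun n x hx => by
    have := HQ.genPart_mem _ _ (lam_mem hx hatOne_mem)
    rwa [zero_add] at this) i x hx

lemma barCob_genUnary (h : IsInt Ξ) (HQ : IsCoder (env_gr_int h p) p (envCop h p) (envCob h p) 1 Q)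
    (x : Bar Ξ) : barCob h (genUnary Q x) = coder (bar_int h) 1 (genUnary Q) (barCob h x) := by
  suffices barCob h ∘ₗ genUnary Q = coder (bar_int h) 1 (genUnary Q) ∘ₗ barCob h from lcongr this x
  refine hom_ext (bar_int h) fun i x hx => ?_
  refine sub_eq_zero.1 (suspend_injective (bar_int h) p (x := x) (δ := barCob h
    ∘ₗ genUnary Q - coder (bar_int h) 1 (genUnary Q) ∘ₗ barCob h) ?_)
  have e := HQ.cobracket_genUnary (envδ_isLieCoalg h p).mem (mem_shift (q := p) hx)
  rw [one_mul] at e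
  exact (map_sub _ _ _).trans (sub_eq_zero.2 (e.trans (suspend_coder h (genUnary_mem h HQ) _)))

lemma map_barPr_envδ (h : IsInt Ξ) (X : WΞ) : tmap (barPr Ξ) (barPr Ξ) (envδ h p (packet X)) = match X with
      | [α, β] => sg K (p * (α.deg - p)) • (α.val ⊗ₜ β.val)
        - sg K (α.deg * β.deg + p * (β.deg - p)) • (β.val ⊗ₜ α.val)
      | _ => 0 := by
  rw [envδ_packet, map_cutSum]
  match X with
  | [] => simp [cutSum]
  | [α] => simp [cutSum]
  | [α, β] => simp [cutSum, packet_eq, barPr_barMk, totalDeg]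
  | α :: β :: γ :: X =>
    rw [← cutSum_zero (α :: β :: γ :: X)]
    refine cutSum_congr fun A B e => ?_
    have z : ∀ (α β : Letter Ξ) (X : WΞ), barPr Ξ (packet (α :: β :: X)) = 0 := fun _ _ _ => by
      simp [packet_eq, barPr_barMk]
    match A, B, e with
    | [], _, _ => simp
    | [_], _, rfl => simp [z]
    | _ :: _ :: _, _, _ => simp [z]

lemma barPr_genUnary (h : IsInt Ξ) {d : V ⊸ V} {M : V ⊗[K] V ⊸ V}
    (hQ : ∀ x, envPr Ξ p (Q x) = d (envPr Ξ p x) + (2⁻¹ : K) •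
      M (tmap (envPr Ξ p) (envPr Ξ p) (envCob h p x))) (x : Bar Ξ) :
    barPr Ξ (genUnary Q x) = d (barPr Ξ x) + (2⁻¹ : K) • M (tmap (barPr Ξ) (barPr Ξ) (envδ h p x)) := by
  have e := hQ (toPlus _ (lam _ x (hatOne _)))
  have e2 : tmap (envPr Ξ p) (envPr Ξ p) (envCob h p (toPlus _ (lam _ x (hatOne _))))
      = tmap (barPr Ξ) (barPr Ξ) (envδ h p x) := by
    have := plusPr_plusδ (env_int h p) (envδ_isLieCoalg h p).mem (toPlus _ (lam _ x (hatOne _)))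
    rw [plusPr_toPlus, hatPr_lam, counit_one, one_smul] at this
    rw [← this, tmap_map]
    rfl
  rw [e2] at e
  refine e.trans ?_
  rw [show envPr Ξ p (toPlus _ (lam _ x (hatOne _))) = barPr Ξ x by
    rw [envPr, lcomp, plusPr_toPlus, hatPr_lam, counit_one, one_smul]]

end GenUnary

section BinaryWords

variable (c : ℤ) (ℓ : Letter Ξ → Letter Ξ → V)

/-- The extension of a bracket of degree `c` to two words. -/
def binaryWord : WΞ → WΞ → TV
  | [], _ => 0
  | _, [] => 0
  | α :: X, β :: Y => sg K (β.deg * totalDeg X) • (tι K (ℓ α β) * sh X Y)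
      + sg K (c * α.deg) • (tι K α.val * binaryWord X (β :: Y))
      + sg K (β.deg * (α.deg + totalDeg X) + c * β.deg) • (tι K β.val * binaryWord (α :: X) Y)
  termination_by X Y => X.length + Y.length

@[simp] lemma binaryWord_nil_left (Y : WΞ) : binaryWord c ℓ [] Y = 0 := by
  rw [binaryWord]

@[simp] lemma binaryWord_nil_right (X : WΞ) : binaryWord c ℓ X [] = 0 := by
  cases X <;> rw [binaryWord]; simp

lemma binaryWord_cons (α β : Letter Ξ) (X Y : WΞ) : binaryWord c ℓ (α :: X) (β :: Y)
      = sg K (β.deg * totalDeg X) • (tι K (ℓ α β) * sh X Y)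
        + sg K (c * α.deg) • (tι K α.val * binaryWord c ℓ X (β :: Y))
        + sg K (β.deg * (α.deg + totalDeg X) + c * β.deg) • (tι K β.val * binaryWord c ℓ (α :: X) Y) := by
  rw [binaryWord]

lemma binaryWord_mem (hℓ : ∀ α β, ℓ α β ∈ Ξ (α.deg + β.deg + c)) (X Y : WΞ) :
    binaryWord c ℓ X Y ∈ wordGr Ξ (totalDeg X + totalDeg Y + c) := by
  induction X, Y using inter_ind with
  | nil_left Y => rw [binaryWord_nil_left]; exact zero_mem _
  | nil_right X => rw [binaryWord_nil_right]; exact zero_mem _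
  | cons α X β Y ih1 ih2 =>
    rw [binaryWord_cons]
    refine add_mem (add_mem (Submodule.smul_mem _ _ ?_) (Submodule.smul_mem _ _ ?_)) (Submodule.smul_mem _ _ ?_)
    · convert mulι_mem (hℓ α β) (sh_mem X Y) using 1; simp only [deg_cons]; ring_nf
    · convert mulι_mem α.mem ih1 using 1; simp only [deg_cons]; ring_nf
    · convert mulι_mem β.mem ih2 using 1; simp only [deg_cons]; ring_nf

def binaryTerm (A B C D : WΞ) : TV ⊗[K] TV := sg K (totalDeg B * totalDeg C) • (binaryWord c ℓ A C ⊗ₜ sh B D)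
    + sg K (totalDeg B * totalDeg C + c * (totalDeg A + totalDeg C)) • (sh A C ⊗ₜ binaryWord c ℓ B D)

lemma dec_binaryWord (X Y : WΞ) : dec K V (binaryWord c ℓ X Y)
    = cutSum X fun A B => cutSum Y fun C D => binaryTerm c ℓ A B C D := by
  induction X, Y using inter_ind with
  | nil_left Y =>
    rw [binaryWord_nil_left, map_zero, cutSum, ← cutSum_zero Y]
    exact cutSum_congr fun C D _ => by simp [binaryTerm]
  | nil_right X =>
    rw [binaryWord_nil_right, map_zero, ← cutSum_zero X]
    exact cutSum_congr fun C D _ => by simp [cutSum, binaryTerm]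
  | cons α X β Y ih1 ih2 =>
    have r1 : ∀ C D, binaryTerm c ℓ [] (α :: X) (β :: C) D = sg K (β.deg * (α.deg + totalDeg X) + c * β.deg) •
          tmap (mulι β.val) lid (binaryTerm c ℓ [] (α :: X) C D) := fun C D => by
      simp only [binaryTerm, binaryWord_nil_left, zero_tmul, smul_zero, zero_add,
        map_smul, map_tmul, mulι_apply, lid_apply, smul_smul, sg_mul',
        sh_nil_left, word_cons, deg_cons, deg_nil]
      congr 2; ring
    have r2 : ∀ A B, binaryTerm c ℓ (α :: A) B [] (β :: Y)
        = sg K (c * α.deg) • tmap (mulι α.val) lid (binaryTerm c ℓ A B [] (β :: Y)) :=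
      fun A B => by
      simp only [binaryTerm, binaryWord_nil_right, zero_tmul, smul_zero, zero_add,
        map_smul, map_tmul, mulι_apply, lid_apply, smul_smul, sg_mul',
        sh_nil_right, word_cons, deg_cons, deg_nil]
      congr 2; ring
    have r3 : ∀ A B C D, A ++ B = X → binaryTerm c ℓ (α :: A) B (β :: C) D
        = sg K (β.deg * totalDeg X) • tmap (mulι (ℓ α β)) lid
            (sg K (totalDeg B * totalDeg C) • (sh A C ⊗ₜ[K] sh B D))
          + sg K (c * α.deg) • tmap (mulι α.val) lid (binaryTerm c ℓ A B (β :: C) D)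
          + sg K (β.deg * (α.deg + totalDeg X) + c * β.deg) •
            tmap (mulι β.val) lid (binaryTerm c ℓ (α :: A) B C D) := fun A B C D e => by
      rw [binaryTerm, binaryWord_cons, sh_cons, ← e]
      simp only [binaryTerm, map_add, map_smul, map_tmul, mulι_apply,
        lid_apply, add_tmul, smul_add, ← smul_tmul',
        smul_smul, sg_mul', deg_cons, deg_append]
      rw [← sub_eq_zero]
      have s : ∀ {m n : ℤ} (z : TV ⊗[K] TV), Even (m - n) →
        sg K m • z = sg K n • z := fun z h => by rw [sg_congr h]
      rw [s (_ ⊗ₜ _) (m := totalDeg B * (β.deg + totalDeg C) + β.deg * totalDeg A)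
          (n := β.deg * (totalDeg A + totalDeg B) + totalDeg B * totalDeg C) ⟨0, by ring⟩,
        s (_ ⊗ₜ _) (m := totalDeg B * (β.deg + totalDeg C) + c * α.deg)
          (n := c * α.deg + totalDeg B * (β.deg + totalDeg C)) ⟨0, by ring⟩,
        s (_ ⊗ₜ _) (m := totalDeg B * (β.deg + totalDeg C) + (β.deg * (α.deg + totalDeg A) + c * β.deg))
          (n := β.deg * (α.deg + (totalDeg A + totalDeg B)) + c * β.deg + totalDeg B * totalDeg C)
          ⟨0, by ring⟩,
        s (_ ⊗ₜ _) (m := totalDeg B * (β.deg + totalDeg C) + c * (α.deg + totalDeg A + (β.deg + totalDeg C)))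
          (n := c * α.deg + (totalDeg B * (β.deg + totalDeg C)
            + c * (totalDeg A + (β.deg + totalDeg C)))) ⟨0, by ring⟩,
        s (_ ⊗ₜ _) (m := totalDeg B * (β.deg + totalDeg C)
            + c * (α.deg + totalDeg A + (β.deg + totalDeg C)) + β.deg * (α.deg + totalDeg A))
          (n := β.deg * (α.deg + (totalDeg A + totalDeg B)) + c * β.deg
            + (totalDeg B * totalDeg C + c * (α.deg + totalDeg A + totalDeg C))) ⟨0, by ring⟩]
      abel
    have r0 : binaryTerm c ℓ [] (α :: X) [] (β :: Y) = 1 ⊗ₜ[K] binaryWord c ℓ (α :: X) (β :: Y) := by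
      simp [binaryTerm]
    rw [cutSum, cutSum, cutSum_congr fun C D _ => r1 C D, cutSum_congr (X := X) fun A B e => by
      rw [cutSum, r2, cutSum_congr fun C D _ => r3 A B C D e], r0, binaryWord_cons]
    simp only [map_add, map_smul, dec_mul, ih1, ih2, dec_sh, cutSum, map_cutSum, smul_add,
      smul_cutSum, cutSum_add, tmul_add, tmul_smul]
    abel

lemma tensorPr_binaryWord (X Y : WΞ) : tensorPr K V (binaryWord c ℓ X Y) = match X, Y with
      | [α], [β] => ℓ α β
      | _, _ => 0 := by
  match X, Y with
  | [], _ => simp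
  | _ :: _, [] => simp
  | [α], [β] => simp [binaryWord_cons]
  | [α], β :: γ :: Y => simp [binaryWord_cons]
  | α :: γ :: X, [β] => simp [binaryWord_cons]
  | α :: γ :: X, β :: γ' :: Y =>
    simp [binaryWord_cons, tenCounit_sh]

end BinaryWords

section Cross

variable {ι M : Type*} [AddCommGroup M]

lemma cutSum_sub (X : List ι) (f g : List ι → List ι → M) :
    cutSum X (fun A B => f A B - g A B) = cutSum X f - cutSum X g := by
  rw [eq_sub_iff_add_eq, ← cutSum_add]; simp only [sub_add_cancel]

lemma cutSum_first {X : List ι} {f : List ι → List ι → M}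
    (h : ∀ A B, A ++ B = X → A ≠ [] → f A B = 0) : cutSum X f = f [] X := by
  cases X with
  | nil => rfl
  | cons α X =>
    rw [cutSum, cutSum_congr fun A B e => h (α :: A) B (by rw [List.cons_append, e]) (by simp),
      cutSum_zero, add_zero]

lemma cutSum_cross_last {X Y : List ι} {F : List ι → List ι → List ι → List ι → M}
    (h : ∀ A B C D, B ≠ [] → D ≠ [] → F A B C D = 0) (h0 : F X [] Y [] = 0) :
    cutSum X (fun A B => cutSum Y fun C D => F A B C D)
      = cutSum X (fun A B => F A B Y []) + cutSum Y fun C D => F X [] C D := by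
  rw [add_comm, ← sub_eq_iff_eq_add, ← cutSum_sub, cutSum_last fun A B _ hB => ?_]
  · simp [h0]
  · rw [cutSum_last fun C D _ hD => h _ _ _ _ hB hD]; simp

lemma cutSum_cross_first {X Y : List ι} {F : List ι → List ι → List ι → List ι → M}
    (h : ∀ A B C D, A ≠ [] → C ≠ [] → F A B C D = 0) (h0 : F [] X [] Y = 0) :
    cutSum X (fun A B => cutSum Y fun C D => F A B C D)
      = cutSum X (fun A B => F A B [] Y) + cutSum Y fun C D => F [] X C D := by
  rw [add_comm, ← sub_eq_iff_eq_add, ← cutSum_sub, cutSum_first fun A B _ hA => ?_]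
  · simp [h0]
  · rw [cutSum_first fun C D _ hC => h _ _ _ _ hA hC]; simp

end Cross

section GenBinary

variable {c : ℤ} {ℓ : Letter Ξ → Letter Ξ → V} {p : ℤ}

lemma barMk_dec_binaryWord (X Y : WΞ) : tmap (barMk Ξ) (barMk Ξ) (dec K V (binaryWord c ℓ X Y))
      = cutSum X (fun A B => sg K (totalDeg B * totalDeg Y) • (barMk Ξ (binaryWord c ℓ A Y) ⊗ₜ packet B)
          + sg K (c * totalDeg A) • (packet A ⊗ₜ barMk Ξ (binaryWord c ℓ B Y)))
        + cutSum Y fun C D => barMk Ξ (binaryWord c ℓ X C) ⊗ₜ packet D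
          + sg K (totalDeg X * totalDeg C + c * totalDeg C) • (packet C ⊗ₜ barMk Ξ (binaryWord c ℓ X D)) := by
  rw [dec_binaryWord]
  simp only [binaryTerm, cutSum_add, map_add, map_cutSum, map_smul, map_tmul]
  rw [cutSum_cross_last fun A B C D hB hD => by
      rw [barMk_sh hB hD, tmul_zero, smul_zero],
    cutSum_cross_first fun A B C D hA hC => by
      rw [barMk_sh hA hC, zero_tmul, smul_zero]]
  · simp only [sh_nil_left, sh_nil_right, deg_nil, zero_mul, mul_zero, sg_zero, one_smul,
      zero_add, add_zero, packet_eq]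
    abel
  · simp
  · simp

/-- The suspended commutator of a tensor. -/
def suspendSub (h : IsInt Ξ) (p : ℤ) : Bar Ξ ⊗[K] Bar Ξ ⊸ Bar Ξ ⊗[K] Bar Ξ :=
  tmap (parity _ (env_int h p) p) lid ∘ₗ (lid - koszulFlip _ (bar_int h))

lemma suspendSub_tmul (h : IsInt Ξ) {i j : ℤ} {x y : Bar Ξ}
    (hx : x ∈ Bar.grading Ξ i) (hy : y ∈ Bar.grading Ξ j) : suspendSub h p (x ⊗ₜ y)
      = sg K (p * (i - p)) • (x ⊗ₜ y) - sg K (i * j + p * (j - p)) • (y ⊗ₜ x) := by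
  rw [suspendSub, lcomp, lsub, lid_apply, kflip_apply _ _ hx hy, map_sub, map_smul, map_tmul, map_tmul,
    lid_apply, lid_apply, par_apply _ _ p (mem_shift hx),
    par_apply _ _ p (mem_shift hy), ← smul_tmul', ← smul_tmul',
    smul_smul, sg_mul']

lemma envδ_barMk (h : IsInt Ξ) (t : TV) :
    envδ h p (barMk Ξ t) = suspendSub h p (tmap (barMk Ξ) (barMk Ξ) (dec K V t)) := by
  rw [suspend_apply, barCob_barMk, barMk_tenCob]; rfl

lemma tmul_eq_of {C : Type*} [AddCommGroup C] [Module K C] {x y z : C} (h : z = 0 ∨ x = y) :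
    x ⊗ₜ[K] z = y ⊗ₜ z ∧ z ⊗ₜ[K] x = z ⊗ₜ y := by
  rcases h with rfl | rfl <;> simp

lemma four_terms {a b c d : M} {m n k l m' n' k' l' : ℤ}
    (e₁ : sg K m = sg K m') (e₂ : sg K n = sg K n') (e₃ : sg K k = sg K k')
    (e₄ : sg K l = sg K l') : sg K m • a - sg K n • b + (sg K k • c - sg K l • d)
      = sg K m' • a - sg K l' • d + (sg K k' • c - sg K n' • b) := by
  rw [e₁, e₂, e₃, e₄]; abel

/-- The bilinear generators part of a coderivation is computed on packets by its values on
letters. -/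
lemma bar_binary [CharZero K] (h : IsInt Ξ) {g : Bar Ξ ⊸ Bar Ξ ⊸ Bar Ξ}
    (hc : c = 1 - p) (hℓ : ∀ α β, ℓ α β ∈ Ξ (α.deg + β.deg + c))
    (hδ : ∀ X Y : WΞ, envδ h p (g (packet X) (packet Y)) = sg K p •
      (tmap (g.flip (packet Y)) (parity _ (env_int h p) (totalDeg Y - p)) (envδ h p (packet X))
        + tmap (parity _ (env_int h p) 1) (g.flip (packet Y)) (envδ h p (packet X))
        + sg K (p * (totalDeg X - p)) • (tmap (g (packet X)) lid (envδ h p (packet Y))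
          + tmap (parity _ (env_int h p) (1 + (totalDeg X - p))) (g (packet X)) (envδ h p (packet Y)))))
    (hπ : ∀ X Y, barPr Ξ (g (packet X) (packet Y))
      = sg K (p * totalDeg X + 1) • tensorPr K V (binaryWord c ℓ X Y)) (X Y : WΞ) :
    g (packet X) (packet Y) = sg K (p * totalDeg X + 1) • barMk Ξ (binaryWord c ℓ X Y) := by
  induction hn : X.length + Y.length using Nat.strong_induction_on generalizing X Y with
  | _ n ih =>
    have hb : ∀ X Y, barMk Ξ (binaryWord c ℓ X Y) ∈ Bar.grading Ξ (totalDeg X + totalDeg Y + c) :=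
      fun X Y => barMk_mem (binaryWord_mem c ℓ hℓ X Y)
    have ihX : ∀ A B, B ++ A = X ∨ A ++ B = X → packet B = 0 ∨ g (packet A) (packet Y)
        = sg K (p * totalDeg A + 1) • barMk Ξ (binaryWord c ℓ A Y) := fun A B e => by
      rcases eq_or_ne B [] with rfl | hB
      · exact Or.inl packet_nil
      · have := List.length_pos_iff.2 hB
        refine Or.inr (ih _ ?_ A Y rfl)
        rcases e with rfl | rfl <;> rw [List.length_append] at hn <;> omega
    have ihY : ∀ A B, B ++ A = Y ∨ A ++ B = Y → packet B = 0 ∨ g (packet X) (packet A)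
        = sg K (p * totalDeg X + 1) • barMk Ξ (binaryWord c ℓ X A) := fun A B e => by
      rcases eq_or_ne B [] with rfl | hB
      · exact Or.inl packet_nil
      · have := List.length_pos_iff.2 hB
        refine Or.inr (ih _ ?_ X A rfl)
        rcases e with rfl | rfl <;> rw [List.length_append] at hn <;> omega
    refine sub_eq_zero.1 (bar_eq_zero h (suspend_injective (bar_int h) p ?_) ?_)
    · refine (map_sub (envδ h p) _ _).trans (sub_eq_zero.2 ?_)
      rw [hδ, map_smul, envδ_barMk, barMk_dec_binaryWord, envδ_packet, envδ_packet]
      simp only [map_cutSum, smul_add, ← cutSum_add, smul_cutSum, map_add]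
      refine congrArg₂ _ (cutSum_congr fun A B e => ?_) (cutSum_congr fun C D e => ?_)
      · have e1 := tmul_eq_of (K := K) (ihX A B (Or.inr e))
        have e2 := tmul_eq_of (K := K) (ihX B A (Or.inl e))
        simp only [map_sub, map_smul, map_tmul, LinearMap.flip_apply,
          par_apply _ _ _ (packet_mem_shift A), par_apply _ _ _ (packet_mem_shift B),
          suspendSub_tmul h (hb A Y) (packet_mem B), suspendSub_tmul h (packet_mem A) (hb B Y),
          tmul_smul, ← smul_tmul', e1.1, e1.2, e2.1, e2.2, smul_sub,
          smul_smul, sg_mul']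
        subst hc e
        refine four_terms ?_ ?_ ?_ ?_ <;> refine sg_eq_of_zmod ?_ <;> rw [deg_append] <;>
          push_cast <;> generalize (totalDeg A : ZMod 2) = a, (totalDeg B : ZMod 2) = b,
            (totalDeg Y : ZMod 2) = y, (p : ZMod 2) = q <;> clear * - <;> decide +revert
      · have e1 := tmul_eq_of (K := K) (ihY C D (Or.inr e))
        have e2 := tmul_eq_of (K := K) (ihY D C (Or.inl e))
        simp only [map_sub, map_smul, map_tmul, lid_apply,
          par_apply _ _ _ (packet_mem_shift C), par_apply _ _ _ (packet_mem_shift D),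
          suspendSub_tmul h (hb X C) (packet_mem D), suspendSub_tmul h (packet_mem C) (hb X D),
          tmul_smul, ← smul_tmul', e1.1, e1.2, e2.1, e2.2, smul_sub,
          smul_smul, sg_mul']
        subst hc e
        refine four_terms ?_ ?_ ?_ ?_ <;> refine sg_eq_of_zmod ?_ <;> 
          push_cast <;> generalize (totalDeg C : ZMod 2) = a, (totalDeg D : ZMod 2) = b,
            (totalDeg X : ZMod 2) = y, (p : ZMod 2) = q <;> clear * - <;> decide +revert
    · rw [map_sub, hπ, map_smul, barPr_barMk, sub_self]

end GenBinary

/-! ### The formulas for the operations on packets -/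

section Adjacent

variable {ι : Type*} (c : ℤ) (J : ι → Letter Ξ) (f : ι → ι → V)

/-- The product of a letter with the first letter of a word. -/
def adjLead (i : ι) : List ι → TV
  | [] => 0
  | j :: L => tι K (f i j) * word (L.map J)

/-- The sum of the words in which two adjacent letters are multiplied. -/
def adjWord : List ι → TV
  | [] => 0
  | i :: L => adjLead J f i L
      + sg K (c * (J i).deg) • (tι K (J i).val * adjWord L)

lemma vals_cons (α : Letter Ξ) (X : WΞ) : vals (α :: X) = α.val :: vals X := rfl

lemma sum_adjacent {n : ℕ} (s : Fin n → ι) : (∑ k : Fin n, ∑ k' : Fin n,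
      if k'.val = k.val + 1 then sg K (c * totalDeg (((List.ofFn s).map J).take k.val)) •
        tensorWord K (vals (((List.ofFn s).map J).take k.val) ++ [f (s k) (s k')]
          ++ vals (((List.ofFn s).map J).drop (k.val + 2))) else 0)
    = adjWord c J f (List.ofFn s) := by
  induction n with
  | zero => rfl
  | succ n ih =>
    rw [List.ofFn_succ, adjWord, ← ih, Fin.sum_univ_succ]
    congr 1
    · rw [Fin.sum_univ_succ, if_neg (by simp), zero_add]
      cases n with
      | zero => rfl
      | succ n =>
        rw [Fin.sum_univ_succ, if_pos (by simp), Finset.sum_eq_zero fun j _ => if_neg (by simp), List.ofFn_succ]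
        simp [adjLead, vals, totalDeg, tensorWord, word]
    · rw [Finset.mul_sum, Finset.smul_sum]
      refine Finset.sum_congr rfl fun k _ => ?_
      rw [Fin.sum_univ_succ, if_neg (by simp), zero_add, Finset.mul_sum, Finset.smul_sum]
      refine Finset.sum_congr rfl fun k' _ => ?_
      simp only [Fin.val_succ, add_left_inj, mul_ite, mul_zero, smul_ite, smul_zero, List.map_cons,
        List.take_succ_cons, deg_cons, vals_cons, List.cons_append, tensorWord_cons, mul_add,
        sg_add, mul_smul, mul_smul_comm]
      rfl

variable (d : ι → V)

/-- The sum of the words in which one letter is replaced. -/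
def letterWord : List ι → TV
  | [] => 0
  | i :: L => tι K (d i) * word (L.map J)
      + sg K (c * (J i).deg) • (tι K (J i).val * letterWord L)

lemma sum_letter {n : ℕ} (s : Fin n → ι) : (∑ k : Fin n,
      sg K (c * totalDeg (((List.ofFn s).map J).take k.val)) •
        tensorWord K (vals (((List.ofFn s).map J).take k.val) ++ [d (s k)]
          ++ vals (((List.ofFn s).map J).drop (k.val + 1))))
    = letterWord c J d (List.ofFn s) := by
  induction n with
  | zero => rfl
  | succ n ih =>
    rw [List.ofFn_succ, letterWord, ← ih, Fin.sum_univ_succ]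
    congr 1
    · simp [vals, totalDeg, tensorWord, word]
    · rw [Finset.mul_sum, Finset.smul_sum]
      refine Finset.sum_congr rfl fun k _ => ?_
      simp only [Fin.val_succ, List.map_cons,
        List.take_succ_cons, deg_cons, vals_cons, List.cons_append, tensorWord_cons, mul_add,
        sg_add, mul_smul, mul_smul_comm]
      rfl

lemma unaryWord_eq (d : Letter Ξ → V) (μ : Letter Ξ → Letter Ξ → V) (X : WΞ) :
    unaryWord d μ X = letterWord 1 id d X + adjWord 1 id μ X := by
  induction X with
  | nil => simp [unaryWord, letterWord, adjWord]
  | cons α X ih =>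
    have e : unaryLead μ α X = adjLead id μ α X := by
      cases X <;> simp [unaryLead, adjLead]
    simp only [unaryWord, letterWord, adjWord, ih, mul_add, smul_add, e, one_mul, List.map_id, id]
    abel

lemma barDiff_eq (d : Letter Ξ → V) (μ : Letter Ξ → Letter Ξ → V) (X : WΞ) :
    barDiff d μ X = barMk Ξ (unaryWord d μ X) := by
  have e1 := sum_letter (K := K) 1 id d X.get
  have e2 := sum_adjacent (K := K) 1 id μ X.get
  rw [List.ofFn_get] at e1 e2
  rw [unaryWord_eq, ← e1, ← e2]
  simp only [map_add, map_sum, barDiff, nop_smul (K := K), one_mul, List.map_id]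
  refine congrArg₂ _ (Finset.sum_congr rfl fun k _ => ?_) (Finset.sum_congr rfl fun k _ =>
    Finset.sum_congr rfl fun k' _ => ?_)
  · rw [map_smul]; rfl
  · split_ifs
    · rw [map_smul]; rfl
    · exact (map_zero _).symm

/-- The bracket of two letters of different words. -/
def crossBr (ℓ : Letter Ξ → Letter Ξ → V) (P : ι → Prop) [DecidablePred P] (i j : ι) : V :=
  if P i ∧ ¬P j then ℓ (J i) (J j) else 0

variable [LinearOrder ι] (ℓ : Letter Ξ → Letter Ξ → V) (P : ι → Prop) [DecidablePred P]

lemma sum_adjLead {a b : ι} {A B : List ι} (ha : P a) (hA : ∀ i ∈ A, P i) (hb : ¬P b)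
    (h : (A ++ b :: B).Pairwise (· < ·)) : ((interleave A (b :: B)).map fun L =>
      sg K (koszulExp (fun i => (J i).deg) L) • adjLead J (crossBr J ℓ P) a L).sum
    = sg K ((J b).deg * totalDeg (A.map J)) • (tι K (ℓ (J a) (J b)) * sh (A.map J) (B.map J)) := by
  have z : ∀ L ∈ interleave A B, sg K (koszulExp (fun i => (J i).deg) (b :: L)) •
      adjLead J (crossBr J ℓ P) a (b :: L) = (sg K ((J b).deg * totalDeg (A.map J)) •
        LinearMap.mulLeft K (tι K (ℓ (J a) (J b))))
          (sg K (koszulExp (fun i => (J i).deg) L) • word (L.map J)) := fun L hL => by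
    rw [koszulExp_cons_right _ h hL, adjLead, crossBr, if_pos ⟨ha, hb⟩, map_smul,
      lsmul, lmulLeft, smul_smul, sg_mul', add_comm]
    simp [totalDeg, Function.comp_def]
  have hs : ((interleave A B).map fun L => sg K (koszulExp (fun i => (J i).deg) (b :: L)) •
      adjLead J (crossBr J ℓ P) a (b :: L)).sum
      = sg K ((J b).deg * totalDeg (A.map J)) • (tι K (ℓ (J a) (J b)) * sh (A.map J) (B.map J)) := by
    rw [List.map_congr_left z, list_sum_map, sum_interleave_eq_sh J A B
      (h.sublist ((List.sublist_cons_self b B).append_left _))]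
    rfl
  cases A with
  | nil => rw [← hs]; simp
  | cons a' A =>
    rw [interleave_cons, List.map_append, List.sum_append, List.map_map, List.map_map, ← hs]
    refine (congrArg (· + _) (List.sum_eq_zero fun x hx => ?_)).trans (zero_add _)
    obtain ⟨L, -, rfl⟩ := List.mem_map.1 hx
    rw [Function.comp_apply, adjLead, crossBr, if_neg (fun e => e.2 (hA a' (by simp))),
      map_zero, zero_mul, smul_zero]

lemma sum_interleave_eq_binaryWord (A B : List ι) (hA : ∀ i ∈ A, P i) (hB : ∀ i ∈ B, ¬P i)
    (h : (A ++ B).Pairwise (· < ·)) : ((interleave A B).map fun L =>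
      sg K (koszulExp (fun i => (J i).deg) L) • adjWord c J (crossBr J ℓ P) L).sum
    = binaryWord c ℓ (A.map J) (B.map J) := by
  have zl : ∀ L : List ι, (∀ i ∈ L, P i) ∨ (∀ i ∈ L, ¬P i) → adjWord c J (crossBr J ℓ P) L = 0 := fun L => by
    induction L with
    | nil => intro _; rfl
    | cons i L ih =>
      intro H
      rw [adjWord, ih (H.imp (fun H j hj => H j (by simp [hj])) fun H j hj => H j (by simp [hj])),
        mul_zero, smul_zero, add_zero]
      cases L with
      | nil => rfl
      | cons j L =>
        rw [adjLead, crossBr, if_neg, map_zero, zero_mul]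
        rintro ⟨h1, h2⟩
        rcases H with H | H
        · exact h2 (H j (by simp))
        · exact H i (by simp) h1
  induction A, B using inter_ind with
  | nil_left B => simp [zl B (Or.inr hB)]
  | nil_right A => simp [zl A (Or.inl hA)]
  | cons a A b B ih1 ih2 =>
    have h1 : (A ++ b :: B).Pairwise (· < ·) := (List.pairwise_cons.1 h).2
    have h2 : (a :: A ++ B).Pairwise (· < ·) := h.sublist ((List.sublist_cons_self b B).append_left _)
    have i1 := ih1 (fun i hi => hA i (by simp [hi])) hB h1
    have i2 := ih2 hA (fun i hi => hB i (by simp [hi])) h2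
    rw [List.map_cons] at i1 i2
    rw [interleave_cons, List.map_append, List.sum_append, List.map_map, List.map_map,
      List.map_cons, List.map_cons, binaryWord_cons, ← i1, ← i2, ← sum_adjLead J ℓ P
        (hA a (by simp)) (fun i hi => hA i (by simp [hi])) (hB b (by simp)) h1]
    congr 1
    · rw [← lmulLeft (R := K) (tι K (J a).val), ← lsmul, ← list_sum_map, ← List.sum_map_add]
      refine congrArg List.sum (List.map_congr_left fun L hL => ?_)
      rw [Function.comp_apply, koszulExp_cons_left _ h hL, adjWord, smul_add, map_smul, lsmul, lmulLeft]
    · rw [← lmulLeft (R := K) (tι K (J b).val), ← lsmul, ← list_sum_map]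
      refine congrArg List.sum (List.map_congr_left fun L hL => ?_)
      have z : adjLead J (crossBr J ℓ P) b L = 0 := by
        cases L with
        | nil => rfl
        | cons j L =>
          rw [adjLead, crossBr, if_neg fun e => hB b (by simp) e.1, map_zero, zero_mul]
      rw [Function.comp_apply, koszulExp_cons_right _ h hL, adjWord, z, zero_add, map_smul,
        lsmul, lmulLeft, smul_smul, smul_smul, sg_mul', sg_mul']
      congr 2
      simp [totalDeg, Function.comp_def]; ring

lemma barBracket_eq (X Y : WΞ) : barBracket c ℓ X Y = barMk Ξ (binaryWord c ℓ X Y) := by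
  have e : ∀ σ : Equiv.Perm (Fin (X.length + Y.length)), rearranged X Y σ
      = (List.ofFn fun i => σ.symm i).map (joined X Y) := fun σ => by
    rw [rearranged, List.map_ofFn]; rfl
  have key := sum_interleave_eq_binaryWord (K := K) c (joined X Y) ℓ (fun i => i.val < X.length) _ _
    (fun i hi => mem_leftIdx.1 hi) (fun i hi => not_lt.2 (mem_rightIdx.1 hi))
    (leftIdx_append_pairwise X.length Y.length)
  rw [leftIdx_joined, rightIdx_joined] at key
  rw [← key, ← sum_isBat X.length Y.length fun L => sg K (koszulExp (fun i => (joined X Y i).deg) L) •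
    adjWord c (joined X Y) (crossBr (joined X Y) ℓ fun i => i.val < X.length) L, map_sum,
    barBracket]
  refine Finset.sum_congr rfl fun σ _ => ?_
  rw [← sum_adjacent, map_smul, map_sum, Finset.smul_sum]
  refine Finset.sum_congr rfl fun k _ => ?_
  rw [map_sum, Finset.smul_sum]
  refine Finset.sum_congr rfl fun k' _ => ?_
  simp only [crossBr, e, not_lt]
  by_cases h1 : k'.val = k.val + 1
  · by_cases h2 : (σ.symm k).val < X.length ∧ X.length ≤ (σ.symm k').val
    · rw [if_pos ⟨h1, h2⟩, if_pos h1, if_pos h2, mul_smul, rearrangedSign, koszulSign,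
        nop_smul (K := K), nop_smul (K := K), map_smul]
      rfl
    · rw [if_neg fun h => h2 h.2, if_pos h1, if_neg h2, map_smul]
      simp [tensorWord]
  · rw [if_neg fun h => h1 h.1, if_neg h1, map_zero, smul_zero]

end Adjacent

/-! ### The formulas for the operations on monomials -/

section Koszul

variable {ι : Type*} [LinearOrder ι] (deg : ι → ℤ)

lemma koszulExp_append_min {a : ι} {A B : List ι} (hA : ∀ x ∈ A, a < x) (hB : ∀ x ∈ B, a < x) :
    koszulExp deg (A ++ a :: B) = deg a * (A.map deg).sum + koszulExp deg (A ++ B) := by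
  induction A with
  | nil =>
    rw [List.nil_append, koszulExp, List.filter_eq_nil_iff.2 fun x hx => by simpa using (hB x hx).le]
    simp
  | cons i A ih =>
    rw [List.cons_append, koszulExp, ih fun x hx => hA x (by simp [hx]), List.cons_append, koszulExp,
      List.filter_append, List.filter_append, List.filter_cons_of_pos (by simpa using hA i (by simp))]
    simp only [List.map_append, List.sum_append, List.map_cons, List.sum_cons]
    ring

lemma sum_sort (I : Finset ι) : (I.sort.map deg).sum = ∑ i ∈ I, deg i := by
  rw [← List.sum_toFinset deg (Finset.sort_nodup I _), Finset.sort_toFinset]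

lemma sort_insert_min {a : ι} {I : Finset ι} (h : ∀ x ∈ I, a < x) : (insert a I).sort = a :: I.sort :=
  Finset.sort_insert _ (fun b hb => (h b hb).le) fun ha => lt_irrefl a (h a ha)

end Koszul

section Monomial

variable {ι : Type*} [LinearOrder ι] (X : ι → W) {deg : ι → ℤ}

variable (Γ) in
/-- The monomial whose factors are indexed by a finite set. -/
def finMon (I : Finset ι) : SΓ := hatMk Γ (tensorWord K (I.sort.map X))

lemma finMon_empty : finMon Γ X ∅ = hatOne Γ := by rw [finMon, Finset.sort_empty]; rfl

lemma finMon_insert {a : ι} {I : Finset ι} (h : ∀ x ∈ I, a < x) :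
    finMon Γ X (insert a I) = lam Γ (X a) (finMon Γ X I) := by
  rw [finMon, sort_insert_min h, List.map_cons, tensorWord_cons]; rfl

lemma finMon_mem (hX : ∀ i, X i ∈ Γ (deg i)) (T : Finset ι) : finMon Γ X T ∈ hatGr Γ (∑ i ∈ T, deg i) := by
  induction T using Finset.induction_on_min with
  | empty => rw [finMon_empty]; exact hatOne_mem
  | insert a T ha ih =>
    rw [finMon_insert X ha, Finset.sum_insert fun h => lt_irrefl a (ha a h), add_comm]
    exact lam_mem (hX a) ih

lemma insert_sdiff_subset {a : ι} {T I : Finset ι} (ha : ∀ x ∈ T, a < x) (hI : I ⊆ T) :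
    insert a T \ I = insert a (T \ I) :=
  Finset.insert_sdiff_of_notMem _ fun h => lt_irrefl a (ha a (hI h))

lemma insert_sdiff_insert_min {a : ι} {T I : Finset ι} (ha : ∀ x ∈ T, a < x) :
    insert a T \ insert a I = T \ I := by
  have := fun h => lt_irrefl a (ha a h)
  ext x; simp only [Finset.mem_sdiff, Finset.mem_insert]; grind

lemma erase_insert_min {a s : ι} {T : Finset ι} (ha : ∀ x ∈ T, a < x) (hs : s ∈ T) :
    (insert a T).erase s = insert a (T.erase s) :=
  Finset.erase_insert_of_ne (ha s hs).ne

lemma hatΔ_finMon (h : IsInt Γ) (hX : ∀ i, X i ∈ Γ (deg i)) (T : Finset ι) :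
    hatΔ h (finMon Γ X T) = ∑ I ∈ T.powerset, sg K (koszulExp deg (I.sort ++ (T \ I).sort)) •
      (finMon Γ X I ⊗ₜ finMon Γ X (T \ I)) := by
  induction T using Finset.induction_on_min with
  | empty => simp [finMon_empty, koszulExp]
  | insert a T ha ih =>
    have hI : ∀ I ∈ T.powerset, ∀ x ∈ I, a < x := fun I hI x hx => ha x (Finset.mem_powerset.1 hI hx)
    have hJ : ∀ I, ∀ x ∈ T \ I, a < x := fun I x hx => ha x (Finset.sdiff_subset hx)
    rw [finMon_insert X ha, hatΔ_lam, ih,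
      Finset.sum_powerset_insert fun h => lt_irrefl a (ha a h), diag_apply, map_sum, map_sum, add_comm]
    refine congrArg₂ _ (Finset.sum_congr rfl fun I H => ?_) (Finset.sum_congr rfl fun I H => ?_)
    · rw [insert_sdiff_subset ha (Finset.mem_powerset.1 H), map_smul, lam2_tmul h (hX a),
        par_apply _ _ _ (finMon_mem X hX I), ← smul_tmul', smul_smul, sg_mul',
        finMon_insert X (hJ I), sort_insert_min (hJ I), koszulExp_append_min deg
          (fun x hx => hI I H x ((Finset.mem_sort _).1 hx))
          (fun x hx => hJ I x ((Finset.mem_sort _).1 hx)), sum_sort, add_comm]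
    · rw [insert_sdiff_insert_min ha, map_smul, lam1_tmul, finMon_insert X (hI I H),
        sort_insert_min (hI I H), List.cons_append, ← List.nil_append (a :: _),
        koszulExp_append_min deg (by simp) fun x hx => ?_]
      · simp
      · rw [List.mem_append, Finset.mem_sort, Finset.mem_sort] at hx
        exact hx.elim (hI I H x) (hJ I x)

lemma finMon_unary {k : ℤ} {G : W → W} {E : SΓ ⊸ SΓ}
    (hG : ∀ i, ∀ x ∈ Γ i, G x ∈ Γ (i + k)) (E1 : E (hatOne Γ) = 0)
    (E2 : ∀ i, ∀ w ∈ Γ i, ∀ x, E (lam Γ w x) = lam Γ (G w) x + sg K (k * i) • lam Γ w (E x))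
    (hX : ∀ i, X i ∈ Γ (deg i)) (T : Finset ι) :
    E (finMon Γ X T) = ∑ i ∈ T, sg K (koszulExp deg (i :: (T.erase i).sort)) •
      lam Γ (G (X i)) (finMon Γ X (T.erase i)) := by
  induction T using Finset.induction_on_min with
  | empty => rw [finMon_empty, E1]; rfl
  | insert a T ha ih =>
    have hT : a ∉ T := fun h => lt_irrefl a (ha a h)
    rw [finMon_insert X ha, E2 _ _ (hX a), ih, Finset.sum_insert hT, Finset.erase_insert hT, map_sum,
      Finset.smul_sum, ← List.nil_append (a :: _), koszulExp_append_min deg (by simp) fun x hx =>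
        ha x ((Finset.mem_sort _).1 hx)]
    congr 1
    · simp [koszulExp_sorted deg (Finset.sortedLT_sort T).pairwise]
    · refine Finset.sum_congr rfl fun i hi => ?_
      have hJ : ∀ x ∈ T.erase i, a < x := fun x hx => ha x (Finset.mem_of_mem_erase hx)
      rw [erase_insert_min ha hi, finMon_insert X hJ, sort_insert_min hJ, map_smul,
        lam_lam (hX a) (hG _ _ (hX i)), smul_smul, smul_smul, sg_mul', sg_mul',
        show ∀ R, i :: a :: R = [i] ++ a :: R from fun _ => rfl,
        koszulExp_append_min deg (by simp [ha i hi]) fun x hx => hJ x ((Finset.mem_sort _).1 hx),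
        List.singleton_append, List.map_singleton, List.sum_singleton]
      exact congrArg (· • _) (sg_congr ⟨k * deg a, by ring⟩)

lemma finMon_binary {g : W → W → W} {E : SΓ ⊸ SΓ} {L : W → SΓ ⊸ SΓ}
    (hg : ∀ i, ∀ x ∈ Γ i, ∀ j, ∀ y ∈ Γ j, g x y ∈ Γ (i + j + 1)) (E1 : E (hatOne Γ) = 0)
    (L1 : ∀ w, L w (hatOne Γ) = 0)
    (E2 : ∀ i, ∀ w ∈ Γ i, ∀ x, E (lam Γ w x) = L w x + sg K i • lam Γ w (E x))
    (L2 : ∀ i, ∀ w ∈ Γ i, ∀ j, ∀ y ∈ Γ j, ∀ x,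
      L w (lam Γ y x) = lam Γ (g w y) x + sg K ((1 + i) * j) • lam Γ y (L w x))
    (hX : ∀ i, X i ∈ Γ (deg i)) (T : Finset ι) :
    E (finMon Γ X T) = ∑ i ∈ T, ∑ j ∈ T, if i < j then
      sg K (koszulExp deg (i :: j :: ((T.erase i).erase j).sort)) •
        lam Γ (g (X i) (X j)) (finMon Γ X ((T.erase i).erase j)) else 0 := by
  induction T using Finset.induction_on_min with
  | empty => rw [finMon_empty, E1]; rfl
  | insert a T ha ih =>
    have hT : a ∉ T := fun h => lt_irrefl a (ha a h)
    rw [finMon_insert X ha, E2 _ _ (hX a), ih, Finset.sum_insert hT, Finset.sum_insert hT,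
      if_neg (lt_irrefl a), zero_add, map_sum, Finset.smul_sum,
      finMon_unary X (k := 1 + deg a) (G := g (X a)) (fun j y hy => by
        have := hg _ _ (hX a) _ _ hy
        rwa [add_comm (deg a), add_assoc, add_comm (deg a)] at this) (L1 _) (L2 _ _ (hX a)) hX]
    refine congrArg₂ _ (Finset.sum_congr rfl fun j hj => ?_) (Finset.sum_congr rfl fun i hi => ?_)
    · rw [if_pos (ha j hj), Finset.erase_insert hT, ← List.nil_append (a :: _),
        koszulExp_append_min deg (by simp) fun x hx => ?_]
      · simp
      · rw [List.mem_cons, Finset.mem_sort] at hx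
        exact hx.elim (fun e => e ▸ ha j hj) fun hx => ha x (Finset.mem_of_mem_erase hx)
    · rw [Finset.sum_insert hT, if_neg (ha i hi).not_gt, zero_add, map_sum, Finset.smul_sum]
      refine Finset.sum_congr rfl fun j hj => ?_
      by_cases hij : i < j
      · have hJ : ∀ x ∈ (T.erase i).erase j, a < x := fun x hx =>
          ha x (Finset.mem_of_mem_erase (Finset.mem_of_mem_erase hx))
        rw [if_pos hij, if_pos hij, erase_insert_min ha hi,
          erase_insert_min (fun x hx => ha x (Finset.mem_of_mem_erase hx))
            (Finset.mem_erase.2 ⟨hij.ne', hj⟩), finMon_insert X hJ, sort_insert_min hJ, map_smul,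
          lam_lam (hX a) (hg _ _ (hX i) _ _ (hX j)), smul_smul, smul_smul, sg_mul', sg_mul',
          show ∀ R, i :: j :: a :: R = [i, j] ++ a :: R from fun _ => rfl,
          koszulExp_append_min deg (by simp [ha i hi, ha j hj]) fun x hx =>
            hJ x ((Finset.mem_sort _).1 hx)]
        refine congrArg (· • _) (sg_congr ⟨deg a, ?_⟩)
        simp; ring
      · rw [if_neg hij, if_neg hij, map_zero, smul_zero]

lemma hatδ_finMon (h : IsInt Γ) {p : ℤ} {δ : W ⊸ W ⊗[K] W}
    (hδ : ∀ i, ∀ x ∈ Γ i, δ x ∈ tensorGrading Γ (i - p)) (hX : ∀ i, X i ∈ Γ (deg i))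
    (T : Finset ι) : hatδ h δ (finMon Γ X T) = ∑ s ∈ T, ∑ I ∈ (T.erase s).powerset,
      sg K (koszulExp deg (I.sort ++ s :: (T.erase s \ I).sort) + deg s * ∑ i ∈ I, deg i) •
        mulMap (lam1 Γ) (lam2 h) (δ (X s)) (finMon Γ X I ⊗ₜ finMon Γ X (T.erase s \ I)) := by
  induction T using Finset.induction_on_min with
  | empty => rw [finMon_empty, hatδ_one]; rfl
  | insert a T ha ih =>
    have hT : a ∉ T := fun h => lt_irrefl a (ha a h)
    have hs : ∀ {I : Finset ι}, (∀ x ∈ I, a < x) → ∀ x ∈ I.sort, a < x := fun H x hx =>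
      H x ((Finset.mem_sort _).1 hx)
    rw [finMon_insert X ha, hatδ_lam h hδ (hX a), ih, Finset.sum_insert hT, Finset.erase_insert hT,
      hatΔ_finMon X h hX, map_sum, map_sum, Finset.smul_sum]
    refine congrArg₂ _ (Finset.sum_congr rfl fun I H => ?_) (Finset.sum_congr rfl fun s hs' => ?_)
    · have hI : ∀ x ∈ I, a < x := fun x hx => ha x (Finset.mem_powerset.1 H hx)
      have hJ : ∀ x ∈ T \ I, a < x := fun x hx => ha x (Finset.sdiff_subset hx)
      rw [map_smul, koszulExp_append_min deg (hs hI) (hs hJ), sum_sort]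
      exact congrArg (· • _) (sg_congr ⟨-(deg a * ∑ i ∈ I, deg i), by ring⟩)
    · have hE : ∀ x ∈ T.erase s, a < x := fun x hx => ha x (Finset.mem_of_mem_erase hx)
      have hE' : a ∉ T.erase s := fun h => hT (Finset.mem_of_mem_erase h)
      rw [erase_insert_min ha hs', Finset.sum_powerset_insert hE', ← Finset.sum_add_distrib, map_sum,
        Finset.smul_sum]
      refine Finset.sum_congr rfl fun I H => ?_
      have hI : ∀ x ∈ I, a < x := fun x hx => hE x (Finset.mem_powerset.1 H hx)
      have hJ : ∀ x ∈ T.erase s \ I, a < x := fun x hx => hE x (Finset.sdiff_subset hx)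
      have e := mulMap_diag h (hX a) (hδ _ _ (hX s)) (finMon Γ X I ⊗ₜ finMon Γ X (T.erase s \ I))
      rw [insert_sdiff_subset hE (Finset.mem_powerset.1 H), insert_sdiff_insert_min hE, map_smul,
        finMon_insert X hI, finMon_insert X hJ, sort_insert_min hI, sort_insert_min hJ,
        Finset.sum_insert fun h => lt_irrefl a (hI a h)]
      rw [diag_apply, lam1_tmul, lam2_tmul h (hX a), par_apply _ _ _ (finMon_mem X hX I),
        ← smul_tmul', map_add, map_smul] at e
      have e' : diag h (X a) (mulMap (lam1 Γ) (lam2 h) (δ (X s))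
          (finMon Γ X I ⊗ₜ finMon Γ X (T.erase s \ I))) = sg K (deg a * (deg s - p)) • (sg K (deg a *
            (deg s - p)) • diag h (X a) (mulMap (lam1 Γ) (lam2 h) (δ (X s))
          (finMon Γ X I ⊗ₜ finMon Γ X (T.erase s \ I)))) := by
        rw [smul_smul, sg_mul_self, one_smul]
      have k1 : koszulExp deg (a :: (I.sort ++ s :: (T.erase s \ I).sort))
          = koszulExp deg (I.sort ++ s :: (T.erase s \ I).sort) := by
        rw [← List.nil_append (a :: _), koszulExp_append_min deg (by simp) fun x hx => ?_]
        · simp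
        · rw [List.mem_append, List.mem_cons] at hx
          rcases hx with hx | rfl | hx
          exacts [hs hI x hx, ha x hs', hs hJ x hx]
      have k2 : koszulExp deg (I.sort ++ s :: a :: (T.erase s \ I).sort) = deg a * (∑ i ∈ I, deg i + deg s)
            + koszulExp deg (I.sort ++ s :: (T.erase s \ I).sort) := by
        rw [show ∀ A B, A ++ s :: a :: B = (A ++ [s]) ++ a :: B by simp,
          koszulExp_append_min deg (fun x hx => ?_) (hs hJ), List.map_append, List.sum_append, sum_sort,
          List.map_singleton, List.sum_singleton, List.append_assoc, List.singleton_append]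
        rw [List.mem_append, List.mem_singleton] at hx
        exact hx.elim (hs hI x) fun e => e ▸ ha s hs'
      rw [e', ← e, List.cons_append, k1, k2]
      simp only [smul_add, smul_smul, sg_mul']
      refine (congrArg₂ _ ?_ ?_).trans (add_comm _ _) <;> refine congrArg (· • _) (sg_congr ?_)
      · exact ⟨0, by ring⟩
      · exact ⟨0, by ring⟩

end Monomial

lemma cutSum_eq_range {ι M : Type*} [AddCommMonoid M] (X : List ι) (f : List ι → List ι → M) :
    cutSum X f = ∑ j ∈ Finset.range (X.length + 1), f (X.take j) (X.drop j) := by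
  induction X generalizing f with
  | nil => simp [cutSum]
  | cons α X ih =>
    rw [List.length_cons, Finset.sum_range_succ', add_comm, cutSum, ih]
    rfl

lemma cutSum_eq_Ioo {ι M : Type*} [AddCommMonoid M] {X : List ι} {f : List ι → List ι → M}
    (h1 : f [] X = 0) (h2 : f X [] = 0) :
    cutSum X f = ∑ j ∈ Finset.Ioo 0 X.length, f (X.take j) (X.drop j) := by
  rw [cutSum_eq_range]
  refine (Finset.sum_subset (fun j hj => ?_) fun j hj hj' => ?_).symm
  · simp at hj ⊢; omega
  · simp only [Finset.mem_range, Finset.mem_Ioo] at hj hj'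
    obtain rfl | rfl : j = 0 ∨ j = X.length := by omega
    · simpa using h1
    · simpa using h2

section

lemma hatMk_append_singleton {ι : Type*} {X : ι → W} {deg : ι → ℤ} (hX : ∀ i, X i ∈ Γ (deg i))
    (l : List ι) {e : ℤ} {u : W} (hu : u ∈ Γ e) : hatMk Γ (tensorWord K (l.map X ++ [u]))
      = sg K (e * (l.map deg).sum) • lam Γ u (hatMk Γ (tensorWord K (l.map X))) := by
  induction l with
  | nil => simp only [List.map_nil, List.nil_append, tensorWord_cons, List.sum_nil, mul_zero, sg_zero,
      one_smul, lam_hatMk]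
  | cons i l ih =>
    rw [List.map_cons, List.cons_append, tensorWord_cons, ← lam_hatMk, ih, map_smul,
      lam_lam (hX i) hu, smul_smul, sg_mul', tensorWord_cons, ← lam_hatMk]
    refine congrArg (· • _) (sg_congr ⟨0, ?_⟩)
    simp; ring

end

section Env

variable {p : ℤ} (h : IsInt Ξ)

variable (p) in
/-- The monomial, in the symmetric algebra, of the packets indexed by a finite set. -/
abbrev packetMon {n : ℕ} (X : Fin n → WΞ) (I : Finset (Fin n)) : SymHat (shift (Bar.grading Ξ) p) :=
  finMon (shift (Bar.grading Ξ) p) (fun i => packet (X i)) I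

lemma packet_comp_mem {n : ℕ} (X : Fin n → WΞ) (i : Fin n) :
    packet (X i) ∈ shift (Bar.grading Ξ) p (degIn p (X i)) := packet_mem_shift (X i)

lemma mk_map_packet (l : List (Bar Ξ)) : SymPlus.mk (shift (Bar.grading Ξ) p) l
    = toPlus _ (hatMk _ (tensorWord K l)) := rfl

lemma monomial_factors {n : ℕ} (X : Fin n → WΞ) (I : Finset (Fin n)) :
    monomial p (factors X I) = toPlus _ (packetMon p X I) := by
  rw [monomial, factors, List.map_map]; rfl

lemma monomial_ofFn {n : ℕ} (X : Fin n → WΞ) :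
    monomial p (List.ofFn X) = toPlus _ (packetMon p X Finset.univ) := by
  rw [← monomial_factors, factors, sorted, Fin.sort_univ, List.ofFn_eq_map]

lemma envCop_isCoproduct : IsCoproduct p (envCop h p) := by
  intro n X
  rw [monomial_ofFn, plusΔ_toPlus,
    hatΔ_finMon _ (env_int h p) (packet_comp_mem X), map_sum, Finset.powerset_univ,
    Finset.sum_filter]
  refine Finset.sum_congr rfl fun I _ => ?_
  rw [map_smul, map_tmul]
  split_ifs with hI
  · rw [koszulSign, nop_smul (K := K), monomial_factors, monomial_factors, Finset.compl_eq_univ_sdiff]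
    rfl
  · rw [not_and_or, Finset.not_nonempty_iff_eq_empty, Finset.not_nonempty_iff_eq_empty] at hI
    rcases hI with rfl | hI
    · rw [finMon_empty, toPlus_one, zero_tmul, smul_zero]
    · rw [← Finset.compl_eq_univ_sdiff, hI, finMon_empty, toPlus_one, tmul_zero, smul_zero]

lemma mulMap_packet {n : ℕ} (X : Fin n → WΞ) (I J : Finset (Fin n)) (A B : WΞ) :
    tmap (toPlus _) (toPlus _) (mulMap (lam1 _) (lam2 (env_int h p)) (packet A ⊗ₜ packet B)
        (packetMon p X I ⊗ₜ packetMon p X J))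
      = sg K ((degIn p A + degIn p B) * ∑ i ∈ I, degIn p (X i)) •
        (monomial p (factors X I ++ [A]) ⊗ₜ[K] monomial p ([B] ++ factors X J)) := by
  have e : monomial p (factors X I ++ [A]) = sg K (degIn p A * ∑ i ∈ I, degIn p (X i)) •
      toPlus _ (lam _ (packet A) (packetMon p X I)) := by
    rw [monomial, List.map_append, factors, List.map_map, mk_map_packet, ← map_smul, ← sum_sort]
    exact congrArg _ (hatMk_append_singleton (packet_comp_mem X) _ (packet_mem_shift A))
  rw [mulMap_tmul, lam2_tmul _ (packet_mem_shift B), lam1_tmul,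
    par_apply _ _ _ (finMon_mem _ (packet_comp_mem X) I), map_tmul, e, map_smul,
    map_smul, ← smul_tmul', ← smul_tmul', smul_smul, sg_mul']
  refine congrArg₂ _ (sg_congr ⟨-(degIn p A * ∑ i ∈ I, degIn p (X i)), ?_⟩) (congrArg₂ _ rfl ?_)
  · rw [degIn, degIn]; ring
  · rw [monomial, factors, List.map_append, List.map_map, List.map_singleton, mk_map_packet,
      List.singleton_append, tensorWord_cons]
    rfl

lemma envCob_isCobracket : IsCobracket p (fun x => p * x) (fun u v => u * v + p + 1) (envCob h p) := by
  intro n X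
  rw [monomial_ofFn, plusδ_toPlus,
    hatδ_finMon _ (env_int h p) (envδ_isLieCoalg h p).mem (packet_comp_mem X), map_sum]
  refine Finset.sum_congr rfl fun s _ => ?_
  rw [map_sum, ← Finset.compl_singleton]
  refine Finset.sum_congr rfl fun I _ => ?_
  set J := {s}ᶜ \ I
  rw [map_smul, koszulSign, nop_smul (K := K), List.append_assoc, List.singleton_append, ← sg_mul', mul_smul]
  refine congrArg₂ _ rfl ?_
  let Φ := tmap (toPlus (shift (Bar.grading Ξ) p)) (toPlus _) ∘ₗ
    (mulMap (lam1 (shift (Bar.grading Ξ) p)) (lam2 (env_int h p))).flip (packetMon p X I ⊗ₜ packetMon p X J)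
  change sg K _ • Φ (envδ h p (packet (X s))) = _
  rw [envδ_packet, map_cutSum, cutSum_eq_Ioo (by simp) (by simp), Finset.smul_sum]
  refine Finset.sum_congr rfl fun j _ => ?_
  have e : degIn p (X s) = degIn p ((X s).take j) + degIn p ((X s).drop j) + p := by
    have := congrArg totalDeg (List.take_append_drop j (X s))
    rw [deg_append] at this
    simp only [degIn]; omega
  generalize (X s).take j = A at *
  generalize (X s).drop j = B at *
  have hΦ : ∀ A B, Φ (packet A ⊗ₜ packet B) = sg K ((degIn p A + degIn p B) * ∑ i ∈ I, degIn p (X i)) •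
      (monomial p (factors X I ++ [A]) ⊗ₜ[K] monomial p ([B] ++ factors X J)) :=
    fun A B => mulMap_packet h X I J A B
  have e' : ∀ A : WΞ, totalDeg A = degIn p A + p := fun A => by rw [degIn]; ring
  rw [map_sub, map_smul, map_smul, hΦ, hΦ, e, sub_eq_add_neg, nop_smul (K := K), nop_smul (K := K), e' A, e' B]
  simp only [smul_add, smul_smul, sg_mul', ← neg_smul, neg_sg]
  generalize ∑ i ∈ I, degIn p (X i) = k
  generalize degIn p A = a
  generalize degIn p B = b
  refine congrArg₂ _ ?_ ?_ <;> refine congrArg (· • _) (sg_eq_of_zmod ?_) <;> push_cast <;>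
    generalize (a : ZMod 2) = a' <;> generalize (b : ZMod 2) = b' <;>
    generalize (p : ZMod 2) = p' <;> generalize (k : ZMod 2) = k' <;> clear * - <;> decide +revert

lemma isUnaryExtension_of [CharZero K] {Q : Env Ξ p ⊸ Env Ξ p} {D : WΞ → Bar Ξ}
    (HQ : IsCoder (env_gr_int h p) p (envCop h p) (envCob h p) 1 Q)
    (hN : ∀ x, genPart Q (hatNum (env_int h p) x) = (1 + 0 : K) • genPart Q x)
    (hD : ∀ X, genUnary Q (packet X) = D X) : IsUnaryExtension p D Q := by
  intro n X
  obtain ⟨E, hE, E1, E2⟩ := unary_toPlus_lam h HQ hN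
  rw [monomial_ofFn, hE, finMon_unary (k := 1) (G := genUnary Q) _ (fun i x hx => ?_) E1
    (fun i w hw x => by rw [one_mul]; exact E2 i w hw x) (packet_comp_mem X), map_sum]
  · refine Finset.sum_congr rfl fun i _ => ?_
    rw [map_smul, koszulSign, nop_smul (K := K), ← Finset.compl_singleton, hD, factors,
      List.map_map, mk_map_packet, List.singleton_append,
      List.singleton_append, tensorWord_cons]
    rfl
  · have := genUnary_mem h HQ _ x hx
    rwa [add_right_comm] at this

lemma isBinaryExtension_of [CharZero K] {Q : Env Ξ p ⊸ Env Ξ p} {B : WΞ → WΞ → Bar Ξ}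
    (HQ : IsCoder (env_gr_int h p) p (envCop h p) (envCob h p) 1 Q)
    (hN : ∀ x, genPart Q (hatNum (env_int h p) x) = (1 + 1 : K) • genPart Q x)
    (hB : ∀ X Y, genBinary Q (packet X) (packet Y) = B X Y) : IsBinaryExtension p B Q := by
  intro n X
  obtain ⟨E, L, hE, E1, L1, E2, L2⟩ := binary_toPlus_lam h HQ hN
  rw [monomial_ofFn, hE, finMon_binary (g := fun x y => genBinary Q x y) _
    (fun i x hx j y hy => ?_) E1 L1 E2 L2 (packet_comp_mem X), map_sum]
  · refine Finset.sum_congr rfl fun i _ => ?_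
    rw [map_sum]
    refine Finset.sum_congr rfl fun j _ => ?_
    split_ifs with hij
    · rw [map_smul, koszulSign, nop_smul (K := K), show ({i, j}ᶜ : Finset (Fin n))
        = (Finset.univ.erase i).erase j by ext x; simp; tauto, hB, factors, List.map_map,
        mk_map_packet, List.singleton_append, tensorWord_cons]
      rfl
    · exact map_zero _
  · rw [genBinary_apply]
    refine HQ.genPart_mem _ _ ?_
    have := lam_mem hx (lam_mem hy hatOne_mem)
    rwa [zero_add, add_comm] at this

lemma env_ext (h : IsInt Ξ) {f g : Env Ξ p ⊸ M} (hfg : ∀ (n : ℕ) (X : Fin n → WΞ),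
      f (monomial p (List.ofFn X)) = g (monomial p (List.ofFn X))) : f = g := by
  refine lext fun x => ?_
  obtain ⟨x, rfl⟩ := toPlus_surj x
  suffices f ∘ₗ toPlus _ = g ∘ₗ toPlus _ from lcongr this x
  refine hatMon_ext h fun l => ?_
  have := hfg _ l.get
  rwa [List.ofFn_get] at this

end Env

lemma plusPr_plusΔ_lam {K : Type u} [Field K] {W : Type v} [AddCommGroup W] [Module K W]
    {Γ : ℤ → Submodule K W} (h : IsInt Γ) {i j : ℤ} {x y : W} (hx : x ∈ Γ i)
    (hy : y ∈ Γ j) : tmap (plusPr Γ) (plusPr Γ)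
      (plusΔ h (toPlus Γ (lam Γ x (lam Γ y (hatOne Γ))))) = x ⊗ₜ y + sg K (i * j) • (y ⊗ₜ x) := by
  rw [plusΔ_toPlus, hatΔ_lam, hatΔ_lam, hatΔ_one, diag_apply, diag_apply, lam1_tmul, lam2_tmul h hy,
    par_apply _ _ _ hatOne_mem, map_add (lam1 Γ x), map_add (lam2 h x), lam1_tmul, ← smul_tmul',
    map_smul, map_smul, lam1_tmul, lam2_tmul h hx, lam2_tmul h hx, par_apply _ _ _ hatOne_mem,
    par_apply _ _ _ (lam_mem hy hatOne_mem)]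
  simp only [mul_zero, sg_zero, one_smul, map_add, map_tmul, plusPr_toPlus, hatPr_lam,
    counit_lam, counit_one, zero_smul, hatPr_one, tmul_zero,
    map_smul, ← smul_tmul', zero_add, add_zero]

section

variable {p : ℤ} {R : Env Ξ p →ₗ[K] Env Ξ p}

lemma tenCounit_ι (v : V) : tenCounit K V (tι K v) = 0 := by
  rw [← mul_one (tι K v), tenCounit_mul]

lemma tensorPr_unaryWord (d : Letter Ξ → V) (μ : Letter Ξ → Letter Ξ → V)
    (X : WΞ) : tensorPr K V (unaryWord d μ X) = match X with
      | [α] => d α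
      | [α, β] => μ α β
      | _ => 0 := by
  rcases X with _ | ⟨α, _ | ⟨β, _ | ⟨γ, X⟩⟩⟩ <;>
    simp [unaryWord, unaryLead, tenCounit_ι]

lemma barPr_packet (X : WΞ) : barPr Ξ (packet X) = match X with
      | [α] => α.val
      | _ => 0 := by
  change tensorPr K V (word X) = _
  rcases X with _ | ⟨α, _ | ⟨β, X⟩⟩ <;> simp

lemma barPr_genBinary [CharZero K] (h : IsInt Ξ) {d : V ⊸ V}
    {M L : V ⊗[K] V ⊸ V} (H : IsSusAlg (shift_int h p) p d M L)
    (hR : ∀ x, envPr Ξ p (R x) = (2⁻¹ : K) • L (tmap (envPr Ξ p) (envPr Ξ p) (envCop h p x))) (X Y : WΞ) :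
    barPr Ξ (genBinary R (packet X) (packet Y)) = L (barPr Ξ (packet X) ⊗ₜ barPr Ξ (packet Y)) := by
  have hX := packet_mem_shift (p := p) X
  have hY := packet_mem_shift (p := p) Y
  have hX' : barPr Ξ (packet X) ∈ shift Ξ p (totalDeg X - p) := barPr_mem hX
  have hY' : barPr Ξ (packet Y) ∈ shift Ξ p (totalDeg Y - p) := barPr_mem hY
  refine (hR (toPlus _ (lam _ (packet X) (lam _ (packet Y) (hatOne _))))).trans ?_
  rw [envPr, tmap_comp, lcomp, plusPr_plusΔ_lam (env_int h p) hX hY, map_add, map_smul, map_tmul,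
    map_tmul, ← kflip_apply _ (shift_int h p) hX' hY', map_add, H.L_flip,
    ← two_smul K, smul_smul, inv_mul_cancel₀ two_ne_zero, one_smul]

end

namespace DGABAlgebra

variable {a b : ℤ} (X : DGABAlgebra a b 𝒜)

lemma val_mem_shift (α : Letter (shift 𝒜 (-a + 1))) :
    α.val ∈ shift (shift 𝒜 (-a + 1)) (a - b) (α.deg - (a - b)) := by
  have := α.mem
  unfold shift at *
  rwa [sub_add_cancel]

lemma ell_mem (α β : Letter (shift 𝒜 (-a + 1))) :
    X.ell α β ∈ shift 𝒜 (-a + 1) (α.deg + β.deg + (b - a + 1)) := by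
  rw [ell, nop_smul (K := K)]
  refine Submodule.smul_mem _ _ ?_
  have := X.bracket_mem α.mem β.mem
  unfold shift
  convert this using 2; ring

lemma half_susMul [CharZero K] {h : IsInt (shift (shift 𝒜 (-a + 1)) (a - b))}
    (α β : Letter (shift 𝒜 (-a + 1))) :
    (2⁻¹ : K) • X.susMul h (sg K ((a - b) * (α.deg - (a - b))) • (α.val ⊗ₜ β.val)
      - sg K (α.deg * β.deg + (a - b) * (β.deg - (a - b))) • (β.val ⊗ₜ α.val)) = X.mu α β := by
  have e : ∀ x : A, x + x = (2 : K) • x := fun x => (two_smul K x).symm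
  rw [map_sub, map_smul, map_smul, X.susMul_tmul (val_mem_shift α), X.susMul_tmul (val_mem_shift β),
    X.mul_comm β.mem α.mem, nop_smul (K := K), smul_smul, smul_smul, smul_smul, sg_mul',
    sg_mul', sg_mul', sub_eq_add_neg, ← neg_smul, neg_sg, mu, nop_smul (K := K),
    sg_eq_of_zmod (n := α.deg), sg_eq_of_zmod (m := _ + 1) (n := α.deg), e, smul_smul,
    inv_mul_cancel₀ two_ne_zero, one_smul]
  all_goals
    push_cast
    generalize (a : ZMod 2) = a', (b : ZMod 2) = b', (α.deg : ZMod 2) = i', (β.deg : ZMod 2) = j'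
    clear * -
    decide +revert

variable (h : IsInt (shift 𝒜 (-a + 1)))
  {Q R : Env (shift 𝒜 (-a + 1)) (a - b) →ₗ[K] Env (shift 𝒜 (-a + 1)) (a - b)} [CharZero K]

lemma genUnary_packet (HQ : IsCoder (env_gr_int h (a - b)) (a - b) (envCop h (a - b)) (envCob h (a - b)) 1 Q)
    (hQ : ∀ x, envPr (shift 𝒜 (-a + 1)) (a - b) (Q x) = X.d (envPr _ (a - b) x) + (2⁻¹ : K) •
      X.susMul (shift_int h (a - b)) (tmap (envPr _ (a - b)) (envPr _ (a - b)) (envCob h (a - b) x)))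
    (Y : List (Letter (shift 𝒜 (-a + 1)))) : genUnary Q (packet Y) = X.D Y := by
  rw [D, barDiff_eq]
  refine bar_unary h (genUnary_mem h HQ) (barCob_genUnary h HQ) (fun Y => ?_) Y
  rw [barPr_genUnary h hQ, map_barPr_envδ, tensorPr_unaryWord, barPr_packet]
  rcases Y with _ | ⟨α, _ | ⟨β, _ | ⟨γ, Y⟩⟩⟩
  · simp
  · simp
  · simpa using X.half_susMul α β
  · simp

lemma genBinary_packet (HR : IsCoder (env_gr_int h (a - b)) (a - b) (envCop h (a - b)) (envCob h (a - b)) 1 R)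
    (hR : ∀ x, envPr (shift 𝒜 (-a + 1)) (a - b) (R x) = (2⁻¹ : K) •
      X.susBr (shift_int h (a - b)) (tmap (envPr _ (a - b)) (envPr _ (a - b)) (envCop h (a - b) x)))
    (Y Z : List (Letter (shift 𝒜 (-a + 1)))) :
    genBinary R (packet Y) (packet Z) = X.ell₂'' Y Z := by
  have := bar_binary (c := b - a + 1) (ℓ := X.ell) (p := a - b) (g := genBinary R) h (by ring)
    X.ell_mem (fun Y Z => by
      rw [IsCoder.cobracket_genBinary (envδ_isLieCoalg h (a - b)).mem HR
        (packet_mem_shift Y) (packet_mem_shift Z), one_mul]) (fun Y Z => by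
      rw [barPr_genBinary h (X.isSuspendedAlgebra (h := shift_int h (a - b))) hR,
        tensorPr_binaryWord, barPr_packet, barPr_packet]
      rcases Y with _ | ⟨α, _ | ⟨α', Y⟩⟩ <;> rcases Z with _ | ⟨β, _ | ⟨β', Z⟩⟩ <;> try simp
      rw [X.susBr_tmul (val_mem_shift α), ell, nop_smul (K := K), smul_smul, sg_mul']
      exact congrArg (· • _) (sg_eq_of_zmod (by
        push_cast; generalize (a : ZMod 2) = a', (b : ZMod 2) = b', (α.deg : ZMod 2) = i'
        clear * -; decide +revert))) Y Z
  rw [this, ell₂'', ell₂', ell₂, barBracket_eq, nop_smul (K := K), nop_smul (K := K), smul_smul, sg_mul']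
  refine congrArg (· • _) (sg_eq_of_zmod ?_)
  rw [degIn, degIn]
  push_cast; generalize (a : ZMod 2) = a', (b : ZMod 2) = b', (totalDeg Y : ZMod 2) = i'
  clear * -; decide +revert

end DGABAlgebra

section

variable {p : ℤ}

lemma IsCobracket.congr {e₁ e₁' : ℤ → ℤ} {e₂ e₂' : ℤ → ℤ → ℤ}
    {δ : Env Ξ p ⊸ Env Ξ p ⊗[K] Env Ξ p} (H : IsCobracket p e₁ e₂ δ)
    (h1 : ∀ x, Even (e₁' x - e₁ x)) (h2 : ∀ x y, Even (e₂' x y - e₂ x y)) :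
    IsCobracket p e₁' e₂' δ := by
  intro n X
  simp only [H n X, Int.negOnePow_eq_iff _ _ |>.2 (h1 _), Int.negOnePow_eq_iff _ _ |>.2 (h2 _ _)]

lemma symPlus_mk_neg (x : Bar Ξ) (l : List (Bar Ξ)) : SymPlus.mk (shift (Bar.grading Ξ) p) ([-x] ++ l)
    = -SymPlus.mk (shift (Bar.grading Ξ) p) ([x] ++ l) := by
  rw [SymPlus.mk, List.singleton_append, tensorWord_cons, map_neg, neg_mul, map_neg, ← tensorWord_cons]
  rfl

lemma IsBinaryExtension.neg {B B' : WΞ → WΞ → Bar Ξ}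
    {ℓ : Env Ξ p ⊸ Env Ξ p} (H : IsBinaryExtension p B ℓ) (hB : ∀ X Y, B' X Y = -B X Y) :
    IsBinaryExtension p B' (-ℓ) := by
  intro n X
  rw [lneg, H, ← Finset.sum_neg_distrib]
  refine Finset.sum_congr rfl fun i _ => ?_
  rw [← Finset.sum_neg_distrib]
  refine Finset.sum_congr rfl fun j _ => ?_
  split_ifs
  · rw [hB, symPlus_mk_neg, smul_neg]
  · exact neg_zero

lemma barBracket_neg (c : ℤ) (ℓ : Letter Ξ → Letter Ξ → V) (X Y : WΞ) :
    barBracket c (fun α β => -ℓ α β) X Y = -barBracket c ℓ X Y := by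
  rw [barBracket_eq, barBracket_eq, ← map_neg]
  congr 1
  induction X, Y using inter_ind with
  | nil_left Y => simp
  | nil_right X => simp
  | cons α X β Y ih1 ih2 =>
    rw [binaryWord_cons, binaryWord_cons, ih1, ih2]
    simp only [map_neg, neg_mul, mul_neg, smul_neg, neg_add]

lemma envPr_isCanonicalProjection : IsCanonicalProjection p (envPr Ξ p) := by
  intro l
  change barPr Ξ (plusPr _ (toPlus _ (hatMon p l))) = _
  rw [plusPr_toPlus]
  rcases l with _ | ⟨X, _ | ⟨Y, l⟩⟩
  · rw [hatMon_nil, hatPr_one, map_zero]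
  · rw [hatMon_cons, hatPr_lam, hatMon_nil, counit_one, one_smul, barPr_packet]
    rcases X with _ | ⟨α, _ | ⟨β, X⟩⟩ <;> rfl
  · rw [hatMon_cons, hatPr_lam, hatMon_cons, counit_lam, zero_smul, map_zero]
    rcases X with _ | ⟨α, _ | ⟨β, X⟩⟩ <;> rfl

lemma env_isCodifferentialBicoalgebra (h : IsInt Ξ) {Q : Env Ξ p ⊸ Env Ξ p}
    (HQ : IsCoder (env_gr_int h p) p (envCop h p) (envCob h p) 1 Q)
    (sq : Q ∘ₗ Q = 0) : IsCodifferentialBicoalgebra p (Env.grading Ξ p) (envCop h p) (envCob h p) Q where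
  toIsGradedBicoalgebra := env_isGradedBicoalgebra h p
  codiff_mem := HQ.mem
  codiff_sq := sq
  coderivation_coproduct := lext fun x => (HQ.coproduct x).symm
  coderivation_cobracket := lext fun x => by
    rw [nop_smul (K := K), lsmul, lcomp, lcomp, HQ.cobracket, one_mul, smul_smul, sg_mul_self, one_smul]
    rfl

lemma env_isCofree [CharZero K] (h : IsInt Ξ) : IsCofree.{u, max u v, w, v} p
    (Env.grading Ξ p) (envCop h p) (envCob h p) (shift Ξ p) (envPr Ξ p) := by
  refine ⟨env_isConilpotent h p, fun _ _ => envPr_mem, fun B _ _ Ψ Δ δ HB hB f hf => ?_⟩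
  obtain ⟨F, hF, h1, h2, h3⟩ := env_lift h HB hB hf
  refine ⟨F, ⟨hF, lext h1, lext h2, lext h3⟩, fun G ⟨_, g1, g2, g3⟩ => ?_⟩
  exact env_lift_unique h hB (lcongr g1) h1 (lcongr g2) h2 fun x =>
    (lcongr g3 x).trans (h3 x).symm

end

section

namespace DGABAlgebra

variable {a b : ℤ} (X : DGABAlgebra a b 𝒜) {E E' : EnvOps (shift 𝒜 (-a + 1)) (a - b)}

lemma exists_isEnvelope [CharZero K] (h : IsInt (shift 𝒜 (-a + 1))) :
    ∃ Q R : Env (shift 𝒜 (-a + 1)) (a - b) ⊸ Env (shift 𝒜 (-a + 1)) (a - b),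
      IsCoder (env_gr_int h (a - b)) (a - b) (envCop h (a - b))
        (envCob h (a - b)) 1 (R + Q) ∧ (R + Q) ∘ₗ (R + Q) = 0 ∧
      X.IsEnvelope ⟨envCop h (a - b), envCob h (a - b), Q, R⟩ := by
  obtain ⟨Q, R, HQ, HR, hQ, hR, sq⟩ := exists_codifferential h (X.isSuspendedAlgebra (h := shift_int h (a - b)))
  exact ⟨Q, R, HR.add HQ, sq, envCop_isCoproduct h, envCob_isCobracket h,
    isUnaryExtension_of h HQ (genPart_hatNum_of h HQ (envPr_unary_number h hQ)) (X.genUnary_packet h HQ hQ),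
    isBinaryExtension_of h HR (genPart_hatNum_of h HR (envPr_binary_number h hR)) (X.genBinary_packet h HR hR)⟩

variable {X}

lemma IsEnvelope.unique (h : IsInt (shift 𝒜 (-a + 1))) (HE : X.IsEnvelope E) (HE' : X.IsEnvelope E') : E = E' :=
  EnvOps.ext (env_ext h fun n X => (HE.coproduct n X).trans (HE'.coproduct n X).symm)
    (env_ext h fun n X => (HE.cobracket n X).trans (HE'.cobracket n X).symm)
    (env_ext h fun n X => (HE.m n X).trans (HE'.m n X).symm)
    (env_ext h fun n X => (HE.ell n X).trans (HE'.ell n X).symm)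

end DGABAlgebra

namespace DGGerstenhaberAlgebra

variable (G : DGGerstenhaberAlgebra 𝒜)

lemma toAB_ell₂'' (P R : List (Letter (shift 𝒜 1))) : G.toAB.ell₂'' P R = -G.ell₂ P R := by
  have e : G.toAB.ell₂ P R = G.bracketH P R := by
    refine congrArg (fun ℓ => barBracket 0 ℓ P R) (funext₂ fun α β => ?_)
    exact (congrArg (· • _) (Int.negOnePow_even _ ⟨0, by ring⟩)).trans (one_smul _ _)
  rw [DGABAlgebra.ell₂'', DGABAlgebra.ell₂', e, ell₂, nop_smul (K := K),
    nop_smul (K := K), nop_smul (K := K), smul_smul, sg_mul', ← neg_smul, neg_sg]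
  refine congrArg (· • _) (sg_congr ⟨-1, ?_⟩)
  rw [degIn]; ring

lemma opp_ell₂ (P R : List (Letter (shift 𝒜 1))) : G.opp.ell₂ P R = -G.ell₂ P R := by
  rw [ell₂, ell₂, ← smul_neg, bracketH, bracketH, ← barBracket_neg]
  rfl

variable {G} {E : EnvOps (shift 𝒜 1) 1}

lemma isEnvelope_iff : G.toAB.IsEnvelope E ↔ G.IsGInfinityEnvelope ⟨E.coproduct, E.cobracket, E.m, -E.ell⟩ where
  mp H := ⟨H.coproduct, H.cobracket.congr (fun x => ⟨0, by ring⟩) fun x y => ⟨-1, by ring⟩, H.m,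
    IsBinaryExtension.neg H.ell fun X Y => by rw [toAB_ell₂'', neg_neg]⟩
  mpr H := ⟨H.coproduct, H.cobracket.congr (fun x => ⟨0, by ring⟩) fun x y => ⟨1, by ring⟩, H.m, by
    have := H.ell.neg (G.toAB_ell₂'')
    rwa [neg_neg] at this⟩

lemma opp_iff : G.IsGInfinityEnvelope ⟨E.coproduct, E.cobracket, E.m, -E.ell⟩ ↔
    G.opp.IsGInfinityEnvelope E where
  mp H := ⟨H.coproduct, H.cobracket, H.m, by
    have := H.ell.neg (G.opp_ell₂)
    rwa [neg_neg] at this⟩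
  mpr H := ⟨H.coproduct, H.cobracket, H.m, H.ell.neg fun X Y => by rw [opp_ell₂, neg_neg]⟩

end DGGerstenhaberAlgebra

namespace DGPoissonAlgebra

variable (P : DGPoissonAlgebra 𝒜)

lemma toAB_ell₂'' (X Y : List (Letter (shift 𝒜 1))) : P.toAB.ell₂'' X Y = -P.bracketH X Y := by
  have e : P.toAB.ell₂ X Y = P.bracketH X Y := by
    refine congrArg (fun ℓ => barBracket 1 ℓ X Y) (funext₂ fun α β => ?_)
    exact congrArg (fun k : ℤ => k.negOnePow • P.bracket α.val β.val) (by ring)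
  rw [DGABAlgebra.ell₂'', DGABAlgebra.ell₂', e, nop_smul (K := K),
    nop_smul (K := K), smul_smul, sg_mul', sg_congr (n := 1) ⟨-1, by rw [degIn, degIn]; ring⟩, sg_one,
    neg_one_smul]

lemma opp_bracketH (X Y : List (Letter (shift 𝒜 1))) : P.opp.bracketH X Y = -P.bracketH X Y := by
  rw [bracketH, bracketH, ← barBracket_neg]
  exact congrArg (fun ℓ => barBracket 1 ℓ X Y) (funext₂ fun α β => smul_neg _ _)

variable {P} {E : EnvOps (shift 𝒜 1) 0}

lemma isEnvelope_iff : P.toAB.IsEnvelope E ↔ P.IsPInfinityEnvelope ⟨E.coproduct, E.cobracket, E.m, -E.ell⟩ where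
  mp H := ⟨H.coproduct, H.cobracket.congr (fun x => ⟨0, by ring⟩) fun x y => ⟨0, by ring⟩, H.m,
    IsBinaryExtension.neg H.ell fun X Y => by rw [toAB_ell₂'', neg_neg]⟩
  mpr H := ⟨H.coproduct, H.cobracket.congr (fun x => ⟨0, by ring⟩) fun x y => ⟨0, by ring⟩, H.m, by
    have := H.ell.neg (P.toAB_ell₂'')
    rwa [neg_neg] at this⟩

lemma opp_iff : P.IsPInfinityEnvelope ⟨E.coproduct, E.cobracket, E.m, -E.ell⟩ ↔
    P.opp.IsPInfinityEnvelope E where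
  mp H := ⟨H.coproduct, H.cobracket, H.m, by
    have := H.ell.neg (P.opp_bracketH)
    rwa [neg_neg] at this⟩
  mpr H := ⟨H.coproduct, H.cobracket, H.m, H.ell.neg fun X Y => by rw [opp_bracketH, neg_neg]⟩

end DGPoissonAlgebra

end

end

end HomotopyAB

theorem mainTheorem6 {K : Type u} [Field K] [CharZero K] {A : Type v} [AddCommGroup A] [Module K A]
    (𝒜 : ℤ → Submodule K A) (h𝒜 : DirectSum.IsInternal 𝒜) :
    (∀ (a b : ℤ) (X : DGABAlgebra a b 𝒜),
      (∃! E : EnvOps (shift 𝒜 (-a + 1)) (a - b), X.IsEnvelope E) ∧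
      ∀ E : EnvOps (shift 𝒜 (-a + 1)) (a - b), X.IsEnvelope E →
        IsCodifferentialBicoalgebra (a - b) (Env.grading (shift 𝒜 (-a + 1)) (a - b))
          E.coproduct E.cobracket (E.ell + E.m) ∧
        ∃ π : Env (shift 𝒜 (-a + 1)) (a - b) →ₗ[K] A,
          IsCanonicalProjection (a - b) π ∧
          IsCofree.{u, max u v, w, v} (a - b) (Env.grading (shift 𝒜 (-a + 1)) (a - b))
            E.coproduct E.cobracket (shift (shift 𝒜 (-a + 1)) (a - b)) π) ∧
    (∀ (G : DGGerstenhaberAlgebra 𝒜) (E : EnvOps (shift 𝒜 1) 1),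
      (G.toAB.IsEnvelope E ↔
        G.IsGInfinityEnvelope ⟨E.coproduct, E.cobracket, E.m, -E.ell⟩) ∧
      (G.toAB.IsEnvelope E ↔ G.opp.IsGInfinityEnvelope E)) ∧
    (∀ (P : DGPoissonAlgebra 𝒜) (E : EnvOps (shift 𝒜 1) 0),
      (P.toAB.IsEnvelope E ↔
        P.IsPInfinityEnvelope ⟨E.coproduct, E.cobracket, E.m, -E.ell⟩) ∧
      (P.toAB.IsEnvelope E ↔ P.opp.IsPInfinityEnvelope E)) := by
  have h := shift_int h𝒜
  refine ⟨fun a b X => ?_, fun G E => ⟨DGGerstenhaberAlgebra.isEnvelope_iff,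
    DGGerstenhaberAlgebra.isEnvelope_iff.trans DGGerstenhaberAlgebra.opp_iff⟩, fun P E =>
    ⟨DGPoissonAlgebra.isEnvelope_iff, DGPoissonAlgebra.isEnvelope_iff.trans DGPoissonAlgebra.opp_iff⟩⟩
  obtain ⟨Q, R, HQ, sq, HE⟩ := X.exists_isEnvelope (h _)
  refine ⟨⟨_, HE, fun E H => H.unique (h _) HE⟩, fun E H => ?_⟩
  obtain rfl := H.unique (h _) HE
  exact ⟨env_isCodifferentialBicoalgebra (h _) HQ sq, _, envPr_isCanonicalProjection,
    env_isCofree (h _)⟩
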